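/- **Setting.** Let $F(x)=\mathrm E_\xi[f(x;\xi)]$ on $\mathbb R^d$ ($d\ge1$). Assume that every $f(\cdot;\xi)$ is twice continuously differentiable with $L_1$-Lipschitz gradient and $L_2$-Lipschitz Hessian, that $F(x_1)-\inf F\le\Delta$ for the initial point $x_1$, and that for all $x$: $\mathrm E[\exp(\|\nabla f(x;\xi)-\nabla F(x)\|^2/G^2)]\le e$ and $\mathrm E\|\nabla f(x;\xi)-\nabla F(x)\|^2\le V$. For an i.i.d. sample $S$ put $F_S=\frac1{|S|}\sum_{\xi\in S}f(\cdot;\xi)$. An $(\epsilon,\gamma)$-second-order stationary point (SSP) is a point $x$ with $\|\nabla F(x)\|\le\epsilon$ and $\lambda_{\min}(\nabla^2F(x))\ge-\gamma$. The IFO complexity is the number of queries $(x,\xi)\mapsto (f(x;\xi),\nabla f(x;\xi))$. **Algorithm NEON-SCSG.** Iterate from $x_1$, with fresh independent randomness in each iteration. *(SCSG epoch.)* Draw $S_1$ with $|S_1|\ge b$ and $N$ with $\Pr(N=k)=\big(\tfrac{|S_1|}{|S_1|+b}\big)^k\tfrac{b}{|S_1|+b}$, $k\ge0$; put $z_0=x_j$;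 for $k=1,\dots,N$ draw a sample $B_k$ of size $b$ and put $z_k=z_{k-1}-\eta_1\big(\nabla F_{B_k}(z_{k-1})-\nabla F_{B_k}(z_0)+\nabla F_{S_1}(z_0)\big)$, where $\eta_1=\frac{c'}{L_1}(|S_1|/b)^{-2/3}$ and $0<c'\le1/6$; let $y_j=z_N$. *(First-order check.)* If $\|\nabla F_S(y_j)\|>\epsilon_0$ for an independent sample $S$, put $x_{j+1}=y_j$. *(Negative curvature step.)* Otherwise draw $S_2$, let $u$ be the output of NEON or of NEON$^+$ for $g=F_{S_2}$ at $y_j$; if $u=0$ return $y_j$, else $x_{j+1}=y_j-\frac{c\gamma_0\bar\xi}{L_2}\frac{u}{\|u\|}$ with a Rademacher variable $\bar\xi$. The IFO complexity of this step is denoted by $T_n$. Here $\epsilon_0,\gamma_0$ are the accuracies with which the algorithm is run. With $\hat g(u)=g(y_j+u)-g(y_j)-\nabla g(y_j)^\top u$ and $u_0$ uniform on the ball of radius $r$, *NEON* computes $u_{\tau+1}=u_\tau-\eta\nabla\hat g(u_\tau)$, $\tau=0,\dots,t$, and returns a minimiser of $\hat g$ among the $u_\tau$ with $\|u_\tau\|\le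 U$ if the minimum is $\le-2.5\mathcal F$, and $0$ otherwise. *NEON$^+$* puts $v_0=u_0$ and, for $\tau=0,\dots,t$, computes $v_{\tau+1}=u_\tau-\eta\nabla\hat g(u_\tau)$, $u_{\tau+1}=v_{\tau+1}+\zeta(v_{\tau+1}-v_\tau)$. If at some $\tau\le t$ one has $\hat g(v_\tau)-\hat g(u_\tau)-\nabla\hat g(u_\tau)^\top(v_\tau-u_\tau)<-\frac{\gamma_0}2\|v_\tau-u_\tau\|^2$, it stops at the first such $\tau$ and returns the first $v_k$, $k\le\tau$, with $\|v_k-u_k\|\ge\zeta\sqrt{6\eta\mathcal F}$ if there is one, and $v_\tau-u_\tau$ otherwise. If this never happens, it returns a minimiser of $\hat g$ among the $v_\tau$ with $\|v_\tau\|\le U$ if the minimum is $\le-2\mathcal F$, and $0$ otherwise. **Corollary.** Let either procedure (NEON or NEON$^+$) be fixed. For all $d\ge1$, $\epsilon,\gamma,\delta\in(0,1)$ and integers $b\ge1$ with $b\le\max(\epsilon^{-2},\gamma^{-9/2}b^{-1/2})$, the algorithm can be run with $\epsilon_0=\epsilon/2$, $\gamma_0=\gamma/2$ and with sample sizes and NEON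 parameters that depend only on $d,\epsilon,\gamma,\delta,b,c'$ and the constants $L_1,L_2,G,V,\Delta$, with $b\le|S_1|=\widetilde O(\max(\epsilon^{-2},\gamma^{-9/2}b^{-1/2}))$ and $T_n=\widetilde O(\gamma^{-3})$ for NEON, respectively $T_n=\widetilde O(\gamma^{-5/2})$ for NEON$^+$, such that for every problem as above: 1. There is $C=\widetilde\Omega(1)$, depending only on the same data, such that the negative curvature step from any point $y$ with $\lambda_{\min}(\nabla^2F(y))\le-\gamma$ decreases $F$ by at least $C\gamma^3$ in expectation (the point stays at $y$ if $u=0$), while the output $y$ of one SCSG epoch started at any $x$ satisfies $\mathrm E[F(y)-F(x)]\le C\gamma^3/2$, and $\mathrm E[F(y)-F(x)]\le-\varepsilon(\epsilon,\alpha)$ whenever $\mathrm E\|\nabla F(y)\|^2\ge\epsilon^2$, with $\varepsilon(\epsilon,\alpha)=\Omega(\epsilon^{4/3}/b^{1/3})$. The expected IFO complexity of one epoch is $\widetilde O(\max(\epsilon^{-2},\gamma^{-9/2}b^{-1/2}))$. 2. With probability at least $1-\delta$, NEON-SCSG terminates and returns an $(\epsilon,\gamma)$-SSP, and its expected total IFO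 complexity is $$\widetilde O\Big(\max\Big(\frac{b^{1/3}}{\epsilon^{4/3}},\frac1{\gamma^3}\Big)\Big(T_n+\frac1{\epsilon^2}+\frac1{\gamma^{9/2}b^{1/2}}\Big)\Big).$$ 3. In particular this is $\widetilde O(\epsilon^{-7/2})$ if $\gamma=\epsilon^{1/2}$ and $|b-\epsilon^{-1/2}|<1$, and $\widetilde O(\epsilon^{-10/3})$ if $\gamma\ge\epsilon^{4/9}$ and $b=1$. Here $\Omega$ hides a factor, and $\widetilde O$, $\widetilde\Omega$ hide a factor and a power of $\log\frac{3d}{\epsilon\gamma\delta}$; these factors and powers depend only on $L_1,L_2,G,V,\Delta,c'$ and the chosen procedure. -/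

import Mathlib

open MeasureTheory ProbabilityTheory
open scoped ENNReal

noncomputable section

namespace NeonSCSG

/-- The space `ℝ^d` with its Euclidean norm. -/
abbrev E (d : ℕ) : Type := EuclideanSpace ℝ (Fin d)

variable {d : ℕ} {Ξ : Type*}

/-! ### The stochastic optimisation problem -/

/-- The Hessian `∇² g (x)`, as a linear operator. -/
def hessian (g : E d → ℝ) (x : E d) : E d →L[ℝ] E d := fderiv ℝ (gradient g) x

/-- The minimum eigenvalue of an operator (only used for symmetric operators and `0 < d`). -/
def lambdaMin (A : E d →L[ℝ] E d) : ℝ :=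
  sInf {μ : ℝ | Module.End.HasEigenvalue (A : E d →ₗ[ℝ] E d) μ}

/-- `x` is an `(ε, γ)`-second-order stationary point of `F`. -/
def IsSSP (F : E d → ℝ) (ε γ : ℝ) (x : E d) : Prop :=
  ‖gradient F x‖ ≤ ε ∧ -γ ≤ lambdaMin (hessian F x)

/-- The objective `F(x) = E_ξ f(x; ξ)`, where `P` is the law of `ξ`. -/
def objective [MeasurableSpace Ξ] (P : Measure Ξ) (f : E d → Ξ → ℝ) (x : E d) : ℝ :=
  ∫ ξ, f x ξ ∂P

/-- The empirical average `F_S(x) = (1/m) ∑ i, f(x; ξ_i)` over a sample `S` of size `m`. -/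
def batch (f : E d → Ξ → ℝ) {m : ℕ} (S : Fin m → Ξ) (x : E d) : ℝ :=
  (1 / (m : ℝ)) * ∑ i, f x (S i)

/-- The standing assumptions on the problem `min F`, `F(x) = E f(x; ξ)`, with initial point `x₁`. -/
structure Assumptions [MeasurableSpace Ξ] (P : Measure Ξ) (f : E d → Ξ → ℝ) (x₁ : E d)
    (L₁ L₂ G V Δ : ℝ) : Prop where
  measurable : ∀ x, Measurable (f x)
  integrable : ∀ x, Integrable (f x) P
  twice_differentiable : ∀ ξ, ContDiff ℝ 2 (fun x => f x ξ)
  lipschitz_gradient : ∀ ξ x y,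
    ‖gradient (fun z => f z ξ) x - gradient (fun z => f z ξ) y‖ ≤ L₁ * ‖x - y‖
  lipschitz_hessian : ∀ ξ x y,
    ‖hessian (fun z => f z ξ) x - hessian (fun z => f z ξ) y‖ ≤ L₂ * ‖x - y‖
  initial_gap : ∀ x, objective P f x₁ - objective P f x ≤ Δ
  subgaussian : ∀ x,
    ∫⁻ ξ, ENNReal.ofReal
        (Real.exp (‖gradient (fun z => f z ξ) x - gradient (objective P f) x‖ ^ 2 / G ^ 2)) ∂P
      ≤ ENNReal.ofReal (Real.exp 1)
  variance : ∀ x,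
    ∫⁻ ξ, ENNReal.ofReal
        (‖gradient (fun z => f z ξ) x - gradient (objective P f) x‖ ^ 2) ∂P
      ≤ ENNReal.ofReal V

/-! ### Inputs and tuning parameters of the algorithm -/

/-- Which procedure extracts negative curvature: NEON (gradient descent) or
NEON⁺ (accelerated gradient). -/
inductive NeonKind
  | neon
  | neonPlus

/-- The data handed to NEON-SCSG: the kind of NEON procedure, the two Lipschitz constants, the step
size constant `c'` and the mini-batch size `b` of SCSG, and the accuracies at which first-order
stationarity and negative curvature are tested. -/
structure Input where
  kind : NeonKind
  L₁ : ℝ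
  L₂ : ℝ
  c' : ℝ
  b : ℕ
  ε : ℝ
  γ : ℝ

/-- The remaining parameters: the sample size `m₁ = |S₁|` of an SCSG epoch, the sample size `mc` of
the first-order check, the sample size `m₂ = |S₂|` of NEON, and NEON's number of iterations `t`,
step size `η`, threshold `𝓕`, truncation radius `U`, noise radius `r`, momentum `ζ` (for NEON⁺) and
the factor `c` in the length `c γ / L₂` of the negative curvature step. -/
structure Tuning where
  m₁ : ℕ
  mc : ℕ
  m₂ : ℕ
  t : ℕ
  η : ℝ
  𝓕 : ℝ
  U : ℝ
  r : ℝ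
  ζ : ℝ
  c : ℝ

/-- The admissible tunings. The SCSG epoch requires `b ≤ |S₁|`. -/
def Tuning.Valid (p : Tuning) (b : ℕ) : Prop :=
  b ≤ p.m₁ ∧ 0 < p.mc ∧ 0 < p.m₂ ∧ 0 < p.η ∧ 0 < p.𝓕 ∧ 0 < p.U ∧ 0 < p.r ∧
    0 < p.ζ ∧ p.ζ < 1 ∧ 0 < p.c

/-! ### One epoch of SCSG -/

/-- The randomness of an SCSG epoch: the sample `S₁`, the number `N` of updates and the sequence of
independent mini-batches (of which the first `N` are used). -/
abbrev EpochSeed (Ξ : Type*) (m b : ℕ) : Type _ := (Fin m → Ξ) × ℕ × (ℕ → Fin b → Ξ)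

/-- The parameter `b / (m + b)`. -/
def stopProb (m b : ℕ) : unitInterval :=
  ⟨(b : ℝ) / ((m : ℝ) + b), by positivity,
    div_le_one_of_le₀ (by linarith [(Nat.cast_nonneg m : (0 : ℝ) ≤ m)]) (by positivity)⟩

/-- `S₁` consists of `m` i.i.d. samples, `N ~ Geom(m / (m + b))`, i.e.
`Pr(N = k) = (m / (m + b)) ^ k * (b / (m + b))` for `k = 0, 1, 2, …`, and every mini-batch consists
of `b` i.i.d. samples; all of them are independent. -/
def epochLaw [MeasurableSpace Ξ] (P : Measure Ξ) [IsProbabilityMeasure P] (m b : ℕ) :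
    Measure (EpochSeed Ξ m b) :=
  (Measure.pi fun _ => P).prod
    ((geometricMeasure (stopProb m b)).prod
      (Measure.infinitePi fun _ => Measure.pi fun _ => P))

instance [MeasurableSpace Ξ] (P : Measure Ξ) [IsProbabilityMeasure P] (m b : ℕ) :
    IsProbabilityMeasure (epochLaw P m b) := by
  unfold epochLaw; infer_instance

/-- The inner iterates `x_k = x_{k-1} - η v_k` of an epoch started at `x`, where
`v_k = ∇F_{S_k}(x_{k-1}) - ∇F_{S_k}(x) + ∇F_{S₁}(x)`. -/
def epochIter (f : E d → Ξ → ℝ) (η : ℝ) {m b : ℕ} (S₁ : Fin m → Ξ) (B : ℕ → Fin b → Ξ)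
    (x : E d) : ℕ → E d
  | 0 => x
  | k + 1 =>
    epochIter f η S₁ B x k -
      η • (gradient (batch f (B k)) (epochIter f η S₁ B x k) - gradient (batch f (B k)) x
        + gradient (batch f S₁) x)

/-- SCSG-epoch`(x, S₁, b)`, with step size `(c' / L₁) (|S₁| / b) ^ (-2/3)`. -/
def scsgEpoch (f : E d → Ξ → ℝ) (I : Input) {m : ℕ} (s : EpochSeed Ξ m I.b) (x : E d) : E d :=
  epochIter f (I.c' / I.L₁ * ((m : ℝ) / (I.b : ℝ)) ^ (-(2 / 3) : ℝ)) s.1 s.2.2 x s.2.1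

/-- The number of IFO calls of an epoch: `|S₁|` for `∇F_{S₁}(x)`, and `2 b` for each update. -/
def epochCost {m b : ℕ} (s : EpochSeed Ξ m b) : ℕ := m + 2 * b * s.2.1

/-! ### The procedures NEON and NEON⁺ -/

/-- `ĝ_x(u) = g(x + u) - g(x) - ⟨∇g(x), u⟩`. -/
def residual (g : E d → ℝ) (x u : E d) : ℝ :=
  g (x + u) - g x - inner ℝ (gradient g x) u

/-- `∇ĝ_x(u) = ∇g(x + u) - ∇g(x)`. -/
def residualGrad (g : E d → ℝ) (x u : E d) : E d := gradient g (x + u) - gradient g x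

/-- NEON's iterates `u_{τ+1} = u_τ - η (∇g(x + u_τ) - ∇g(x))`. -/
def neonIter (g : E d → ℝ) (x : E d) (η : ℝ) (u₀ : E d) : ℕ → E d
  | 0 => u₀
  | τ + 1 => neonIter g x η u₀ τ - η • residualGrad g x (neonIter g x η u₀ τ)

/-- `IsArgmin h u U n τ`: among the indices `σ ≤ n` with `‖u σ‖ ≤ U`, the value `h (u σ)` is
minimal at `σ = τ`. -/
def IsArgmin (h : E d → ℝ) (u : ℕ → E d) (U : ℝ) (n τ : ℕ) : Prop :=
  τ ≤ n ∧ ‖u τ‖ ≤ U ∧ ∀ σ ≤ n, ‖u σ‖ ≤ U → h (u τ) ≤ h (u σ)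

open Classical in
/-- The output of NEON started at the noise vector `u₀` (the first minimiser is returned). -/
def neon (g : E d → ℝ) (p : Tuning) (x u₀ : E d) : E d :=
  if h : ∃ τ, IsArgmin (residual g x) (neonIter g x p.η u₀) p.U (p.t + 1) τ ∧
      residual g x (neonIter g x p.η u₀ τ) ≤ -(2.5 * p.𝓕)
  then neonIter g x p.η u₀ (Nat.find h) else 0

/-- The pairs `(y_τ, u_τ)` of Nesterov's accelerated gradient method applied to `ĝ_x`. -/
def nagIter (g : E d → ℝ) (x : E d) (η ζ : ℝ) (u₀ : E d) : ℕ → E d × E d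
  | 0 => (u₀, u₀)
  | τ + 1 =>
    let q := nagIter g x η ζ u₀ τ
    let y := q.2 - η • residualGrad g x q.2
    (y, y + ζ • (y - q.1))

/-- The test `Δ_x(y, u) < - (γ / 2) ‖y - u‖²` of NEON⁺. -/
def NCTest (g : E d → ℝ) (x : E d) (γ : ℝ) (q : E d × E d) : Prop :=
  residual g x q.1 - residual g x q.2 - inner ℝ (residualGrad g x q.2) (q.1 - q.2) <
    -(γ / 2) * ‖q.1 - q.2‖ ^ 2

open Classical in
/-- NCFind applied to the history up to time `τ`. -/
def ncFind (q : ℕ → E d × E d) (p : Tuning) (τ : ℕ) : E d :=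
  if h : ∃ j, j ≤ τ ∧ p.ζ * √(6 * p.η * p.𝓕) ≤ ‖(q j).1 - (q j).2‖
  then (q (Nat.find h)).1 else (q τ).1 - (q τ).2

open Classical in
/-- The output of NEON⁺ started at the noise vector `u₀`. -/
def neonPlus (g : E d → ℝ) (γ : ℝ) (p : Tuning) (x u₀ : E d) : E d :=
  if h : ∃ τ, τ ≤ p.t ∧ NCTest g x γ (nagIter g x p.η p.ζ u₀ τ)
  then ncFind (nagIter g x p.η p.ζ u₀) p (Nat.find h)
  else if h : ∃ τ,
      IsArgmin (residual g x) (fun σ => (nagIter g x p.η p.ζ u₀ σ).1) p.U (p.t + 1) τ ∧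
        residual g x (nagIter g x p.η p.ζ u₀ τ).1 ≤ -(2 * p.𝓕)
  then (nagIter g x p.η p.ζ u₀ (Nat.find h)).1 else 0

/-- The procedure selected by `I.kind`. -/
def negCurv (g : E d → ℝ) (I : Input) (p : Tuning) (x u₀ : E d) : E d :=
  match I.kind with
  | .neon => neon g p x u₀
  | .neonPlus => neonPlus g I.γ p x u₀

/-- The IFO complexity `T_n` of one negative curvature step: the sample size `|S₂|` times the number
of points at which NEON queries `F_{S₂}`. These are `y`, `y + u_0, …, y + u_{t+1}` for NEON, and
`y`, `y + y_0, …, y + y_{t+1}`, `y + u_0, …, y + u_t` for NEON⁺ (charged in full even if NEON⁺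
stops early). -/
def neonCost (kind : NeonKind) (p : Tuning) : ℕ :=
  match kind with
  | .neon => p.m₂ * (p.t + 3)
  | .neonPlus => p.m₂ * (2 * p.t + 4)

/-- The randomness of a negative curvature step: the sample `S₂`, a point of the unit ball and a
random sign. -/
abbrev NeonSeed (Ξ : Type*) (d m : ℕ) : Type _ := (Fin m → Ξ) × E d × Bool

/-- The uniform distribution on the unit ball of `ℝ^d`. -/
def unitBallLaw (d : ℕ) : Measure (E d) :=
  ProbabilityTheory.cond volume (Metric.closedBall (0 : E d) 1)

instance (d : ℕ) : IsProbabilityMeasure (unitBallLaw d) :=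
  cond_isProbabilityMeasure_of_finite
    (Metric.measure_closedBall_pos volume (0 : E d) one_pos).ne'
    measure_closedBall_lt_top.ne

/-- The law of the randomness of a negative curvature step. -/
def neonLaw [MeasurableSpace Ξ] (P : Measure Ξ) [IsProbabilityMeasure P] (d m : ℕ) :
    Measure (NeonSeed Ξ d m) :=
  (Measure.pi fun _ => P).prod ((unitBallLaw d).prod (PMF.uniformOfFintype Bool).toMeasure)

instance [MeasurableSpace Ξ] (P : Measure Ξ) [IsProbabilityMeasure P] (d m : ℕ) :
    IsProbabilityMeasure (neonLaw P d m) := by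
  unfold neonLaw; infer_instance

/-- The vector returned by NEON`(F_{S₂}, y)`. Its initial noise `r • z`, with `z` uniform on the
unit ball, is uniform on the ball of radius `r`. -/
def curvatureVector (f : E d → Ξ → ℝ) (I : Input) (p : Tuning) (s : NeonSeed Ξ d p.m₂)
    (y : E d) : E d :=
  negCurv (batch f s.1) I p y (p.r • s.2.1)

/-- The Rademacher variable. -/
def sign (σ : Bool) : ℝ := if σ then 1 else -1

open Classical in
/-- The negative curvature step from `y`: the point stays at `y` if NEON returns `u = 0`, and moves
to `y - (c γ ξ̄ / L₂) u / ‖u‖` otherwise. -/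
def escape (f : E d → Ξ → ℝ) (I : Input) (p : Tuning) (s : NeonSeed Ξ d p.m₂) (y : E d) : E d :=
  let u := curvatureVector f I p s y
  if u = 0 then y else y - (p.c * I.γ * sign s.2.2 / I.L₂ / ‖u‖) • u

/-! ### The algorithm NEON-SCSG -/

/-- The randomness of one iteration: an SCSG epoch, the sample of the first-order check, and a
negative curvature step. -/
abbrev Seed (Ξ : Type*) (d b : ℕ) (p : Tuning) : Type _ :=
  EpochSeed Ξ p.m₁ b × (Fin p.mc → Ξ) × NeonSeed Ξ d p.m₂

/-- The law of the randomness of one iteration. -/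
def seedLaw [MeasurableSpace Ξ] (P : Measure Ξ) [IsProbabilityMeasure P] (d b : ℕ) (p : Tuning) :
    Measure (Seed Ξ d b p) :=
  (epochLaw P p.m₁ b).prod ((Measure.pi fun _ => P).prod (neonLaw P d p.m₂))

instance [MeasurableSpace Ξ] (P : Measure Ξ) [IsProbabilityMeasure P] (d b : ℕ) (p : Tuning) :
    IsProbabilityMeasure (seedLaw P d b p) := by
  unfold seedLaw; infer_instance

/-- The law of the randomness of a whole run: independent seeds, one for each iteration. -/
def runLaw [MeasurableSpace Ξ] (P : Measure Ξ) [IsProbabilityMeasure P] (d b : ℕ) (p : Tuning) :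
    Measure (ℕ → Seed Ξ d b p) :=
  Measure.infinitePi fun _ => seedLaw P d b p

/-- The first-order condition `‖∇F_S(y)‖ ≤ ε` at the output `y` of the epoch started at `x`. -/
def FirstOrderMet (f : E d → Ξ → ℝ) (I : Input) (p : Tuning) (s : Seed Ξ d I.b p) (x : E d) :
    Prop :=
  ‖gradient (batch f s.2.1) (scsgEpoch f I s.1 x)‖ ≤ I.ε

open Classical in
/-- One iteration from `x`: the next point and `false`, or the returned point and `true`. -/
def iteration (f : E d → Ξ → ℝ) (I : Input) (p : Tuning) (s : Seed Ξ d I.b p) (x : E d) :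
    E d × Bool :=
  let y := scsgEpoch f I s.1 x
  if FirstOrderMet f I p s x then
    if curvatureVector f I p s.2.2 y = 0 then (y, true) else (escape f I p s.2.2 y, false)
  else (y, false)

open Classical in
/-- The IFO complexity of one iteration from `x`; NEON is only charged if it is called. -/
def iterationCost (f : E d → Ξ → ℝ) (I : Input) (p : Tuning) (s : Seed Ξ d I.b p) (x : E d) : ℕ :=
  epochCost s.1 + p.mc + if FirstOrderMet f I p s x then neonCost I.kind p else 0

/-- The state after `j` iterations started at `x₁`: the current point, and whether the algorithm has
returned it. -/
def run (f : E d → Ξ → ℝ) (I : Input) (p : Tuning) (x₁ : E d) (ω : ℕ → Seed Ξ d I.b p) :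
    ℕ → E d × Bool
  | 0 => (x₁, false)
  | j + 1 =>
    let q := run f I p x₁ ω j
    if q.2 then q else iteration f I p (ω j) q.1

/-- The algorithm terminates and returns `y`. -/
def Returns (f : E d → Ξ → ℝ) (I : Input) (p : Tuning) (x₁ : E d) (ω : ℕ → Seed Ξ d I.b p)
    (y : E d) : Prop :=
  ∃ j, run f I p x₁ ω j = (y, true)

/-- The total IFO complexity of a run: the sum over all iterations before termination. -/
def totalCost (f : E d → Ξ → ℝ) (I : Input) (p : Tuning) (x₁ : E d) (ω : ℕ → Seed Ξ d I.b p) :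
    ℝ≥0∞ :=
  ∑' j, if (run f I p x₁ ω j).2 then 0
    else (iterationCost f I p (ω j) (run f I p x₁ ω j).1 : ℝ≥0∞)

/-! ### The properties required of the two components -/

/-- A negative curvature step from a point `y` with `λ_min(∇²F(y)) ≤ -γ` decreases `F` by at least
`C γ³` in expectation. -/
def EscapeGuarantee [MeasurableSpace Ξ] (P : Measure Ξ) [IsProbabilityMeasure P]
    (f : E d → Ξ → ℝ) (I : Input) (p : Tuning) (γ C : ℝ) : Prop :=
  ∀ y : E d, lambdaMin (hessian (objective P f) y) ≤ -γ →
    Integrable (fun s => objective P f (escape f I p s y) - objective P f y) (neonLaw P d p.m₂) ∧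
    ∫ s, (objective P f (escape f I p s y) - objective P f y) ∂(neonLaw P d p.m₂) ≤ -(C * γ ^ 3)

/-- The output `y` of an SCSG epoch from `x` satisfies `E[F(y) - F(x)] ≤ -φ` whenever
`E‖∇F(y)‖² ≥ ε²`, and `E[F(y) - F(x)] ≤ C γ³ / 2` in any case. -/
def EpochGuarantee [MeasurableSpace Ξ] (P : Measure Ξ) [IsProbabilityMeasure P]
    (f : E d → Ξ → ℝ) (I : Input) (m : ℕ) (ε γ φ C : ℝ) : Prop :=
  ∀ x : E d,
    Integrable (fun s => objective P f (scsgEpoch f I s x) - objective P f x)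
      (epochLaw P m I.b) ∧
    (ENNReal.ofReal (ε ^ 2) ≤
        ∫⁻ s, ENNReal.ofReal (‖gradient (objective P f) (scsgEpoch f I s x)‖ ^ 2)
          ∂(epochLaw P m I.b) →
      ∫ s, (objective P f (scsgEpoch f I s x) - objective P f x) ∂(epochLaw P m I.b) ≤ -φ) ∧
    ∫ s, (objective P f (scsgEpoch f I s x) - objective P f x) ∂(epochLaw P m I.b)
      ≤ C * γ ^ 3 / 2

/-- The exponent of `1 / γ` in `T_n`: `3` for NEON and `5/2` for NEON⁺. -/
def neonExponent : NeonKind → ℝ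
  | .neon => 3
  | .neonPlus => 5 / 2

/-- The rate `max (1 / ε², 1 / (γ^{9/2} b^{1/2}))` of the sample size `|S₁|`. -/
def sampleRate (ε γ : ℝ) (b : ℕ) : ℝ :=
  max (1 / ε ^ 2) (1 / (γ ^ (9 / 2 : ℝ) * (b : ℝ) ^ (1 / 2 : ℝ)))

/-- The logarithm `log (3 d / (ε γ δ))` hidden, with a power, in the notation `Õ`. -/
def logFactor (d : ℕ) (ε γ δ : ℝ) : ℝ := Real.log (3 * d / (ε * γ * δ))

end NeonSCSG

end

open NeonSCSG

noncomputable section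

namespace NeonSCSG

variable {d : ℕ} {Ξ : Type*}

/-! ### Smooth functions -/

/-! The proof is a potential argument on F. Let D be the smaller of the gain of a negative curvature
step and A ε²/8, where A is of order (|S₁|/b)^(1/3). Every iteration that does not return lowers F
by about D in expectation, so F - inf F + D·1{still running} is a supermartingale with drift -D/2
while the run is active (`IterationTuned.lintegral_transition_le`). Hence the expected number of
iterations is at most 2Δ/D + 2. Fresh seeds are independent of the current state
(`lintegral_chain`), so multiplying this number by the cost of an iteration bounds the expected
total cost, and multiplying it by the probability of a wrong return in one iteration bounds the
failure probability. No high-probability control of the trajectory is needed.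

The decrease has two sources. An epoch satisfies E[F(y) + A‖∇F(y)‖²] ≤ F(x) + A V/|S₁|
(`Assumptions.lintegral_scsgEpoch_le`). This follows from the Lyapunov function F + c‖z - x‖², since
the geometric law of N is exactly the weight that makes its recursion telescope. The term A‖∇F(y)‖²
pays for the iterations whose first-order check fails: Markov's inequality bounds the probability of
that failure by a multiple of ‖∇F(y)‖² + V/m. If the check succeeds, the negative curvature step
provides the decrease or the algorithm returns.

NEON is gradient descent on the residual of g. If its iterates travel far, then the residual has
dropped (`sq_dist_neonIter_le`), and if they stay near the origin, the component along an
eigenvector of negative curvature grows geometrically. So some iterate has very negative residual,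
and by Taylor's formula it is a direction of negative curvature. NEON⁺ follows the same scheme with
the energy ĝ(v) + ‖momentum‖²/(2η) in place of ĝ (`energy_le`) and a growth rate of order √γ instead
of γ. The random sign removes the gradient term from the decrease of F (`second_difference_le`).

Curvature of F_S transfers to F by a matrix concentration inequality with logarithmic dependence on
d (`Assumptions.measure_hessian_le`). It is proved with the trace of a truncated hyperbolic cosine:
one random summand multiplies its expectation by at most a cosh, because the first-order term has
mean zero and the second derivative is controlled by the function itself. The initial noise is
unfavourable only in a thin slab of the ball (`unitBallLaw_slab_le`).

All failure probabilities are set to a multiple of exp(-X) with X = j log(3d/(εγδ)). A constant j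
makes exp(X) beat every polynomial in X, d, 1/ε, 1/γ and 1/δ that occurs (`exists_log_scale`), while
sizes and costs are only polynomial in X. The rate γ^(-9/2) b^(-1/2) of |S₁| is what makes the noise
of an epoch smaller than the gain γ³ of a negative curvature step (`Setting.noise_le_gain`). -/

/-- A twice differentiable function with `L₁`-Lipschitz gradient and `L₂`-Lipschitz Hessian. -/
structure IsSmooth (g : E d → ℝ) (L₁ L₂ : ℝ) : Prop where
  diff : Differentiable ℝ g
  diff_grad : Differentiable ℝ (gradient g)
  lip_grad : ∀ x y, ‖gradient g x - gradient g y‖ ≤ L₁ * ‖x - y‖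
  lip_hess : ∀ x y, ‖hessian g x - hessian g y‖ ≤ L₂ * ‖x - y‖

lemma differentiable_gradient {g : E d → ℝ} (hg : ContDiff ℝ 2 g) :
    Differentiable ℝ (gradient g) := by
  have h : Differentiable ℝ (fderiv ℝ g) :=
    (hg.fderiv_right (m := 1) (by norm_num)).differentiable (by norm_num)
  exact (InnerProductSpace.toDual ℝ (E d)).symm.toContinuousLinearEquiv.differentiable.comp h

lemma inner_gradient {g : E d → ℝ} {x : E d} (hg : DifferentiableAt ℝ g x) (v : E d) :
    inner ℝ (gradient g x) v = fderiv ℝ g x v := by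
  rw [hg.hasGradientAt.hasFDerivAt.fderiv]; simp

namespace IsSmooth

variable {g : E d → ℝ} {L₁ L₂ : ℝ} (h : IsSmooth g L₁ L₂)
include h

lemma mono {L : ℝ} (hL : L₁ ≤ L) : IsSmooth g L L₂ :=
  ⟨h.diff, h.diff_grad, fun x y => (h.lip_grad x y).trans (by gcongr), h.lip_hess⟩

lemma hasFDerivAt_gradient (x : E d) : HasFDerivAt (gradient g) (hessian g x) x :=
  (h.diff_grad x).hasFDerivAt

lemma hasDerivAt_line (x w : E d) (t : ℝ) :
    HasDerivAt (fun t : ℝ => g (x + t • w)) (inner ℝ (gradient g (x + t • w)) w) t := by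
  have h1 : HasDerivAt (fun t : ℝ => x + t • w) w t := by
    simpa using ((hasDerivAt_id t).smul_const w).const_add x
  rw [inner_gradient (h.diff _)]
  exact (h.diff (x + t • w)).hasFDerivAt.comp_hasDerivAt t h1

lemma hasDerivAt_gradient_line (x w : E d) (t : ℝ) :
    HasDerivAt (fun t : ℝ => gradient g (x + t • w)) (hessian g (x + t • w) w) t := by
  have h1 : HasDerivAt (fun t : ℝ => x + t • w) w t := by
    simpa using ((hasDerivAt_id t).smul_const w).const_add x
  exact (h.hasFDerivAt_gradient (x + t • w)).comp_hasDerivAt t h1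

/-- The remainder along the segment t ↦ x + t • w vanishes at t = 0, and its derivative is at most
that of a monomial in t; the mean value inequality compares the two. The two Taylor bounds for g
below use the same comparison. -/
lemma norm_gradient_taylor (x w : E d) :
    ‖gradient g (x + w) - gradient g x - hessian g x w‖ ≤ L₂ / 2 * ‖w‖ ^ 2 := by
  have key := image_norm_le_of_norm_deriv_right_le_deriv_boundary
    (f := fun t : ℝ => gradient g (x + t • w) - gradient g x - t • hessian g x w)
    (f' := fun t => hessian g (x + t • w) w - hessian g x w) (a := 0) (b := 1)
    (B := fun t => L₂ / 2 * ‖w‖ ^ 2 * t ^ 2) (B' := fun t => L₂ * ‖w‖ ^ 2 * t)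
    ?_ ?_ (by simp) ?_ ?_
  · have := key (x := 1) (by simp)
    simpa using this
  · have h1 := h.diff_grad.continuous
    fun_prop
  · intro t _
    have := ((h.hasDerivAt_gradient_line x w t).sub_const (gradient g x)).sub
      ((hasDerivAt_id t).smul_const (hessian g x w))
    exact (this.congr_deriv (by simp)).hasDerivWithinAt
  · intro t
    refine ((hasDerivAt_pow 2 t).const_mul (L₂ / 2 * ‖w‖ ^ 2)).congr_deriv ?_
    push_cast; ring
  · intro t ht
    rw [← sub_apply]
    refine (ContinuousLinearMap.le_opNorm _ _).trans ?_
    have := h.lip_hess (x + t • w) x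
    simp only [add_sub_cancel_left, norm_smul, Real.norm_eq_abs, abs_of_nonneg ht.1] at this
    calc _ ≤ L₂ * (t * ‖w‖) * ‖w‖ := by gcongr
      _ = _ := by ring

lemma abs_taylor_one (x w : E d) :
    |g (x + w) - g x - inner ℝ (gradient g x) w| ≤ L₁ / 2 * ‖w‖ ^ 2 := by
  have key := image_norm_le_of_norm_deriv_right_le_deriv_boundary
    (f := fun t : ℝ => g (x + t • w) - g x - t * inner ℝ (gradient g x) w)
    (f' := fun t => inner ℝ (gradient g (x + t • w)) w - inner ℝ (gradient g x) w)
    (a := 0) (b := 1)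
    (B := fun t => L₁ / 2 * ‖w‖ ^ 2 * t ^ 2) (B' := fun t => L₁ * ‖w‖ ^ 2 * t)
    ?_ ?_ (by simp) ?_ ?_
  · have := key (x := 1) (by simp)
    simpa using this
  · have h1 := h.diff.continuous
    fun_prop
  · intro t _
    have := ((h.hasDerivAt_line x w t).sub_const (g x)).sub
      ((hasDerivAt_id t).mul_const (inner ℝ (gradient g x) w))
    exact (this.congr_deriv (by simp)).hasDerivWithinAt
  · intro t
    refine ((hasDerivAt_pow 2 t).const_mul (L₁ / 2 * ‖w‖ ^ 2)).congr_deriv ?_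
    push_cast; ring
  · intro t ht
    rw [← inner_sub_left]
    refine (norm_inner_le_norm _ _).trans ?_
    have := h.lip_grad (x + t • w) x
    simp only [add_sub_cancel_left, norm_smul, Real.norm_eq_abs, abs_of_nonneg ht.1] at this
    calc _ ≤ L₁ * (t * ‖w‖) * ‖w‖ := by gcongr
      _ = _ := by ring

lemma abs_taylor_two (x w : E d) :
    |g (x + w) - g x - inner ℝ (gradient g x) w - 1 / 2 * inner ℝ (hessian g x w) w|
      ≤ L₂ / 6 * ‖w‖ ^ 3 := by
  have key := image_norm_le_of_norm_deriv_right_le_deriv_boundary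
    (f := fun t : ℝ => g (x + t • w) - g x - t * inner ℝ (gradient g x) w
      - 1 / 2 * t ^ 2 * inner ℝ (hessian g x w) w)
    (f' := fun t => inner ℝ (gradient g (x + t • w) - gradient g x - hessian g x (t • w)) w)
    (a := 0) (b := 1)
    (B := fun t => L₂ / 6 * ‖w‖ ^ 3 * t ^ 3) (B' := fun t => L₂ / 2 * ‖w‖ ^ 3 * t ^ 2)
    ?_ ?_ (by simp) ?_ ?_
  · have := key (x := 1) (by simp)
    simpa using this
  · have h1 := h.diff.continuous
    fun_prop
  · intro t _
    have := (((h.hasDerivAt_line x w t).sub_const (g x)).sub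
      ((hasDerivAt_id t).mul_const (inner ℝ (gradient g x) w))).sub
      ((((hasDerivAt_id t).pow 2).const_mul (1 / 2)).mul_const (inner ℝ (hessian g x w) w))
    refine (this.congr_deriv ?_).hasDerivWithinAt
    simp [inner_sub_left, inner_smul_left]
  · intro t
    refine ((hasDerivAt_pow 3 t).const_mul (L₂ / 6 * ‖w‖ ^ 3)).congr_deriv ?_
    push_cast; ring
  · intro t ht
    refine (norm_inner_le_norm _ _).trans ?_
    have := h.norm_gradient_taylor x (t • w)
    simp only [norm_smul, Real.norm_eq_abs, abs_of_nonneg ht.1] at this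
    calc _ ≤ L₂ / 2 * (t * ‖w‖) ^ 2 * ‖w‖ := by gcongr
      _ = _ := by ring

lemma norm_hessian_le (hL : 0 ≤ L₁) (x : E d) : ‖hessian g x‖ ≤ L₁ :=
  (h.hasFDerivAt_gradient x).le_of_lip' hL (Filter.Eventually.of_forall fun y => h.lip_grad y x)

/-- This is the symmetry of second derivatives, transported through the Riesz isomorphism that turns
`fderiv` into `gradient`. -/
lemma hessian_symm (x v w : E d) :
    inner ℝ (hessian g x v) w = inner ℝ v (hessian g x w) := by
  have h2 : HasFDerivAt (fun y => fderiv ℝ g y)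
      ((InnerProductSpace.toDual ℝ (E d)).toContinuousLinearEquiv.toContinuousLinearMap.comp
        (hessian g x)) x := by
    have := (InnerProductSpace.toDual ℝ (E d)).toContinuousLinearEquiv.hasFDerivAt.comp x
      (h.hasFDerivAt_gradient x)
    refine this.congr_of_eventuallyEq (Filter.Eventually.of_forall fun y => ?_)
    simp [gradient]
  have := second_derivative_symmetric (fun y => (h.diff y).hasFDerivAt) h2 v w
  simp only [ContinuousLinearMap.comp_apply] at this
  rw [real_inner_comm _ v]
  exact this

end IsSmooth

/-! ### Convex combinations and translations -/

lemma gradient_batch {f : E d → Ξ → ℝ} (hf : ∀ ξ, Differentiable ℝ fun x => f x ξ) {m : ℕ}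
    (S : Fin m → Ξ) (x : E d) :
    gradient (batch f S) x = (1 / (m : ℝ)) • ∑ i, gradient (fun z => f z (S i)) x := by
  have h1 : HasFDerivAt (batch f S)
      ((1 / (m : ℝ)) • ∑ i, fderiv ℝ (fun z => f z (S i)) x) x := by
    unfold batch
    exact (HasFDerivAt.fun_sum fun i _ => (hf (S i) x).hasFDerivAt).const_mul _
  simp [gradient, h1.fderiv]

lemma hessian_batch {f : E d → Ξ → ℝ} {L₁ L₂ : ℝ} (hf : ∀ ξ, IsSmooth (fun x => f x ξ) L₁ L₂)
    {m : ℕ} (S : Fin m → Ξ) (x : E d) :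
    hessian (batch f S) x = (1 / (m : ℝ)) • ∑ i, hessian (fun z => f z (S i)) x := by
  have h1 : gradient (batch f S) =
      fun x => (1 / (m : ℝ)) • ∑ i, gradient (fun z => f z (S i)) x :=
    funext fun x => gradient_batch (fun ξ => (hf ξ).diff) S x
  have h2 : HasFDerivAt (gradient (batch f S))
      ((1 / (m : ℝ)) • ∑ i, hessian (fun z => f z (S i)) x) x := by
    rw [h1]
    exact (HasFDerivAt.fun_sum fun i _ => (hf (S i)).hasFDerivAt_gradient x).fun_const_smul _
  exact h2.fderiv

lemma norm_average_le {V : Type*} [SeminormedAddCommGroup V] [NormedSpace ℝ V] {m : ℕ} (hm : 0 < m)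
    (v : Fin m → V) {c : ℝ} (hv : ∀ i, ‖v i‖ ≤ c) : ‖(1 / (m : ℝ)) • ∑ i, v i‖ ≤ c := by
  have hm' : (0 : ℝ) < m := by exact_mod_cast hm
  rw [norm_smul, Real.norm_of_nonneg (by positivity)]
  have := norm_sum_le_of_le Finset.univ (fun i _ => hv i)
  simp only [Finset.sum_const, Finset.card_univ, Fintype.card_fin, nsmul_eq_mul] at this
  calc _ ≤ 1 / (m : ℝ) * (m * c) := by gcongr
    _ = c := by field_simp

lemma isSmooth_batch {f : E d → Ξ → ℝ} {L₁ L₂ : ℝ} (hf : ∀ ξ, IsSmooth (fun x => f x ξ) L₁ L₂)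
    {m : ℕ} (hm : 0 < m) (S : Fin m → Ξ) : IsSmooth (batch f S) L₁ L₂ where
  diff := by
    unfold batch
    exact (Differentiable.fun_sum fun i _ => (hf (S i)).diff).const_mul _
  diff_grad := by
    rw [funext fun x => gradient_batch (fun ξ => (hf ξ).diff) S x]
    exact (Differentiable.fun_sum fun i _ => (hf (S i)).diff_grad).fun_const_smul _
  lip_grad x y := by
    rw [gradient_batch (fun ξ => (hf ξ).diff), gradient_batch (fun ξ => (hf ξ).diff), ← smul_sub,
      ← Finset.sum_sub_distrib]
    exact norm_average_le hm _ fun i => (hf (S i)).lip_grad x y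
  lip_hess x y := by
    have e := smul_sub (1 / (m : ℝ)) (∑ i, hessian (fun z => f z (S i)) x)
      (∑ i, hessian (fun z => f z (S i)) y)
    rw [hessian_batch hf, hessian_batch hf, ← e, ← Finset.sum_sub_distrib]
    exact norm_average_le hm _ fun i => (hf (S i)).lip_hess x y

lemma Assumptions.isSmooth [MeasurableSpace Ξ] {P : Measure Ξ} {f : E d → Ξ → ℝ} {x₁ : E d}
    {L₁ L₂ G V Δ : ℝ} (h : Assumptions P f x₁ L₁ L₂ G V Δ) (ξ : Ξ) :
    IsSmooth (fun x => f x ξ) L₁ L₂ where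
  diff := (h.twice_differentiable ξ).differentiable (by norm_num)
  diff_grad := differentiable_gradient (h.twice_differentiable ξ)
  lip_grad := h.lipschitz_gradient ξ
  lip_hess := h.lipschitz_hessian ξ

/-! ### Eigenvectors of negative curvature -/

/-- An operator whose least eigenvalue is at most a negative number has an eigenvector to prove
it. -/
lemma exists_eigenvector_of_lambdaMin_le {A : E d →L[ℝ] E d} {γ : ℝ} (hγ : 0 < γ)
    (h : lambdaMin A ≤ -γ) : ∃ (μ : ℝ) (v : E d), μ ≤ -γ ∧ ‖v‖ = 1 ∧ A v = μ • v := by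
  set s := {μ : ℝ | Module.End.HasEigenvalue (A : E d →ₗ[ℝ] E d) μ} with hs
  -- An empty spectrum would give `sInf ∅ = 0`, which is above -γ.
  have hne : s.Nonempty := by
    by_contra hne
    rw [Set.not_nonempty_iff_eq_empty] at hne
    have : lambdaMin A = 0 := by
      change sInf s = 0
      rw [hne, Real.sInf_empty]
    linarith
  have hfin : s.Finite := Module.End.finite_hasEigenvalue _
  obtain ⟨v, hv⟩ := (hne.csInf_mem hfin : sInf s ∈ s).exists_hasEigenvector
  have hv0 : v ≠ 0 := hv.2
  refine ⟨sInf s, (‖v‖⁻¹ : ℝ) • v, h, ?_, ?_⟩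
  · rw [norm_smul, norm_inv, norm_norm, inv_mul_cancel₀ (norm_ne_zero_iff.mpr hv0)]
  · have := hv.apply_eq_smul
    simp only [ContinuousLinearMap.coe_coe] at this
    rw [map_smul, this, smul_comm]

/-- A symmetric operator with a direction of negative curvature has an eigenvector that is at least
as negative. -/
lemma exists_eigenvector_of_inner_le {A : E d →L[ℝ] E d}
    (hA : ∀ v w, inner ℝ (A v) w = inner ℝ v (A w)) {γ : ℝ} {v : E d} (hv : ‖v‖ = 1)
    (h : inner ℝ (A v) v ≤ -γ) :
    ∃ (μ : ℝ) (w : E d), μ ≤ -γ ∧ ‖w‖ = 1 ∧ A w = μ • w := by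
  have hsym : (A : E d →ₗ[ℝ] E d).IsSymmetric := hA
  have hv0 : v ≠ 0 := by rintro rfl; simp at hv
  have : Nontrivial (E d) := ⟨v, 0, hv0⟩
  -- The infimum of the Rayleigh quotient is an eigenvalue, and v shows that it is at most -γ.
  -- Boundedness below is needed because an unbounded real infimum would be 0.
  obtain ⟨w, hw⟩ := (hsym.hasEigenvalue_iInf_of_finiteDimensional).exists_hasEigenvector
  have hw0 : w ≠ 0 := hw.2
  refine ⟨⨅ x : { x : E d // x ≠ 0 },
    RCLike.re (inner ℝ ((A : E d →ₗ[ℝ] E d) x) (x : E d)) / ‖(x : E d)‖ ^ 2,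
    (‖w‖⁻¹ : ℝ) • w, ?_, ?_, ?_⟩
  · have hbdd : BddBelow (Set.range fun x : { x : E d // x ≠ 0 } =>
        RCLike.re (inner ℝ ((A : E d →ₗ[ℝ] E d) x) (x : E d)) / ‖(x : E d)‖ ^ 2) := by
      refine ⟨-‖A‖, ?_⟩
      rintro _ ⟨⟨x, hx⟩, rfl⟩
      have hx' : 0 < ‖x‖ := norm_pos_iff.mpr hx
      simp only [ContinuousLinearMap.coe_coe]
      rw [le_div_iff₀ (by positivity)]
      have h1 := abs_le.mp (abs_real_inner_le_norm (A x) x)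
      have h2 : ‖A x‖ * ‖x‖ ≤ ‖A‖ * ‖x‖ * ‖x‖ := by gcongr; exact A.le_opNorm x
      simp only [RCLike.re_to_real]
      nlinarith [h1.1]
    refine (ciInf_le hbdd ⟨v, hv0⟩).trans ?_
    simpa [hv] using h
  · rw [norm_smul, norm_inv, norm_norm, inv_mul_cancel₀ (norm_ne_zero_iff.mpr hw0)]
  · have := hw.apply_eq_smul
    simp only [ContinuousLinearMap.coe_coe] at this
    rw [map_smul, this, smul_comm]
    rfl

end NeonSCSG

end

noncomputable section

namespace NeonSCSG

variable {d : ℕ} {Ξ : Type*}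

/-! ### The residual function -/

section Residual

variable {g : E d → ℝ} {L L₂ : ℝ} {x : E d}

@[simp] lemma residual_zero (g : E d → ℝ) (x : E d) : residual g x 0 = 0 := by simp [residual]

/-- The residual differs from g (x + ·) by an affine function, so both have the same Bregman
divergence. All estimates for the residual are read off from g at x + u through this identity. -/
lemma residual_sub (u w : E d) :
    residual g x w - residual g x u - inner ℝ (residualGrad g x u) (w - u) =
      g (x + w) - g (x + u) - inner ℝ (gradient g (x + u)) (w - u) := by
  simp only [residual, residualGrad, inner_sub_left, inner_sub_right]; ring

variable (hg : IsSmooth g L L₂)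
include hg

lemma norm_residualGrad_le (u : E d) : ‖residualGrad g x u‖ ≤ L * ‖u‖ := by
  simpa [residualGrad] using hg.lip_grad (x + u) x

lemma residual_le (u w : E d) :
    residual g x w ≤
      residual g x u + inner ℝ (residualGrad g x u) (w - u) + L / 2 * ‖w - u‖ ^ 2 := by
  have h1 := residual_sub (g := g) (x := x) u w
  have h2 := hg.abs_taylor_one (x + u) (w - u)
  rw [show x + u + (w - u) = x + w by abel] at h2
  linarith [(abs_le.mp h2).2]

lemma residual_le_sq (u : E d) : residual g x u ≤ L / 2 * ‖u‖ ^ 2 := by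
  have := residual_le hg (x := x) 0 u
  simpa [residualGrad] using this

lemma inner_hessian_le (u : E d) :
    inner ℝ (hessian g x u) u ≤ 2 * residual g x u + L₂ / 3 * ‖u‖ ^ 3 := by
  have := abs_le.mp (hg.abs_taylor_two x u)
  simp only [residual]
  linarith [this.1]

lemma abs_inner_residualGrad_sub (u v : E d) (hv : ‖v‖ = 1) :
    |inner ℝ (residualGrad g x u) v - inner ℝ (hessian g x u) v| ≤ L₂ / 2 * ‖u‖ ^ 2 := by
  rw [← inner_sub_left]
  refine (abs_real_inner_le_norm _ _).trans ?_
  rw [hv, mul_one]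
  exact hg.norm_gradient_taylor x u

/-- A point with small residual is a direction of negative curvature. -/
lemma curvature_of_residual_le {u : E d} {U F : ℝ} (hL₂ : 0 ≤ L₂) (hU : 0 < U) (hF : 0 < F)
    (hu : ‖u‖ ≤ U) (h : residual g x u ≤ -(2 * F)) (hsmall : L₂ * U ^ 3 ≤ 3 * F) :
    inner ℝ (hessian g x u) u ≤ -(3 * F / U ^ 2) * ‖u‖ ^ 2 := by
  have h1 := inner_hessian_le hg (x := x) u
  have h2 : L₂ * ‖u‖ ^ 3 ≤ L₂ * U ^ 3 := by gcongr
  have h3 : 3 * F / U ^ 2 * ‖u‖ ^ 2 ≤ 3 * F / U ^ 2 * U ^ 2 := by gcongr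
  rw [div_mul_cancel₀ _ (by positivity)] at h3
  linarith

/-- The difference of two points that fail the almost convexity test is a direction of negative
curvature. -/
lemma curvature_of_test {u w : E d} {U γ : ℝ} (hL₂ : 0 ≤ L₂) (hu : ‖u‖ ≤ U) (hw : ‖w‖ ≤ U)
    (h : residual g x (u + w) - residual g x u - inner ℝ (residualGrad g x u) w <
      -(γ / 2) * ‖w‖ ^ 2) (hsmall : 8 * (L₂ * U) ≤ γ) :
    inner ℝ (hessian g x w) w ≤ -(γ / 2) * ‖w‖ ^ 2 := by
  have h1 := residual_sub (g := g) (x := x) u (u + w)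
  rw [add_sub_cancel_left, ← add_assoc] at h1
  have h2 := (abs_le.mp (hg.abs_taylor_two (x + u) w)).1
  have h3 : |inner ℝ (hessian g x w) w - inner ℝ (hessian g (x + u) w) w| ≤
      L₂ * ‖u‖ * ‖w‖ * ‖w‖ := by
    rw [← inner_sub_left, ← sub_apply]
    refine (abs_real_inner_le_norm _ _).trans ?_
    gcongr
    refine (ContinuousLinearMap.le_opNorm _ _).trans ?_
    gcongr
    simpa using hg.lip_hess x (x + u)
  have h4 := (abs_le.mp h3).2
  have h5 : L₂ * ‖u‖ * ‖w‖ * ‖w‖ ≤ L₂ * U * ‖w‖ ^ 2 := by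
    rw [mul_assoc, ← sq]; gcongr
  have h6 : L₂ * ‖w‖ ^ 3 ≤ L₂ * U * ‖w‖ ^ 2 := by
    rw [pow_succ' ‖w‖ 2, ← mul_assoc]; gcongr
  have h7 : 0 ≤ L₂ * U * ‖w‖ ^ 2 := by
    have := (norm_nonneg _).trans hu
    positivity
  have h8 : 8 * (L₂ * U) * ‖w‖ ^ 2 ≤ γ * ‖w‖ ^ 2 := by gcongr
  linarith

end Residual

/-! ### NEON -/

lemma isArgmin_exists {h : E d → ℝ} {u : ℕ → E d} {U c : ℝ} {n σ : ℕ} (hσ : σ ≤ n)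
    (hU : ‖u σ‖ ≤ U) (hc : h (u σ) ≤ c) : ∃ τ, IsArgmin h u U n τ ∧ h (u τ) ≤ c := by
  classical
  obtain ⟨τ, hτ, hmin⟩ := ((Finset.range (n + 1)).filter fun k => ‖u k‖ ≤ U).exists_min_image
    (fun k => h (u k)) ⟨σ, by simp [hU]; omega⟩
  simp only [Finset.mem_filter, Finset.mem_range] at hτ hmin
  exact ⟨τ, ⟨by omega, hτ.2, fun k hk hkU => hmin k ⟨by omega, hkU⟩⟩,
    (hmin σ ⟨by omega, hU⟩).trans hc⟩

section Neon

variable {g : E d → ℝ} {L L₂ : ℝ} {x : E d} {p : Tuning}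

lemma neon_spec {u₀ : E d} (h : neon g p x u₀ ≠ 0) :
    residual g x (neon g p x u₀) ≤ -(2.5 * p.𝓕) ∧ ‖neon g p x u₀‖ ≤ p.U := by
  classical
  unfold neon at h ⊢
  split_ifs at h ⊢ with hex
  · exact ⟨(Nat.find_spec hex).2, (Nat.find_spec hex).1.2.1⟩
  · simp at h

lemma neon_ne_zero_of_residual_le {u₀ : E d} {σ : ℕ} (hF : 0 < p.𝓕) (hσ : σ ≤ p.t + 1)
    (hU : ‖neonIter g x p.η u₀ σ‖ ≤ p.U)
    (h : residual g x (neonIter g x p.η u₀ σ) ≤ -(2.5 * p.𝓕)) : neon g p x u₀ ≠ 0 := by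
  classical
  have hex := isArgmin_exists (u := neonIter g x p.η u₀) hσ hU h
  unfold neon
  rw [dif_pos hex]
  intro h0
  have := (Nat.find_spec hex).2
  rw [h0, residual_zero] at this
  linarith

variable (hg : IsSmooth g L L₂)
include hg

/-- Descent lemma: with η L ≤ 1 the squared length of a gradient step is paid for by the decrease of
the residual. -/
lemma residual_neonIter_succ_le {η : ℝ} (hη : 0 < η) (hηL : η * L ≤ 1) (u₀ : E d) (k : ℕ) :
    ‖neonIter g x η u₀ (k + 1) - neonIter g x η u₀ k‖ ^ 2 ≤
      2 * η * (residual g x (neonIter g x η u₀ k) - residual g x (neonIter g x η u₀ (k + 1))) := by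
  set u := neonIter g x η u₀ k with hu
  have hs : neonIter g x η u₀ (k + 1) - u = -(η • residualGrad g x u) := by
    simp only [neonIter, ← hu]; abel
  have h1 := residual_le hg (x := x) u (neonIter g x η u₀ (k + 1))
  rw [hs, norm_neg, norm_smul, inner_neg_right, inner_smul_right, real_inner_self_eq_norm_sq,
    Real.norm_of_nonneg hη.le] at h1
  rw [hs, norm_neg, norm_smul, Real.norm_of_nonneg hη.le]
  have h2 : η * L * (η * ‖residualGrad g x u‖) ^ 2 ≤ 1 * (η * ‖residualGrad g x u‖) ^ 2 := by
    gcongr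
  nlinarith [mul_le_mul_of_nonneg_left h1 (by positivity : 0 ≤ 2 * η)]

/-- Cauchy–Schwarz over the n steps, then telescoping. Iterates that have travelled far must have
lowered the residual. -/
lemma sq_dist_neonIter_le {η : ℝ} (hη : 0 < η) (hηL : η * L ≤ 1) (u₀ : E d) (n : ℕ) :
    ‖neonIter g x η u₀ n - u₀‖ ^ 2 ≤
      n * (2 * η * (residual g x u₀ - residual g x (neonIter g x η u₀ n))) := by
  set u := neonIter g x η u₀ with hu
  have h0 : u 0 = u₀ := rfl
  have h1 : ‖u n - u₀‖ ≤ ∑ k ∈ Finset.range n, ‖u (k + 1) - u k‖ := by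
    rw [← h0, ← Finset.sum_range_sub]
    exact norm_sum_le _ _
  calc ‖u n - u₀‖ ^ 2 ≤ (∑ k ∈ Finset.range n, ‖u (k + 1) - u k‖) ^ 2 := by gcongr
    _ ≤ n * ∑ k ∈ Finset.range n, ‖u (k + 1) - u k‖ ^ 2 := by
        simpa using sq_sum_le_card_mul_sum_sq (s := Finset.range n)
          (f := fun k => ‖u (k + 1) - u k‖)
    _ ≤ n * ∑ k ∈ Finset.range n, 2 * η * (residual g x (u k) - residual g x (u (k + 1))) := by
        gcongr with k _
        exact residual_neonIter_succ_le hg hη hηL u₀ k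
    _ = _ := by
        rw [← Finset.mul_sum, Finset.sum_range_sub', h0]

/-- The linearised step multiplies the component along v by 1 - ημ ≥ 1 + ηγ. Inside the ball of
radius U the nonlinear error is at most L₂U²/2 ≤ γα/2, and the component never falls below α, so at
least half of the growth survives. -/
lemma inner_neonIter_ge {η U γ α μ : ℝ} {u₀ v : E d} (hη : 0 < η) (hv : ‖v‖ = 1)
    (hμ : μ ≤ -γ) (hγ : 0 ≤ γ) (hL₂ : 0 ≤ L₂) (hHv : hessian g x v = μ • v)
    (hα : 0 < α) (hu₀ : α ≤ inner ℝ u₀ v) (hsmall : L₂ * U ^ 2 ≤ γ * α) (n : ℕ)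
    (hloc : ∀ k < n, ‖neonIter g x η u₀ k‖ ≤ U) :
    (1 + η * γ / 2) ^ n * α ≤ inner ℝ (neonIter g x η u₀ n) v := by
  induction n with
  | zero => simpa [neonIter] using hu₀
  | succ n ih =>
    have ih := ih fun k hk => hloc k (by omega)
    set u := neonIter g x η u₀ n with hu
    have hα' : α ≤ inner ℝ u v := by
      refine le_trans ?_ ih
      have : 1 ≤ (1 + η * γ / 2) ^ n := one_le_pow₀ (by nlinarith [mul_nonneg hη.le hγ])
      nlinarith
    have h1 := (abs_le.mp (abs_inner_residualGrad_sub hg (x := x) u v hv)).2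
    rw [hg.hessian_symm, hHv, inner_smul_right] at h1
    have h2 : L₂ * ‖u‖ ^ 2 ≤ L₂ * U ^ 2 := by
      have := hloc n (by omega)
      gcongr
    have h3 : inner ℝ (residualGrad g x u) v ≤ -(γ / 2) * inner ℝ u v := by nlinarith
    have h4 : inner ℝ (neonIter g x η u₀ (n + 1)) v =
        inner ℝ u v - η * inner ℝ (residualGrad g x u) v := by
      simp only [neonIter, ← hu, inner_sub_left, inner_smul_left]; simp
    rw [h4, pow_succ]
    have h5 : 0 ≤ 1 + η * γ / 2 := by positivity
    nlinarith [mul_le_mul_of_nonneg_left h3 hη.le, mul_le_mul_of_nonneg_left ih h5]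

/-- NEON finds negative curvature if the noise has a sizeable component along an eigenvector of
negative curvature. -/
lemma neon_ne_zero {γ α μ r : ℝ} {u₀ v : E d} (hη : 0 < p.η) (hηL : p.η * L ≤ 1) (hL : 0 ≤ L)
    (hv : ‖v‖ = 1) (hμ : μ ≤ -γ) (hγ : 0 ≤ γ) (hL₂ : 0 ≤ L₂) (hHv : hessian g x v = μ • v)
    (hα : 0 < α) (hu₀ : α ≤ |inner ℝ u₀ v|) (hsmall : L₂ * p.U ^ 2 ≤ γ * α)
    (hgrowth : p.U < (1 + p.η * γ / 2) ^ (p.t + 1) * α) (hU : 0 < p.U) (hF : 0 < p.𝓕)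
    (ht : 0 < p.t) (hr : ‖u₀‖ ≤ r) (hrU : 8 * r ≤ p.U)
    (hFU : 2.5 * p.𝓕 + L / 2 * r ^ 2 ≤ 9 / 128 * p.U ^ 2 / (p.η * p.t)) :
    neon g p x u₀ ≠ 0 := by
  -- The vector -v is an eigenvector for the same eigenvalue, so the sign of the component is
  -- irrelevant.
  wlog hpos : 0 ≤ inner ℝ u₀ v generalizing v
  · refine this (v := -v) (by simpa using hv) (by simp [hHv]) (by simpa using hu₀) ?_
    rw [inner_neg_right]; linarith
  rw [abs_of_nonneg hpos] at hu₀
  classical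
  have hexit : ∃ n, n ≤ p.t + 1 ∧ p.U < ‖neonIter g x p.η u₀ n‖ := by
    by_contra! hno
    have h1 := inner_neonIter_ge hg hη hv hμ hγ hL₂ hHv hα hu₀ hsmall (p.t + 1)
      fun k hk => hno k hk.le
    have h2 := real_inner_le_norm (neonIter g x p.η u₀ (p.t + 1)) v
    rw [hv, mul_one] at h2
    linarith [hno (p.t + 1) le_rfl]
  obtain ⟨hn1, hn2⟩ := Nat.find_spec hexit
  have hmin := fun k => Nat.find_min hexit (m := k)
  generalize Nat.find hexit = n at *
  -- The start lies inside the ball, so the first exit happens at some n + 1, and iterate n is the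
  -- last one inside. This iterate is the witness.
  obtain _ | n := n
  · have : neonIter g x p.η u₀ 0 = u₀ := rfl
    rw [this] at hn2
    linarith [norm_nonneg u₀]
  have hin : ‖neonIter g x p.η u₀ n‖ ≤ p.U := by
    have := hmin n (by omega)
    by_contra! hcon
    exact this ⟨by omega, hcon⟩
  refine neon_ne_zero_of_residual_le hF (by omega : n ≤ p.t + 1) hin ?_
  have h1 := sq_dist_neonIter_le hg (x := x) hη hηL u₀ n
  set u := neonIter g x p.η u₀ n with hu
  -- A gradient step with η L ≤ 1 at most doubles the norm. Hence the last iterate inside has norm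
  -- at least U/2, and it is 3U/8 away from the start because r ≤ U/8.
  have h2 : p.U ≤ 2 * ‖u‖ := by
    refine hn2.le.trans ?_
    simp only [neonIter, ← hu]
    refine (norm_sub_le _ _).trans ?_
    rw [norm_smul, Real.norm_of_nonneg hη.le]
    have := mul_le_mul_of_nonneg_left (norm_residualGrad_le hg (x := x) u) hη.le
    nlinarith [norm_nonneg u]
  have h3 : 3 / 8 * p.U ≤ ‖u - u₀‖ := by
    have := norm_sub_norm_le u u₀
    linarith
  have h4 : residual g x u₀ ≤ L / 2 * r ^ 2 :=
    (residual_le_sq hg u₀).trans (by gcongr)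
  have h5 : (3 / 8 * p.U) ^ 2 ≤ ‖u - u₀‖ ^ 2 := by gcongr
  have ht' : (0 : ℝ) < p.t := by exact_mod_cast ht
  have hD : 0 ≤ residual g x u₀ - residual g x u := by
    by_contra! hneg
    have : (n : ℝ) * (2 * p.η * (residual g x u₀ - residual g x u)) ≤ 0 :=
      mul_nonpos_of_nonneg_of_nonpos (by positivity)
        (mul_nonpos_of_nonneg_of_nonpos (by positivity) hneg.le)
    nlinarith
  have h6 : (3 / 8 * p.U) ^ 2 ≤ p.t * (2 * p.η * (residual g x u₀ - residual g x u)) := by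
    refine (h5.trans h1).trans ?_
    gcongr
    omega
  have h7 : 9 / 128 * p.U ^ 2 / (p.η * p.t) ≤ residual g x u₀ - residual g x u := by
    rw [div_le_iff₀ (by positivity)]
    nlinarith
  linarith

end Neon

end NeonSCSG

end

noncomputable section

namespace NeonSCSG

variable {d : ℕ} {Ξ : Type*}

/-! ### NEON⁺ -/

/-- The increments `y_k - y_{k-1}` of the accelerated gradient method. -/
def nagDiff (q : ℕ → E d × E d) : ℕ → E d
  -- The method starts with zero momentum, since v₀ = u₀.
  | 0 => 0
  | k + 1 => (q (k + 1)).1 - (q k).1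

section NeonPlus

variable {g : E d → ℝ} {L L₂ : ℝ} {x : E d} {p : Tuning}

lemma nagIter_snd (g : E d → ℝ) (x : E d) (η ζ : ℝ) (u₀ : E d) (k : ℕ) :
    (nagIter g x η ζ u₀ k).2 =
      (nagIter g x η ζ u₀ k).1 + ζ • nagDiff (nagIter g x η ζ u₀) k := by
  cases k <;> simp [nagIter, nagDiff]

lemma nagIter_succ_fst (g : E d → ℝ) (x : E d) (η ζ : ℝ) (u₀ : E d) (k : ℕ) :
    (nagIter g x η ζ u₀ (k + 1)).1 =
      (nagIter g x η ζ u₀ k).2 - η • residualGrad g x (nagIter g x η ζ u₀ k).2 := rfl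

lemma nagIter_succ_fst' (g : E d → ℝ) (x : E d) (η ζ : ℝ) (u₀ : E d) (k : ℕ) :
    (nagIter g x η ζ u₀ (k + 1)).1 =
      (nagIter g x η ζ u₀ k).1 + nagDiff (nagIter g x η ζ u₀) (k + 1) := by
  simp [nagDiff]

lemma nagDiff_succ (g : E d → ℝ) (x : E d) (η ζ : ℝ) (u₀ : E d) (k : ℕ) :
    nagDiff (nagIter g x η ζ u₀) (k + 1) = ζ • nagDiff (nagIter g x η ζ u₀) k -
      η • residualGrad g x (nagIter g x η ζ u₀ k).2 := by
  change (nagIter g x η ζ u₀ (k + 1)).1 - (nagIter g x η ζ u₀ k).1 = _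
  rw [nagIter_succ_fst]
  nth_rewrite 1 [nagIter_snd]
  abel

lemma norm_nagIter_le {η ζ ω r : ℝ} {u₀ : E d} (hr : ‖u₀‖ ≤ r) {k : ℕ}
    (hD : ∀ j ≤ k, ‖nagDiff (nagIter g x η ζ u₀) j‖ ≤ ω) :
    ‖(nagIter g x η ζ u₀ k).1‖ ≤ r + k * ω := by
  induction k with
  | zero => simpa [nagIter] using hr
  | succ k ih =>
    have h1 := ih fun j hj => hD j (by omega)
    have h2 := hD (k + 1) le_rfl
    rw [nagIter_succ_fst']
    push_cast
    linarith [norm_add_le (nagIter g x η ζ u₀ k).1 (nagDiff (nagIter g x η ζ u₀) (k + 1))]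

lemma norm_nagIter_snd_le {η ζ ω r : ℝ} {u₀ : E d} (hr : ‖u₀‖ ≤ r) (hζ0 : 0 ≤ ζ) (hζ1 : ζ ≤ 1)
    {k : ℕ} (hD : ∀ j ≤ k, ‖nagDiff (nagIter g x η ζ u₀) j‖ ≤ ω) :
    ‖(nagIter g x η ζ u₀ k).2‖ ≤ r + (k + 1) * ω := by
  have h1 := norm_nagIter_le hr hD
  have h2 := hD k le_rfl
  rw [nagIter_snd]
  refine (norm_add_le _ _).trans ?_
  rw [norm_smul, Real.norm_of_nonneg hζ0]
  nlinarith [norm_nonneg (nagDiff (nagIter g x η ζ u₀) k)]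

variable (hg : IsSmooth g L L₂)
include hg

/-- The energy is residual plus kinetic term. The failed test says that the residual is convex
between u and v up to a defect (γ/2)‖ζD‖², and the friction ζ²(1 + ηγ) ≤ 1 removes at least that
much kinetic energy. The gradient step itself only lowers the energy since η L ≤ 1. -/
lemma energy_le {η ζ γ : ℝ} (hη : 0 < η) (hηL : η * L ≤ 1) (hζ0 : 0 ≤ ζ)
    (hζ : ζ ^ 2 * (1 + η * γ) ≤ 1) (u₀ : E d) (k : ℕ)
    (htest : ¬ NCTest g x γ (nagIter g x η ζ u₀ k)) :
    residual g x (nagIter g x η ζ u₀ (k + 1)).1 +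
        ‖nagDiff (nagIter g x η ζ u₀) (k + 1)‖ ^ 2 / (2 * η) ≤
      residual g x (nagIter g x η ζ u₀ k).1 +
        ‖nagDiff (nagIter g x η ζ u₀) k‖ ^ 2 / (2 * η) := by
  have hs := nagIter_snd g x η ζ u₀ k
  have hD := nagDiff_succ g x η ζ u₀ k
  have hy := nagIter_succ_fst g x η ζ u₀ k
  set y := (nagIter g x η ζ u₀ k).1
  set u := (nagIter g x η ζ u₀ k).2
  set D := nagDiff (nagIter g x η ζ u₀) k
  set R := residualGrad g x u
  have h1 := residual_le hg (x := x) u (nagIter g x η ζ u₀ (k + 1)).1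
  have e1 : (nagIter g x η ζ u₀ (k + 1)).1 - u = -(η • R) := by rw [hy]; abel
  rw [e1, norm_neg, norm_smul, inner_neg_right, inner_smul_right, Real.norm_of_nonneg hη.le,
    real_inner_self_eq_norm_sq] at h1
  have h2 : residual g x u - ζ * inner ℝ R D - γ / 2 * (ζ ^ 2 * ‖D‖ ^ 2) ≤ residual g x y := by
    unfold NCTest at htest
    push Not at htest
    have e2 : y - u = -(ζ • D) := by rw [hs]; abel
    change -(γ / 2) * ‖y - u‖ ^ 2 ≤ residual g x y - residual g x u - inner ℝ R (y - u) at htest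
    rw [e2, norm_neg, norm_smul, inner_neg_right, inner_smul_right, Real.norm_of_nonneg hζ0,
      mul_pow] at htest
    linarith
  have h3 : ‖nagDiff (nagIter g x η ζ u₀) (k + 1)‖ ^ 2 =
      ζ ^ 2 * ‖D‖ ^ 2 - 2 * η * (ζ * inner ℝ R D) + η ^ 2 * ‖R‖ ^ 2 := by
    rw [hD, norm_sub_sq_real, inner_smul_left, inner_smul_right, norm_smul, norm_smul,
      Real.norm_of_nonneg hζ0, Real.norm_of_nonneg hη.le, real_inner_comm]
    simp only [conj_trivial]
    ring
  rw [h3]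
  have h4 : (ζ ^ 2 * ‖D‖ ^ 2 - 2 * η * (ζ * inner ℝ R D) + η ^ 2 * ‖R‖ ^ 2) / (2 * η) =
      ζ ^ 2 * ‖D‖ ^ 2 / (2 * η) - ζ * inner ℝ R D + η * ‖R‖ ^ 2 / 2 := by
    field_simp
  rw [h4]
  have h5 : ζ ^ 2 * ‖D‖ ^ 2 / (2 * η) + γ / 2 * (ζ ^ 2 * ‖D‖ ^ 2) ≤ ‖D‖ ^ 2 / (2 * η) := by
    rw [show ζ ^ 2 * ‖D‖ ^ 2 / (2 * η) + γ / 2 * (ζ ^ 2 * ‖D‖ ^ 2) =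
      (ζ ^ 2 * (1 + η * γ)) * ‖D‖ ^ 2 / (2 * η) by field_simp]
    gcongr
    nlinarith [sq_nonneg ‖D‖]
  have h6 : L / 2 * (η * ‖R‖) ^ 2 ≤ η * ‖R‖ ^ 2 / 2 := by
    have : η * L * (η * ‖R‖ ^ 2) ≤ 1 * (η * ‖R‖ ^ 2) := by gcongr
    nlinarith
  linarith

lemma energy_le_zero {η ζ γ : ℝ} (hη : 0 < η) (hηL : η * L ≤ 1) (hζ0 : 0 ≤ ζ)
    (hζ : ζ ^ 2 * (1 + η * γ) ≤ 1) (u₀ : E d) (k : ℕ)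
    (htest : ∀ j < k, ¬ NCTest g x γ (nagIter g x η ζ u₀ j)) :
    residual g x (nagIter g x η ζ u₀ k).1 +
        ‖nagDiff (nagIter g x η ζ u₀) k‖ ^ 2 / (2 * η) ≤ L / 2 * ‖u₀‖ ^ 2 := by
  induction k with
  | zero => simpa [nagIter, nagDiff] using residual_le_sq hg u₀
  | succ k ih =>
    exact (energy_le hg hη hηL hζ0 hζ u₀ k (htest k (by omega))).trans
      (ih fun j hj => htest j (by omega))

/-- The first long step of the accelerated gradient method leads to a point with small residual. -/
lemma residual_le_of_long_step {η ζ γ ω r F : ℝ} (hη : 0 < η) (hηL : η * L ≤ 1) (hζ0 : 0 ≤ ζ)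
    (hζ1 : ζ ≤ 1) (hζ : ζ ^ 2 * (1 + η * γ) ≤ 1) (hL : 0 ≤ L) {u₀ : E d} (hr : ‖u₀‖ ≤ r)
    (hω : 0 < ω) (hωF : ω ^ 2 = 6 * η * F) (hrF : L / 2 * r ^ 2 ≤ F / 2) {k : ℕ}
    (htest : ∀ j < k, ¬ NCTest g x γ (nagIter g x η ζ u₀ j))
    (hlong : ω ≤ ‖nagDiff (nagIter g x η ζ u₀) k‖)
    (hshort : ∀ j < k, ‖nagDiff (nagIter g x η ζ u₀) j‖ ≤ ω) :
    residual g x (nagIter g x η ζ u₀ k).1 ≤ -(5 / 2 * F) ∧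
      ‖(nagIter g x η ζ u₀ k).1‖ ≤ 2 * (r + k * ω) := by
  constructor
  · have h1 := energy_le_zero hg hη hηL hζ0 hζ u₀ k htest
    have h2 : 3 * F ≤ ‖nagDiff (nagIter g x η ζ u₀) k‖ ^ 2 / (2 * η) := by
      rw [le_div_iff₀ (by positivity)]
      have : ω ^ 2 ≤ ‖nagDiff (nagIter g x η ζ u₀) k‖ ^ 2 := by gcongr
      linarith
    have h3 : L / 2 * ‖u₀‖ ^ 2 ≤ L / 2 * r ^ 2 := by gcongr
    linarith
  · obtain _ | k := k
    · simp only [nagDiff, norm_zero] at hlong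
      linarith
    · have h1 := norm_nagIter_snd_le (g := g) (x := x) (η := η) hr hζ0 hζ1 (k := k)
        fun j hj => hshort j (by omega)
      rw [nagIter_succ_fst]
      refine (norm_sub_le _ _).trans ?_
      rw [norm_smul, Real.norm_of_nonneg hη.le]
      have := mul_le_mul_of_nonneg_left
        (norm_residualGrad_le hg (x := x) (nagIter g x η ζ u₀ k).2) hη.le
      push_cast
      nlinarith [norm_nonneg (nagIter g x η ζ u₀ k).2]

/-- Projected on v, the scheme is a recursion for the position a and the momentum b: b' ≥ (1 - s) b
+ s² a and a' = a + b'. The combination a + b/(4s) grows by the factor 1 + s/4 in each step. As s is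
of order √(ηγ), this is the acceleration over NEON. -/
lemma inner_nagIter_ge {η ζ s U γ α μ : ℝ} {u₀ v : E d} (hη : 0 < η) (hs : 0 < s) (hs' : s ≤ 1 / 2)
    (hsγ : s ^ 2 = η * γ / 2) (hζ : ζ = 1 - s) (hv : ‖v‖ = 1)
    (hμ : μ ≤ -γ) (hL₂ : 0 ≤ L₂) (hHv : hessian g x v = μ • v)
    (hα : 0 < α) (hu₀ : α ≤ inner ℝ u₀ v) (hsmall : L₂ * U ^ 2 ≤ γ * α) (n : ℕ)
    (hloc : ∀ k < n, ‖(nagIter g x η ζ u₀ k).2‖ ≤ U) :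
    α ≤ inner ℝ (nagIter g x η ζ u₀ n).1 v ∧
      0 ≤ inner ℝ (nagDiff (nagIter g x η ζ u₀) n) v ∧
      (1 + s / 4) ^ n * α ≤ inner ℝ (nagIter g x η ζ u₀ n).1 v +
        1 / (4 * s) * inner ℝ (nagDiff (nagIter g x η ζ u₀) n) v := by
  have hγ : 0 < γ := by
    have : 0 < η * γ := by nlinarith [sq_pos_of_pos hs]
    exact pos_of_mul_pos_right this hη.le
  induction n with
  | zero => simp [nagIter, nagDiff, hu₀]
  | succ n ih =>
    obtain ⟨ih1, ih2, ih3⟩ := ih fun k hk => hloc k (by omega)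
    have hu := nagIter_snd g x η ζ u₀ n
    rw [nagIter_succ_fst', nagDiff_succ]
    set y := (nagIter g x η ζ u₀ n).1
    set u := (nagIter g x η ζ u₀ n).2 with hu_def
    set D := nagDiff (nagIter g x η ζ u₀) n
    have h1 := (abs_le.mp (abs_inner_residualGrad_sub hg (x := x) u v hv)).2
    rw [hg.hessian_symm, hHv, inner_smul_right] at h1
    have h2 : L₂ * ‖u‖ ^ 2 ≤ L₂ * U ^ 2 := by
      have := hloc n (by omega)
      gcongr
    have h3 : inner ℝ u v = inner ℝ y v + ζ * inner ℝ D v := by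
      rw [hu, inner_add_left, inner_smul_left]; simp
    simp only [inner_add_left, inner_sub_left, inner_smul_left, conj_trivial]
    set a := inner ℝ y v
    set b := inner ℝ D v
    set c := inner ℝ (residualGrad g x u) v
    have hζ0 : 0 ≤ ζ := by linarith
    have hb : 0 ≤ ζ * b := by positivity
    have h4 : c ≤ -(γ / 2) * a := by
      rw [h3] at h1
      nlinarith
    have h5 : s ^ 2 * a ≤ -(η * c) := by nlinarith
    have h6 : 0 ≤ s ^ 2 * a := mul_nonneg (sq_nonneg s) (hα.le.trans ih1)
    refine ⟨by linarith, by linarith, ?_⟩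
    have h7 : (1 + s / 4) * (a + 1 / (4 * s) * b) ≤ a + (1 + 1 / (4 * s)) * (ζ * b + s ^ 2 * a) := by
      have e : 1 / (4 * s) * s = 1 / 4 := by field_simp
      have e1 : (1 + s / 4) * (a + 1 / (4 * s) * b) =
          a + s / 4 * a + 1 / (4 * s) * b + (1 / (4 * s) * s) / 4 * b := by ring
      have e2 : a + (1 + 1 / (4 * s)) * (ζ * b + s ^ 2 * a) = a + (1 - s) * b + s ^ 2 * a +
          1 / (4 * s) * b - (1 / (4 * s) * s) * b + (1 / (4 * s) * s) * s * a := by rw [hζ]; ring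
      rw [e1, e2, e]
      have : 0 ≤ (11 / 16 - s) * b := mul_nonneg (by linarith) ih2
      linarith
    have h8 : 0 ≤ 1 / (4 * s) := by positivity
    rw [pow_succ']
    nlinarith [mul_le_mul_of_nonneg_left ih3 (by positivity : 0 ≤ 1 + s / 4),
      mul_le_mul_of_nonneg_left h5 h8]

/-- Hypotheses on the parameters of NEON⁺, run with test accuracy `γ`. -/
structure NagTuned (p : Tuning) (γ L r : ℝ) : Prop where
  η_pos : 0 < p.η
  η_le : p.η * L ≤ 1
  L_nonneg : 0 ≤ L
  ζ_pos : 0 < p.ζ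
  ζ_le : p.ζ ≤ 1
  ζ_sq : p.ζ ^ 2 * (1 + p.η * γ) ≤ 1
  F_pos : 0 < p.𝓕
  noise : L / 2 * r ^ 2 ≤ p.𝓕 / 2
  -- The sum bounds every point reached by at most t + 1 short steps. The factor 2 allows for the
  -- gradient step that produces the first long increment, which can double the norm.
  radius : 2 * (r + (p.t + 1) * √(6 * p.η * p.𝓕)) ≤ p.U

omit hg in
-- Since v - u = -ζ • momentum, the threshold of `ncFind` is a threshold on the momentum alone.
lemma NagTuned.long_iff {γ r : ℝ} (hp : NagTuned p γ L r) (u₀ : E d) (k : ℕ) :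
    p.ζ * √(6 * p.η * p.𝓕) ≤
        ‖(nagIter g x p.η p.ζ u₀ k).1 - (nagIter g x p.η p.ζ u₀ k).2‖ ↔
      √(6 * p.η * p.𝓕) ≤ ‖nagDiff (nagIter g x p.η p.ζ u₀) k‖ := by
  rw [nagIter_snd, sub_add_cancel_left, norm_neg, norm_smul, Real.norm_of_nonneg hp.ζ_pos.le]
  exact mul_le_mul_iff_right₀ hp.ζ_pos

omit hg in
lemma NagTuned.step_pos {γ r : ℝ} (hp : NagTuned p γ L r) : 0 < √(6 * p.η * p.𝓕) := by
  have h1 := hp.η_pos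
  have h2 := hp.F_pos
  positivity

lemma NagTuned.long_step {γ r : ℝ} (hp : NagTuned p γ L r) {u₀ : E d} (hr : ‖u₀‖ ≤ r) {k : ℕ}
    (hk : k ≤ p.t + 1) (htest : ∀ j < k, ¬ NCTest g x γ (nagIter g x p.η p.ζ u₀ j))
    (hlong : √(6 * p.η * p.𝓕) ≤ ‖nagDiff (nagIter g x p.η p.ζ u₀) k‖)
    (hshort : ∀ j < k, ‖nagDiff (nagIter g x p.η p.ζ u₀) j‖ ≤ √(6 * p.η * p.𝓕)) :
    residual g x (nagIter g x p.η p.ζ u₀ k).1 ≤ -(2 * p.𝓕) ∧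
      ‖(nagIter g x p.η p.ζ u₀ k).1‖ ≤ p.U := by
  have h1 := hp.η_pos
  have h2 := hp.F_pos
  have h3 := hp.step_pos
  obtain ⟨h4, h5⟩ := residual_le_of_long_step hg hp.η_pos hp.η_le hp.ζ_pos.le hp.ζ_le hp.ζ_sq
    hp.L_nonneg hr hp.step_pos (Real.sq_sqrt (by positivity)) hp.noise htest hlong hshort
  refine ⟨by linarith, h5.trans (le_trans ?_ hp.radius)⟩
  have : (k : ℝ) ≤ p.t + 1 := by exact_mod_cast hk
  gcongr

/-- The vector returned by NEON⁺ is a direction of negative curvature. -/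
lemma neonPlus_spec {γ r : ℝ} (hp : NagTuned p γ L r) {u₀ : E d} (hr : ‖u₀‖ ≤ r)
    (h : neonPlus g γ p x u₀ ≠ 0) :
    (residual g x (neonPlus g γ p x u₀) ≤ -(2 * p.𝓕) ∧ ‖neonPlus g γ p x u₀‖ ≤ p.U) ∨
    ∃ u : E d, ‖u‖ ≤ p.U ∧ ‖neonPlus g γ p x u₀‖ ≤ p.U ∧
      residual g x (u + neonPlus g γ p x u₀) - residual g x u -
        inner ℝ (residualGrad g x u) (neonPlus g γ p x u₀) <
          -(γ / 2) * ‖neonPlus g γ p x u₀‖ ^ 2 := by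
  classical
  unfold neonPlus at h ⊢
  split_ifs at h ⊢ with h1 h2
  · obtain ⟨hτ, htest⟩ := Nat.find_spec h1
    have hbefore : ∀ j < Nat.find h1, ¬ NCTest g x γ (nagIter g x p.η p.ζ u₀ j) :=
      fun j hj hc => Nat.find_min h1 hj ⟨by omega, hc⟩
    generalize Nat.find h1 = τ at *
    unfold ncFind at h ⊢
    split_ifs at h ⊢ with h3
    · left
      obtain ⟨hj, hlong⟩ := Nat.find_spec h3
      have hmin : ∀ i < Nat.find h3,
          ‖nagDiff (nagIter g x p.η p.ζ u₀) i‖ ≤ √(6 * p.η * p.𝓕) := fun i hi => by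
        by_contra! hc
        exact Nat.find_min h3 hi ⟨by omega, (hp.long_iff u₀ i).mpr hc.le⟩
      exact hp.long_step hg hr (by omega) (fun i hi => hbefore i (by omega))
        ((hp.long_iff u₀ _).mp hlong) hmin
    · right
      push Not at h3
      have hshort : ∀ j ≤ τ, ‖nagDiff (nagIter g x p.η p.ζ u₀) j‖ ≤ √(6 * p.η * p.𝓕) :=
        fun j hj => by
          by_contra! hc
          exact absurd ((hp.long_iff u₀ j).mpr hc.le) (not_le.mpr (h3 j hj))
      have hu := norm_nagIter_snd_le hr hp.ζ_pos.le hp.ζ_le hshort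
      have hτ' : (τ : ℝ) ≤ p.t := by exact_mod_cast hτ
      have hω := hp.step_pos
      have hr0 := (norm_nonneg u₀).trans hr
      refine ⟨(nagIter g x p.η p.ζ u₀ τ).2, hu.trans ?_, ?_, ?_⟩
      · have := hp.radius
        have h5 : 0 ≤ ((p.t : ℝ) + 1) * √(6 * p.η * p.𝓕) := by positivity
        have h6 : ((τ : ℝ) + 1) * √(6 * p.η * p.𝓕) ≤ (p.t + 1) * √(6 * p.η * p.𝓕) := by gcongr
        linarith
      · refine (h3 τ le_rfl).le.trans ?_
        have := hp.radius
        have h5 : p.ζ * √(6 * p.η * p.𝓕) ≤ 1 * √(6 * p.η * p.𝓕) := by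
          gcongr; exact hp.ζ_le
        have h6 : 0 ≤ (p.t : ℝ) * √(6 * p.η * p.𝓕) := by positivity
        linarith
      · rw [add_sub_cancel]
        exact htest
  · left
    exact ⟨(Nat.find_spec h2).2, (Nat.find_spec h2).1.2.1⟩
  · simp at h

/-- NEON⁺ finds negative curvature if the noise has a sizeable component along an eigenvector of
negative curvature. -/
lemma neonPlus_ne_zero {γt γ α μ r s : ℝ} {u₀ v : E d} (hp : NagTuned p γt L r) (hr : ‖u₀‖ ≤ r)
    (hs : 0 < s) (hs' : s ≤ 1 / 2) (hsγ : s ^ 2 = p.η * γ / 2) (hζ : p.ζ = 1 - s) (hv : ‖v‖ = 1)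
    (hμ : μ ≤ -γ) (hL₂ : 0 ≤ L₂) (hHv : hessian g x v = μ • v)
    (hα : 0 < α) (hu₀ : α ≤ |inner ℝ u₀ v|) (hsmall : L₂ * p.U ^ 2 ≤ γ * α)
    (hgrowth : p.U * (1 + 1 / (4 * s)) < (1 + s / 4) ^ (p.t + 1) * α) :
    neonPlus g γt p x u₀ ≠ 0 := by
  wlog hpos : 0 ≤ inner ℝ u₀ v generalizing v
  · refine this (v := -v) (by simpa using hv) (by simp [hHv]) (by simpa using hu₀) ?_
    rw [inner_neg_right]; linarith
  rw [abs_of_nonneg hpos] at hu₀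
  classical
  have hω := hp.step_pos
  have hr0 := (norm_nonneg u₀).trans hr
  have hF := hp.F_pos
  intro hzero
  -- If the test fires, the output is either a point with negative residual or a difference v - u
  -- that satisfies a strict inequality between quantities vanishing at 0. Neither can be zero.
  by_cases h1 : ∃ τ, τ ≤ p.t ∧ NCTest g x γt (nagIter g x p.η p.ζ u₀ τ)
  · unfold neonPlus at hzero
    rw [dif_pos h1] at hzero
    obtain ⟨hτ, htest⟩ := Nat.find_spec h1
    have hbefore : ∀ j < Nat.find h1, ¬ NCTest g x γt (nagIter g x p.η p.ζ u₀ j) :=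
      fun j hj hc => Nat.find_min h1 hj ⟨by omega, hc⟩
    generalize Nat.find h1 = τ at *
    unfold ncFind at hzero
    split_ifs at hzero with h3
    · obtain ⟨hj, hlong⟩ := Nat.find_spec h3
      have hmin : ∀ i < Nat.find h3,
          ‖nagDiff (nagIter g x p.η p.ζ u₀) i‖ ≤ √(6 * p.η * p.𝓕) := fun i hi => by
        by_contra! hc
        exact Nat.find_min h3 hi ⟨by omega, (hp.long_iff u₀ i).mpr hc.le⟩
      have := (hp.long_step hg hr (by omega) (fun i hi => hbefore i (by omega))
        ((hp.long_iff u₀ _).mp hlong) hmin).1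
      rw [hzero, residual_zero] at this
      linarith
    · rw [sub_eq_zero] at hzero
      simp [NCTest, hzero] at htest
  · have htest : ∀ j < p.t + 1, ¬ NCTest g x γt (nagIter g x p.η p.ζ u₀ j) := by
      push Not at h1
      exact fun j hj => h1 j (by omega)
    by_cases h2 : ∃ k, k ≤ p.t + 1 ∧ √(6 * p.η * p.𝓕) ≤ ‖nagDiff (nagIter g x p.η p.ζ u₀) k‖
    · obtain ⟨hk, hlong⟩ := Nat.find_spec h2
      have hmin : ∀ i < Nat.find h2,
          ‖nagDiff (nagIter g x p.η p.ζ u₀) i‖ ≤ √(6 * p.η * p.𝓕) := fun i hi => by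
        by_contra! hc
        exact Nat.find_min h2 hi ⟨by omega, hc.le⟩
      obtain ⟨h4, h5⟩ := hp.long_step hg hr hk (fun i hi => htest i (by omega)) hlong hmin
      have h6 := isArgmin_exists (u := fun σ => (nagIter g x p.η p.ζ u₀ σ).1) hk h5 h4
      unfold neonPlus at hzero
      rw [dif_neg h1, dif_pos h6] at hzero
      have := (Nat.find_spec h6).2
      rw [hzero, residual_zero] at this
      linarith
    -- Without a long step all iterates stay in the ball of radius U, whereas the component along v
    -- together with its momentum must have outgrown it.
    · push Not at h2
      have hshort : ∀ k ≤ p.t + 1, ‖nagDiff (nagIter g x p.η p.ζ u₀) k‖ ≤ √(6 * p.η * p.𝓕) :=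
        fun k hk => (h2 k hk).le
      have hrad := hp.radius
      have h5 : 0 ≤ ((p.t : ℝ) + 1) * √(6 * p.η * p.𝓕) := by positivity
      have hloc : ∀ k < p.t + 1, ‖(nagIter g x p.η p.ζ u₀ k).2‖ ≤ p.U := fun k hk => by
        refine (norm_nagIter_snd_le hr hp.ζ_pos.le hp.ζ_le
          fun j hj => hshort j (by omega)).trans ?_
        have : (k : ℝ) ≤ p.t := by exact_mod_cast (by omega : k ≤ p.t)
        have h6 : ((k : ℝ) + 1) * √(6 * p.η * p.𝓕) ≤ (p.t + 1) * √(6 * p.η * p.𝓕) := by gcongr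
        linarith
      obtain ⟨-, -, h6⟩ := inner_nagIter_ge hg hp.η_pos hs hs' hsγ hζ hv hμ hL₂ hHv hα hu₀ hsmall
        (p.t + 1) hloc
      have h7 := norm_nagIter_le (g := g) (x := x) hr (fun j hj => hshort j hj)
      push_cast at h7
      have h8 := real_inner_le_norm (nagIter g x p.η p.ζ u₀ (p.t + 1)).1 v
      have h9 := real_inner_le_norm (nagDiff (nagIter g x p.η p.ζ u₀) (p.t + 1)) v
      rw [hv, mul_one] at h8 h9
      have h10 := hshort (p.t + 1) le_rfl
      have h11 : 0 ≤ (p.t : ℝ) * √(6 * p.η * p.𝓕) := by positivity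
      have h12 : 1 / (4 * s) * inner ℝ (nagDiff (nagIter g x p.η p.ζ u₀) (p.t + 1)) v ≤
          1 / (4 * s) * p.U := by
        gcongr
        linarith
      linarith

end NeonPlus

end NeonSCSG

end

noncomputable section

namespace NeonSCSG

variable {d : ℕ} {Ξ : Type*}

/-! ### Traces of powers of symmetric operators -/

/-- An operator that is symmetric with respect to the inner product. -/
def IsSymm (A : E d →L[ℝ] E d) : Prop := ∀ v w, inner ℝ (A v) w = inner ℝ v (A w)

/-- The trace, as a continuous linear functional. -/
def opTrace (d : ℕ) : (E d →L[ℝ] E d) →L[ℝ] ℝ :=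
  LinearMap.toContinuousLinearMap
    ((LinearMap.trace ℝ (E d)).comp (ContinuousLinearMap.coeLM ℝ))

lemma opTrace_apply (A : E d →L[ℝ] E d) :
    opTrace d A = LinearMap.trace ℝ (E d) (A : E d →ₗ[ℝ] E d) := rfl

lemma opTrace_mul_comm (A B : E d →L[ℝ] E d) : opTrace d (A * B) = opTrace d (B * A) := by
  rw [opTrace_apply, opTrace_apply]
  exact LinearMap.trace_mul_comm ℝ (A : E d →ₗ[ℝ] E d) (B : E d →ₗ[ℝ] E d)

lemma opTrace_eq_sum {ι : Type*} [Fintype ι] (b : OrthonormalBasis ι ℝ (E d))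
    (A : E d →L[ℝ] E d) : opTrace d A = ∑ i, inner ℝ (b i) (A (b i)) :=
  LinearMap.trace_eq_sum_inner _ b

lemma op_smul_mul (c : ℝ) (A B : E d →L[ℝ] E d) : (c • A) * B = c • (A * B) := by
  ext; simp

lemma op_add_zero_smul (A B : E d →L[ℝ] E d) : A + (0 : ℝ) • B = A := by
  ext; simp

lemma op_add_one_smul (A B : E d →L[ℝ] E d) : A + (1 : ℝ) • B = A + B := by
  ext; simp

lemma opTrace_one : opTrace d 1 = d := by
  rw [opTrace_apply]
  exact (LinearMap.trace_one ℝ (E d)).trans (by simp)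

namespace IsSymm

variable {A B : E d →L[ℝ] E d}

lemma add (hA : IsSymm A) (hB : IsSymm B) : IsSymm (A + B) := fun v w => by
  simp [inner_add_left, inner_add_right, hA v w, hB v w]

lemma sub (hA : IsSymm A) (hB : IsSymm B) : IsSymm (A - B) := fun v w => by
  simp [inner_sub_left, inner_sub_right, hA v w, hB v w]

lemma smul (hA : IsSymm A) (c : ℝ) : IsSymm (c • A) := fun v w => by
  simp [inner_smul_left, inner_smul_right, hA v w]

lemma zero : IsSymm (0 : E d →L[ℝ] E d) := fun v w => by simp

lemma sum {ι : Type*} {s : Finset ι} {X : ι → E d →L[ℝ] E d} (h : ∀ i ∈ s, IsSymm (X i)) :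
    IsSymm (∑ i ∈ s, X i) := by
  classical
  induction s using Finset.induction_on with
  | empty => simpa using zero
  | insert i s hi ih =>
    rw [Finset.sum_insert hi]
    exact (h i (by simp)).add (ih fun j hj => h j (by simp [hj]))

lemma pow (hA : IsSymm A) (n : ℕ) : IsSymm (A ^ n) := by
  induction n with
  | zero => exact fun v w => by simp
  | succ n ih =>
    intro v w
    rw [pow_succ, mul_apply_eq_comp, ih, hA, ← mul_apply_eq_comp, ← pow_succ, ← pow_succ']

/-- The spectral theorem. -/
lemma exists_eigenbasis (hA : IsSymm A) :
    ∃ (b : OrthonormalBasis (Fin d) ℝ (E d)) (μ : Fin d → ℝ),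
      ∀ (n : ℕ) (i : Fin d), (A ^ n) (b i) = μ i ^ n • b i := by
  have hT : (A : E d →ₗ[ℝ] E d).IsSymmetric := hA
  have hn : Module.finrank ℝ (E d) = d := by simp
  refine ⟨hT.eigenvectorBasis hn, hT.eigenvalues hn, fun n i => ?_⟩
  have h1 : A (hT.eigenvectorBasis hn i) =
      hT.eigenvalues hn i • hT.eigenvectorBasis hn i := hT.apply_eigenvectorBasis hn i
  induction n with
  | zero => simp
  | succ n ih =>
    rw [pow_succ, mul_apply_eq_comp, h1, map_smul, ih, smul_smul, pow_succ']

end IsSymm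

lemma opTrace_pow_eq {A : E d →L[ℝ] E d} {b : OrthonormalBasis (Fin d) ℝ (E d)} {μ : Fin d → ℝ}
    (h : ∀ (n : ℕ) (i : Fin d), (A ^ n) (b i) = μ i ^ n • b i) (n : ℕ) :
    opTrace d (A ^ n) = ∑ i, μ i ^ n := by
  rw [opTrace_eq_sum b]
  refine Finset.sum_congr rfl fun i _ => ?_
  rw [h, inner_smul_right, real_inner_self_eq_norm_sq, b.norm_eq_one]
  simp

lemma opTrace_pow_nonneg {A : E d →L[ℝ] E d} (hA : IsSymm A) (n : ℕ) :
    0 ≤ opTrace d (A ^ (2 * n)) := by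
  obtain ⟨b, μ, h⟩ := hA.exists_eigenbasis
  rw [opTrace_pow_eq h]
  exact Finset.sum_nonneg fun i _ => by rw [pow_mul]; positivity

lemma pow_mul_pow_le (x y : ℝ) {i j n : ℕ} (h : i + j = 2 * n) :
    x ^ i * y ^ j ≤ x ^ (2 * n) + y ^ (2 * n) := by
  have hx : |x| ^ (2 * n) = x ^ (2 * n) := by rw [pow_mul, pow_mul, sq_abs]
  have hy : |y| ^ (2 * n) = y ^ (2 * n) := by rw [pow_mul, pow_mul, sq_abs]
  have h1 : x ^ i * y ^ j ≤ |x| ^ i * |y| ^ j := by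
    rw [← abs_pow, ← abs_pow, ← abs_mul]; exact le_abs_self _
  rw [← hx, ← hy]
  rcases le_total |x| |y| with hxy | hxy
  · have : |x| ^ i * |y| ^ j ≤ |y| ^ i * |y| ^ j := by gcongr
    rw [← pow_add, h] at this
    have h0 : 0 ≤ |x| ^ (2 * n) := by positivity
    linarith
  · have : |x| ^ i * |y| ^ j ≤ |x| ^ i * |x| ^ j := by gcongr
    rw [← pow_add, h] at this
    have h0 : 0 ≤ |y| ^ (2 * n) := by positivity
    linarith

/-- In an eigenbasis of Z the trace is the sum of μ_k^i μ_l^j X_kl². Since i + j is even, the mixed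
power is at most the sum of the two pure powers, and every row of X has square sum at most a². -/
lemma opTrace_pow_mul_pow_mul_le {Z X : E d →L[ℝ] E d} (hZ : IsSymm Z) (hX : IsSymm X) {a : ℝ}
    (ha : ‖X‖ ≤ a) {i j n : ℕ} (h : i + j = 2 * n) :
    opTrace d (Z ^ i * X * Z ^ j * X) ≤ 2 * a ^ 2 * opTrace d (Z ^ (2 * n)) := by
  obtain ⟨b, μ, hb⟩ := hZ.exists_eigenbasis
  have ha0 : 0 ≤ a := (norm_nonneg _).trans ha
  have h1 : opTrace d (Z ^ i * X * Z ^ j * X) =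
      ∑ k, ∑ l, μ k ^ i * μ l ^ j * (inner ℝ (b l) (X (b k))) ^ 2 := by
    rw [opTrace_eq_sum b]
    refine Finset.sum_congr rfl fun k _ => ?_
    simp only [mul_apply_eq_comp]
    rw [← hZ.pow, hb, inner_smul_left, ← hX, ← hZ.pow, ← b.sum_inner_mul_inner, Finset.mul_sum]
    refine Finset.sum_congr rfl fun l _ => ?_
    rw [hZ.pow, hb, inner_smul_right, real_inner_comm (b l)]
    simp only [conj_trivial]
    ring
  have h2 : ∀ k, ∑ l, (inner ℝ (b l) (X (b k))) ^ 2 ≤ a ^ 2 := fun k => by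
    have : ∑ l, (inner ℝ (b l) (X (b k))) ^ 2 = ‖X (b k)‖ ^ 2 := by
      rw [← b.sum_sq_norm_inner_right]; simp
    rw [this]
    have := X.le_of_opNorm_le ha (b k)
    rw [b.norm_eq_one, mul_one] at this
    gcongr
  have h3 : ∀ k l, inner ℝ (b l) (X (b k)) = inner ℝ (b k) (X (b l)) := fun k l => by
    rw [← hX, real_inner_comm]
  rw [h1, opTrace_pow_eq hb]
  calc ∑ k, ∑ l, μ k ^ i * μ l ^ j * (inner ℝ (b l) (X (b k))) ^ 2
      ≤ ∑ k, ∑ l, (μ k ^ (2 * n) + μ l ^ (2 * n)) * (inner ℝ (b l) (X (b k))) ^ 2 := by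
        gcongr with k _ l _
        exact pow_mul_pow_le _ _ h
    _ = 2 * ∑ k, μ k ^ (2 * n) * ∑ l, (inner ℝ (b l) (X (b k))) ^ 2 := by
        simp only [add_mul, Finset.sum_add_distrib, two_mul]
        congr 1
        · simp only [Finset.mul_sum]
        · rw [Finset.sum_comm]
          simp only [Finset.mul_sum]
          exact Finset.sum_congr rfl fun k _ => Finset.sum_congr rfl fun l _ => by rw [h3]
    _ ≤ 2 * ∑ k, μ k ^ (2 * n) * a ^ 2 := by
        gcongr with k _
        · rw [pow_mul]; positivity
        · exact h2 k
    _ = 2 * a ^ 2 * ∑ k, μ k ^ (2 * n) := by rw [← Finset.sum_mul]; ring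

/-! ### The trace of the truncated hyperbolic cosine -/

/-- The trace of the Taylor polynomial of degree `2 P` of `cosh (θ A)`. -/
def traceCosh (P : ℕ) (θ : ℝ) (A : E d →L[ℝ] E d) : ℝ :=
  ∑ p ∈ Finset.range (P + 1), θ ^ (2 * p) / (2 * p).factorial * opTrace d (A ^ (2 * p))

lemma traceCosh_nonneg {P : ℕ} {θ : ℝ} {A : E d →L[ℝ] E d} (hA : IsSymm A) :
    0 ≤ traceCosh P θ A :=
  Finset.sum_nonneg fun p _ => mul_nonneg (by rw [pow_mul]; positivity) (opTrace_pow_nonneg hA p)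

lemma traceCosh_zero (P : ℕ) (θ : ℝ) : traceCosh P θ (0 : E d →L[ℝ] E d) = d := by
  unfold traceCosh
  rw [Finset.sum_range_succ', Finset.sum_eq_zero]
  · simp [opTrace_one]
  · intro p _
    simp

lemma continuous_traceCosh (P : ℕ) (θ : ℝ) : Continuous (traceCosh (d := d) P θ) := by
  unfold traceCosh
  exact continuous_finsetSum _ fun p _ =>
    continuous_const.mul ((opTrace d).continuous.comp (continuous_pow _))

/-- The first order part of `traceCosh` at `A` is the functional `X ↦ tr (W X)` with this `W`. -/
def traceSinhOp (P : ℕ) (θ : ℝ) (A : E d →L[ℝ] E d) : E d →L[ℝ] E d :=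
  ∑ p ∈ Finset.range P, (θ ^ (2 * (p + 1)) / (2 * p + 1).factorial) • A ^ (2 * p + 1)

/-- The derivative of a power is a sum over the positions of X; by cyclicity of the trace all its
terms agree. -/
lemma hasDerivAt_opTrace_pow (Y X : E d →L[ℝ] E d) (n : ℕ) (s : ℝ) :
    HasDerivAt (fun s : ℝ => opTrace d ((Y + s • X) ^ (n + 1)))
      ((n + 1) * opTrace d ((Y + s • X) ^ n * X)) s := by
  have h1 : HasDerivAt (fun s : ℝ => Y + s • X) X s := by
    simpa using ((hasDerivAt_id s).smul_const X).const_add Y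
  have h2 := (opTrace d).hasFDerivAt.comp_hasDerivAt s (h1.fun_pow' (n + 1))
  refine h2.congr_deriv ?_
  rw [map_sum]
  have : ∀ i ∈ Finset.range (n + 1),
      opTrace d ((Y + s • X) ^ ((n + 1).pred - i) * X * (Y + s • X) ^ i) =
        opTrace d ((Y + s • X) ^ n * X) := fun i hi => by
    rw [opTrace_mul_comm, ← mul_assoc, ← pow_add]
    congr 3
    simp at hi ⊢
    omega
  rw [Finset.sum_congr rfl this]
  simp

lemma hasDerivAt_opTrace_pow_mul (Y X : E d →L[ℝ] E d) (n : ℕ) (s : ℝ) :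
    HasDerivAt (fun s : ℝ => opTrace d ((Y + s • X) ^ n * X))
      (∑ i ∈ Finset.range n, opTrace d ((Y + s • X) ^ (n.pred - i) * X * (Y + s • X) ^ i * X))
      s := by
  have h1 : HasDerivAt (fun s : ℝ => Y + s • X) X s := by
    simpa using ((hasDerivAt_id s).smul_const X).const_add Y
  have h2 := (opTrace d).hasFDerivAt.comp_hasDerivAt s ((h1.fun_pow' n).mul_const X)
  refine h2.congr_deriv ?_
  rw [Finset.sum_mul, map_sum]

/-- Comparison with the solution of f'' = k² f. The function w is a Wronskian of f with sinh (k (1 -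
s)), so the hypothesis makes it nonincreasing; its values at 0 and 1 are the two sides multiplied by
k. -/
lemma le_of_second_deriv_le {f f' f'' : ℝ → ℝ} {k : ℝ} (hk : 0 < k)
    (hf : ∀ s, HasDerivAt f (f' s) s) (hf' : ∀ s, HasDerivAt f' (f'' s) s)
    (h : ∀ s, f'' s ≤ k ^ 2 * f s) :
    f 1 ≤ Real.cosh k * f 0 + Real.sinh k / k * f' 0 := by
  set w : ℝ → ℝ := fun s => f' s * Real.sinh (k * (1 - s)) + k * f s * Real.cosh (k * (1 - s))
  have hw : ∀ s, HasDerivAt w ((f'' s - k ^ 2 * f s) * Real.sinh (k * (1 - s))) s := fun s => by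
    have e : HasDerivAt (fun s : ℝ => k * (1 - s)) (-k) s := by
      simpa using ((hasDerivAt_id s).const_sub 1).const_mul k
    refine (((hf' s).mul e.sinh).add (((hf s).const_mul k).mul e.cosh)).congr_deriv ?_
    ring
  have hanti : AntitoneOn w (Set.Icc 0 1) := by
    refine antitoneOn_of_hasDerivWithinAt_nonpos (convex_Icc 0 1)
      (fun s _ => (hw s).continuousAt.continuousWithinAt)
      (fun s _ => (hw s).hasDerivWithinAt) fun s hs => ?_
    rw [interior_Icc] at hs
    refine mul_nonpos_of_nonpos_of_nonneg (by linarith [h s]) (Real.sinh_nonneg_iff.mpr ?_)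
    nlinarith [hs.2]
  have := hanti (by simp) (by simp) (zero_le_one' ℝ)
  simp only [w, sub_self, mul_zero, Real.sinh_zero, Real.cosh_zero, sub_zero, mul_one, zero_add]
    at this
  have e : Real.cosh k * f 0 + Real.sinh k / k * f' 0 =
      (f' 0 * Real.sinh k + k * f 0 * Real.cosh k) / k := by
    field_simp; ring
  rw [e, le_div_iff₀ hk]
  linarith

/-- This one-step bound takes the place of the Golden–Thompson or Lieb inequality. Along s ↦ Y + s •
X the second derivative of `traceCosh` is at most 2a²θ² times `traceCosh` itself, so the comparison
lemma applies with k = √2 a θ. The first-order term is linear in X and will vanish in expectation.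
-/
lemma traceCosh_add_le {P : ℕ} {θ a : ℝ} (hθ : 0 < θ) (ha : 0 < a) {Y X : E d →L[ℝ] E d}
    (hY : IsSymm Y) (hX : IsSymm X) (hXa : ‖X‖ ≤ a) :
    traceCosh P θ (Y + X) ≤ Real.cosh (√2 * a * θ) * traceCosh P θ Y +
      Real.sinh (√2 * a * θ) / (√2 * a * θ) * opTrace d (traceSinhOp P θ Y * X) := by
  have hk : 0 < √2 * a * θ := by positivity
  have key := le_of_second_deriv_le (k := √2 * a * θ) hk
    (f := fun s => traceCosh P θ (Y + s • X))
    (f' := fun s => opTrace d (traceSinhOp P θ (Y + s • X) * X))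
    (f'' := fun s => ∑ p ∈ Finset.range P, θ ^ (2 * (p + 1)) / (2 * p + 1).factorial *
      ∑ i ∈ Finset.range (2 * p + 1),
        opTrace d ((Y + s • X) ^ ((2 * p + 1).pred - i) * X * (Y + s • X) ^ i * X)) ?_ ?_ ?_
  · simpa only [op_add_zero_smul, op_add_one_smul] using key
  · intro s
    have e1 : (fun s : ℝ => traceCosh P θ (Y + s • X)) = fun s =>
        (∑ p ∈ Finset.range P, θ ^ (2 * (p + 1)) / (2 * (p + 1)).factorial *
          opTrace d ((Y + s • X) ^ (2 * p + 1 + 1))) + d := by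
      funext s
      unfold traceCosh
      rw [Finset.sum_range_succ']
      simp [opTrace_one, mul_add]
    rw [e1]
    refine ((HasDerivAt.fun_sum fun p _ =>
      (hasDerivAt_opTrace_pow Y X (2 * p + 1) s).const_mul _).add_const _).congr_deriv ?_
    unfold traceSinhOp
    rw [Finset.sum_mul, map_sum]
    refine Finset.sum_congr rfl fun p _ => ?_
    rw [op_smul_mul, map_smul, smul_eq_mul, show 2 * (p + 1) = 2 * p + 1 + 1 by ring,
      Nat.factorial_succ (2 * p + 1)]
    push_cast
    have : ((2 * p + 1).factorial : ℝ) ≠ 0 := by positivity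
    have : (2 * (p : ℝ) + 1 + 1) ≠ 0 := by positivity
    field_simp
  · intro s
    have e1 : (fun s : ℝ => opTrace d (traceSinhOp P θ (Y + s • X) * X)) = fun s =>
        ∑ p ∈ Finset.range P, θ ^ (2 * (p + 1)) / (2 * p + 1).factorial *
          opTrace d ((Y + s • X) ^ (2 * p + 1) * X) := by
      funext s
      unfold traceSinhOp
      rw [Finset.sum_mul, map_sum]
      simp [op_smul_mul]
    rw [e1]
    exact HasDerivAt.fun_sum fun p _ => (hasDerivAt_opTrace_pow_mul Y X (2 * p + 1) s).const_mul _
  · intro s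
    have hZ : IsSymm (Y + s • X) := hY.add (hX.smul s)
    set Z := Y + s • X
    calc _ ≤ ∑ p ∈ Finset.range P, θ ^ (2 * (p + 1)) / (2 * p + 1).factorial *
          ∑ i ∈ Finset.range (2 * p + 1), 2 * a ^ 2 * opTrace d (Z ^ (2 * p)) := by
          gcongr with p _ i hi
          refine opTrace_pow_mul_pow_mul_le hZ hX hXa ?_
          simp at hi ⊢
          omega
      _ = (√2 * a * θ) ^ 2 * ∑ p ∈ Finset.range P,
            θ ^ (2 * p) / (2 * p).factorial * opTrace d (Z ^ (2 * p)) := by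
          rw [Finset.mul_sum]
          refine Finset.sum_congr rfl fun p _ => ?_
          rw [Finset.sum_const, Finset.card_range, nsmul_eq_mul, Nat.factorial_succ, mul_pow,
            mul_pow, Real.sq_sqrt (by norm_num)]
          push_cast
          have : ((2 * p).factorial : ℝ) ≠ 0 := by positivity
          have : (2 * (p : ℝ) + 1) ≠ 0 := by positivity
          field_simp
          ring
      -- The second derivative only sees powers of degree below 2P; the top term of `traceCosh` that
      -- is added here is nonnegative.
      _ ≤ _ := by
          unfold traceCosh
          rw [Finset.sum_range_succ]
          gcongr
          have := opTrace_pow_nonneg hZ P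
          have h0 : 0 ≤ θ ^ (2 * P) / (2 * P).factorial := by positivity
          nlinarith [mul_nonneg h0 this]

/-- A symmetric operator of large norm has large `traceCosh`. -/
lemma cosh_partial_le_traceCosh {P : ℕ} {θ τ : ℝ} (hθ : 0 ≤ θ) (hτ : 0 ≤ τ) {A : E d →L[ℝ] E d}
    (hA : IsSymm A) (h : τ < ‖A‖) :
    ∑ p ∈ Finset.range (P + 1), (θ * τ) ^ (2 * p) / (2 * p).factorial ≤ traceCosh P θ A := by
  obtain ⟨b, μ, hb⟩ := hA.exists_eigenbasis
  -- If all eigenvalues were at most τ in absolute value, Parseval's identity in the eigenbasis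
  -- would give ‖A‖ ≤ τ.
  have hex : ∃ k, τ < |μ k| := by
    by_contra! hno
    refine absurd (A.opNorm_le_bound hτ fun v => ?_) (not_le.mpr h)
    have h1 : ‖A v‖ ^ 2 ≤ (τ * ‖v‖) ^ 2 := by
      rw [← b.sum_sq_norm_inner_right (A v), mul_pow, ← b.sum_sq_norm_inner_right v,
        Finset.mul_sum]
      gcongr with i _
      have h2 := hb 1 i
      rw [pow_one, pow_one] at h2
      rw [← hA, h2, inner_smul_left, norm_mul, mul_pow]
      gcongr
      simpa using hno i
    exact le_of_sq_le_sq h1 (by positivity)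
  obtain ⟨k, hk⟩ := hex
  unfold traceCosh
  gcongr with p _
  rw [opTrace_pow_eq hb, mul_pow, mul_div_right_comm]
  gcongr
  calc τ ^ (2 * p) ≤ |μ k| ^ (2 * p) := by gcongr
    _ = μ k ^ (2 * p) := by rw [pow_mul, pow_mul, sq_abs]
    _ ≤ _ := Finset.single_le_sum (f := fun i => μ i ^ (2 * p))
        (fun i _ => by rw [pow_mul]; positivity) (Finset.mem_univ k)

end NeonSCSG

end

noncomputable section

namespace NeonSCSG

variable {d : ℕ} {Ξ : Type*}

/-! ### Measurability of derivatives with respect to a parameter -/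

/-- The directional derivative is the pointwise limit of difference quotients with step 1/(n + 1),
each of which is measurable in the parameter. -/
lemma measurable_fderiv_apply_param [MeasurableSpace Ξ] {W : Type*} [NormedAddCommGroup W]
    [NormedSpace ℝ W] [MeasurableSpace W] [BorelSpace W] [SecondCountableTopology W]
    {h : E d → Ξ → W}
    (hm : ∀ x, Measurable (h x)) (hd : ∀ ξ, Differentiable ℝ fun x => h x ξ) (x v : E d) :
    Measurable fun ξ => fderiv ℝ (fun z => h z ξ) x v := by
  refine measurable_of_tendsto_metrizable
    (f := fun (n : ℕ) ξ => ((n : ℝ) + 1) • (h (x + ((n : ℝ) + 1)⁻¹ • v) ξ - h x ξ))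
    (fun n => ((hm _).sub (hm _)).const_smul _) ?_
  rw [tendsto_pi_nhds]
  intro ξ
  have h1 := (hd ξ x).hasFDerivAt.lim v (c := fun n : ℕ => (n : ℝ) + 1) (l := Filter.atTop)
  exact h1 (tendsto_norm_atTop_atTop.comp
    (Filter.tendsto_atTop_add_const_right _ _ tendsto_natCast_atTop_atTop))

lemma eq_sum_basisFun (v : E d) :
    v = ∑ i, (inner ℝ (EuclideanSpace.basisFun (Fin d) ℝ i) v) • EuclideanSpace.basisFun (Fin d) ℝ i :=
  ((EuclideanSpace.basisFun (Fin d) ℝ).sum_repr' v).symm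

lemma measurable_gradient_param [MeasurableSpace Ξ] {f : E d → Ξ → ℝ}
    (hm : ∀ x, Measurable (f x)) (hd : ∀ ξ, Differentiable ℝ fun x => f x ξ) (x : E d) :
    Measurable fun ξ => gradient (fun z => f z ξ) x := by
  have : (fun ξ => gradient (fun z => f z ξ) x) = fun ξ =>
      ∑ i, (fderiv ℝ (fun z => f z ξ) x (EuclideanSpace.basisFun (Fin d) ℝ i)) •
        EuclideanSpace.basisFun (Fin d) ℝ i := by
    funext ξ
    conv_lhs => rw [eq_sum_basisFun (gradient (fun z => f z ξ) x)]
    refine Finset.sum_congr rfl fun i _ => ?_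
    rw [real_inner_comm, inner_gradient (hd ξ x)]
  rw [this]
  exact Finset.measurable_fun_sum _ fun i _ =>
    (measurable_fderiv_apply_param hm hd x _).smul_const _

/-- In finite dimension an operator is a continuous function of its values on a basis. -/
lemma measurable_operator [MeasurableSpace Ξ] {A : Ξ → E d →L[ℝ] E d}
    (h : ∀ v, Measurable fun ξ => A ξ v) : Measurable A := by
  let e := EuclideanSpace.basisFun (Fin d) ℝ
  let Φ : (Fin d → E d) → (E d →L[ℝ] E d) := fun w => ∑ i, (innerSL ℝ (e i)).smulRight (w i)
  have hΦ : Continuous Φ := by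
    refine continuous_finsetSum _ fun i _ => ?_
    exact (ContinuousLinearMap.smulRightL ℝ (E d) (E d) (innerSL ℝ (e i))).continuous.comp
      (continuous_apply i)
  have : A = fun ξ => Φ fun i => A ξ (e i) := by
    funext ξ
    ext1 v
    conv_lhs => rw [eq_sum_basisFun v]
    simp only [Φ, map_sum, map_smul, sum_apply, ContinuousLinearMap.smulRight_apply,
      innerSL_apply_apply]
    rfl
  rw [this]
  exact hΦ.measurable.comp (measurable_pi_lambda _ fun i => h (e i))

lemma measurable_hessian_param [MeasurableSpace Ξ] {f : E d → Ξ → ℝ}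
    (hm : ∀ x, Measurable (f x)) (hd : ∀ ξ, Differentiable ℝ fun x => f x ξ)
    (hd' : ∀ ξ, Differentiable ℝ (gradient fun x => f x ξ)) (x : E d) :
    Measurable fun ξ => hessian (fun z => f z ξ) x :=
  measurable_operator fun v =>
    measurable_fderiv_apply_param (h := fun x ξ => gradient (fun z => f z ξ) x)
      (measurable_gradient_param hm hd) hd' x v

/-! ### The objective -/

section Objective

variable [MeasurableSpace Ξ] {P : Measure Ξ} [IsProbabilityMeasure P] {f : E d → Ξ → ℝ}
  {x₁ : E d} {L₁ L₂ G V Δ : ℝ}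

namespace Assumptions

variable (h : Assumptions P f x₁ L₁ L₂ G V Δ)
include h

omit [IsProbabilityMeasure P] in
lemma measurable_gradient (x : E d) : Measurable fun ξ => gradient (fun z => f z ξ) x :=
  measurable_gradient_param h.measurable (fun ξ => (h.isSmooth ξ).diff) x

omit [IsProbabilityMeasure P] in
lemma measurable_hessian (x : E d) : Measurable fun ξ => hessian (fun z => f z ξ) x :=
  measurable_hessian_param h.measurable (fun ξ => (h.isSmooth ξ).diff)
    (fun ξ => (h.isSmooth ξ).diff_grad) x

omit [IsProbabilityMeasure P] in
lemma memLp_noise (x : E d) :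
    MemLp (fun ξ => gradient (fun z => f z ξ) x - gradient (objective P f) x) 2 P := by
  refine ⟨((h.measurable_gradient x).sub_const _).aestronglyMeasurable, ?_⟩
  rw [eLpNorm_lt_top_iff_lintegral_rpow_enorm_lt_top (by norm_num) (by norm_num)]
  refine lt_of_le_of_lt (le_of_eq ?_) ((h.variance x).trans_lt ENNReal.ofReal_lt_top)
  refine lintegral_congr fun ξ => ?_
  rw [← ofReal_norm, ENNReal.ofReal_rpow_of_nonneg (norm_nonneg _) (by norm_num)]
  norm_num

/-- Here `gradient (objective P f) x` is just some fixed vector, not yet known to be the mean. A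
finite second moment around any vector already gives integrability. -/
lemma integrable_gradient (x : E d) : Integrable (fun ξ => gradient (fun z => f z ξ) x) P := by
  have h1 := ((h.memLp_noise x).integrable (by norm_num)).add
    (integrable_const (gradient (objective P f) x))
  refine h1.congr (Filter.Eventually.of_forall fun ξ => ?_)
  simp

/-- Differentiation under the integral. On the unit ball around x the gradients are dominated by the
integrable function ‖∇f(x; ξ)‖ + |L₁|. -/
lemma hasGradientAt_objective (x : E d) :
    HasGradientAt (objective P f) (∫ ξ, gradient (fun z => f z ξ) x ∂P) x := by
  have key := hasFDerivAt_integral_of_dominated_loc_of_lip (μ := P) (F := f) (x₀ := x)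
    (F' := fun ξ => InnerProductSpace.toDual ℝ (E d) (gradient (fun z => f z ξ) x))
    (bound := fun ξ => ‖gradient (fun z => f z ξ) x‖ + |L₁|) (Metric.ball_mem_nhds x one_pos)
    (Filter.Eventually.of_forall fun x => (h.measurable x).aestronglyMeasurable) (h.integrable x)
    ((InnerProductSpace.toDual ℝ (E d)).continuous.measurable.comp
      (h.measurable_gradient x)).aestronglyMeasurable
    (Filter.Eventually.of_forall fun ξ => ?_)
    ((h.integrable_gradient x).norm.add (integrable_const _))
    (Filter.Eventually.of_forall fun ξ => ((h.isSmooth ξ).diff x).hasGradientAt.hasFDerivAt)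
  · have h2 := key.2
    have e : (InnerProductSpace.toDual ℝ (E d)) (∫ ξ, gradient (fun z => f z ξ) x ∂P) =
        ∫ ξ, (InnerProductSpace.toDual ℝ (E d)) (gradient (fun z => f z ξ) x) ∂P :=
      ((InnerProductSpace.toDual ℝ (E d)).toContinuousLinearEquiv.toContinuousLinearMap.integral_comp_comm
        (h.integrable_gradient x)).symm
    rw [hasGradientAt_iff_hasFDerivAt, e]
    exact h2
  · refine (convex_ball x 1).lipschitzOnWith_of_nnnorm_fderiv_le
      (fun y _ => (h.isSmooth ξ).diff y) fun y hy => ?_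
    rw [← NNReal.coe_le_coe, coe_nnnorm, Real.coe_nnabs, abs_of_nonneg (by positivity)]
    have e : ‖fderiv ℝ (fun z => f z ξ) y‖ = ‖gradient (fun z => f z ξ) y‖ := by
      simp [gradient]
    rw [e]
    have h1 := h.lipschitz_gradient ξ y x
    have h2 := norm_sub_norm_le (gradient (fun z => f z ξ) y) (gradient (fun z => f z ξ) x)
    have h3 : L₁ * ‖y - x‖ ≤ |L₁| * 1 := by
      rw [mem_ball_iff_norm] at hy
      exact mul_le_mul (le_abs_self _) hy.le (norm_nonneg _) (abs_nonneg _)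
    linarith

lemma gradient_objective (x : E d) :
    gradient (objective P f) x = ∫ ξ, gradient (fun z => f z ξ) x ∂P :=
  (h.hasGradientAt_objective x).gradient

lemma hasFDerivAt_gradient_objective (x : E d) :
    Integrable (fun ξ => hessian (fun z => f z ξ) x) P ∧
    HasFDerivAt (gradient (objective P f)) (∫ ξ, hessian (fun z => f z ξ) x ∂P) x := by
  rw [funext h.gradient_objective]
  refine hasFDerivAt_integral_of_dominated_loc_of_lip (μ := P)
    (F := fun x ξ => gradient (fun z => f z ξ) x) (x₀ := x)
    (bound := fun _ => |L₁|) Filter.univ_mem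
    (Filter.Eventually.of_forall fun x => (h.measurable_gradient x).aestronglyMeasurable)
    (h.integrable_gradient x) (h.measurable_hessian x).aestronglyMeasurable
    (Filter.Eventually.of_forall fun ξ => ?_) (integrable_const _)
    (Filter.Eventually.of_forall fun ξ => (h.isSmooth ξ).hasFDerivAt_gradient x)
  refine LipschitzOnWith.of_dist_le_mul fun y _ z _ => ?_
  rw [Real.coe_nnabs, abs_abs, dist_eq_norm, dist_eq_norm]
  refine (h.lipschitz_gradient ξ y z).trans ?_
  gcongr
  exact le_abs_self _

lemma hessian_objective (x : E d) :
    hessian (objective P f) x = ∫ ξ, hessian (fun z => f z ξ) x ∂P :=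
  (h.hasFDerivAt_gradient_objective x).2.fderiv

lemma isSmooth_objective : IsSmooth (objective P f) L₁ L₂ where
  diff x := (h.hasGradientAt_objective x).differentiableAt
  diff_grad x := (h.hasFDerivAt_gradient_objective x).2.differentiableAt
  lip_grad x y := by
    rw [h.gradient_objective, h.gradient_objective,
      ← integral_sub (h.integrable_gradient x) (h.integrable_gradient y)]
    simpa using norm_integral_le_of_norm_le_const (μ := P)
      (Filter.Eventually.of_forall fun ξ => h.lipschitz_gradient ξ x y)
  lip_hess x y := by
    rw [h.hessian_objective, h.hessian_objective,
      ← integral_sub (h.hasFDerivAt_gradient_objective x).1 (h.hasFDerivAt_gradient_objective y).1]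
    simpa using norm_integral_le_of_norm_le_const (μ := P)
      (Filter.Eventually.of_forall fun ξ => h.lipschitz_hessian ξ x y)

end Assumptions

end Objective

/-! ### Sums of i.i.d. samples -/

section Sums

variable [MeasurableSpace Ξ] {P : Measure Ξ} [IsProbabilityMeasure P]

lemma lintegral_pi_succ {m : ℕ} {F : (Fin (m + 1) → Ξ) → ℝ≥0∞} (hF : Measurable F) :
    ∫⁻ S, F S ∂(Measure.pi fun _ => P) =
      ∫⁻ ξ, ∫⁻ S, F (Fin.cons ξ S) ∂(Measure.pi fun _ : Fin m => P) ∂P := by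
  have h1 := (measurePreserving_piFinSuccAbove (fun _ : Fin (m + 1) => P) 0).symm
  rw [← h1.lintegral_comp hF, lintegral_prod _ (by exact (hF.comp h1.measurable).aemeasurable)]
  refine lintegral_congr fun ξ => lintegral_congr fun S => ?_
  congr 1
  exact Fin.insertNth_zero (α := fun _ => Ξ) ξ S

/-- A supermartingale bound for sums of i.i.d. random elements. -/
lemma lintegral_pi_sum_le {W : Type*} [AddCommMonoid W] {X : Ξ → W} {Φ : ℕ → W → ℝ≥0∞}
    -- The index k counts the samples still to be drawn, so Φ (k + 1) has to dominate the mean of Φ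
    -- k after one more summand. The predicate C is an invariant of the partial sums, namely
    -- symmetry in the matrix case.
    {C : W → Prop} (hC : ∀ Y, C Y → ∀ ξ, C (Y + X ξ))
    (hmeas : ∀ m Y, Measurable fun S : Fin m → Ξ => Φ 0 (Y + ∑ i, X (S i)))
    (hstep : ∀ k Y, C Y → ∫⁻ ξ, Φ k (Y + X ξ) ∂P ≤ Φ (k + 1) Y) (m : ℕ) (Y : W) (hY : C Y) :
    ∫⁻ S, Φ 0 (Y + ∑ i, X (S i)) ∂(Measure.pi fun _ : Fin m => P) ≤ Φ m Y := by
  induction m generalizing Y with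
  | zero => simp
  | succ m ih =>
    rw [lintegral_pi_succ (hmeas (m + 1) Y)]
    refine le_trans (lintegral_mono fun ξ => ?_) (hstep m Y hY)
    refine le_trans (le_of_eq (lintegral_congr fun S => ?_)) (ih _ (hC Y hY ξ))
    simp [Fin.sum_univ_succ, add_assoc]

end Sums

end NeonSCSG

end

noncomputable section

namespace NeonSCSG

variable {d : ℕ} {Ξ : Type*}

/-! ### Concentration of empirical averages -/

/-- Isolates the linear term of the exponential, which disappears for a centred variable; what
remains involves only x², on which the sub-Gaussian hypothesis gives control. -/
lemma exp_le_add_exp_sq (x : ℝ) : Real.exp x ≤ x + Real.exp (x ^ 2) := by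
  have h1 := Real.add_one_le_exp (x ^ 2)
  rcases le_or_gt |x| 1 with hx | hx
  · have := (abs_le.mp (Real.abs_exp_sub_one_sub_id_le hx)).2
    linarith
  · rcases lt_abs.mp hx with hx | hx
    · have : Real.exp x ≤ Real.exp (x ^ 2) := Real.exp_le_exp.mpr (by nlinarith)
      linarith
    · have : Real.exp x ≤ 1 := Real.exp_le_one_iff.mpr (by linarith)
      nlinarith

/-- Convexity of exp on the segment from 0 to y. It reduces exp (s‖X‖²/G²) with s ≤ 1 to the moment
that is assumed finite. -/
lemma exp_mul_le {s y : ℝ} (hs0 : 0 ≤ s) (hs1 : s ≤ 1) :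
    Real.exp (s * y) ≤ 1 - s + s * Real.exp y := by
  have := convexOn_exp.2 (Set.mem_univ 0) (Set.mem_univ y) (by linarith : 0 ≤ 1 - s) hs0 (by ring)
  simpa using this

section Concentration

variable [MeasurableSpace Ξ] {P : Measure Ξ} [IsProbabilityMeasure P] {f : E d → Ξ → ℝ}
  {x₁ : E d} {L₁ L₂ G V Δ : ℝ}

namespace Assumptions

variable (h : Assumptions P f x₁ L₁ L₂ G V Δ)
include h

lemma integral_noise (x : E d) :
    ∫ ξ, (gradient (fun z => f z ξ) x - gradient (objective P f) x) ∂P = 0 := by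
  rw [integral_sub (h.integrable_gradient x) (integrable_const _), h.gradient_objective x]
  simp

omit [IsProbabilityMeasure P] in
lemma integrable_noise_sq (x : E d) :
    Integrable (fun ξ => ‖gradient (fun z => f z ξ) x - gradient (objective P f) x‖ ^ 2) P :=
  (h.memLp_noise x).integrable_norm_pow (by norm_num)

omit [IsProbabilityMeasure P] in
lemma integral_noise_sq_le (hV : 0 ≤ V) (x : E d) :
    ∫ ξ, ‖gradient (fun z => f z ξ) x - gradient (objective P f) x‖ ^ 2 ∂P ≤ V := by
  rw [integral_eq_lintegral_of_nonneg_ae (Filter.Eventually.of_forall fun ξ => by positivity)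
    (h.integrable_noise_sq x).aestronglyMeasurable]
  exact ENNReal.toReal_le_of_le_ofReal hV (h.variance x)

omit [IsProbabilityMeasure P] in
lemma gradient_batch_sub {m : ℕ} (hm : 0 < m) (S : Fin m → Ξ) (x : E d) :
    gradient (batch f S) x - gradient (objective P f) x = (1 / (m : ℝ)) •
      ∑ i, (gradient (fun z => f z (S i)) x - gradient (objective P f) x) := by
  rw [gradient_batch (fun ξ => (h.isSmooth ξ).diff), Finset.sum_sub_distrib, smul_sub]
  congr 1
  rw [Finset.sum_const, Finset.card_univ, Fintype.card_fin, ← Nat.cast_smul_eq_nsmul ℝ, smul_smul,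
    one_div_mul_cancel (by positivity), one_smul]

/-- The variance of the average of `m` stochastic gradients. -/
lemma variance_batch (hV : 0 ≤ V) {m : ℕ} (hm : 0 < m) (x : E d) :
    ∫⁻ S, ENNReal.ofReal (‖gradient (batch f S) x - gradient (objective P f) x‖ ^ 2)
      ∂(Measure.pi fun _ : Fin m => P) ≤ ENNReal.ofReal (V / m) := by
  set X : Ξ → E d := fun ξ => gradient (fun z => f z ξ) x - gradient (objective P f) x with hX
  have hXm : Measurable X := (h.measurable_gradient x).sub_const _
  -- The potential ‖Y‖² + kV reserves one variance for each of the k samples still to come; the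
  -- cross terms vanish because the noise is centred.
  have key := lintegral_pi_sum_le (P := P) (X := X)
    (Φ := fun k Y => ENNReal.ofReal (‖Y‖ ^ 2 + k * V)) (C := fun _ => True) (fun _ _ _ => trivial)
    (fun m Y => by fun_prop) (fun k Y _ => ?_) m 0 trivial
  · have hm' : (0 : ℝ) < m := by exact_mod_cast hm
    calc _ = ∫⁻ S, ENNReal.ofReal ((1 / (m : ℝ)) ^ 2) *
            ENNReal.ofReal (‖(0 : E d) + ∑ i, X (S i)‖ ^ 2 + (0 : ℕ) * V)
              ∂(Measure.pi fun _ : Fin m => P) := by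
          refine lintegral_congr fun S => ?_
          rw [← ENNReal.ofReal_mul (by positivity), h.gradient_batch_sub hm, norm_smul, mul_pow,
            Real.norm_of_nonneg (by positivity)]
          simp [hX]
      _ ≤ ENNReal.ofReal ((1 / (m : ℝ)) ^ 2) * ENNReal.ofReal (‖(0 : E d)‖ ^ 2 + m * V) := by
          rw [lintegral_const_mul' _ _ ENNReal.ofReal_ne_top]
          gcongr
      _ = _ := by
          rw [← ENNReal.ofReal_mul (by positivity)]
          congr 1
          simp
          field_simp
  · have hX1 : Integrable X P := (h.memLp_noise x).integrable (by norm_num)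
    have e : ∀ ξ, ‖Y + X ξ‖ ^ 2 + k * V = ‖Y‖ ^ 2 + k * V + 2 * inner ℝ Y (X ξ) + ‖X ξ‖ ^ 2 :=
      fun ξ => by rw [norm_add_sq_real]; ring
    have i1 : Integrable (fun ξ => 2 * inner ℝ Y (X ξ)) P := (hX1.const_inner Y).const_mul 2
    have i2 : Integrable (fun ξ => ‖Y‖ ^ 2 + k * V + 2 * inner ℝ Y (X ξ)) P :=
      (integrable_const _).add i1
    have i3 : Integrable (fun ξ => ‖X ξ‖ ^ 2) P := h.integrable_noise_sq x
    have i4 : Integrable (fun ξ => ‖Y‖ ^ 2 + k * V + 2 * inner ℝ Y (X ξ) + ‖X ξ‖ ^ 2) P :=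
      i2.add i3
    simp_rw [e]
    rw [← ofReal_integral_eq_lintegral_ofReal i4
      (Filter.Eventually.of_forall fun ξ => by
        change 0 ≤ ‖Y‖ ^ 2 + k * V + 2 * inner ℝ Y (X ξ) + ‖X ξ‖ ^ 2
        rw [← e]; positivity)]
    refine ENNReal.ofReal_le_ofReal ?_
    rw [integral_add i2 i3, integral_add (integrable_const _) i1, integral_const_mul,
      integral_inner hX1, h.integral_noise x, integral_const]
    have := h.integral_noise_sq_le hV x
    simp only [probReal_univ, one_smul, inner_zero_right, mul_zero, add_zero]
    push_cast
    linarith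

/-- A stochastic gradient is sub-Gaussian in every direction. -/
lemma lintegral_exp_noise_le (hG : 0 < G) {θ : ℝ} (hθG : θ ^ 2 * G ^ 2 ≤ 1) (x : E d) {w : E d}
    (hw : ‖w‖ = 1) :
    ∫⁻ ξ, ENNReal.ofReal (Real.exp
        (θ * inner ℝ (gradient (fun z => f z ξ) x - gradient (objective P f) x) w)) ∂P ≤
      ENNReal.ofReal (Real.exp (2 * θ ^ 2 * G ^ 2)) := by
  set X : Ξ → E d := fun ξ => gradient (fun z => f z ξ) x - gradient (objective P f) x with hX
  have hXm : Measurable X := (h.measurable_gradient x).sub_const _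
  have hX1 : Integrable X P := (h.memLp_noise x).integrable (by norm_num)
  have hexp : Integrable (fun ξ => Real.exp (‖X ξ‖ ^ 2 / G ^ 2)) P := by
    refine ⟨by fun_prop, ?_⟩
    rw [hasFiniteIntegral_iff_ofReal (Filter.Eventually.of_forall fun ξ => by positivity)]
    exact (h.subgaussian x).trans_lt ENNReal.ofReal_lt_top
  have hexp_le : ∫ ξ, Real.exp (‖X ξ‖ ^ 2 / G ^ 2) ∂P ≤ Real.exp 1 := by
    rw [integral_eq_lintegral_of_nonneg_ae (Filter.Eventually.of_forall fun ξ => by positivity)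
      hexp.aestronglyMeasurable]
    exact ENNReal.toReal_le_of_le_ofReal (by positivity) (h.subgaussian x)
  have hpt : ∀ ξ, Real.exp (θ * inner ℝ (X ξ) w) ≤ θ * inner ℝ (X ξ) w +
      (1 - θ ^ 2 * G ^ 2 + θ ^ 2 * G ^ 2 * Real.exp (‖X ξ‖ ^ 2 / G ^ 2)) := fun ξ => by
    refine (exp_le_add_exp_sq _).trans ?_
    gcongr
    refine le_trans ?_ (exp_mul_le (by positivity) hθG)
    rw [Real.exp_le_exp]
    have h1 := abs_real_inner_le_norm (X ξ) w
    rw [hw, mul_one] at h1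
    have h2 : (inner ℝ (X ξ) w) ^ 2 ≤ ‖X ξ‖ ^ 2 := by
      rw [← sq_abs]; gcongr
    have h3 : θ ^ 2 * G ^ 2 * (‖X ξ‖ ^ 2 / G ^ 2) = θ ^ 2 * ‖X ξ‖ ^ 2 := by field_simp
    rw [h3, mul_pow]
    gcongr
  have i1 : Integrable (fun ξ => θ * inner ℝ (X ξ) w) P := (hX1.inner_const w).const_mul θ
  have i3 : Integrable (fun ξ => θ ^ 2 * G ^ 2 * Real.exp (‖X ξ‖ ^ 2 / G ^ 2)) P :=
    hexp.const_mul _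
  have i2 : Integrable (fun ξ => 1 - θ ^ 2 * G ^ 2 + θ ^ 2 * G ^ 2 *
      Real.exp (‖X ξ‖ ^ 2 / G ^ 2)) P := (integrable_const _).add i3
  calc _ ≤ ∫⁻ ξ, ENNReal.ofReal (θ * inner ℝ (X ξ) w +
        (1 - θ ^ 2 * G ^ 2 + θ ^ 2 * G ^ 2 * Real.exp (‖X ξ‖ ^ 2 / G ^ 2))) ∂P :=
        lintegral_mono fun ξ => ENNReal.ofReal_le_ofReal (hpt ξ)
    _ = ENNReal.ofReal (∫ ξ, (θ * inner ℝ (X ξ) w +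
        (1 - θ ^ 2 * G ^ 2 + θ ^ 2 * G ^ 2 * Real.exp (‖X ξ‖ ^ 2 / G ^ 2))) ∂P) :=
        (ofReal_integral_eq_lintegral_ofReal (i1.add i2)
          (Filter.Eventually.of_forall fun ξ => (Real.exp_pos _).le.trans (hpt ξ))).symm
    _ ≤ _ := by
        refine ENNReal.ofReal_le_ofReal ?_
        have e1 : ∫ ξ, inner ℝ (X ξ) w ∂P = 0 := by
          simp_rw [real_inner_comm w]
          rw [integral_inner hX1, h.integral_noise x, inner_zero_right]
        rw [integral_add i1 i2, integral_add (integrable_const _) i3, integral_const_mul,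
          integral_const_mul, e1, integral_const]
        simp only [probReal_univ, one_smul, mul_zero, zero_add]
        -- With s = θ²G² the mean is at most 1 - s + s e ≤ 1 + 2s ≤ exp (2s), because e ≤ 3.
        have h1 := Real.add_one_le_exp (2 * θ ^ 2 * G ^ 2)
        have h2 := Real.exp_one_lt_d9
        have h3 : 0 ≤ θ ^ 2 * G ^ 2 := by positivity
        nlinarith

/-- The first-order check rarely accepts a point with large gradient. -/
lemma measure_check_le (hG : 0 < G) {m : ℕ} (hm : 0 < m) {ε θ : ℝ} (hθ : 0 ≤ θ)
    (hθG : θ ^ 2 * G ^ 2 ≤ 1) (x : E d) (hx : ε < ‖gradient (objective P f) x‖) (hε : 0 ≤ ε) :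
    (Measure.pi fun _ : Fin m => P) {S | ‖gradient (batch f S) x‖ ≤ ε / 2} ≤
      ENNReal.ofReal (Real.exp (m * (2 * θ ^ 2 * G ^ 2 - θ * (ε / 2)))) := by
  set g := gradient (objective P f) x with hg
  have hg0 : 0 < ‖g‖ := hε.trans_lt hx
  -- If ‖∇F(x)‖ > ε but the sample gradient has norm at most ε/2, then the noise averages at least
  -- ε/2 in the direction -∇F(x)/‖∇F(x)‖. A Chernoff bound in this single direction suffices, so no
  -- dimension enters.
  set w : E d := -(‖g‖⁻¹ • g) with hw_def
  have hw : ‖w‖ = 1 := by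
    rw [hw_def, norm_neg, norm_smul, norm_inv, norm_norm, inv_mul_cancel₀ hg0.ne']
  set X : Ξ → ℝ := fun ξ => inner ℝ (gradient (fun z => f z ξ) x - g) w with hX
  have hXm : Measurable X := ((h.measurable_gradient x).sub_const _).inner_const
  have key := lintegral_pi_sum_le (P := P) (X := X)
    (Φ := fun k Y => ENNReal.ofReal (Real.exp (2 * θ ^ 2 * G ^ 2) ^ k * Real.exp (θ * Y)))
    (C := fun _ => True) (fun _ _ _ => trivial)
    (fun m Y => by fun_prop) (fun k Y _ => ?_) m 0 trivial
  · have hm' : (0 : ℝ) < m := by exact_mod_cast hm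
    have hsub : {S : Fin m → Ξ | ‖gradient (batch f S) x‖ ≤ ε / 2} ⊆
        {S | ENNReal.ofReal (Real.exp (θ * (m * (ε / 2)))) ≤
          ENNReal.ofReal (Real.exp (2 * θ ^ 2 * G ^ 2) ^ 0 *
            Real.exp (θ * (0 + ∑ i, X (S i))))} := by
      intro S hS
      simp only [Set.mem_ofPred_eq] at hS ⊢
      refine ENNReal.ofReal_le_ofReal ?_
      rw [pow_zero, one_mul, zero_add, Real.exp_le_exp]
      gcongr
      have e1 := congrArg (fun v => inner ℝ v w) (h.gradient_batch_sub hm S x)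
      simp only [inner_smul_left, sum_inner, conj_trivial, inner_sub_left (𝕜 := ℝ)
        (gradient (batch f S) x)] at e1
      have e2 : inner ℝ g w = -‖g‖ := by
        rw [hw_def, inner_neg_right, inner_smul_right, real_inner_self_eq_norm_sq]
        field_simp
      have e3 := neg_le_of_abs_le (abs_real_inner_le_norm (gradient (batch f S) x) w)
      rw [hw, mul_one] at e3
      rw [← hg, e2] at e1
      have e4 : ε / 2 ≤ 1 / (m : ℝ) * ∑ i, X (S i) := by
        simp only [hX]
        rw [← e1]; linarith
      calc (m : ℝ) * (ε / 2) ≤ m * (1 / (m : ℝ) * ∑ i, X (S i)) := by gcongr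
        _ = _ := by field_simp
    refine (measure_mono hsub).trans ?_
    have hmk := meas_ge_le_lintegral_div (μ := Measure.pi fun _ : Fin m => P)
      (f := fun S => ENNReal.ofReal (Real.exp (2 * θ ^ 2 * G ^ 2) ^ 0 *
            Real.exp (θ * (0 + ∑ i, X (S i)))))
      (ε := ENNReal.ofReal (Real.exp (θ * (m * (ε / 2)))))
      (Measurable.aemeasurable (by fun_prop))
      (by simpa using Real.exp_pos _) ENNReal.ofReal_ne_top
    refine hmk.trans ?_
    refine (ENNReal.div_le_div_right key _).trans ?_
    rw [← ENNReal.ofReal_div_of_pos (Real.exp_pos _)]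
    refine ENNReal.ofReal_le_ofReal (le_of_eq ?_)
    rw [← Real.exp_nat_mul, ← Real.exp_add, ← Real.exp_sub]
    congr 1
    ring
  · have e : ∀ ξ, ENNReal.ofReal (Real.exp (2 * θ ^ 2 * G ^ 2) ^ k * Real.exp (θ * (Y + X ξ))) =
        ENNReal.ofReal (Real.exp (2 * θ ^ 2 * G ^ 2) ^ k * Real.exp (θ * Y)) *
          ENNReal.ofReal (Real.exp (θ * X ξ)) := fun ξ => by
      rw [← ENNReal.ofReal_mul (by positivity), mul_add, Real.exp_add]
      congr 1
      ring
    simp_rw [e]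
    rw [lintegral_const_mul' _ _ ENNReal.ofReal_ne_top]
    refine (mul_le_mul_right (h.lintegral_exp_noise_le hG hθG x hw) _).trans (le_of_eq ?_)
    rw [← ENNReal.ofReal_mul (by positivity), pow_succ]
    congr 1
    ring

omit [IsProbabilityMeasure P] h in
lemma tendsto_cosh_partial (y : ℝ) :
    Filter.Tendsto (fun n => ∑ p ∈ Finset.range (n + 1), y ^ (2 * p) / (2 * p).factorial)
      Filter.atTop (nhds (Real.cosh y)) :=
  (Filter.tendsto_add_atTop_iff_nat 1).mpr (Real.hasSum_cosh y).tendsto_sum_nat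

lemma isSymm_hessian_sub (ξ : Ξ) (x : E d) :
    IsSymm (hessian (fun z => f z ξ) x - hessian (objective P f) x) :=
  IsSymm.sub ((h.isSmooth ξ).hessian_symm x) (h.isSmooth_objective.hessian_symm x)

/-- Each summand is centred and bounded by 2L₁. The first-order term of the one-step bound is a
continuous linear functional of it and integrates to zero, so every sample costs one factor cosh κ.
The start contributes the trace of the identity, d. -/
lemma lintegral_traceCosh_le (hL₁ : 0 < L₁) {n : ℕ} {θ : ℝ} (hθ : 0 < θ) (x : E d) (m : ℕ) :
    ∫⁻ S, ENNReal.ofReal (traceCosh n θ (∑ i, (hessian (fun z => f z (S i)) x -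
        hessian (objective P f) x))) ∂(Measure.pi fun _ : Fin m => P) ≤
      ENNReal.ofReal (Real.cosh (√2 * (2 * L₁) * θ) ^ m * d) := by
  set X : Ξ → E d →L[ℝ] E d :=
    fun ξ => hessian (fun z => f z ξ) x - hessian (objective P f) x with hX
  set κ := √2 * (2 * L₁) * θ with hκ
  have hXm : Measurable X := (h.measurable_hessian x).sub_const _
  have hX1 : Integrable X P := (h.hasFDerivAt_gradient_objective x).1.sub (integrable_const _)
  have hX0 : ∫ ξ, X ξ ∂P = 0 := by
    rw [integral_sub (h.hasFDerivAt_gradient_objective x).1 (integrable_const _),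
      ← h.hessian_objective x]
    simp
  have hXa : ∀ ξ, ‖X ξ‖ ≤ 2 * L₁ := fun ξ => by
    refine (norm_sub_le _ _).trans ?_
    have h1 := (h.isSmooth ξ).norm_hessian_le hL₁.le x
    have h2 := h.isSmooth_objective.norm_hessian_le hL₁.le x
    linarith
  have key := lintegral_pi_sum_le (P := P) (X := X)
    (Φ := fun k Y => ENNReal.ofReal (Real.cosh κ ^ k * traceCosh n θ Y)) (C := IsSymm)
    (fun Y hY ξ => hY.add (h.isSymm_hessian_sub ξ x)) (fun m Y => ?_) (fun k Y hY => ?_) m 0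
    IsSymm.zero
  · rw [traceCosh_zero] at key
    simpa only [zero_add, pow_zero, one_mul] using key
  · have : Measurable fun S : Fin m → Ξ => Y + ∑ i, X (S i) := by fun_prop
    exact (((continuous_traceCosh n θ).measurable.comp this).const_mul _).ennreal_ofReal
  · set W := traceSinhOp n θ Y
    have hc := Real.cosh_pos κ
    have hpt : ∀ ξ, Real.cosh κ ^ k * traceCosh n θ (Y + X ξ) ≤
        Real.cosh κ ^ k * (Real.cosh κ * traceCosh n θ Y +
          Real.sinh κ / κ * opTrace d (W * X ξ)) := fun ξ => by
      gcongr
      exact traceCosh_add_le hθ (by positivity) hY (h.isSymm_hessian_sub ξ x) (hXa ξ)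
    let T := (opTrace d).comp (ContinuousLinearMap.compL ℝ (E d) (E d) (E d) W)
    have i1 : Integrable (fun ξ => opTrace d (W * X ξ)) P := T.integrable_comp hX1
    have e1 : ∫ ξ, opTrace d (W * X ξ) ∂P = 0 := by
      have := T.integral_comp_comm hX1
      rw [hX0, map_zero] at this
      exact this
    calc _ ≤ ∫⁻ ξ, ENNReal.ofReal (Real.cosh κ ^ k * (Real.cosh κ * traceCosh n θ Y +
          Real.sinh κ / κ * opTrace d (W * X ξ))) ∂P :=
          lintegral_mono fun ξ => ENNReal.ofReal_le_ofReal (hpt ξ)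
      _ = ENNReal.ofReal (∫ ξ, (Real.cosh κ ^ k * (Real.cosh κ * traceCosh n θ Y +
          Real.sinh κ / κ * opTrace d (W * X ξ))) ∂P) :=
          (ofReal_integral_eq_lintegral_ofReal
            (((integrable_const _).add (i1.const_mul _)).const_mul _)
            (Filter.Eventually.of_forall fun ξ => le_trans (mul_nonneg (by positivity)
              (traceCosh_nonneg (hY.add (h.isSymm_hessian_sub ξ x)))) (hpt ξ))).symm
      _ = _ := by
          rw [integral_const_mul, integral_add (integrable_const _) (i1.const_mul _),
            integral_const_mul (Real.sinh κ / κ), e1, integral_const, pow_succ]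
          simp only [probReal_univ, one_smul, mul_zero, add_zero, mul_assoc]

omit [IsProbabilityMeasure P] in
lemma hessian_batch_sub {m : ℕ} (hm : 0 < m) (S : Fin m → Ξ) (x : E d) :
    hessian (batch f S) x - hessian (objective P f) x = (1 / (m : ℝ)) •
      ∑ i, (hessian (fun z => f z (S i)) x - hessian (objective P f) x) := by
  have hm' : (m : ℝ) ≠ 0 := by positivity
  rw [hessian_batch h.isSmooth, Finset.sum_sub_distrib]
  ext1 v
  simp only [sub_apply, smul_apply, smul_sub, Finset.sum_const, Finset.card_univ, Fintype.card_fin,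
    ← Nat.cast_smul_eq_nsmul ℝ, smul_smul, one_div_mul_cancel hm', one_smul]

/-- Concentration of the Hessian of an empirical average, with a logarithmic dependence on the
dimension. -/
lemma measure_hessian_le (hL₁ : 0 < L₁) {m : ℕ} (hm : 0 < m) {σ : ℝ} (hσ : 0 < σ) (x : E d) :
    (Measure.pi fun _ : Fin m => P)
        {S | σ < ‖hessian (batch f S) x - hessian (objective P f) x‖} ≤
      ENNReal.ofReal (2 * d * Real.exp (-(m * σ ^ 2 / (16 * L₁ ^ 2)))) := by
  set μ := Measure.pi fun _ : Fin m => P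
  -- Minimises 4L₁²θ² - θσ; the minimum is -σ²/(16L₁²).
  set θ := σ / (8 * L₁ ^ 2) with hθ_def
  have hθ : 0 < θ := by positivity
  have hm' : (0 : ℝ) < m := by exact_mod_cast hm
  set B := Real.cosh (√2 * (2 * L₁) * θ) ^ m * d with hB
  set A := {S : Fin m → Ξ | σ < ‖hessian (batch f S) x - hessian (objective P f) x‖} with hA
  have hAfin : μ A ≠ ⊤ := measure_ne_top _ _
  have hbound : ∀ n : ℕ, (∑ p ∈ Finset.range (n + 1),
      (θ * (m * σ)) ^ (2 * p) / (2 * p).factorial) * (μ A).toReal ≤ B := fun n => by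
    set s := ∑ p ∈ Finset.range (n + 1), (θ * (m * σ)) ^ (2 * p) / (2 * p).factorial with hs
    have hs0 : 0 ≤ s := Finset.sum_nonneg fun p _ => by positivity
    have hsub : A ⊆ {S | ENNReal.ofReal s ≤ ENNReal.ofReal (traceCosh n θ
        (∑ i, (hessian (fun z => f z (S i)) x - hessian (objective P f) x)))} := by
      intro S hS
      refine ENNReal.ofReal_le_ofReal (cosh_partial_le_traceCosh hθ.le (by positivity)
        (IsSymm.sum fun i _ => h.isSymm_hessian_sub (S i) x) ?_)
      simp only [hA, Set.mem_ofPred_eq, h.hessian_batch_sub hm] at hS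
      rw [norm_smul, Real.norm_of_nonneg (by positivity)] at hS
      calc (m : ℝ) * σ < m * (1 / (m : ℝ) * ‖_‖) := by gcongr
        _ = _ := by field_simp
    have hmk := mul_meas_ge_le_lintegral₀ (μ := μ) (f := fun S => ENNReal.ofReal (traceCosh n θ
        (∑ i, (hessian (fun z => f z (S i)) x - hessian (objective P f) x)))) ?_ (ENNReal.ofReal s)
    · have h1 := (mul_le_mul_right (measure_mono hsub) (ENNReal.ofReal s)).trans
        (hmk.trans (h.lintegral_traceCosh_le hL₁ hθ x m))
      have h2 := ENNReal.toReal_le_of_le_ofReal (by positivity) h1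
      rwa [ENNReal.toReal_mul, ENNReal.toReal_ofReal hs0] at h2
    · have hXm : Measurable fun ξ => hessian (fun z => f z ξ) x - hessian (objective P f) x :=
        (h.measurable_hessian x).sub_const _
      have : Measurable fun S : Fin m → Ξ =>
          ∑ i, (hessian (fun z => f z (S i)) x - hessian (objective P f) x) :=
        Finset.measurable_fun_sum _ fun i _ => hXm.comp (measurable_pi_apply i)
      exact (((continuous_traceCosh n θ).measurable.comp this)).ennreal_ofReal.aemeasurable
  -- Markov's inequality holds for every truncation degree n with the same right side, so the
  -- partial sums may be replaced by the full cosh.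
  have hlim : Real.cosh (θ * (m * σ)) * (μ A).toReal ≤ B :=
    le_of_tendsto' ((tendsto_cosh_partial _).mul_const _) hbound
  rw [← ENNReal.ofReal_toReal hAfin]
  refine ENNReal.ofReal_le_ofReal ?_
  have h1 : Real.exp (θ * (m * σ)) / 2 ≤ Real.cosh (θ * (m * σ)) := by
    rw [Real.cosh_eq]; linarith [Real.exp_pos (-(θ * (m * σ)))]
  have h2 : B ≤ Real.exp (m * ((√2 * (2 * L₁) * θ) ^ 2 / 2)) * d := by
    rw [hB, Real.exp_nat_mul]
    gcongr
    exact Real.cosh_le_exp_half_sq _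
  have h3 : Real.exp (θ * (m * σ)) / 2 * (μ A).toReal ≤
      Real.exp (m * ((√2 * (2 * L₁) * θ) ^ 2 / 2)) * d :=
    (mul_le_mul_of_nonneg_right h1 ENNReal.toReal_nonneg).trans (hlim.trans h2)
  have h4 : (m : ℝ) * ((√2 * (2 * L₁) * θ) ^ 2 / 2) = θ * (m * σ) + -(m * σ ^ 2 / (16 * L₁ ^ 2)) := by
    rw [mul_pow, mul_pow, Real.sq_sqrt (by norm_num), hθ_def]
    field_simp
    ring
  rw [h4, Real.exp_add] at h3
  have h5 := Real.exp_pos (θ * (m * σ))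
  refine le_of_mul_le_mul_left ?_ h5
  linarith

end Assumptions

end Concentration

end NeonSCSG

end

noncomputable section

namespace NeonSCSG

variable {d : ℕ} {Ξ : Type*}

/-! ### The uniform distribution on the ball -/

/-- A thin slab has small probability under the uniform distribution on the unit ball. -/
lemma unitBallLaw_slab_le (hd : 0 < d) {v : E d} (hv : ‖v‖ = 1) {s : ℝ} (hs : 0 < s) :
    unitBallLaw d {z | |inner ℝ z v| < s} ≤ ENNReal.ofReal (12 * d * s) := by
  have hd' : (0 : ℝ) < d := by exact_mod_cast hd
  rcases lt_or_ge 1 (2 * s * d) with hbig | hsmall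
  · refine prob_le_one.trans ?_
    rw [← ENNReal.ofReal_one]
    exact ENNReal.ofReal_le_ofReal (by nlinarith)
  -- About 1/(2sd) translates of the slab by multiples of 2s v are disjoint and fit into the ball of
  -- radius 1 + 2sK, whose volume exceeds that of the unit ball by a factor of at most e ≤ 3. So the
  -- slab has at most the fraction 3/K, and rounding K down loses another factor 2.
  set K : ℕ := ⌊1 / (2 * s * d)⌋₊ with hK
  have hK1 : (K : ℝ) ≤ 1 / (2 * s * d) := Nat.floor_le (by positivity)
  have hone : 1 ≤ 1 / (2 * s * d) := by rwa [le_div_iff₀ (by positivity), one_mul]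
  have hKpos : 1 ≤ K := (Nat.one_le_floor_iff _).mpr hone
  have hK2 : 1 / (2 * s * d) ≤ 2 * K := by
    have h1 := (Nat.lt_floor_add_one (1 / (2 * s * d))).le
    have h2 : (1 : ℝ) ≤ K := by exact_mod_cast hKpos
    rw [← hK] at h1
    linarith
  have hK0 : (0 : ℝ) < K := by exact_mod_cast hKpos
  set B := Metric.closedBall (0 : E d) 1 with hB
  set A : Set (E d) := B ∩ {z | |inner ℝ z v| < s} with hA
  have hAm : MeasurableSet A := by
    refine measurableSet_closedBall.inter (measurableSet_lt ?_ measurable_const)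
    fun_prop
  let T : ℕ → Set (E d) := fun k => (fun z => (2 * s * k) • v + z) '' A
  have hTvol : ∀ k, volume (T k) = volume A := fun k => by
    simp only [T, Set.image_add_left, measure_preimage_add]
  have hTm : ∀ k, MeasurableSet (T k) := fun k => by
    simp only [T, Set.image_add_left]
    exact (measurable_const_add _) hAm
  have hvv : inner ℝ v v = (1 : ℝ) := by rw [real_inner_self_eq_norm_sq, hv]; norm_num
  have hdisj : (↑(Finset.range K) : Set ℕ).PairwiseDisjoint T := by
    intro i _ j _ hij
    refine Set.disjoint_left.mpr ?_
    rintro _ ⟨z, hz, rfl⟩ ⟨w, hw, hzw⟩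
    have h1 := congrArg (fun u => inner ℝ u v) hzw
    simp only [inner_add_left, inner_smul_left, conj_trivial, hvv, mul_one] at h1
    have hz2 : |inner ℝ z v| < s := hz.2
    have hw2 : |inner ℝ w v| < s := hw.2
    have hz' := abs_lt.mp hz2
    have hw' := abs_lt.mp hw2
    rcases lt_or_gt_of_ne hij with hlt | hlt
    · have : (i : ℝ) + 1 ≤ j := by exact_mod_cast hlt
      nlinarith
    · have : (j : ℝ) + 1 ≤ i := by exact_mod_cast hlt
      nlinarith
  have hsub : (⋃ k ∈ Finset.range K, T k) ⊆ Metric.closedBall (0 : E d) (1 + 2 * s * K) := by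
    intro y hy
    simp only [Set.mem_iUnion, Finset.mem_range] at hy
    obtain ⟨k, hk, z, hz, rfl⟩ := hy
    have h1 : ‖z‖ ≤ 1 := by simpa [hB] using hz.1
    have h2 : (k : ℝ) ≤ K := by exact_mod_cast hk.le
    rw [mem_closedBall_zero_iff]
    refine (norm_add_le _ _).trans ?_
    rw [norm_smul, hv, mul_one, Real.norm_of_nonneg (by positivity)]
    nlinarith
  have hvol : (K : ℝ≥0∞) * volume A ≤ ENNReal.ofReal 3 * volume B := by
    calc (K : ℝ≥0∞) * volume A = ∑ k ∈ Finset.range K, volume (T k) := by simp [hTvol]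
      _ = volume (⋃ k ∈ Finset.range K, T k) :=
          (measure_biUnion_finset hdisj fun k _ => hTm k).symm
      _ ≤ volume (Metric.closedBall (0 : E d) (1 + 2 * s * K)) := measure_mono hsub
      _ = ENNReal.ofReal ((1 + 2 * s * K) ^ d) * volume B := by
          rw [Measure.addHaar_closedBall' _ _ (by positivity)]
          simp [hB]
      _ ≤ _ := by
          gcongr
          have h1 : 2 * s * K * d ≤ 1 := by
            rw [le_div_iff₀ (by positivity)] at hK1
            linarith
          calc (1 + 2 * s * K) ^ d ≤ Real.exp (2 * s * K) ^ d := by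
                gcongr
                linarith [Real.add_one_le_exp (2 * s * K)]
            _ = Real.exp (d * (2 * s * K)) := (Real.exp_nat_mul _ _).symm
            _ ≤ Real.exp 1 := Real.exp_le_exp.mpr (by linarith)
            _ ≤ 3 := by linarith [Real.exp_one_lt_d9]
  have hB0 : volume B ≠ 0 := (Metric.measure_closedBall_pos volume (0 : E d) one_pos).ne'
  have hBt : volume B ≠ ⊤ := measure_closedBall_lt_top.ne
  unfold unitBallLaw
  rw [cond_apply measurableSet_closedBall, mul_comm]
  change volume A * (volume B)⁻¹ ≤ _
  rw [← div_eq_mul_inv, ENNReal.div_le_iff hB0 hBt]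
  have hKtop : (K : ℝ≥0∞) ≠ ⊤ := ENNReal.natCast_ne_top K
  have hKne : (K : ℝ≥0∞) ≠ 0 := by exact_mod_cast (by omega : K ≠ 0)
  refine (ENNReal.mul_le_mul_iff_right hKne hKtop).mp (hvol.trans ?_)
  rw [← mul_assoc]
  gcongr
  rw [← ENNReal.ofReal_natCast K, ← ENNReal.ofReal_mul (by positivity)]
  refine ENNReal.ofReal_le_ofReal ?_
  rw [div_le_iff₀ (by positivity)] at hK2
  linarith

/-! ### Markov chains driven by independent seeds -/

section Chain

variable {X A : Type*}

/-- Prepend a term to a sequence. -/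
def consSeq (x : X) (ω : ℕ → X) : ℕ → X
  | 0 => x
  | n + 1 => ω n

/-- The state after `n` steps of a process driven by the seeds `ω`. -/
def chain (Φ : X → A → A) (a : A) (ω : ℕ → X) : ℕ → A
  | 0 => a
  | n + 1 => Φ (ω n) (chain Φ a ω n)

lemma chain_consSeq (Φ : X → A → A) (a : A) (x : X) (ω : ℕ → X) (n : ℕ) :
    chain Φ a (consSeq x ω) (n + 1) = chain Φ (Φ x a) ω n := by
  induction n with
  | zero => rfl
  | succ n ih => rw [chain, ih]; rfl

variable [MeasurableSpace X] [MeasurableSpace A]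

lemma measurable_consSeq : Measurable fun p : X × (ℕ → X) => consSeq p.1 p.2 := by
  refine measurable_pi_lambda _ fun n => ?_
  cases n with
  | zero => exact measurable_fst
  | succ n => exact (measurable_pi_apply n).comp measurable_snd

/-- An i.i.d. sequence with an independent copy prepended has the same law. It is enough to check
this on cylinders. -/
lemma map_consSeq (μ : Measure X) [IsProbabilityMeasure μ] :
    (μ.prod (Measure.infinitePi fun _ : ℕ => μ)).map (fun p => consSeq p.1 p.2) =
      Measure.infinitePi fun _ : ℕ => μ := by
  classical
  refine Measure.eq_infinitePi _ fun s t ht => ?_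
  obtain ⟨N, hN⟩ := s.exists_nat_subset_range
  -- The finite index set is enlarged to an initial segment, with trivial constraints at the new
  -- indices, so that index 0 can be split off.
  let t' : ℕ → Set X := fun i => if i ∈ s then t i else Set.univ
  have ht' : ∀ i, MeasurableSet (t' i) := fun i => by
    by_cases hi : i ∈ s <;> simp [t', hi, ht]
  have hpi : Set.pi s t = Set.pi (Finset.range (N + 1)) t' := by
    ext ω
    simp only [Set.mem_pi, Finset.mem_coe]
    refine ⟨fun h i _ => ?_, fun h i hi => ?_⟩
    · by_cases hi : i ∈ s
      · simpa [t', hi] using h i hi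
      · simp [t', hi]
    · have := h i (Finset.range_mono (Nat.le_succ N) (hN hi))
      simpa [t', hi] using this
  have hprod : ∏ i ∈ s, μ (t i) = ∏ i ∈ Finset.range (N + 1), μ (t' i) := by
    rw [← Finset.prod_subset (hN.trans (Finset.range_mono (Nat.le_succ N)))
      (fun i _ hi => by simp [t', hi])]
    exact Finset.prod_congr rfl fun i hi => by simp [t', hi]
  rw [hpi, hprod, Measure.map_apply measurable_consSeq
    (MeasurableSet.pi (Finset.countable_toSet _) fun i _ => ht' i), Finset.prod_range_succ']
  have hpre : (fun p : X × (ℕ → X) => consSeq p.1 p.2) ⁻¹' Set.pi (Finset.range (N + 1)) t' =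
      t' 0 ×ˢ Set.pi (Finset.range N) fun i => t' (i + 1) := by
    ext ⟨x, ω⟩
    simp only [Set.mem_preimage, Set.mem_pi, Finset.mem_coe, Finset.mem_range, Set.mem_prod]
    refine ⟨fun h => ⟨h 0 (by omega), fun i hi => h (i + 1) (by omega)⟩, fun h i hi => ?_⟩
    cases i with
    | zero => exact h.1
    | succ i => exact h.2 i (by omega)
  rw [hpre, Measure.prod_prod, Measure.infinitePi_pi _ fun i _ => ht' (i + 1), mul_comm]

lemma lintegral_infinitePi_succ (μ : Measure X) [IsProbabilityMeasure μ] {F : (ℕ → X) → ℝ≥0∞}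
    (hF : Measurable F) :
    ∫⁻ ω, F ω ∂(Measure.infinitePi fun _ : ℕ => μ) =
      ∫⁻ x, ∫⁻ ω, F (consSeq x ω) ∂(Measure.infinitePi fun _ : ℕ => μ) ∂μ := by
  conv_lhs => rw [← map_consSeq μ]
  rw [lintegral_map hF measurable_consSeq,
    lintegral_prod _ (by exact (hF.comp measurable_consSeq).aemeasurable)]

lemma measurable_chain {Φ : X → A → A} (hΦ : Measurable (Function.uncurry Φ)) (n : ℕ) :
    Measurable fun p : A × (ℕ → X) => chain Φ p.1 p.2 n := by
  induction n with
  | zero => exact measurable_fst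
  | succ n ih =>
    exact hΦ.comp (((measurable_pi_apply n).comp measurable_snd).prodMk ih)

/-- The seed of a step is independent of the state before the step. -/
lemma lintegral_chain (μ : Measure X) [IsProbabilityMeasure μ] {Φ : X → A → A}
    (hΦ : Measurable (Function.uncurry Φ)) {ψ : A → X → ℝ≥0∞}
    (hψ : Measurable (Function.uncurry ψ)) (a : A) (n : ℕ) :
    ∫⁻ ω, ψ (chain Φ a ω n) (ω n) ∂(Measure.infinitePi fun _ : ℕ => μ) =
      ∫⁻ ω, ∫⁻ x, ψ (chain Φ a ω n) x ∂μ ∂(Measure.infinitePi fun _ : ℕ => μ) := by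
  have hm1 : ∀ (a : A) (n : ℕ), Measurable fun ω : ℕ → X => chain Φ a ω n := fun a n =>
    (measurable_chain hΦ n).comp (measurable_const.prodMk measurable_id)
  have hm2 : ∀ (a : A) (n : ℕ), Measurable fun ω : ℕ → X => ψ (chain Φ a ω n) (ω n) := fun a n =>
    hψ.comp ((hm1 a n).prodMk (measurable_pi_apply n))
  -- Splitting off the first seed x turns n + 1 steps from a into n steps from Φ x a driven by the
  -- shifted sequence.
  induction n generalizing a with
  | zero =>
    rw [lintegral_infinitePi_succ μ (hm2 a 0)]
    simp [chain, consSeq]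
  | succ n ih =>
    have hm3 : Measurable fun a => ∫⁻ x, ψ a x ∂μ := hψ.lintegral_prod_right'
    rw [lintegral_infinitePi_succ μ (hm2 a (n + 1)),
      lintegral_infinitePi_succ μ (by exact hm3.comp (hm1 a (n + 1)))]
    refine lintegral_congr fun x => ?_
    simp only [chain_consSeq]
    exact ih (Φ x a)

end Chain

end NeonSCSG

end

noncomputable section

namespace NeonSCSG

variable {d : ℕ} {Ξ : Type*}

/-! ### Measurability of the algorithm -/

section Find

variable {Ω W : Type*} [MeasurableSpace Ω] [MeasurableSpace W]

lemma measurableSet_and {p q : Ω → Prop} (hp : MeasurableSet {ω | p ω})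
    (hq : MeasurableSet {ω | q ω}) : MeasurableSet {ω | p ω ∧ q ω} := hp.inter hq

/-- The space splits into countably many measurable events, on each of which the first admissible
index is a constant τ, and the event that there is none. -/
lemma measurable_dite_find {p : Ω → ℕ → Prop} [∀ ω, DecidablePred (p ω)]
    [∀ ω, Decidable (∃ τ, p ω τ)] {F : Ω → ℕ → W} {H : Ω → W}
    (hp : ∀ τ, MeasurableSet {ω | p ω τ}) (hF : ∀ τ, Measurable fun ω => F ω τ)
    (hH : Measurable H) :
    Measurable fun ω => if h : ∃ τ, p ω τ then F ω (Nat.find h) else H ω := by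
  intro t ht
  have : (fun ω => if h : ∃ τ, p ω τ then F ω (Nat.find h) else H ω) ⁻¹' t =
      (⋃ τ, ({ω | p ω τ} ∩ (⋂ σ ∈ Finset.range τ, {ω | p ω σ}ᶜ)) ∩ (fun ω => F ω τ) ⁻¹' t) ∪
        ((⋃ τ, {ω | p ω τ})ᶜ ∩ H ⁻¹' t) := by
    ext ω
    by_cases h : ∃ τ, p ω τ
    · rw [Set.mem_preimage, dif_pos h]
      simp only [Set.mem_union, Set.mem_iUnion, Set.mem_inter_iff, Set.mem_iInter,
        Finset.mem_range, Set.mem_compl_iff, Set.mem_ofPred_eq, h, not_true, false_and, or_false,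
        Set.mem_preimage]
      refine ⟨fun hx => ⟨Nat.find h, ⟨Nat.find_spec h, fun i hi => Nat.find_min h hi⟩, hx⟩, ?_⟩
      rintro ⟨τ, ⟨h1, h2⟩, h3⟩
      rwa [(Nat.find_eq_iff h).mpr ⟨h1, h2⟩]
    · have h' : ∀ τ, ¬ p ω τ := fun τ hτ => h ⟨τ, hτ⟩
      simp [h']
  rw [this]
  refine (MeasurableSet.iUnion fun τ => ((hp τ).inter ?_).inter (hF τ ht)).union
    ((MeasurableSet.iUnion hp).compl.inter (hH ht))
  exact Finset.measurableSet_biInter _ fun σ _ => (hp σ).compl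

lemma measurableSet_isArgmin {h : Ω → E d → ℝ} {u : Ω → ℕ → E d} (U : ℝ) (n τ : ℕ)
    (hu : ∀ τ, Measurable fun ω => u ω τ) (hh : ∀ τ, Measurable fun ω => h ω (u ω τ)) :
    MeasurableSet {ω | IsArgmin (h ω) (u ω) U n τ} := by
  unfold IsArgmin
  refine measurableSet_and (MeasurableSet.const _)
    (measurableSet_and (measurableSet_le (hu τ).norm measurable_const) ?_)
  have : {ω | ∀ σ ≤ n, ‖u ω σ‖ ≤ U → h ω (u ω τ) ≤ h ω (u ω σ)} =
      ⋂ σ ∈ Finset.range (n + 1),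
        ({ω | ‖u ω σ‖ ≤ U}ᶜ ∪ {ω | h ω (u ω τ) ≤ h ω (u ω σ)}) := by
    ext ω
    simp only [Set.mem_ofPred_eq, Set.mem_iInter, Finset.mem_range, Set.mem_union,
      Set.mem_compl_iff, Nat.lt_succ_iff, imp_iff_not_or]
  rw [this]
  exact Finset.measurableSet_biInter _ fun σ _ =>
    (measurableSet_le (hu σ).norm measurable_const).compl.union (measurableSet_le (hh τ) (hh σ))

/-- Used for the random length N of an epoch; measurability can be checked for each of the countably
many values. -/
lemma measurable_dependent {N : Ω → ℕ} (hN : Measurable N) {F : ℕ → Ω → W}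
    (hF : ∀ n, Measurable (F n)) : Measurable fun ω => F (N ω) ω := by
  have : Measurable fun q : ℕ × Ω => F q.1 q.2 := measurable_from_prod_countable_right hF
  exact this.comp (hN.prodMk measurable_id)

end Find

section Algorithm

variable [MeasurableSpace Ξ] {f : E d → Ξ → ℝ} {L₁ L₂ : ℝ}

/-- A Carathéodory function: continuous in the point, measurable in the sample. Joint measurability
is what later permits Fubini's theorem for states that depend on earlier seeds. -/
lemma measurable_batch (hm : ∀ x, Measurable (f x)) (hf : ∀ ξ, IsSmooth (fun x => f x ξ) L₁ L₂)
    (m : ℕ) : Measurable fun p : (Fin m → Ξ) × E d => batch f p.1 p.2 := by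
  have h1 : Measurable (Function.uncurry fun (x : E d) (S : Fin m → Ξ) => batch f S x) := by
    refine measurable_uncurry_of_continuous_of_measurable (fun S => ?_) fun x => ?_
    · unfold batch
      exact continuous_const.mul (continuous_finsetSum _ fun i _ => (hf (S i)).diff.continuous)
    · unfold batch
      exact (Finset.measurable_fun_sum _ fun i _ =>
        (hm x).comp (measurable_pi_apply i)).const_mul _
  exact h1.comp measurable_swap

lemma measurable_gradient_batch (hm : ∀ x, Measurable (f x))
    (hf : ∀ ξ, IsSmooth (fun x => f x ξ) L₁ L₂) (m : ℕ) :
    Measurable fun p : (Fin m → Ξ) × E d => gradient (batch f p.1) p.2 := by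
  have e : (fun p : (Fin m → Ξ) × E d => gradient (batch f p.1) p.2) = fun p =>
      (1 / (m : ℝ)) • ∑ i, gradient (fun z => f z (p.1 i)) p.2 :=
    funext fun p => gradient_batch (fun ξ => (hf ξ).diff) p.1 p.2
  have h0 : Measurable (Function.uncurry fun (x : E d) (ξ : Ξ) =>
      gradient (fun z => f z ξ) x) :=
    measurable_uncurry_of_continuous_of_measurable (fun ξ => (hf ξ).diff_grad.continuous)
      fun x => measurable_gradient_param hm (fun ξ => (hf ξ).diff) x
  have h1 : ∀ i, Measurable fun p : (Fin m → Ξ) × E d => gradient (fun z => f z (p.1 i)) p.2 :=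
    fun i => h0.comp (by fun_prop : Measurable fun p : (Fin m → Ξ) × E d => (p.2, p.1 i))
  have h2 : Measurable fun p : (Fin m → Ξ) × E d =>
      (∑ i, gradient (fun z => f z (p.1 i)) p.2 : E d) :=
    Finset.measurable_fun_sum _ fun i _ => h1 i
  rw [e]
  exact h2.const_smul (1 / (m : ℝ))

variable (hm : ∀ x, Measurable (f x)) (hf : ∀ ξ, IsSmooth (fun x => f x ξ) L₁ L₂)
include hm hf

lemma measurable_epochIter (η : ℝ) (m b k : ℕ) :
    Measurable fun p : (Fin m → Ξ) × (ℕ → Fin b → Ξ) × E d =>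
      epochIter f η p.1 p.2.1 p.2.2 k := by
  have h1 := measurable_gradient_batch hm hf m
  have h2 := measurable_gradient_batch hm hf b
  induction k with
  | zero => exact measurable_snd.comp measurable_snd
  | succ k ih =>
    have hB : Measurable fun p : (Fin m → Ξ) × (ℕ → Fin b → Ξ) × E d => p.2.1 k := by fun_prop
    have hx : Measurable fun p : (Fin m → Ξ) × (ℕ → Fin b → Ξ) × E d => p.2.2 := by fun_prop
    exact ih.sub ((((h2.comp (hB.prodMk ih)).sub (h2.comp (hB.prodMk hx))).add
      (h1.comp (measurable_fst.prodMk hx))).const_smul η)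

lemma measurable_scsgEpoch (I : Input) (m : ℕ) :
    Measurable fun p : EpochSeed Ξ m I.b × E d => scsgEpoch f I p.1 p.2 := by
  unfold scsgEpoch
  refine measurable_dependent (N := fun p : EpochSeed Ξ m I.b × E d => p.1.2.1) (by fun_prop)
    (F := fun n p => epochIter f (I.c' / I.L₁ * ((m : ℝ) / (I.b : ℝ)) ^ (-(2 / 3) : ℝ)) p.1.1
      p.1.2.2 p.2 n) fun n => ?_
  have : Measurable fun p : EpochSeed Ξ m I.b × E d => (p.1.1, p.1.2.2, p.2) := by fun_prop
  exact (measurable_epochIter hm hf _ m I.b n).comp this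

section NegCurv

variable {Ω : Type*} [MeasurableSpace Ω] {m : ℕ} {S : Ω → Fin m → Ξ} {y u : Ω → E d}
  (hS : Measurable S) (hy : Measurable y)
include hS hy

lemma measurable_batch_comp : Measurable fun ω => batch f (S ω) (y ω) :=
  (measurable_batch hm hf m).comp (hS.prodMk hy)

lemma measurable_gradient_batch_comp : Measurable fun ω => gradient (batch f (S ω)) (y ω) := by
  have h := measurable_gradient_batch hm hf m
  generalize hg : (fun p : (Fin m → Ξ) × E d => gradient (batch f p.1) p.2) = g at h
  have e : (fun ω => gradient (batch f (S ω)) (y ω)) = fun ω => g (S ω, y ω) := by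
    rw [← hg]
  rw [e]
  exact h.comp (hS.prodMk hy)

lemma measurable_residual_comp (hu : Measurable u) :
    Measurable fun ω => residual (batch f (S ω)) (y ω) (u ω) := by
  have h1 : Measurable fun ω => batch f (S ω) (y ω + u ω) :=
    measurable_batch_comp hm hf hS (hy.add hu)
  have h2 := measurable_batch_comp hm hf hS hy
  have h3 := measurable_gradient_batch_comp hm hf hS hy
  unfold residual
  exact (h1.sub h2).sub (h3.inner hu)

lemma measurable_residualGrad_comp (hu : Measurable u) :
    Measurable fun ω => residualGrad (batch f (S ω)) (y ω) (u ω) := by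
  have h1 : Measurable fun ω => gradient (batch f (S ω)) (y ω + u ω) :=
    measurable_gradient_batch_comp hm hf hS (hy.add hu)
  have h2 := measurable_gradient_batch_comp hm hf hS hy
  unfold residualGrad
  exact h1.sub h2

variable (hu : Measurable u)
include hu

lemma measurable_neonIter (η : ℝ) (k : ℕ) :
    Measurable fun ω => neonIter (batch f (S ω)) (y ω) η (u ω) k := by
  induction k with
  | zero => exact hu
  | succ k ih => exact ih.sub ((measurable_residualGrad_comp hm hf hS hy ih).const_smul η)

lemma measurable_nagIter (η ζ : ℝ) (k : ℕ) :
    Measurable fun ω => nagIter (batch f (S ω)) (y ω) η ζ (u ω) k := by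
  induction k with
  | zero => exact hu.prodMk hu
  | succ k ih =>
    have h1 : Measurable fun ω => (nagIter (batch f (S ω)) (y ω) η ζ (u ω) k).2 -
        η • residualGrad (batch f (S ω)) (y ω) (nagIter (batch f (S ω)) (y ω) η ζ (u ω) k).2 :=
      ih.snd.sub ((measurable_residualGrad_comp hm hf hS hy ih.snd).const_smul η)
    exact h1.prodMk (h1.add ((h1.sub ih.fst).const_smul ζ))

lemma measurable_neon (p : Tuning) :
    Measurable fun ω => neon (batch f (S ω)) p (y ω) (u ω) := by
  have h1 := measurable_neonIter hm hf hS hy hu p.η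
  have h2 := fun τ => measurable_residual_comp hm hf hS hy (h1 τ)
  classical
  unfold neon
  exact measurable_dite_find
    (p := fun ω τ => IsArgmin (residual (batch f (S ω)) (y ω))
      (neonIter (batch f (S ω)) (y ω) p.η (u ω)) p.U (p.t + 1) τ ∧
        residual (batch f (S ω)) (y ω) (neonIter (batch f (S ω)) (y ω) p.η (u ω) τ) ≤
          -(2.5 * p.𝓕))
    (F := fun ω => neonIter (batch f (S ω)) (y ω) p.η (u ω)) (H := fun _ => 0)
    (fun τ => measurableSet_and (measurableSet_isArgmin
      (h := fun ω => residual (batch f (S ω)) (y ω))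
      (u := fun ω => neonIter (batch f (S ω)) (y ω) p.η (u ω)) p.U (p.t + 1) τ h1 h2)
        (measurableSet_le (h2 τ) measurable_const)) h1 measurable_const

lemma measurable_ncFind (p : Tuning) (τ : ℕ) :
    Measurable fun ω => ncFind (nagIter (batch f (S ω)) (y ω) p.η p.ζ (u ω)) p τ := by
  have h1 := measurable_nagIter hm hf hS hy hu p.η p.ζ
  unfold ncFind
  exact measurable_dite_find
    (p := fun ω j => j ≤ τ ∧ p.ζ * √(6 * p.η * p.𝓕) ≤
      ‖(nagIter (batch f (S ω)) (y ω) p.η p.ζ (u ω) j).1 -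
        (nagIter (batch f (S ω)) (y ω) p.η p.ζ (u ω) j).2‖)
    (F := fun ω j => (nagIter (batch f (S ω)) (y ω) p.η p.ζ (u ω) j).1)
    (H := fun ω => (nagIter (batch f (S ω)) (y ω) p.η p.ζ (u ω) τ).1 -
      (nagIter (batch f (S ω)) (y ω) p.η p.ζ (u ω) τ).2)
    (fun j => measurableSet_and (MeasurableSet.const _)
      (measurableSet_le measurable_const ((h1 j).fst.sub (h1 j).snd).norm))
    (fun j => (h1 j).fst) ((h1 τ).fst.sub (h1 τ).snd)

lemma measurable_neonPlus (γ : ℝ) (p : Tuning) :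
    Measurable fun ω => neonPlus (batch f (S ω)) γ p (y ω) (u ω) := by
  have h1 := measurable_nagIter hm hf hS hy hu p.η p.ζ
  have h2 := fun τ => measurable_residual_comp hm hf hS hy (h1 τ).fst
  have h3 := fun τ => measurable_residual_comp hm hf hS hy (h1 τ).snd
  have h4 := fun τ => measurable_residualGrad_comp hm hf hS hy (h1 τ).snd
  classical
  unfold neonPlus
  refine measurable_dite_find
    (p := fun ω τ => τ ≤ p.t ∧
      NCTest (batch f (S ω)) (y ω) γ (nagIter (batch f (S ω)) (y ω) p.η p.ζ (u ω) τ))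
    (H := fun ω => if h : ∃ τ, IsArgmin (residual (batch f (S ω)) (y ω))
        (fun σ => (nagIter (batch f (S ω)) (y ω) p.η p.ζ (u ω) σ).1) p.U (p.t + 1) τ ∧
          residual (batch f (S ω)) (y ω) (nagIter (batch f (S ω)) (y ω) p.η p.ζ (u ω) τ).1 ≤
            -(2 * p.𝓕)
      then (nagIter (batch f (S ω)) (y ω) p.η p.ζ (u ω) (Nat.find h)).1 else 0)
    (F := fun ω τ => ncFind (nagIter (batch f (S ω)) (y ω) p.η p.ζ (u ω)) p τ)
    (fun τ => measurableSet_and (MeasurableSet.const _) (measurableSet_lt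
      (((h2 τ).sub (h3 τ)).sub ((h4 τ).inner ((h1 τ).fst.sub (h1 τ).snd)))
      ((((h1 τ).fst.sub (h1 τ).snd).norm.pow_const 2).const_mul _)))
    (fun τ => measurable_ncFind hm hf hS hy hu p τ) ?_
  exact measurable_dite_find
    (p := fun ω τ => IsArgmin (residual (batch f (S ω)) (y ω))
      (fun σ => (nagIter (batch f (S ω)) (y ω) p.η p.ζ (u ω) σ).1) p.U (p.t + 1) τ ∧
        residual (batch f (S ω)) (y ω) (nagIter (batch f (S ω)) (y ω) p.η p.ζ (u ω) τ).1 ≤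
          -(2 * p.𝓕))
    (F := fun ω σ => (nagIter (batch f (S ω)) (y ω) p.η p.ζ (u ω) σ).1) (H := fun _ => 0)
    (fun τ => measurableSet_and (measurableSet_isArgmin
      (h := fun ω => residual (batch f (S ω)) (y ω))
      (u := fun ω σ => (nagIter (batch f (S ω)) (y ω) p.η p.ζ (u ω) σ).1) p.U (p.t + 1) τ
        (fun σ => (h1 σ).fst) h2)
        (measurableSet_le (h2 τ) measurable_const)) (fun σ => (h1 σ).fst) measurable_const

lemma measurable_negCurv (I : Input) (p : Tuning) :
    Measurable fun ω => negCurv (batch f (S ω)) I p (y ω) (u ω) := by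
  unfold negCurv
  cases I.kind
  · exact measurable_neon hm hf hS hy hu p
  · exact measurable_neonPlus hm hf hS hy hu I.γ p

end NegCurv

lemma measurable_curvatureVector (I : Input) (p : Tuning) :
    Measurable fun q : NeonSeed Ξ d p.m₂ × E d => curvatureVector f I p q.1 q.2 :=
  measurable_negCurv hm hf (S := fun q : NeonSeed Ξ d p.m₂ × E d => q.1.1)
    (y := fun q => q.2) (u := fun q => p.r • q.1.2.1) (by fun_prop) (by fun_prop) (by fun_prop) I p

lemma measurable_escape (I : Input) (p : Tuning) :
    Measurable fun q : NeonSeed Ξ d p.m₂ × E d => escape f I p q.1 q.2 := by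
  classical
  have h1 := measurable_curvatureVector hm hf I p
  have h2 : Measurable fun q : NeonSeed Ξ d p.m₂ × E d => sign q.1.2.2 :=
    (measurable_from_top (f := sign)).comp (by fun_prop)
  unfold escape
  refine Measurable.ite (measurableSet_eq_fun h1 measurable_const) measurable_snd ?_
  exact measurable_snd.sub
    ((((h2.const_mul _).div_const _).div h1.norm).smul h1)

lemma measurableSet_firstOrderMet (I : Input) (p : Tuning) :
    MeasurableSet {q : Seed Ξ d I.b p × E d | FirstOrderMet f I p q.1 q.2} := by
  have h1 : Measurable fun q : Seed Ξ d I.b p × E d => scsgEpoch f I q.1.1 q.2 :=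
    (measurable_scsgEpoch hm hf I p.m₁).comp
      (by fun_prop : Measurable fun q : Seed Ξ d I.b p × E d => (q.1.1, q.2))
  have h2 : Measurable fun q : Seed Ξ d I.b p × E d => q.1.2.1 := by fun_prop
  exact measurableSet_le
    ((measurable_gradient_batch hm hf p.mc).comp (h2.prodMk h1)).norm measurable_const

lemma measurable_iteration (I : Input) (p : Tuning) :
    Measurable fun q : Seed Ξ d I.b p × E d => iteration f I p q.1 q.2 := by
  classical
  have h1 : Measurable fun q : Seed Ξ d I.b p × E d => scsgEpoch f I q.1.1 q.2 :=
    (measurable_scsgEpoch hm hf I p.m₁).comp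
      (by fun_prop : Measurable fun q : Seed Ξ d I.b p × E d => (q.1.1, q.2))
  have h2 : Measurable fun q : Seed Ξ d I.b p × E d => q.1.2.2 := by fun_prop
  have h3 := (measurable_curvatureVector hm hf I p).comp (h2.prodMk h1)
  have h4 := (measurable_escape hm hf I p).comp (h2.prodMk h1)
  unfold iteration
  refine Measurable.ite (measurableSet_firstOrderMet hm hf I p) ?_ (h1.prodMk measurable_const)
  exact Measurable.ite (measurableSet_eq_fun h3 measurable_const) (h1.prodMk measurable_const)
    (h4.prodMk measurable_const)

end Algorithm

end NeonSCSG

end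

noncomputable section

namespace NeonSCSG

variable {d : ℕ} {Ξ : Type*}

/-! ### The SCSG epoch -/

section Quadratic

variable [MeasurableSpace Ξ] {P : Measure Ξ} [IsProbabilityMeasure P]

/-- The expectation of a quadratic function of an average of centred i.i.d. vectors. -/
lemma lintegral_quadratic_average_le {X : Ξ → E d} (hXm : Measurable X)
    (hX2 : Integrable (fun ξ => ‖X ξ‖ ^ 2) P) (hX1 : Integrable X P) (hX0 : ∫ ξ, X ξ ∂P = 0)
    {v : ℝ} (hXv : ∫ ξ, ‖X ξ‖ ^ 2 ∂P ≤ v) {A B : ℝ} {q : E d} (hB : 0 ≤ B)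
    (hnonneg : ∀ w : E d, 0 ≤ A + inner ℝ q w + B * ‖w‖ ^ 2) {m : ℕ} (hm : 0 < m) :
    ∫⁻ S, ENNReal.ofReal (A + inner ℝ q ((1 / (m : ℝ)) • ∑ i, X (S i)) +
        B * ‖(1 / (m : ℝ)) • ∑ i, X (S i)‖ ^ 2) ∂(Measure.pi fun _ : Fin m => P) ≤
      ENNReal.ofReal (A + B * (v / m)) := by
  have hm' : (0 : ℝ) < m := by exact_mod_cast hm
  have hv : 0 ≤ v := (integral_nonneg fun ξ => by positivity).trans hXv
  set B' := B / (m : ℝ) ^ 2 with hB'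
  have hB'0 : 0 ≤ B' := by positivity
  set q' : E d := (1 / (m : ℝ)) • q with hq'
  have e1 : ∀ w : E d, A + inner ℝ q ((1 / (m : ℝ)) • w) + B * ‖(1 / (m : ℝ)) • w‖ ^ 2 =
      A + inner ℝ q' w + B' * ‖w‖ ^ 2 := fun w => by
    rw [inner_smul_right, hq', real_inner_smul_left, norm_smul, mul_pow,
      Real.norm_of_nonneg (by positivity), hB']
    ring
  simp_rw [e1]
  have hnonneg' : ∀ w : E d, 0 ≤ A + inner ℝ q' w + B' * ‖w‖ ^ 2 := fun w => by
    rw [← e1]; exact hnonneg _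
  have key := lintegral_pi_sum_le (P := P) (X := X)
    -- The summand k (B' v) stands for the second moments of the samples still to come.
    -- Nonnegativity of the quadratic for all arguments makes the Lebesgue integral agree with the
    -- real one.
    (Φ := fun k Y => ENNReal.ofReal (A + inner ℝ q' Y + B' * ‖Y‖ ^ 2 + k * (B' * v)))
    (C := fun _ => True) (fun _ _ _ => trivial) (fun m Y => by fun_prop) (fun k Y _ => ?_)
    m 0 trivial
  · simp only [zero_add, Nat.cast_zero, zero_mul, add_zero, inner_zero_right, norm_zero] at key
    refine key.trans (le_of_eq ?_)
    congr 1
    rw [hB']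
    field_simp
    ring
  · have e : ∀ ξ, A + inner ℝ q' (Y + X ξ) + B' * ‖Y + X ξ‖ ^ 2 + k * (B' * v) =
        (A + inner ℝ q' Y + B' * ‖Y‖ ^ 2 + k * (B' * v)) + inner ℝ (q' + (2 * B') • Y) (X ξ) +
          B' * ‖X ξ‖ ^ 2 := fun ξ => by
      rw [norm_add_sq_real, inner_add_right, inner_add_left, real_inner_smul_left Y]; ring
    have i1 : Integrable (fun ξ => inner ℝ (q' + (2 * B') • Y) (X ξ)) P := hX1.const_inner _
    have i2 : Integrable (fun ξ => (A + inner ℝ q' Y + B' * ‖Y‖ ^ 2 + k * (B' * v)) +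
        inner ℝ (q' + (2 * B') • Y) (X ξ)) P := (integrable_const _).add i1
    have i3 : Integrable (fun ξ => B' * ‖X ξ‖ ^ 2) P := hX2.const_mul _
    have i4 := i2.add i3
    have hnn : ∀ ξ, 0 ≤ (A + inner ℝ q' Y + B' * ‖Y‖ ^ 2 + k * (B' * v)) +
        inner ℝ (q' + (2 * B') • Y) (X ξ) + B' * ‖X ξ‖ ^ 2 := fun ξ => by
      rw [← e]
      have := hnonneg' (Y + X ξ)
      positivity
    simp_rw [e]
    rw [← ofReal_integral_eq_lintegral_ofReal (by exact i4)
      (Filter.Eventually.of_forall fun ξ => hnn ξ)]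
    refine ENNReal.ofReal_le_ofReal ?_
    rw [integral_add i2 i3, integral_add (integrable_const _) i1, integral_const_mul,
      integral_inner hX1, hX0, integral_const]
    simp only [probReal_univ, one_smul, inner_zero_right, add_zero]
    push_cast
    nlinarith [mul_le_mul_of_nonneg_left hXv hB'0]

end Quadratic

/-- The step of the Lyapunov function `H + c ‖· - x‖²` along a perturbed gradient step. -/
lemma lyapunov_step {L η c w κ b : ℝ} (hL : 0 < L) (hw : 0 < w) (hw1 : w ≤ 1) {c' : ℝ}
    (hc' : 0 < c') (hc'6 : c' ≤ 1 / 6) (hη : η = c' * w ^ 2 / L) (hc : c = L * w / 2)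
    (hκ : κ = w ^ 3) (hb : 1 ≤ b) (g e δ : E d) (H : ℝ) :
    H - η * inner ℝ g (g + e) + L / 2 * η ^ 2 * ‖g + e‖ ^ 2 + c * ‖δ - η • (g + e)‖ ^ 2 +
        (L / 2 * η ^ 2 + c * η ^ 2) * (L ^ 2 * ‖δ‖ ^ 2 / b) + η / 2 * ‖g‖ ^ 2 ≤
      H + (1 + κ) * c * ‖δ‖ ^ 2 + η / 2 * ‖e‖ ^ 2 := by
  have hη0 : 0 < η := by rw [hη]; positivity
  have hc0 : 0 < c := by rw [hc]; positivity
  have hLη : L * η = c' * w ^ 2 := by rw [hη]; field_simp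
  set μ : E d := g + e with hμ
  -- Polarisation turns -η⟨g, μ⟩ into -(η/2)(‖g‖² + ‖μ‖² - ‖e‖²). The first term is the gradient
  -- decrease to be kept; the second is the budget for all error terms in ‖μ‖².
  have h1 : inner ℝ g μ = (‖g‖ ^ 2 + ‖μ‖ ^ 2 - ‖e‖ ^ 2) / 2 := by
    have : e = μ - g := by rw [hμ]; abel
    rw [this, norm_sub_sq_real, real_inner_comm]; ring
  -- Young's inequality with weight 3Lw: since c = Lw/2, its ‖μ‖² part costs exactly η/6, and
  -- together with cη² it stays below η/4.
  have h2 : ‖δ - η • μ‖ ^ 2 ≤ (1 + η * (3 * L * w)) * ‖δ‖ ^ 2 +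
      (η / (3 * L * w) + η ^ 2) * ‖μ‖ ^ 2 := by
    have hβ : 0 < 3 * L * w := by positivity
    rw [norm_sub_sq_real, norm_smul, mul_pow, Real.norm_of_nonneg hη0.le, inner_smul_right]
    have h3 : -(2 * inner ℝ δ μ) ≤ 3 * L * w * ‖δ‖ ^ 2 + 1 / (3 * L * w) * ‖μ‖ ^ 2 := by
      have h4 := abs_real_inner_le_norm δ μ
      have h5 := neg_abs_le (inner ℝ δ μ)
      have h6 : 0 ≤ 1 / (3 * L * w) * (3 * L * w * ‖δ‖ - ‖μ‖) ^ 2 := by positivity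
      have h7 : 1 / (3 * L * w) * (3 * L * w * ‖δ‖ - ‖μ‖) ^ 2 =
          3 * L * w * ‖δ‖ ^ 2 - 2 * (‖δ‖ * ‖μ‖) + 1 / (3 * L * w) * ‖μ‖ ^ 2 := by
        field_simp; ring
      linarith
    have h8 := mul_le_mul_of_nonneg_left h3 hη0.le
    have h9 : η * (3 * L * w * ‖δ‖ ^ 2 + 1 / (3 * L * w) * ‖μ‖ ^ 2) =
        η * (3 * L * w) * ‖δ‖ ^ 2 + η / (3 * L * w) * ‖μ‖ ^ 2 := by ring
    linarith
  have hw2 : w ^ 2 ≤ 1 := pow_le_one₀ hw.le hw1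
  have hLη6 : L * η ≤ 1 / 6 := by
    rw [hLη]
    calc c' * w ^ 2 ≤ 1 / 6 * 1 := by gcongr
      _ = 1 / 6 := by norm_num
  have hcη : c * η ≤ 1 / 12 := by
    have : c * η = w * (L * η) / 2 := by rw [hc]; ring
    rw [this]
    have : w * (L * η) ≤ 1 * (1 / 6) := by gcongr
    linarith
  have hcμ : c * (η / (3 * L * w) + η ^ 2) ≤ η / 4 := by
    have e1 : c * (η / (3 * L * w)) = η / 6 := by rw [hc]; field_simp; norm_num
    have e2 : c * η ^ 2 = c * η * η := by ring
    have := mul_le_mul_of_nonneg_right hcη hη0.le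
    rw [mul_add, e1, e2]
    linarith
  have hLμ : L / 2 * η ^ 2 ≤ η / 12 := by
    have := mul_le_mul_of_nonneg_right hLη6 hη0.le
    have e2 : L / 2 * η ^ 2 = L * η * η / 2 := by ring
    linarith
  -- The drift of ‖δ‖² comes from Young's inequality and from the mini-batch variance. Each takes at
  -- most κc/2; for the first this is where c' ≤ 1/6 is sharp.
  have hδ : c * (1 + η * (3 * L * w)) + (L / 2 * η ^ 2 + c * η ^ 2) * L ^ 2 / b ≤ (1 + κ) * c := by
    have e1 : c * (η * (3 * L * w)) ≤ κ * c / 2 := by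
      have : η * (3 * L * w) = 3 * c' * w ^ 3 := by linear_combination 3 * w * hLη
      rw [this, hκ]
      have := mul_le_mul_of_nonneg_right hc'6 (mul_pos (pow_pos hw 3) hc0).le
      linarith
    have e2 : (L / 2 * η ^ 2 + c * η ^ 2) * L ^ 2 / b ≤ κ * c / 2 := by
      refine (div_le_self (by positivity) hb).trans ?_
      have e3 : (L / 2 * η ^ 2 + c * η ^ 2) * L ^ 2 = L * (1 + w) / 2 * (c' ^ 2 * w ^ 4) := by
        rw [hc]; linear_combination (L * (1 + w) / 2) * (L * η + c' * w ^ 2) * hLη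
      rw [e3, hκ, hc]
      have e4 : c' ^ 2 ≤ (1 / 6) ^ 2 := by gcongr
      have e5 : L * (1 + w) / 2 ≤ L * (1 + 1) / 2 := by gcongr
      calc L * (1 + w) / 2 * (c' ^ 2 * w ^ 4) ≤ L * (1 + 1) / 2 * ((1 / 6) ^ 2 * w ^ 4) := by gcongr
        _ = (L * w ^ 4) / 36 := by ring
        _ ≤ (L * w ^ 4) / 4 := by gcongr; norm_num
        _ = w ^ 3 * (L * w / 2) / 2 := by ring
    linarith
  have hs1 := mul_le_mul_of_nonneg_left h2 hc0.le
  have hs2 := mul_le_mul_of_nonneg_right hcμ (sq_nonneg ‖μ‖)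
  have hs3 := mul_le_mul_of_nonneg_right hLμ (sq_nonneg ‖μ‖)
  have hs4 := mul_le_mul_of_nonneg_right hδ (sq_nonneg ‖δ‖)
  have hs5 : 0 ≤ η * ‖μ‖ ^ 2 := by positivity
  have e6 : (L / 2 * η ^ 2 + c * η ^ 2) * (L ^ 2 * ‖δ‖ ^ 2 / b) =
      (L / 2 * η ^ 2 + c * η ^ 2) * L ^ 2 / b * ‖δ‖ ^ 2 := by ring
  rw [h1, e6]
  linarith

/-! ### Summation against the geometric law -/

section Geometric

lemma stopProb_ne_zero {m b : ℕ} (hb : 0 < b) : stopProb m b ≠ 0 := by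
  intro h
  have h1 := congrArg Subtype.val h
  have hb' : (0 : ℝ) < b := by exact_mod_cast hb
  have : (0 : ℝ) < (b : ℝ) / ((m : ℝ) + b) := by positivity
  exact this.ne' h1

lemma lintegral_geometricMeasure {p : unitInterval} (hp : p ≠ 0) (F : ℕ → ℝ≥0∞) :
    ∫⁻ n, F n ∂(geometricMeasure p) =
      ∑' n, ENNReal.ofReal ((1 - (p : ℝ)) ^ n * (p : ℝ)) * F n := by
  rw [lintegral_countable']
  refine tsum_congr fun n => ?_
  rw [geometricMeasure_singleton hp, mul_comm]

/-- A recursion summed against a geometric law. -/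
lemma lintegral_geometric_recursion {m b : ℕ} (hb : 0 < b) (hm : 0 < m) {a q N : ℕ → ℝ≥0∞}
    {e : ℝ≥0∞}
    (h : ∀ k, a (k + 1) + q (k + 1) + N k ≤
      a k + ENNReal.ofReal (1 + (b : ℝ) / m) * q k + e) :
    ∫⁻ n, (a n + ENNReal.ofReal ((m : ℝ) / b) * N n) ∂(geometricMeasure (stopProb m b)) ≤
      a 0 + q 0 + ENNReal.ofReal ((m : ℝ) / b) * e := by
  have hb' : (0 : ℝ) < b := by exact_mod_cast hb
  have hm' : (0 : ℝ) < m := by exact_mod_cast hm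
  set p : ℝ := (b : ℝ) / ((m : ℝ) + b) with hp
  set ρ : ℝ := (m : ℝ) / ((m : ℝ) + b) with hρ
  have hp0 : 0 < p := by positivity
  have hρ0 : 0 < ρ := by positivity
  have hpρ : p + ρ = 1 := by rw [hp, hρ]; field_simp; ring
  have hval : ((stopProb m b : unitInterval) : ℝ) = p := rfl
  rw [lintegral_geometricMeasure (stopProb_ne_zero hb), hval, show 1 - p = ρ by linarith]
  have hw : ∀ n, ENNReal.ofReal (ρ ^ n * p) * (a n + ENNReal.ofReal ((m : ℝ) / b) * N n) =
      ENNReal.ofReal (ρ ^ n * p) * a n + ENNReal.ofReal (ρ ^ (n + 1)) * N n := fun n => by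
    rw [mul_add, ← mul_assoc, ← ENNReal.ofReal_mul (by positivity)]
    congr 3
    rw [pow_succ, mul_assoc]
    congr 1
    rw [hp, hρ]
    field_simp
  simp_rw [hw]
  -- The inequality for step k is multiplied by ρ^(k+1). As ρ (1 + b/m) = 1, the q-terms telescope,
  -- and as ρ^k p + ρ^(k+1) = ρ^k, the a-terms leave exactly the geometric weights.
  have hinv : ∀ K, ∑ n ∈ Finset.range K, (ENNReal.ofReal (ρ ^ n * p) * a n +
      ENNReal.ofReal (ρ ^ (n + 1)) * N n) + ENNReal.ofReal (ρ ^ K) * (a K + q K) ≤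
      a 0 + q 0 + (∑ n ∈ Finset.range K, ENNReal.ofReal (ρ ^ (n + 1))) * e := by
    intro K
    induction K with
    | zero => simp
    | succ K ih =>
      rw [Finset.sum_range_succ, Finset.sum_range_succ, add_mul, ← add_assoc (a 0 + q 0)]
      have h1 := mul_le_mul_right (h K) (ENNReal.ofReal (ρ ^ (K + 1)))
      have e1 : ENNReal.ofReal (ρ ^ (K + 1)) * ENNReal.ofReal (1 + (b : ℝ) / m) =
          ENNReal.ofReal (ρ ^ K) := by
        rw [← ENNReal.ofReal_mul (by positivity)]
        congr 1
        rw [pow_succ, hρ]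
        field_simp
      have e2 : ENNReal.ofReal (ρ ^ K * p) + ENNReal.ofReal (ρ ^ (K + 1)) =
          ENNReal.ofReal (ρ ^ K) := by
        rw [← ENNReal.ofReal_add (by positivity) (by positivity)]
        congr 1
        rw [pow_succ, ← mul_add, hpρ, mul_one]
      rw [mul_add, mul_add, mul_add, mul_add, ← mul_assoc, e1] at h1
      calc _ = ∑ n ∈ Finset.range K, (ENNReal.ofReal (ρ ^ n * p) * a n +
            ENNReal.ofReal (ρ ^ (n + 1)) * N n) + ENNReal.ofReal (ρ ^ K * p) * a K +
            (ENNReal.ofReal (ρ ^ (K + 1)) * a (K + 1) + ENNReal.ofReal (ρ ^ (K + 1)) * q (K + 1) +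
              ENNReal.ofReal (ρ ^ (K + 1)) * N K) := by ring
        _ ≤ ∑ n ∈ Finset.range K, (ENNReal.ofReal (ρ ^ n * p) * a n +
            ENNReal.ofReal (ρ ^ (n + 1)) * N n) + ENNReal.ofReal (ρ ^ K * p) * a K +
            (ENNReal.ofReal (ρ ^ (K + 1)) * a K + ENNReal.ofReal (ρ ^ K) * q K +
              ENNReal.ofReal (ρ ^ (K + 1)) * e) := by gcongr
        _ = (∑ n ∈ Finset.range K, (ENNReal.ofReal (ρ ^ n * p) * a n +
            ENNReal.ofReal (ρ ^ (n + 1)) * N n) +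
            ((ENNReal.ofReal (ρ ^ K * p) + ENNReal.ofReal (ρ ^ (K + 1))) * a K +
              ENNReal.ofReal (ρ ^ K) * q K)) + ENNReal.ofReal (ρ ^ (K + 1)) * e := by ring
        _ ≤ _ := by
          rw [e2, ← mul_add]
          gcongr
  refine ENNReal.tsum_le_of_sum_range_le fun K => ?_
  refine (le_self_add.trans (hinv K)).trans ?_
  gcongr
  rw [← ENNReal.ofReal_sum_of_nonneg fun n _ => by positivity]
  refine ENNReal.ofReal_le_ofReal ?_
  have hρ1 : ρ < 1 := by linarith
  have h1 := (summable_geometric_of_lt_one hρ0.le hρ1).sum_le_tsum (Finset.range K)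
    fun n _ => by positivity
  rw [tsum_geometric_of_lt_one hρ0.le hρ1] at h1
  simp_rw [pow_succ']
  rw [← Finset.mul_sum]
  calc ρ * ∑ n ∈ Finset.range K, ρ ^ n ≤ ρ * (1 - ρ)⁻¹ := by gcongr
    _ = (m : ℝ) / b := by
      rw [show 1 - ρ = p by linarith, hp, hρ]
      field_simp

/-- The recursion lemma applied to a n = n, which increases by e = 1 in every step. -/
lemma lintegral_geometricMeasure_natCast {m b : ℕ} (hb : 0 < b) (hm : 0 < m) :
    ∫⁻ n, (n : ℝ≥0∞) ∂(geometricMeasure (stopProb m b)) ≤ ENNReal.ofReal ((m : ℝ) / b) := by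
  have hb' : (0 : ℝ) < b := by exact_mod_cast hb
  have hm' : (0 : ℝ) < m := by exact_mod_cast hm
  have key := lintegral_geometric_recursion (a := fun n => (n : ℝ≥0∞)) (q := 0) (N := 0) (e := 1)
    hb hm fun k => by simp
  simpa using key

end Geometric

end NeonSCSG

end

/-! ### Descent inequality and cost of one SCSG epoch -/

noncomputable section

namespace NeonSCSG

variable {d : ℕ} {Ξ : Type*}

section Epoch

variable [MeasurableSpace Ξ] {P : Measure Ξ} [IsProbabilityMeasure P] {f : E d → Ξ → ℝ}
  {x₁ : E d}

namespace Assumptions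

section Step

variable {L₁ L₂ G V Δ : ℝ} (h : Assumptions P f x₁ L₁ L₂ G V Δ)
include h

/-- Centring does not increase the second moment: with M the mean difference, ‖X + M‖ ≤ L₁‖z - x‖
pointwise, and the cross term of the expanded square integrates to zero. This is the variance
reduction of SCSG. -/
lemma integral_norm_noise_sub_sq_le (x z : E d) :
    ∫ ξ, ‖(gradient (fun y => f y ξ) z - gradient (objective P f) z) -
      (gradient (fun y => f y ξ) x - gradient (objective P f) x)‖ ^ 2 ∂P ≤
      L₁ ^ 2 * ‖z - x‖ ^ 2 := by
  set X : Ξ → E d := fun ξ => (gradient (fun y => f y ξ) z - gradient (objective P f) z) -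
      (gradient (fun y => f y ξ) x - gradient (objective P f) x) with hX
  set M : E d := gradient (objective P f) z - gradient (objective P f) x with hM
  have hX2 : MemLp X 2 P := (h.memLp_noise z).sub (h.memLp_noise x)
  have hX1 : Integrable X P := hX2.integrable (by norm_num)
  have hX0 : ∫ ξ, X ξ ∂P = 0 := by
    rw [integral_sub ((h.memLp_noise z).integrable (by norm_num))
      ((h.memLp_noise x).integrable (by norm_num)), h.integral_noise, h.integral_noise, sub_zero]
  have hpt : ∀ ξ, ‖X ξ‖ ^ 2 ≤ L₁ ^ 2 * ‖z - x‖ ^ 2 + inner ℝ ((-2 : ℝ) • M) (X ξ) := fun ξ => by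
    have e1 : gradient (fun y => f y ξ) z - gradient (fun y => f y ξ) x = X ξ + M := by
      simp only [hX, hM]; abel
    have h1 := h.lipschitz_gradient ξ z x
    rw [e1] at h1
    have h2 : ‖X ξ + M‖ ^ 2 ≤ (L₁ * ‖z - x‖) ^ 2 := pow_le_pow_left₀ (norm_nonneg _) h1 2
    rw [norm_add_sq_real, mul_pow] at h2
    rw [real_inner_smul_left, real_inner_comm]
    nlinarith [sq_nonneg ‖M‖]
  refine (integral_mono (hX2.integrable_norm_pow (by norm_num))
    (by exact (integrable_const _).add (hX1.const_inner _)) hpt).trans ?_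
  rw [integral_add (integrable_const _) (hX1.const_inner _), integral_inner hX1, hX0]
  simp

/-- One inner update in expectation over its mini-batch. Given z, the value of the Lyapunov function
after the update is at most a quadratic polynomial in the averaged noise W, so only the mean and
variance of W enter; `lyapunov_step` then balances the terms. The error e of the anchor gradient
stays fixed throughout the epoch. -/
lemma epoch_step {c' w η c κ Fs : ℝ} (hL₁ : 0 < L₁) (hw : 0 < w) (hw1 : w ≤ 1) (hc' : 0 < c')
    (hc'6 : c' ≤ 1 / 6) (hη : η = c' * w ^ 2 / L₁) (hc : c = L₁ * w / 2) (hκ : κ = w ^ 3)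
    (hFs : ∀ z, Fs ≤ objective P f z) {b : ℕ} (hb : 0 < b) (x z g₁ : E d) :
    ∫⁻ B, ENNReal.ofReal
        (objective P f (z - η • (gradient (batch f B) z - gradient (batch f B) x + g₁)) - Fs +
          c * ‖z - η • (gradient (batch f B) z - gradient (batch f B) x + g₁) - x‖ ^ 2)
        ∂(Measure.pi fun _ : Fin b => P) +
      ENNReal.ofReal (η / 2 * ‖gradient (objective P f) z‖ ^ 2) ≤
    ENNReal.ofReal (objective P f z - Fs) + ENNReal.ofReal (1 + κ) *
      ENNReal.ofReal (c * ‖z - x‖ ^ 2) +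
      ENNReal.ofReal (η / 2 * ‖g₁ - gradient (objective P f) x‖ ^ 2) := by
  have hη0 : 0 < η := by rw [hη]; positivity
  have hc0 : 0 < c := by rw [hc]; positivity
  have hκ0 : 0 < κ := by rw [hκ]; positivity
  have hb1 : (1 : ℝ) ≤ b := by exact_mod_cast hb
  set F := objective P f with hF
  set g := gradient F z with hg
  set e := g₁ - gradient F x with he
  set δ := z - x with hδ
  set X : Ξ → E d := fun ξ => (gradient (fun y => f y ξ) z - gradient F z) -
      (gradient (fun y => f y ξ) x - gradient F x) with hX
  have hX2 : MemLp X 2 P := (h.memLp_noise z).sub (h.memLp_noise x)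
  have hX1 : Integrable X P := hX2.integrable (by norm_num)
  have hX0 : ∫ ξ, X ξ ∂P = 0 := by
    rw [integral_sub ((h.memLp_noise z).integrable (by norm_num))
      ((h.memLp_noise x).integrable (by norm_num)), h.integral_noise, h.integral_noise, sub_zero]
  have hXm : Measurable X := ((h.measurable_gradient z).sub_const _).sub
    ((h.measurable_gradient x).sub_const _)
  set A := F z - Fs - η * inner ℝ g (g + e) + L₁ / 2 * η ^ 2 * ‖g + e‖ ^ 2 +
    c * ‖δ - η • (g + e)‖ ^ 2 with hA
  set q : E d := (-η) • g + (L₁ * η ^ 2) • (g + e) - (2 * c * η) • (δ - η • (g + e)) with hq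
  set D := L₁ / 2 * η ^ 2 + c * η ^ 2 with hD
  have hquad : ∀ W : E d, F (z - η • (g + e + W)) - Fs + c * ‖z - η • (g + e + W) - x‖ ^ 2 ≤
      A + inner ℝ q W + D * ‖W‖ ^ 2 := fun W => by
    have h1 := (abs_le.mp (h.isSmooth_objective.abs_taylor_one z (-(η • (g + e + W))))).2
    rw [← sub_eq_add_neg, norm_neg, inner_neg_right, inner_smul_right, norm_smul, mul_pow,
      Real.norm_of_nonneg hη0.le] at h1
    have h2 : z - η • (g + e + W) - x = (δ - η • (g + e)) - η • W := by
      rw [hδ, smul_add]; abel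
    have h3 : ‖g + e + W‖ ^ 2 = ‖g + e‖ ^ 2 + 2 * inner ℝ (g + e) W + ‖W‖ ^ 2 :=
      norm_add_sq_real _ _
    have h4 : ‖(δ - η • (g + e)) - η • W‖ ^ 2 = ‖δ - η • (g + e)‖ ^ 2 -
        2 * (η * inner ℝ (δ - η • (g + e)) W) + η ^ 2 * ‖W‖ ^ 2 := by
      rw [norm_sub_sq_real, inner_smul_right, norm_smul, mul_pow, Real.norm_of_nonneg hη0.le]
    have h5 : inner ℝ g (g + e + W) = inner ℝ g (g + e) + inner ℝ g W := inner_add_right _ _ _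
    have h6 : inner ℝ q W = -η * inner ℝ g W + L₁ * η ^ 2 * inner ℝ (g + e) W -
        2 * c * η * inner ℝ (δ - η • (g + e)) W := by
      rw [hq, inner_sub_left, inner_add_left, real_inner_smul_left, real_inner_smul_left,
        real_inner_smul_left]
    rw [h2, h4, h6, hA, hD]
    rw [h3, h5] at h1
    linarith
  have hnn : ∀ W : E d, 0 ≤ A + inner ℝ q W + D * ‖W‖ ^ 2 := fun W => by
    refine le_trans ?_ (hquad W)
    have := hFs (z - η • (g + e + W))
    have : 0 ≤ F (z - η • (g + e + W)) - Fs := by linarith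
    positivity
  have hv : ∀ B : Fin b → Ξ, gradient (batch f B) z - gradient (batch f B) x + g₁ =
      g + e + (1 / (b : ℝ)) • ∑ i, X (B i) := fun B => by
    have h1 := h.gradient_batch_sub hb B z
    have h2 := h.gradient_batch_sub hb B x
    have h3 : (1 / (b : ℝ)) • ∑ i, X (B i) = (gradient (batch f B) z - gradient F z) -
        (gradient (batch f B) x - gradient F x) := by
      rw [h1, h2, ← smul_sub, ← Finset.sum_sub_distrib]
    rw [h3, he, hg]
    abel
  have key := lintegral_quadratic_average_le hXm (hX2.integrable_norm_pow (by norm_num)) hX1 hX0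
    (h.integral_norm_noise_sub_sq_le x z) (A := A) (B := D) (q := q) (by positivity) hnn hb
  have hsum := lyapunov_step hL₁ hw hw1 hc' hc'6 hη hc hκ hb1 g e δ (F z - Fs)
  have hAD : 0 ≤ A + D * (L₁ ^ 2 * ‖δ‖ ^ 2 / b) := by
    have := hnn 0
    simp only [inner_zero_right, norm_zero, add_zero] at this
    have h2 : 0 ≤ D * (L₁ ^ 2 * ‖δ‖ ^ 2 / b) := by positivity
    norm_num at this
    linarith
  have hFz : 0 ≤ F z - Fs := by linarith [hFs z]
  calc _ ≤ ENNReal.ofReal (A + D * (L₁ ^ 2 * ‖δ‖ ^ 2 / b)) + ENNReal.ofReal (η / 2 * ‖g‖ ^ 2) := by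
        gcongr
        refine le_trans (lintegral_mono fun B => ENNReal.ofReal_le_ofReal ?_) key
        rw [hv]
        exact hquad _
    _ = ENNReal.ofReal (A + D * (L₁ ^ 2 * ‖δ‖ ^ 2 / b) + η / 2 * ‖g‖ ^ 2) :=
        (ENNReal.ofReal_add hAD (by positivity)).symm
    _ ≤ ENNReal.ofReal (F z - Fs + (1 + κ) * (c * ‖δ‖ ^ 2) + η / 2 * ‖e‖ ^ 2) := by
        refine ENNReal.ofReal_le_ofReal ?_
        rw [← mul_assoc]
        exact hsum
    _ = _ := by
        rw [ENNReal.ofReal_add (by positivity) (by positivity), ENNReal.ofReal_add hFz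
          (by positivity), ENNReal.ofReal_mul (by positivity)]

/-- The expected value of `H + A ‖∇F‖²` at the output of an epoch whose sample `S₁` is fixed. -/
lemma lintegral_epochIter_le {c' w η Fs : ℝ} (hL₁ : 0 < L₁) (hw : 0 < w) (hw1 : w ≤ 1)
    (hc' : 0 < c') (hc'6 : c' ≤ 1 / 6) (hη : η = c' * w ^ 2 / L₁)
    (hFs : ∀ z, Fs ≤ objective P f z) {m b : ℕ} (hb : 0 < b) (hm : 0 < m)
    (hκ : (b : ℝ) / m = w ^ 3) (S : Fin m → Ξ) (x : E d) :
    ∫⁻ s, ENNReal.ofReal (objective P f (epochIter f η S s.2 x s.1) - Fs +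
        (m : ℝ) / b * (η / 2) * ‖gradient (objective P f) (epochIter f η S s.2 x s.1)‖ ^ 2)
      ∂((geometricMeasure (stopProb m b)).prod
        (Measure.infinitePi fun _ : ℕ => Measure.pi fun _ : Fin b => P)) ≤
    ENNReal.ofReal (objective P f x - Fs) + ENNReal.ofReal ((m : ℝ) / b) *
      ENNReal.ofReal (η / 2 * ‖gradient (batch f S) x - gradient (objective P f) x‖ ^ 2) := by
  have hη0 : 0 < η := by rw [hη]; positivity
  have hsm := h.isSmooth_objective
  set F := objective P f with hF
  set g₁ := gradient (batch f S) x with hg₁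
  set c := L₁ * w / 2 with hc
  have hc0 : 0 < c := by rw [hc]; positivity
  let Φ : (Fin b → Ξ) → E d → E d :=
    fun B z => z - η • (gradient (batch f B) z - gradient (batch f B) x + g₁)
  set μ : Measure (Fin b → Ξ) := Measure.pi fun _ : Fin b => P with hμ
  have hΦ : Measurable (Function.uncurry Φ) := by
    have h1 := measurable_gradient_batch_comp h.measurable h.isSmooth
      (S := fun p : (Fin b → Ξ) × E d => p.1) (y := fun p => p.2) measurable_fst measurable_snd
    have h2 := measurable_gradient_batch_comp h.measurable h.isSmooth
      (S := fun p : (Fin b → Ξ) × E d => p.1) (y := fun _ => x) measurable_fst measurable_const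
    exact measurable_snd.sub (((h1.sub h2).add_const g₁).const_smul η)
  -- For fixed S₁ the inner loop is a Markov chain driven by independent mini-batches, so mini-batch
  -- k is independent of the iterate to which it is applied.
  have hchain : ∀ (ω : ℕ → Fin b → Ξ) k, epochIter f η S ω x k = chain Φ x ω k := fun ω k => by
    induction k with
    | zero => rfl
    | succ k ih => rw [epochIter, chain, ← ih]
  have hFm : Measurable F := hsm.diff.continuous.measurable
  have hgm : Measurable (gradient F) := hsm.diff_grad.continuous.measurable
  have hcm : ∀ k, Measurable fun ω : ℕ → Fin b → Ξ => chain Φ x ω k := fun k =>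
    (measurable_chain hΦ k).comp (measurable_const.prodMk measurable_id)
  set ν := Measure.infinitePi fun _ : ℕ => μ with hν
  let a : ℕ → ℝ≥0∞ := fun k => ∫⁻ ω, ENNReal.ofReal (F (chain Φ x ω k) - Fs) ∂ν
  let q : ℕ → ℝ≥0∞ := fun k => ∫⁻ ω, ENNReal.ofReal (c * ‖chain Φ x ω k - x‖ ^ 2) ∂ν
  let N : ℕ → ℝ≥0∞ := fun k => ∫⁻ ω, ENNReal.ofReal (η / 2 * ‖gradient F (chain Φ x ω k)‖ ^ 2) ∂ν
  have ham : ∀ k, Measurable fun ω : ℕ → Fin b → Ξ => ENNReal.ofReal (F (chain Φ x ω k) - Fs) :=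
    fun k => ((hFm.comp (hcm k)).sub_const _).ennreal_ofReal
  have hqm : ∀ k, Measurable fun ω : ℕ → Fin b → Ξ =>
      ENNReal.ofReal (c * ‖chain Φ x ω k - x‖ ^ 2) :=
    fun k => ((((hcm k).sub_const x).norm.pow_const 2).const_mul c).ennreal_ofReal
  have hNm : ∀ k, Measurable fun ω : ℕ → Fin b → Ξ =>
      ENNReal.ofReal (η / 2 * ‖gradient F (chain Φ x ω k)‖ ^ 2) :=
    fun k => (((hgm.comp (hcm k)).norm.pow_const 2).const_mul _).ennreal_ofReal
  have hrec : ∀ k, a (k + 1) + q (k + 1) + N k ≤ a k + ENNReal.ofReal (1 + (b : ℝ) / m) * q k +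
      ENNReal.ofReal (η / 2 * ‖g₁ - gradient F x‖ ^ 2) := by
    intro k
    have h1 : a (k + 1) + q (k + 1) = ∫⁻ ω, ∫⁻ B, ENNReal.ofReal (F (Φ B (chain Φ x ω k)) - Fs +
        c * ‖Φ B (chain Φ x ω k) - x‖ ^ 2) ∂μ ∂ν := by
      rw [← lintegral_add_left (ham (k + 1)),
        ← lintegral_chain μ hΦ (ψ := fun z B => ENNReal.ofReal (F (Φ B z) - Fs +
          c * ‖Φ B z - x‖ ^ 2)) _ x k]
      · refine lintegral_congr fun ω => ?_
        rw [ENNReal.ofReal_add (by linarith [hFs (Φ (ω k) (chain Φ x ω k))]) (by positivity)]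
        rfl
      · have h2 : Measurable fun p : E d × (Fin b → Ξ) => Φ p.2 p.1 := hΦ.comp measurable_swap
        exact (((hFm.comp h2).sub_const _).add
          (((h2.sub_const x).norm.pow_const 2).const_mul c)).ennreal_ofReal
    have h3 : ENNReal.ofReal (η / 2 * ‖g₁ - gradient F x‖ ^ 2) =
        ∫⁻ _, ENNReal.ofReal (η / 2 * ‖g₁ - gradient F x‖ ^ 2) ∂ν := by simp
    rw [h1, h3, ← lintegral_const_mul _ (hqm k), ← lintegral_add_left (ham k),
      ← lintegral_add_right _ measurable_const, ← lintegral_add_right _ (hNm k)]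
    refine lintegral_mono fun ω => ?_
    exact h.epoch_step hL₁ hw hw1 hc' hc'6 hη hc hκ hFs hb x (chain Φ x ω k) g₁
  have key := lintegral_geometric_recursion hb hm hrec
  have ha0 : a 0 = ENNReal.ofReal (F x - Fs) := by simp [a, chain]
  have hq0 : q 0 = 0 := by simp [q, chain]
  rw [ha0, hq0, add_zero] at key
  refine le_trans (le_of_eq ?_) key
  have hm0 : Measurable fun s : ℕ × (ℕ → Fin b → Ξ) => chain Φ x s.2 s.1 :=
    measurable_from_prod_countable_right fun k => hcm k
  simp_rw [hchain]
  rw [lintegral_prod _ (by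
    exact (((hFm.comp hm0).sub_const _).add
      (((hgm.comp hm0).norm.pow_const 2).const_mul _)).ennreal_ofReal.aemeasurable)]
  refine lintegral_congr fun n => ?_
  simp only [a, N]
  rw [← lintegral_const_mul _ (hNm n), ← lintegral_add_left (ham n)]
  refine lintegral_congr fun ω => ?_
  rw [ENNReal.ofReal_add (by linarith [hFs (chain Φ x ω n)]) (by positivity),
    mul_assoc, ENNReal.ofReal_mul (by positivity)]

end Step

variable {I : Input} {G V Δ : ℝ} (h : Assumptions P f x₁ I.L₁ I.L₂ G V Δ)
include h

/-- The expected value of `H + A ‖∇F‖²` at the output of an epoch. -/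
lemma lintegral_scsgEpoch_le (hL₁ : 0 < I.L₁) (hc' : 0 < I.c') (hc'6 : I.c' ≤ 1 / 6) (hV : 0 ≤ V)
    {Fs : ℝ} (hFs : ∀ z, Fs ≤ objective P f z) {m : ℕ} (hb : 0 < I.b) (hbm : I.b ≤ m) (x : E d) :
    ∫⁻ s, ENNReal.ofReal (objective P f (scsgEpoch f I s x) - Fs +
        I.c' / (2 * I.L₁) * ((m : ℝ) / I.b) ^ (1 / 3 : ℝ) *
          ‖gradient (objective P f) (scsgEpoch f I s x)‖ ^ 2) ∂(epochLaw P m I.b) ≤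
    ENNReal.ofReal (objective P f x - Fs +
      I.c' / (2 * I.L₁) * ((m : ℝ) / I.b) ^ (1 / 3 : ℝ) * (V / m)) := by
  have hm : 0 < m := hb.trans_le hbm
  have hb' : (0 : ℝ) < I.b := by exact_mod_cast hb
  have hm' : (0 : ℝ) < m := by exact_mod_cast hm
  -- With w³ = b/m the growth factor 1 + κ of the Lyapunov recursion is the 1 + b/m that the
  -- geometric law absorbs, and w² is the power (m/b)^(-2/3) in the step size.
  set w : ℝ := ((I.b : ℝ) / m) ^ (1 / 3 : ℝ) with hw_def
  have hw : 0 < w := by positivity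
  have hw1 : w ≤ 1 := Real.rpow_le_one (by positivity)
    (div_le_one_of_le₀ (by exact_mod_cast hbm) hm'.le) (by norm_num)
  have hκ : (I.b : ℝ) / m = w ^ 3 := by
    rw [hw_def, ← Real.rpow_natCast, ← Real.rpow_mul (by positivity)]; norm_num
  have hη : I.c' / I.L₁ * ((m : ℝ) / I.b) ^ (-(2 / 3) : ℝ) = I.c' * w ^ 2 / I.L₁ := by
    have : ((m : ℝ) / I.b) ^ (-(2 / 3) : ℝ) = w ^ 2 := by
      rw [Real.rpow_neg (by positivity), ← Real.inv_rpow (by positivity), inv_div, hw_def,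
        ← Real.rpow_natCast, ← Real.rpow_mul (by positivity)]
      norm_num
    rw [this]; ring
  have hA : (m : ℝ) / I.b * (I.c' / I.L₁ * ((m : ℝ) / I.b) ^ (-(2 / 3) : ℝ) / 2) =
      I.c' / (2 * I.L₁) * ((m : ℝ) / I.b) ^ (1 / 3 : ℝ) := by
    have : ((m : ℝ) / I.b) * ((m : ℝ) / I.b) ^ (-(2 / 3) : ℝ) = ((m : ℝ) / I.b) ^ (1 / 3 : ℝ) := by
      rw [← Real.rpow_one_add' (by positivity) (by norm_num)]
      norm_num
    rw [← this]
    field_simp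
  have hmeas := measurable_scsgEpoch h.measurable h.isSmooth I m
  have hmx : Measurable fun s : EpochSeed Ξ m I.b => scsgEpoch f I s x :=
    hmeas.comp (measurable_id.prodMk measurable_const)
  have hFm : Measurable (objective P f) := h.isSmooth_objective.diff.continuous.measurable
  have hgm : Measurable (gradient (objective P f)) :=
    h.isSmooth_objective.diff_grad.continuous.measurable
  set A := I.c' / (2 * I.L₁) * ((m : ℝ) / I.b) ^ (1 / 3 : ℝ) with hA_def
  have hA0 : 0 < A := by positivity
  unfold epochLaw
  rw [lintegral_prod _ (by
    exact (((hFm.comp hmx).sub_const _).add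
      (((hgm.comp hmx).norm.pow_const 2).const_mul _)).ennreal_ofReal.aemeasurable)]
  have hstep := fun S : Fin m → Ξ =>
    h.lintegral_epochIter_le hL₁ hw hw1 hc' hc'6 hη hFs hb hm hκ S x
  rw [hA] at hstep
  refine (lintegral_mono hstep).trans ?_
  have hη0 : 0 ≤ I.c' / I.L₁ * ((m : ℝ) / I.b) ^ (-(2 / 3) : ℝ) / 2 := by positivity
  have e1 : ∀ S : Fin m → Ξ, ENNReal.ofReal ((m : ℝ) / I.b) *
      ENNReal.ofReal (I.c' / I.L₁ * ((m : ℝ) / I.b) ^ (-(2 / 3) : ℝ) / 2 *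
        ‖gradient (batch f S) x - gradient (objective P f) x‖ ^ 2) =
      ENNReal.ofReal A * ENNReal.ofReal
        (‖gradient (batch f S) x - gradient (objective P f) x‖ ^ 2) := fun S => by
    rw [← ENNReal.ofReal_mul (by positivity), ← mul_assoc, hA, ENNReal.ofReal_mul hA0.le]
  simp_rw [e1]
  rw [lintegral_add_left measurable_const, lintegral_const_mul' _ _ ENNReal.ofReal_ne_top,
    lintegral_const, measure_univ, mul_one,
    ENNReal.ofReal_add (by linarith [hFs x]) (by positivity), ENNReal.ofReal_mul hA0.le]
  gcongr
  exact h.variance_batch hV hm x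

end Assumptions

/-- The mean number of updates is at most m/b, so the 2b queries per update add 2m to the m queries
for S₁. -/
lemma lintegral_epochCost_le {m b : ℕ} (hb : 0 < b) (hm : 0 < m) :
    ∫⁻ s, (epochCost s : ℝ≥0∞) ∂(epochLaw P m b) ≤ ENNReal.ofReal (3 * m) := by
  have hb' : (0 : ℝ) < b := by exact_mod_cast hb
  have e : ∀ s : EpochSeed Ξ m b, (epochCost s : ℝ≥0∞) = (m : ℝ≥0∞) + (2 * b : ℝ≥0∞) * s.2.1 :=
    fun s => by simp [epochCost]
  simp_rw [e]
  have hm1 : Measurable fun s : EpochSeed Ξ m b => (s.2.1 : ℝ≥0∞) :=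
    (measurable_from_top (f := fun n : ℕ => (n : ℝ≥0∞))).comp (by fun_prop)
  rw [lintegral_add_left measurable_const, lintegral_const, measure_univ, mul_one,
    lintegral_const_mul _ hm1]
  unfold epochLaw
  have hm2 : Measurable fun s : ℕ × (ℕ → Fin b → Ξ) => (s.1 : ℝ≥0∞) :=
    (measurable_from_top (f := fun n : ℕ => (n : ℝ≥0∞))).comp measurable_fst
  have h1 : ∫⁻ s : EpochSeed Ξ m b, (s.2.1 : ℝ≥0∞) ∂((Measure.pi fun _ => P).prod
      ((geometricMeasure (stopProb m b)).prod
        (Measure.infinitePi fun _ : ℕ => Measure.pi fun _ : Fin b => P))) ≤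
      ENNReal.ofReal ((m : ℝ) / b) := by
    rw [lintegral_prod _ hm1.aemeasurable]
    simp only [lintegral_const, measure_univ, mul_one]
    rw [lintegral_prod _ hm2.aemeasurable]
    simp only [lintegral_const, measure_univ, mul_one]
    exact lintegral_geometricMeasure_natCast hb hm
  calc _ ≤ (m : ℝ≥0∞) + (2 * b : ℝ≥0∞) * ENNReal.ofReal ((m : ℝ) / b) := by gcongr
    _ = ENNReal.ofReal (3 * m) := by
      have e2 : (2 * b : ℝ≥0∞) = ENNReal.ofReal (2 * b) := by
        rw [ENNReal.ofReal_mul (by norm_num)]; simp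
      rw [e2, ← ENNReal.ofReal_mul (by positivity), ← ENNReal.ofReal_natCast,
        ← ENNReal.ofReal_add (by positivity) (by positivity)]
      congr 1
      field_simp
      ring

end Epoch

end NeonSCSG

end

noncomputable section

namespace NeonSCSG

variable {d : ℕ} {Ξ : Type*}

/-! ### The negative curvature step -/

section SignFlip

lemma measurePreserving_not :
    MeasurePreserving Bool.not (PMF.uniformOfFintype Bool).toMeasure
      (PMF.uniformOfFintype Bool).toMeasure := by
  refine ⟨measurable_from_top, Measure.ext_of_singleton fun b => ?_⟩
  rw [Measure.map_apply measurable_from_top (MeasurableSet.singleton b)]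
  have : Bool.not ⁻¹' {b} = {!b} := by ext c; cases b <;> cases c <;> simp
  rw [this, PMF.toMeasure_apply_singleton _ _ (MeasurableSet.singleton _),
    PMF.toMeasure_apply_singleton _ _ (MeasurableSet.singleton _)]
  simp

variable [MeasurableSpace Ξ] (P : Measure Ξ) [IsProbabilityMeasure P]

/-- The seed with the opposite random sign. -/
def flipSign {m : ℕ} (s : NeonSeed Ξ d m) : NeonSeed Ξ d m := (s.1, s.2.1, !s.2.2)

lemma measurePreserving_flipSign (m : ℕ) :
    MeasurePreserving (flipSign : NeonSeed Ξ d m → NeonSeed Ξ d m) (neonLaw P d m)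
      (neonLaw P d m) :=
  (MeasurePreserving.id _).prod ((MeasurePreserving.id _).prod measurePreserving_not)

lemma sign_not (b : Bool) : sign (!b) = -sign b := by cases b <;> simp [sign]

lemma sign_sq (b : Bool) : sign b ^ 2 = 1 := by cases b <;> simp [sign]

lemma ae_norm_le_one (m : ℕ) : ∀ᵐ s ∂(neonLaw P d m), ‖s.2.1‖ ≤ 1 := by
  have h1 : ∀ᵐ z ∂(unitBallLaw d), ‖z‖ ≤ 1 := by
    have := ae_cond_mem (μ := (volume : Measure (E d)))
      (Metric.isClosed_closedBall (x := (0 : E d)) (ε := 1)).measurableSet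
    filter_upwards [this] with z hz
    simpa using hz
  have h2 : ∀ᵐ q ∂((unitBallLaw d).prod (PMF.uniformOfFintype Bool).toMeasure), ‖q.1‖ ≤ 1 :=
    Measure.quasiMeasurePreserving_fst.ae h1
  exact Measure.quasiMeasurePreserving_snd.ae h2

end SignFlip

/-- The gradient terms at w and -w cancel. This is the purpose of the random sign: a step along ±w
needs no bound on ∇F(y). -/
lemma second_difference_le {F : E d → ℝ} {L₁ L₂ : ℝ} (hF : IsSmooth F L₁ L₂) (y w : E d) :
    F (y + w) + F (y - w) - 2 * F y ≤ inner ℝ (hessian F y w) w + L₂ / 3 * ‖w‖ ^ 3 := by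
  have h1 := (abs_le.mp (hF.abs_taylor_two y w)).2
  have h2 := (abs_le.mp (hF.abs_taylor_two y (-w))).2
  rw [← sub_eq_add_neg, inner_neg_right, map_neg, inner_neg_neg, norm_neg] at h2
  linarith

/-- Crude version for the rare case in which the sample Hessian says nothing about that of F. -/
lemma second_difference_le' {F : E d → ℝ} {L₁ L₂ : ℝ} (hF : IsSmooth F L₁ L₂) (y w : E d) :
    F (y + w) + F (y - w) - 2 * F y ≤ L₁ * ‖w‖ ^ 2 := by
  have h1 := (abs_le.mp (hF.abs_taylor_one y w)).2
  have h2 := (abs_le.mp (hF.abs_taylor_one y (-w))).2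
  rw [← sub_eq_add_neg, inner_neg_right, norm_neg] at h2
  linarith

/-- The properties of the negative curvature procedure on which its analysis rests: it only returns
directions of curvature at most `-2σ`, and it detects every eigenvalue below `-γ` unless the noise
is almost orthogonal to the eigenvector. -/
structure NeonSpec (d : ℕ) (I : Input) (p : Tuning) (σ s₀ : ℝ) : Prop where
  sound : ∀ (g : E d → ℝ) (y u₀ : E d), IsSmooth g I.L₁ I.L₂ → ‖u₀‖ ≤ p.r →
    negCurv g I p y u₀ ≠ 0 →
      inner ℝ (hessian g y (negCurv g I p y u₀)) (negCurv g I p y u₀) ≤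
        -(2 * σ) * ‖negCurv g I p y u₀‖ ^ 2
  complete : ∀ (g : E d → ℝ) (y u₀ v : E d) (μ : ℝ), IsSmooth g I.L₁ I.L₂ → ‖v‖ = 1 →
    hessian g y v = μ • v → μ ≤ -I.γ → ‖u₀‖ ≤ p.r → p.r * s₀ ≤ |inner ℝ u₀ v| →
      negCurv g I p y u₀ ≠ 0

/-- A tuning of the negative curvature step for which the sample Hessians are `σ`-accurate, and the
noise is favourable, each with probability at least `1 - δ`. -/
structure NegCurvTuned [MeasurableSpace Ξ] (P : Measure Ξ) (f : E d → Ξ → ℝ) (I : Input)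
    (p : Tuning) (σ s₀ δ : ℝ) : Prop extends NeonSpec d I p σ s₀ where
  L₁_pos : 0 < I.L₁
  L₂_pos : 0 < I.L₂
  m₂_pos : 0 < p.m₂
  σ_pos : 0 < σ
  σ_le : σ ≤ I.γ
  γ_pos : 0 < I.γ
  r_pos : 0 < p.r
  δ_nonneg : 0 ≤ δ
  step : p.c * I.γ = σ
  concentration : ∀ y, (Measure.pi fun _ : Fin p.m₂ => P)
    {S | σ < ‖hessian (batch f S) y - hessian (objective P f) y‖} ≤ ENNReal.ofReal δ
  slab : ∀ v : E d, ‖v‖ = 1 → unitBallLaw d {z | |inner ℝ z v| < s₀} ≤ ENNReal.ofReal δ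

/-- The expected decrease along a direction of curvature `-σ`. -/
def gain (I : Input) (σ : ℝ) : ℝ := σ ^ 3 / (3 * I.L₂ ^ 2)

/-- The expected increase along an arbitrary direction. -/
def loss (I : Input) (σ : ℝ) : ℝ := I.L₁ / 2 * (σ / I.L₂) ^ 2

section Escape

variable [MeasurableSpace Ξ] {P : Measure Ξ} [IsProbabilityMeasure P] {f : E d → Ξ → ℝ}
  {x₁ : E d} {I : Input} {p : Tuning} {G V Δ σ s₀ δ : ℝ}

omit [MeasurableSpace Ξ] in
lemma curvatureVector_flipSign (s : NeonSeed Ξ d p.m₂) (y : E d) :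
    curvatureVector f I p (flipSign s) y = curvatureVector f I p s y := rfl

lemma measurable_section {α β γ : Type*} [MeasurableSpace α] [MeasurableSpace β]
    [MeasurableSpace γ] (F : α → β → γ) (hF : Measurable fun q : α × β => F q.1 q.2) (y : β) :
    Measurable fun a => F a y := hF.comp (measurable_id.prodMk measurable_const)

lemma measurable_curvatureVector_left {L₁ L₂ : ℝ} (hm : ∀ x, Measurable (f x))
    (hf : ∀ ξ, IsSmooth (fun x => f x ξ) L₁ L₂) (I : Input) (p : Tuning) (y : E d) :
    Measurable fun s : NeonSeed Ξ d p.m₂ => curvatureVector f I p s y :=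
  measurable_section (fun s y => curvatureVector f I p s y) (measurable_curvatureVector hm hf I p) y

lemma measurable_escape_left {L₁ L₂ : ℝ} (hm : ∀ x, Measurable (f x))
    (hf : ∀ ξ, IsSmooth (fun x => f x ξ) L₁ L₂) (I : Input) (p : Tuning) (y : E d) :
    Measurable fun s : NeonSeed Ξ d p.m₂ => escape f I p s y :=
  measurable_section (fun s y => escape f I p s y) (measurable_escape hm hf I p) y

omit [IsProbabilityMeasure P] in
lemma Assumptions.measurable_hessian_batch (h : Assumptions P f x₁ I.L₁ I.L₂ G V Δ) (m : ℕ)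
    (y : E d) : Measurable fun S : Fin m → Ξ => hessian (batch f S) y := by
  have e : (fun S : Fin m → Ξ => hessian (batch f S) y) = fun S =>
      (1 / (m : ℝ)) • ∑ i, hessian (fun z => f z (S i)) y :=
    funext fun S => hessian_batch h.isSmooth S y
  have h0 : Measurable fun S : Fin m → Ξ =>
      (∑ i, hessian (fun z => f z (S i)) y : E d →L[ℝ] E d) :=
    Finset.measurable_fun_sum _ fun i _ => (h.measurable_hessian y).comp (measurable_pi_apply i)
  rw [e]
  exact h0.const_smul (1 / (m : ℝ))

namespace NegCurvTuned

variable (t : NegCurvTuned P f I p σ s₀ δ) (h : Assumptions P f x₁ I.L₁ I.L₂ G V Δ)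
include t h

/-- If the sample Hessian is within σ ≤ `I.γ` of the true one, the curvature -2`I.γ` of F leaves an
eigenvalue at most -`I.γ` of F_S, which is detected unless the noise lies in a slab. The two bad
events have probability at most δ each. -/
lemma measure_curvatureVector_eq_zero_le (y : E d)
    (hy : lambdaMin (hessian (objective P f) y) ≤ -(2 * I.γ)) :
    neonLaw P d p.m₂ {s | curvatureVector f I p s y = 0} ≤ ENNReal.ofReal (2 * δ) := by
  have hu := measurable_curvatureVector_left h.measurable h.isSmooth I p y
  have hset : MeasurableSet {s : NeonSeed Ξ d p.m₂ | curvatureVector f I p s y = 0} :=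
    measurableSet_eq_fun hu measurable_const
  obtain ⟨μ, v, hμ, hv, hHv⟩ := exists_eigenvector_of_lambdaMin_le (by linarith [t.γ_pos]) hy
  set H := hessian (objective P f) y with hH
  set B : Set (Fin p.m₂ → Ξ) := {S | σ < ‖hessian (batch f S) y - H‖} with hB
  have hgood : ∀ S ∉ B, ∃ (ν : ℝ) (w : E d), ν ≤ -I.γ ∧ ‖w‖ = 1 ∧
      hessian (batch f S) y w = ν • w := by
    intro S hS
    have hS' : ‖hessian (batch f S) y - H‖ ≤ σ := not_lt.mp hS
    have hsm := isSmooth_batch h.isSmooth t.m₂_pos S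
    refine exists_eigenvector_of_inner_le (fun v w => hsm.hessian_symm y v w) hv ?_
    have h1 : inner ℝ (hessian (batch f S) y v) v =
        inner ℝ (H v) v + inner ℝ ((hessian (batch f S) y - H) v) v := by
      rw [← inner_add_left, sub_apply, add_sub_cancel]
    have h2 : inner ℝ ((hessian (batch f S) y - H) v) v ≤ σ := by
      refine (real_inner_le_norm _ _).trans ?_
      have := (hessian (batch f S) y - H).le_opNorm v
      rw [hv, mul_one] at this ⊢
      exact this.trans hS'
    rw [h1, hHv, real_inner_smul_left, real_inner_self_eq_norm_sq, hv]
    have := t.σ_le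
    linarith
  -- The eigenvector w depends on S, so the slab estimate is applied on each fibre of S.
  have hpt : ∀ S, ((unitBallLaw d).prod (PMF.uniformOfFintype Bool).toMeasure)
      (Prod.mk S ⁻¹' {s : NeonSeed Ξ d p.m₂ | curvatureVector f I p s y = 0}) ≤
      B.indicator 1 S + ENNReal.ofReal δ := by
    intro S
    by_cases hS : S ∈ B
    · rw [Set.indicator_of_mem hS]
      exact prob_le_one.trans le_self_add
    · rw [Set.indicator_of_notMem hS, zero_add]
      obtain ⟨ν, w, hν, hw, hHw⟩ := hgood S hS
      have hsub : (Prod.mk S ⁻¹' {s : NeonSeed Ξ d p.m₂ | curvatureVector f I p s y = 0}) ⊆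
          ((Metric.closedBall (0 : E d) 1)ᶜ ∪ {z | |inner ℝ z w| < s₀}) ×ˢ Set.univ := by
        rintro ⟨z, b⟩ hz
        have hz' : negCurv (batch f S) I p y (p.r • z) = 0 := hz
        refine ⟨?_, trivial⟩
        by_contra hcon
        rw [Set.mem_union, not_or, Set.notMem_compl_iff, mem_closedBall_zero_iff] at hcon
        obtain ⟨hz1, hz2⟩ := hcon
        have hz2' : s₀ ≤ |inner ℝ z w| := not_lt.mp hz2
        refine t.complete (batch f S) y (p.r • z) w ν (isSmooth_batch h.isSmooth t.m₂_pos S)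
          hw hHw hν ?_ ?_ hz'
        · rw [norm_smul, Real.norm_of_nonneg t.r_pos.le]
          exact mul_le_of_le_one_right t.r_pos.le hz1
        · rw [real_inner_smul_left, abs_mul, abs_of_pos t.r_pos]
          exact mul_le_mul_of_nonneg_left hz2' t.r_pos.le
      refine (measure_mono hsub).trans ?_
      rw [Measure.prod_prod, measure_univ, mul_one]
      refine (measure_union_le _ _).trans ?_
      have h0 : unitBallLaw d (Metric.closedBall (0 : E d) 1)ᶜ = 0 := by
        have := ae_cond_mem (μ := (volume : Measure (E d)))
          (Metric.isClosed_closedBall (x := (0 : E d)) (ε := 1)).measurableSet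
        exact this
      rw [h0, zero_add]
      exact t.slab w hw
  unfold neonLaw
  rw [Measure.prod_apply hset]
  refine (lintegral_mono hpt).trans ?_
  rw [lintegral_add_right _ measurable_const, lintegral_const, measure_univ, mul_one, two_mul,
    ENNReal.ofReal_add t.δ_nonneg t.δ_nonneg]
  gcongr
  exact (lintegral_indicator_one_le B).trans (t.concentration y)

omit h [IsProbabilityMeasure P] in
lemma norm_escape_sub (s : NeonSeed Ξ d p.m₂) (y : E d) :
    ‖escape f I p s y - y‖ ≤ σ / I.L₂ := by
  have hL := t.L₂_pos
  have hσ := t.σ_pos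
  unfold escape
  dsimp only
  split_ifs with hu
  · rw [sub_self, norm_zero]; positivity
  · have hu' : 0 < ‖curvatureVector f I p s y‖ := norm_pos_iff.mpr hu
    rw [sub_sub_cancel_left, norm_neg, norm_smul, t.step, norm_div, norm_div, norm_mul, norm_norm,
      Real.norm_of_nonneg hσ.le, Real.norm_of_nonneg hL.le, div_mul_cancel₀ _ hu'.ne']
    have : ‖sign s.2.2‖ = 1 := by cases s.2.2 <;> simp [sign]
    rw [this, mul_one]

lemma integrable_escape (y : E d) :
    Integrable (fun s => objective P f (escape f I p s y) - objective P f y)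
      (neonLaw P d p.m₂) := by
  have hm := measurable_escape_left h.measurable h.isSmooth I p y
  have hsm := h.isSmooth_objective
  refine Integrable.of_bound
    ((hsm.diff.continuous.measurable.comp hm).sub_const _).aestronglyMeasurable
    (‖gradient (objective P f) y‖ * (σ / I.L₂) + I.L₁ / 2 * (σ / I.L₂) ^ 2)
    (Filter.Eventually.of_forall fun s => ?_)
  have h1 := hsm.abs_taylor_one y (escape f I p s y - y)
  rw [add_sub_cancel] at h1
  have h2 := t.norm_escape_sub s y
  have h3 := abs_real_inner_le_norm (gradient (objective P f) y) (escape f I p s y - y)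
  have h4 : ‖gradient (objective P f) y‖ * ‖escape f I p s y - y‖ ≤
      ‖gradient (objective P f) y‖ * (σ / I.L₂) := by gcongr
  have h5 : I.L₁ / 2 * ‖escape f I p s y - y‖ ^ 2 ≤ I.L₁ / 2 * (σ / I.L₂) ^ 2 := by
    have := t.L₁_pos
    gcongr
  rw [Real.norm_eq_abs]
  calc |objective P f (escape f I p s y) - objective P f y| =
        |(objective P f (escape f I p s y) - objective P f y -
          inner ℝ (gradient (objective P f) y) (escape f I p s y - y)) +
          inner ℝ (gradient (objective P f) y) (escape f I p s y - y)| := by ring_nf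
    _ ≤ _ := (abs_add_le _ _).trans (by linarith)

/-- With an accurate sample Hessian, sample curvature -2σ becomes curvature -σ of F. The length σ/L₂
then gives -σ(σ/L₂)² + (L₂/3)(σ/L₂)³ = -2 `gain`. With an inaccurate one, at most 2 `loss` is gained
by F. For u = 0 nothing moves. -/
lemma escape_add_flipSign_le (s : NeonSeed Ξ d p.m₂) (y : E d) (hs : ‖s.2.1‖ ≤ 1) :
    (objective P f (escape f I p s y) - objective P f y) +
      (objective P f (escape f I p (flipSign s) y) - objective P f y) ≤
    2 * (-gain I σ * {s | curvatureVector f I p s y ≠ 0}.indicator 1 s +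
      (gain I σ + loss I σ) * {s : NeonSeed Ξ d p.m₂ |
        σ < ‖hessian (batch f s.1) y - hessian (objective P f) y‖}.indicator 1 s) := by
  have hL := t.L₂_pos
  have hL₁ := t.L₁_pos
  have hσ := t.σ_pos
  have hgain : 0 < gain I σ := by unfold gain; positivity
  have hloss : 0 < loss I σ := by unfold loss; positivity
  set u := curvatureVector f I p s y with hu_def
  by_cases hu : u = 0
  · have e1 : escape f I p s y = y := by unfold escape; rw [if_pos hu]
    have e2 : escape f I p (flipSign s) y = y := by
      unfold escape; rw [if_pos (by rw [curvatureVector_flipSign]; exact hu)]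
    have hmem : s ∉ {s | curvatureVector f I p s y ≠ 0} := fun hmem => hmem hu
    rw [e1, e2, Set.indicator_of_notMem hmem]
    have : (0 : ℝ) ≤ {s : NeonSeed Ξ d p.m₂ |
        σ < ‖hessian (batch f s.1) y - hessian (objective P f) y‖}.indicator 1 s :=
      Set.indicator_nonneg (fun _ _ => zero_le_one) _
    simp only [sub_self, add_zero, mul_zero, zero_add]
    positivity
  · have hu' : 0 < ‖u‖ := norm_pos_iff.mpr hu
    set k := p.c * I.γ * sign s.2.2 / I.L₂ / ‖u‖ with hk
    have e1 : escape f I p s y = y - k • u := by unfold escape; rw [if_neg hu]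
    have e2 : escape f I p (flipSign s) y = y + k • u := by
      unfold escape
      rw [if_neg (by rw [curvatureVector_flipSign]; exact hu), curvatureVector_flipSign]
      have : sign (flipSign s).2.2 = -sign s.2.2 := sign_not _
      rw [this, sub_eq_add_neg, ← neg_smul, hk]
      congr 2
      ring
    have hk2 : k ^ 2 * ‖u‖ ^ 2 = (σ / I.L₂) ^ 2 := by
      rw [hk, t.step, div_pow, div_pow, mul_pow, sign_sq]
      field_simp
    have hku : ‖k • u‖ = σ / I.L₂ := by
      have : ‖k • u‖ ^ 2 = (σ / I.L₂) ^ 2 := by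
        rw [norm_smul, mul_pow, Real.norm_eq_abs, sq_abs, hk2]
      exact (pow_left_inj₀ (norm_nonneg _) (by positivity) two_ne_zero).mp this
    have hmem : s ∈ {s | curvatureVector f I p s y ≠ 0} := hu
    rw [e1, e2, Set.indicator_of_mem hmem]
    by_cases hbad : s ∈ {s : NeonSeed Ξ d p.m₂ |
        σ < ‖hessian (batch f s.1) y - hessian (objective P f) y‖}
    · rw [Set.indicator_of_mem hbad]
      have h1 := second_difference_le' h.isSmooth_objective y (k • u)
      rw [hku] at h1
      have : loss I σ = I.L₁ / 2 * (σ / I.L₂) ^ 2 := rfl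
      simp only [Pi.one_apply, mul_one]
      linarith
    · rw [Set.indicator_of_notMem hbad]
      have hgood : ‖hessian (batch f s.1) y - hessian (objective P f) y‖ ≤ σ := not_lt.mp hbad
      have h1 := second_difference_le h.isSmooth_objective y (k • u)
      have h2 := t.sound (batch f s.1) y (p.r • s.2.1)
        (isSmooth_batch h.isSmooth t.m₂_pos s.1)
        (by
          rw [norm_smul, Real.norm_of_nonneg t.r_pos.le]
          exact mul_le_of_le_one_right t.r_pos.le hs) hu
      have h2' : inner ℝ (hessian (batch f s.1) y u) u ≤ -(2 * σ) * ‖u‖ ^ 2 := h2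
      have h3 : inner ℝ ((hessian (objective P f) y - hessian (batch f s.1) y) u) u ≤
          σ * ‖u‖ ^ 2 := by
        refine (real_inner_le_norm _ _).trans ?_
        rw [pow_two, ← mul_assoc]
        gcongr
        refine ((hessian (objective P f) y - hessian (batch f s.1) y).le_opNorm u).trans ?_
        rw [norm_sub_rev]
        gcongr
      have h4 : inner ℝ (hessian (objective P f) y u) u ≤ -σ * ‖u‖ ^ 2 := by
        rw [sub_apply, inner_sub_left] at h3
        linarith
      have h5 : inner ℝ (hessian (objective P f) y (k • u)) (k • u) ≤ -σ * (σ / I.L₂) ^ 2 := by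
        rw [map_smul, real_inner_smul_left, inner_smul_right, ← mul_assoc, ← pow_two, ← hk2]
        have := mul_le_mul_of_nonneg_left h4 (sq_nonneg k)
        linarith
      rw [hku] at h1
      have h6 : -σ * (σ / I.L₂) ^ 2 + I.L₂ / 3 * (σ / I.L₂) ^ 3 = -2 * gain I σ := by
        unfold gain
        field_simp
        ring
      simp only [Pi.one_apply, mul_one, mul_zero, add_zero]
      linarith

/-- Flipping the sign preserves the law and leaves u unchanged, so the mean of the change of F is
half the mean of its symmetrised version. -/
lemma integral_escape_le (y : E d) :
    ∫ s, (objective P f (escape f I p s y) - objective P f y) ∂(neonLaw P d p.m₂) ≤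
      -gain I σ * (neonLaw P d p.m₂).real {s | curvatureVector f I p s y ≠ 0} +
        (gain I σ + loss I σ) * δ := by
  have hL := t.L₂_pos
  have hL₁ := t.L₁_pos
  have hσ := t.σ_pos
  have hgain : 0 < gain I σ := by unfold gain; positivity
  have hloss : 0 < loss I σ := by unfold loss; positivity
  set ν := neonLaw P d p.m₂ with hν
  set D : NeonSeed Ξ d p.m₂ → ℝ := fun s =>
    objective P f (escape f I p s y) - objective P f y with hD
  have hint : Integrable D ν := t.integrable_escape h y
  have hflip := measurePreserving_flipSign (d := d) P p.m₂
  have hmeasflip : Measurable (flipSign : NeonSeed Ξ d p.m₂ → NeonSeed Ξ d p.m₂) := hflip.measurable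
  have hint' : Integrable (fun s => D (flipSign s)) ν := hflip.integrable_comp_of_integrable hint
  have heq : ∫ s, D (flipSign s) ∂ν = ∫ s, D s ∂ν := by
    have h1 : AEStronglyMeasurable D (ν.map flipSign) := by
      rw [hflip.map_eq]; exact hint.aestronglyMeasurable
    have h2 := integral_map (μ := ν) hmeasflip.aemeasurable h1
    rw [hflip.map_eq] at h2
    exact h2.symm
  have hu := measurable_curvatureVector_left h.measurable h.isSmooth I p y
  have hA : MeasurableSet {s : NeonSeed Ξ d p.m₂ | curvatureVector f I p s y ≠ 0} :=
    (measurableSet_eq_fun hu measurable_const).compl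
  set B : Set (NeonSeed Ξ d p.m₂) :=
    {s | σ < ‖hessian (batch f s.1) y - hessian (objective P f) y‖} with hB_def
  have hBm : MeasurableSet {S : Fin p.m₂ → Ξ |
      σ < ‖hessian (batch f S) y - hessian (objective P f) y‖} := by
    have hHm := h.measurable_hessian_batch p.m₂ y
    exact measurableSet_lt measurable_const (hHm.sub_const _).norm
  have hB : MeasurableSet B := measurable_fst hBm
  have hBδ : ν.real B ≤ δ := by
    refine ENNReal.toReal_le_of_le_ofReal t.δ_nonneg ?_
    have h1 : ν B = (Measure.pi fun _ : Fin p.m₂ => P) {S : Fin p.m₂ → Ξ |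
        σ < ‖hessian (batch f S) y - hessian (objective P f) y‖} := by
      have h2 : MeasurePreserving Prod.fst ν (Measure.pi fun _ : Fin p.m₂ => P) :=
        measurePreserving_fst
      exact h2.measure_preimage hBm.nullMeasurableSet
    rw [h1]
    exact t.concentration y
  have i1 : Integrable (fun s => -gain I σ * {s : NeonSeed Ξ d p.m₂ |
      curvatureVector f I p s y ≠ 0}.indicator (1 : NeonSeed Ξ d p.m₂ → ℝ) s) ν :=
    ((integrable_const (1 : ℝ)).indicator hA).const_mul _
  have i2 : Integrable (fun s => (gain I σ + loss I σ) * B.indicator (1 : NeonSeed Ξ d p.m₂ → ℝ) s) ν :=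
    ((integrable_const (1 : ℝ)).indicator hB).const_mul _
  have hle : ∫ s, (D s + D (flipSign s)) ∂ν ≤ ∫ s, 2 * (-gain I σ * {s : NeonSeed Ξ d p.m₂ |
      curvatureVector f I p s y ≠ 0}.indicator (1 : NeonSeed Ξ d p.m₂ → ℝ) s +
        (gain I σ + loss I σ) * B.indicator (1 : NeonSeed Ξ d p.m₂ → ℝ) s) ∂ν := by
    refine integral_mono_ae (hint.add hint') ((i1.add i2).const_mul 2) ?_
    filter_upwards [ae_norm_le_one P p.m₂] with s hs
    exact t.escape_add_flipSign_le h s y hs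
  rw [integral_add hint hint', heq, integral_const_mul, integral_add i1 i2, integral_const_mul,
    integral_const_mul, integral_indicator_one hA, integral_indicator_one hB] at hle
  have := mul_le_mul_of_nonneg_left hBδ (add_pos hgain hloss).le
  linarith

end NegCurvTuned

end Escape

end NeonSCSG

end

noncomputable section

namespace NeonSCSG

variable {d : ℕ} {Ξ : Type*}

/-! ### One iteration -/

section Iteration

variable [MeasurableSpace Ξ] {P : Measure Ξ} [IsProbabilityMeasure P] {f : E d → Ξ → ℝ}
  {x₁ : E d} {I : Input} {p : Tuning} {G V Δ σ s₀ δ : ℝ}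

/-- The constant of the epoch's descent inequality. -/
def epochRate (I : Input) (m : ℕ) : ℝ := I.c' / (2 * I.L₁) * ((m : ℝ) / I.b) ^ (1 / 3 : ℝ)

/-- A tuning for which every iteration that does not terminate decreases `F` by about `D`. -/
structure IterationTuned (P : Measure Ξ) (f : E d → Ξ → ℝ) (I : Input)
    (p : Tuning) (σ s₀ δ V D : ℝ) : Prop extends NegCurvTuned P f I p σ s₀ δ where
  c'_pos : 0 < I.c'
  c'_le : I.c' ≤ 1 / 6
  b_pos : 0 < I.b
  b_le : I.b ≤ p.m₁
  mc_pos : 0 < p.mc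
  V_nonneg : 0 ≤ V
  ε_pos : 0 < I.ε
  D_pos : 0 < D
  D_le_gain : D ≤ gain I σ
  D_le_rate : D ≤ epochRate I p.m₁ * I.ε ^ 2 / 2
  failure : (gain I σ + loss I σ) * δ ≤ D / 4
  noise : epochRate I p.m₁ * (V / p.m₁) + epochRate I p.m₁ * (V / p.mc) ≤ D / 4
  check : ∀ x, 2 * I.ε < ‖gradient (objective P f) x‖ →
    (Measure.pi fun _ : Fin p.mc => P) {S | ‖gradient (batch f S) x‖ ≤ I.ε} ≤ ENNReal.ofReal δ

/-- Markov's inequality for the second moment. The bound is stated in terms of ‖∇F(y)‖² so that it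
can be charged to the gradient term of the epoch inequality. -/
lemma Assumptions.measure_check_fails_le (h : Assumptions P f x₁ I.L₁ I.L₂ G V Δ) (hV : 0 ≤ V)
    {m : ℕ} (hm : 0 < m) {ε : ℝ} (hε : 0 < ε) (y : E d) :
    (Measure.pi fun _ : Fin m => P) {S | ¬ ‖gradient (batch f S) y‖ ≤ ε} ≤
      ENNReal.ofReal (2 * (‖gradient (objective P f) y‖ ^ 2 + V / m) / ε ^ 2) := by
  set g := gradient (objective P f) y with hg
  have hmeas : Measurable fun S : Fin m → Ξ => gradient (batch f S) y :=
    measurable_section (fun S y => gradient (batch f S) y)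
      (measurable_gradient_batch h.measurable h.isSmooth m) y
  have hv := h.variance_batch hV hm y
  have h1 : ∫⁻ S, ENNReal.ofReal (‖gradient (batch f S) y‖ ^ 2) ∂(Measure.pi fun _ : Fin m => P) ≤
      ENNReal.ofReal (2 * (‖g‖ ^ 2 + V / m)) := by
    calc _ ≤ ∫⁻ S, (ENNReal.ofReal (2 * ‖g‖ ^ 2) + ENNReal.ofReal 2 *
            ENNReal.ofReal (‖gradient (batch f S) y - g‖ ^ 2)) ∂(Measure.pi fun _ : Fin m => P) := by
          refine lintegral_mono fun S => ?_
          rw [← ENNReal.ofReal_mul (by norm_num), ← ENNReal.ofReal_add (by positivity)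
            (by positivity)]
          refine ENNReal.ofReal_le_ofReal ?_
          have h2 : ‖gradient (batch f S) y‖ ≤ ‖g‖ + ‖gradient (batch f S) y - g‖ := by
            have := norm_add_le g (gradient (batch f S) y - g)
            rwa [add_sub_cancel] at this
          have h3 : ‖gradient (batch f S) y‖ ^ 2 ≤ (‖g‖ + ‖gradient (batch f S) y - g‖) ^ 2 := by
            gcongr
          nlinarith [sq_nonneg (‖g‖ - ‖gradient (batch f S) y - g‖)]
      _ ≤ ENNReal.ofReal (2 * ‖g‖ ^ 2) + ENNReal.ofReal 2 * ENNReal.ofReal (V / m) := by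
          rw [lintegral_add_left measurable_const, lintegral_const, measure_univ, mul_one,
            lintegral_const_mul' _ _ ENNReal.ofReal_ne_top]
          gcongr
      _ = _ := by
          rw [← ENNReal.ofReal_mul (by norm_num), ← ENNReal.ofReal_add (by positivity)
            (by positivity), mul_add]
  have hsub : {S : Fin m → Ξ | ¬ ‖gradient (batch f S) y‖ ≤ ε} ⊆
      {S | ENNReal.ofReal (ε ^ 2) ≤ ENNReal.ofReal (‖gradient (batch f S) y‖ ^ 2)} := by
    intro S hS
    have hS' : ε < ‖gradient (batch f S) y‖ := not_le.mp hS
    have : ε ^ 2 ≤ ‖gradient (batch f S) y‖ ^ 2 := by gcongr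
    exact ENNReal.ofReal_le_ofReal this
  refine (measure_mono hsub).trans ?_
  refine (meas_ge_le_lintegral_div (hmeas.norm.pow_const 2).ennreal_ofReal.aemeasurable
    (by simpa using hε.ne') ENNReal.ofReal_ne_top).trans ?_
  rw [ENNReal.ofReal_div_of_pos (by positivity)]
  gcongr

omit [MeasurableSpace Ξ] in
lemma escape_of_eq_zero {s : NeonSeed Ξ d p.m₂} {y : E d} (hu : curvatureVector f I p s y = 0) :
    escape f I p s y = y := by unfold escape; rw [if_pos hu]

omit [MeasurableSpace Ξ] in
lemma iteration_fst (s : Seed Ξ d I.b p) (x : E d) [Decidable (FirstOrderMet f I p s x)] :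
    (iteration f I p s x).1 = if FirstOrderMet f I p s x then
      escape f I p s.2.2 (scsgEpoch f I s.1 x) else scsgEpoch f I s.1 x := by
  unfold iteration
  dsimp only
  by_cases h1 : FirstOrderMet f I p s x
  · rw [if_pos h1, if_pos h1]
    by_cases h2 : curvatureVector f I p s.2.2 (scsgEpoch f I s.1 x) = 0
    · rw [if_pos h2, escape_of_eq_zero h2]
    · rw [if_neg h2]
  · rw [if_neg h1, if_neg h1]

omit [MeasurableSpace Ξ] in
lemma iteration_snd (s : Seed Ξ d I.b p) (x : E d) :
    (iteration f I p s x).2 = true ↔ FirstOrderMet f I p s x ∧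
      curvatureVector f I p s.2.2 (scsgEpoch f I s.1 x) = 0 := by
  unfold iteration
  dsimp only
  by_cases h1 : FirstOrderMet f I p s x
  · rw [if_pos h1]
    by_cases h2 : curvatureVector f I p s.2.2 (scsgEpoch f I s.1 x) = 0 <;> simp [h1, h2]
  · simp [h1]

/-- The decrease `gain` · P(u ≠ 0) is rewritten as D - D · P(u = 0). A missing decrease therefore
counts as a chance of returning, whatever the curvature at y is. -/
lemma NegCurvTuned.lintegral_escape_le (t : NegCurvTuned P f I p σ s₀ δ)
    (h : Assumptions P f x₁ I.L₁ I.L₂ G V Δ) {D Fs : ℝ} (hFs : ∀ z, Fs ≤ objective P f z)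
    (hD : 0 < D) (hDg : D ≤ gain I σ) (hfail : (gain I σ + loss I σ) * δ ≤ D / 4) (y : E d) :
    ∫⁻ s, ENNReal.ofReal (objective P f (escape f I p s y) - Fs) ∂(neonLaw P d p.m₂) +
      ENNReal.ofReal D ≤
    ENNReal.ofReal (objective P f y - Fs) + ENNReal.ofReal (D / 4) + ENNReal.ofReal D *
      neonLaw P d p.m₂ {s | curvatureVector f I p s y = 0} := by
  set ν := neonLaw P d p.m₂ with hν
  have hi := t.integrable_escape h y
  have hle := t.integral_escape_le h y
  have hi' : Integrable (fun s => objective P f (escape f I p s y) - Fs) ν := by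
    have := hi.add (integrable_const (objective P f y - Fs))
    refine this.congr (Filter.Eventually.of_forall fun s => ?_)
    simp
  have hset : MeasurableSet {s : NeonSeed Ξ d p.m₂ | curvatureVector f I p s y = 0} :=
    measurableSet_eq_fun (measurable_curvatureVector_left h.measurable h.isSmooth I p y)
      measurable_const
  have hcompl : ν.real {s : NeonSeed Ξ d p.m₂ | curvatureVector f I p s y ≠ 0} =
      1 - ν.real {s | curvatureVector f I p s y = 0} := by
    rw [← probReal_compl_eq_one_sub hset]
    rfl
  have hreal : ν {s | curvatureVector f I p s y = 0} =
      ENNReal.ofReal (ν.real {s | curvatureVector f I p s y = 0}) := by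
    rw [ofReal_measureReal]
  have hint : ∫ s, (objective P f (escape f I p s y) - Fs) ∂ν =
      (objective P f y - Fs) + ∫ s, (objective P f (escape f I p s y) - objective P f y) ∂ν := by
    have e : ∀ s, objective P f (escape f I p s y) - Fs = (objective P f y - Fs) +
        (objective P f (escape f I p s y) - objective P f y) := fun s => by ring
    simp_rw [e]
    rw [integral_add (integrable_const _) hi, integral_const, probReal_univ, one_smul]
  have hnn : 0 ≤ ∫ s, (objective P f (escape f I p s y) - Fs) ∂ν :=
    integral_nonneg fun s => sub_nonneg.mpr (hFs _)
  rw [← ofReal_integral_eq_lintegral_ofReal hi'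
    (Filter.Eventually.of_forall fun s => sub_nonneg.mpr (hFs _)), hreal,
    ← ENNReal.ofReal_mul hD.le, ← ENNReal.ofReal_add hnn hD.le,
    ← ENNReal.ofReal_add (sub_nonneg.mpr (hFs y)) (by positivity),
    ← ENNReal.ofReal_add (add_nonneg (sub_nonneg.mpr (hFs y)) (by positivity)) (by positivity)]
  refine ENNReal.ofReal_le_ofReal ?_
  rw [hint]
  rw [hcompl] at hle
  set π := ν.real {s | curvatureVector f I p s y = 0} with hπ
  have hπ1 : π ≤ 1 := measureReal_le_one
  nlinarith [mul_le_mul_of_nonneg_right hDg (sub_nonneg.mpr hπ1)]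

section AfterEpoch

/-- The randomness of an iteration after its epoch. -/
abbrev CheckSeed (Ξ : Type*) (d : ℕ) (p : Tuning) : Type _ := (Fin p.mc → Ξ) × NeonSeed Ξ d p.m₂

/-- The law of the randomness of an iteration after its epoch. -/
def checkLaw (P : Measure Ξ) [IsProbabilityMeasure P] (d : ℕ) (p : Tuning) :
    Measure (CheckSeed Ξ d p) := (Measure.pi fun _ => P).prod (neonLaw P d p.m₂)

instance : IsProbabilityMeasure (checkLaw P d p) := by unfold checkLaw; infer_instance

namespace IterationTuned

variable {D : ℝ} (t : IterationTuned P f I p σ s₀ δ V D)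
  (h : Assumptions P f x₁ I.L₁ I.L₂ G V Δ)
include t h

-- The amortisation of an iteration given the output y of the epoch. If the check succeeds, the
-- negative curvature step yields D up to D/4 and the chance of returning. If it fails, nothing is
-- gained, but as D ≤ A ε₀²/2, the probability of failure times D is at most A(‖∇F(y)‖² + V/m); the
-- epoch has already paid A‖∇F(y)‖².
open Classical in
lemma lintegral_check_le {Fs : ℝ} (hFs : ∀ z, Fs ≤ objective P f z) (y : E d) :
    ∫⁻ q, ENNReal.ofReal ((if ‖gradient (batch f q.1) y‖ ≤ I.ε then
        objective P f (escape f I p q.2 y) else objective P f y) - Fs) ∂(checkLaw P d p) +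
      ENNReal.ofReal D ≤
    ENNReal.ofReal (objective P f y - Fs + epochRate I p.m₁ * ‖gradient (objective P f) y‖ ^ 2) +
      ENNReal.ofReal (epochRate I p.m₁ * (V / p.mc) + D / 4) + ENNReal.ofReal D *
      checkLaw P d p {q | ‖gradient (batch f q.1) y‖ ≤ I.ε ∧ curvatureVector f I p q.2 y = 0} := by
  have hD := t.D_pos
  have hA : 0 < epochRate I p.m₁ := by
    have h1 := t.c'_pos
    have h2 := t.L₁_pos
    have h3 : (0 : ℝ) < I.b := by exact_mod_cast t.b_pos
    have h4 : (0 : ℝ) < p.m₁ := by exact_mod_cast t.b_pos.trans_le t.b_le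
    unfold epochRate
    positivity
  have hV := t.V_nonneg
  have hu := measurable_curvatureVector_left h.measurable h.isSmooth I p y
  have hesc := measurable_escape_left h.measurable h.isSmooth I p y
  have hgm : Measurable fun S : Fin p.mc → Ξ => gradient (batch f S) y :=
    measurable_section (fun S y => gradient (batch f S) y)
      (measurable_gradient_batch h.measurable h.isSmooth p.mc) y
  have hFm : Measurable (objective P f) := h.isSmooth_objective.diff.continuous.measurable
  have hmet : MeasurableSet {S : Fin p.mc → Ξ | ‖gradient (batch f S) y‖ ≤ I.ε} :=
    measurableSet_le hgm.norm measurable_const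
  have hzero : MeasurableSet {s : NeonSeed Ξ d p.m₂ | curvatureVector f I p s y = 0} :=
    measurableSet_eq_fun hu measurable_const
  have hterm : MeasurableSet {q : CheckSeed Ξ d p |
      ‖gradient (batch f q.1) y‖ ≤ I.ε ∧ curvatureVector f I p q.2 y = 0} :=
    measurableSet_and (measurable_fst hmet) (measurable_snd hzero)
  have hval : Measurable fun q : CheckSeed Ξ d p =>
      ENNReal.ofReal ((if ‖gradient (batch f q.1) y‖ ≤ I.ε then
        objective P f (escape f I p q.2 y) else objective P f y) - Fs) := by
    have h1 : Measurable fun q : CheckSeed Ξ d p => objective P f (escape f I p q.2 y) :=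
      hFm.comp (hesc.comp measurable_snd)
    have h2 : MeasurableSet {q : CheckSeed Ξ d p | ‖gradient (batch f q.1) y‖ ≤ I.ε} :=
      measurable_fst hmet
    exact ((Measurable.ite h2 h1 measurable_const).sub_const _).ennreal_ofReal
  set μ := Measure.pi fun _ : Fin p.mc => P with hμ
  set ν := neonLaw P d p.m₂ with hν
  have hstep : ∀ S : Fin p.mc → Ξ,
      ∫⁻ s, ENNReal.ofReal ((if ‖gradient (batch f S) y‖ ≤ I.ε then
        objective P f (escape f I p s y) else objective P f y) - Fs) ∂ν + ENNReal.ofReal D ≤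
      ENNReal.ofReal (objective P f y - Fs) + ENNReal.ofReal (D / 4) + ENNReal.ofReal D *
        (ν (Prod.mk S ⁻¹' {q : CheckSeed Ξ d p | ‖gradient (batch f q.1) y‖ ≤ I.ε ∧
          curvatureVector f I p q.2 y = 0}) +
        {S : Fin p.mc → Ξ | ¬ ‖gradient (batch f S) y‖ ≤ I.ε}.indicator 1 S) := by
    intro S
    by_cases hS : ‖gradient (batch f S) y‖ ≤ I.ε
    · have h1 := t.toNegCurvTuned.lintegral_escape_le h hFs t.D_pos t.D_le_gain t.failure y
      simp only [if_pos hS]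
      refine h1.trans ?_
      gcongr
      refine le_trans (measure_mono fun s hs => ?_) le_self_add
      exact ⟨hS, hs⟩
    · simp only [if_neg hS]
      have hmem : S ∈ {S : Fin p.mc → Ξ | ¬ ‖gradient (batch f S) y‖ ≤ I.ε} := hS
      rw [lintegral_const, measure_univ, mul_one, Set.indicator_of_mem hmem, Pi.one_apply, mul_add,
        mul_one]
      exact add_le_add le_self_add le_add_self
  have hfails := h.measure_check_fails_le hV t.mc_pos t.ε_pos y
  have hfset : MeasurableSet {S : Fin p.mc → Ξ | ¬ ‖gradient (batch f S) y‖ ≤ I.ε} := hmet.compl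
  have hind : Measurable ({S : Fin p.mc → Ξ | ¬ ‖gradient (batch f S) y‖ ≤ I.ε}.indicator
      (1 : (Fin p.mc → Ξ) → ℝ≥0∞)) := measurable_one.indicator hfset
  unfold checkLaw
  rw [lintegral_prod _ hval.aemeasurable, Measure.prod_apply hterm]
  have hkey := lintegral_mono hstep (μ := μ)
  rw [lintegral_add_right _ measurable_const, lintegral_add_left measurable_const,
    lintegral_const_mul' _ _ ENNReal.ofReal_ne_top, lintegral_add_right _ hind,
    lintegral_indicator_one hfset] at hkey
  simp only [lintegral_const, measure_univ, mul_one] at hkey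
  refine hkey.trans ?_
  have hfD : ENNReal.ofReal D * μ {S : Fin p.mc → Ξ | ¬ ‖gradient (batch f S) y‖ ≤ I.ε} ≤
      ENNReal.ofReal (epochRate I p.m₁ * ‖gradient (objective P f) y‖ ^ 2) +
        ENNReal.ofReal (epochRate I p.m₁ * (V / p.mc)) := by
    calc _ ≤ ENNReal.ofReal D * ENNReal.ofReal
          (2 * (‖gradient (objective P f) y‖ ^ 2 + V / p.mc) / I.ε ^ 2) := by gcongr
      _ ≤ _ := by
        rw [← ENNReal.ofReal_mul hD.le, ← ENNReal.ofReal_add (by positivity) (by positivity)]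
        refine ENNReal.ofReal_le_ofReal ?_
        have hε := t.ε_pos
        have h1 := mul_le_mul_of_nonneg_right t.D_le_rate
          (by positivity : 0 ≤ 2 * (‖gradient (objective P f) y‖ ^ 2 + V / p.mc) / I.ε ^ 2)
        refine h1.trans (le_of_eq ?_)
        field_simp
  rw [mul_add, ENNReal.ofReal_add (by linarith [hFs y]) (by positivity),
    ENNReal.ofReal_add (by positivity) (by positivity)]
  calc _ ≤ ENNReal.ofReal (objective P f y - Fs) + ENNReal.ofReal (D / 4) +
        (ENNReal.ofReal D * ∫⁻ S, ν (Prod.mk S ⁻¹' {q : CheckSeed Ξ d p |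
          ‖gradient (batch f q.1) y‖ ≤ I.ε ∧ curvatureVector f I p q.2 y = 0}) ∂μ +
        (ENNReal.ofReal (epochRate I p.m₁ * ‖gradient (objective P f) y‖ ^ 2) +
        ENNReal.ofReal (epochRate I p.m₁ * (V / p.mc)))) := by
        gcongr
    _ = _ := by ring

end IterationTuned

end AfterEpoch

end Iteration

end NeonSCSG

end

/-! ### Decrease, wrong returns and cost in one iteration -/

noncomputable section

namespace NeonSCSG

variable {d : ℕ} {Ξ : Type*}

section IterationBounds

variable [MeasurableSpace Ξ] {P : Measure Ξ} [IsProbabilityMeasure P] {f : E d → Ξ → ℝ}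
  {x₁ : E d} {I : Input} {p : Tuning} {G V Δ σ s₀ δ D : ℝ}

lemma measurable_scsgEpoch_left {L₁ L₂ : ℝ} (hm : ∀ x, Measurable (f x))
    (hf : ∀ ξ, IsSmooth (fun x => f x ξ) L₁ L₂) (I : Input) (m : ℕ) (x : E d) :
    Measurable fun s : EpochSeed Ξ m I.b => scsgEpoch f I s x :=
  measurable_section (fun s x => scsgEpoch f I s x) (measurable_scsgEpoch hm hf I m) x

lemma measurable_iteration_left {L₁ L₂ : ℝ} (hm : ∀ x, Measurable (f x))
    (hf : ∀ ξ, IsSmooth (fun x => f x ξ) L₁ L₂) (I : Input) (p : Tuning) (x : E d) :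
    Measurable fun s : Seed Ξ d I.b p => iteration f I p s x :=
  measurable_section (fun s x => iteration f I p s x) (measurable_iteration hm hf I p) x

namespace IterationTuned

variable (t : IterationTuned P f I p σ s₀ δ V D) (h : Assumptions P f x₁ I.L₁ I.L₂ G V Δ)
include t h

omit [IsProbabilityMeasure P] h in
lemma epochRate_pos : 0 < epochRate I p.m₁ := by
  have h1 := t.c'_pos
  have h2 := t.L₁_pos
  have h3 : (0 : ℝ) < I.b := by exact_mod_cast t.b_pos
  have h4 : (0 : ℝ) < p.m₁ := by exact_mod_cast t.b_pos.trans_le t.b_le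
  unfold epochRate
  positivity

/-- The gradient term charged after the epoch is the one that `Assumptions.lintegral_scsgEpoch_le`
provides, with the same coefficient `epochRate`. -/
lemma lintegral_iteration_le {Fs : ℝ} (hFs : ∀ z, Fs ≤ objective P f z) (x : E d) :
    ∫⁻ s, ENNReal.ofReal (objective P f (iteration f I p s x).1 - Fs) ∂(seedLaw P d I.b p) +
      ENNReal.ofReal (D / 2) ≤
    ENNReal.ofReal (objective P f x - Fs) + ENNReal.ofReal D *
      seedLaw P d I.b p {s | (iteration f I p s x).2 = true} := by
  classical
  have hD := t.D_pos
  have hA := t.epochRate_pos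
  have hV := t.V_nonneg
  have hb : (0 : ℝ) < I.b := by exact_mod_cast t.b_pos
  have hit := measurable_iteration_left h.measurable h.isSmooth I p x
  have hep := measurable_scsgEpoch_left h.measurable h.isSmooth I p.m₁ x
  have hFm : Measurable (objective P f) := h.isSmooth_objective.diff.continuous.measurable
  have hgm : Measurable (gradient (objective P f)) :=
    h.isSmooth_objective.diff_grad.continuous.measurable
  have hval : Measurable fun s : Seed Ξ d I.b p =>
      ENNReal.ofReal (objective P f (iteration f I p s x).1 - Fs) :=
    ((hFm.comp hit.fst).sub_const _).ennreal_ofReal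
  have hterm : MeasurableSet {s : Seed Ξ d I.b p | (iteration f I p s x).2 = true} :=
    measurableSet_eq_fun hit.snd measurable_const
  set ε := epochLaw P p.m₁ I.b with hε
  have hstep : ∀ e : EpochSeed Ξ p.m₁ I.b,
      ∫⁻ q, ENNReal.ofReal (objective P f (iteration f I p (e, q) x).1 - Fs) ∂(checkLaw P d p) +
        ENNReal.ofReal D ≤
      ENNReal.ofReal (objective P f (scsgEpoch f I e x) - Fs +
        epochRate I p.m₁ * ‖gradient (objective P f) (scsgEpoch f I e x)‖ ^ 2) +
      ENNReal.ofReal (epochRate I p.m₁ * (V / p.mc) + D / 4) + ENNReal.ofReal D *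
        checkLaw P d p (Prod.mk e ⁻¹' {s : Seed Ξ d I.b p | (iteration f I p s x).2 = true}) := by
    intro e
    have h1 := t.lintegral_check_le h hFs (scsgEpoch f I e x)
    have e1 : Prod.mk e ⁻¹' {s : Seed Ξ d I.b p | (iteration f I p s x).2 = true} =
        {q : CheckSeed Ξ d p | ‖gradient (batch f q.1) (scsgEpoch f I e x)‖ ≤ I.ε ∧
          curvatureVector f I p q.2 (scsgEpoch f I e x) = 0} := by
      ext q
      exact iteration_snd (e, q) x
    rw [e1]
    refine le_trans (le_of_eq ?_) h1
    congr 1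
    refine lintegral_congr fun q => ?_
    rw [iteration_fst]
    by_cases h2 : ‖gradient (batch f q.1) (scsgEpoch f I e x)‖ ≤ I.ε
    · have h3 : FirstOrderMet f I p (e, q) x := h2
      rw [if_pos h2, if_pos h3]
    · have h3 : ¬ FirstOrderMet f I p (e, q) x := h2
      rw [if_neg h2, if_neg h3]
  have hkey := lintegral_mono hstep (μ := ε)
  have hm1 : Measurable fun e : EpochSeed Ξ p.m₁ I.b =>
      ENNReal.ofReal (objective P f (scsgEpoch f I e x) - Fs +
        epochRate I p.m₁ * ‖gradient (objective P f) (scsgEpoch f I e x)‖ ^ 2) :=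
    (((hFm.comp hep).sub_const _).add
      (((hgm.comp hep).norm.pow_const 2).const_mul _)).ennreal_ofReal
  rw [lintegral_add_right _ measurable_const,
    lintegral_add_left (by exact hm1.add measurable_const), lintegral_add_right _ measurable_const,
    lintegral_const_mul' _ _ ENNReal.ofReal_ne_top] at hkey
  simp only [lintegral_const, measure_univ, mul_one] at hkey
  have hepoch := h.lintegral_scsgEpoch_le t.L₁_pos t.c'_pos t.c'_le hV hFs t.b_pos t.b_le x
  have hlaw : seedLaw P d I.b p = ε.prod (checkLaw P d p) := rfl
  rw [hlaw, lintegral_prod _ hval.aemeasurable, Measure.prod_apply hterm]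
  have hFx : 0 ≤ objective P f x - Fs := sub_nonneg.mpr (hFs x)
  have hsum : ENNReal.ofReal (objective P f x - Fs + epochRate I p.m₁ * (V / p.m₁)) +
      ENNReal.ofReal (epochRate I p.m₁ * (V / p.mc) + D / 4) ≤
      ENNReal.ofReal (objective P f x - Fs) + ENNReal.ofReal (D / 2) := by
    rw [← ENNReal.ofReal_add (by positivity) (by positivity),
      ← ENNReal.ofReal_add hFx (by positivity)]
    refine ENNReal.ofReal_le_ofReal ?_
    linarith [t.noise]
  have e2 : ENNReal.ofReal D = ENNReal.ofReal (D / 2) + ENNReal.ofReal (D / 2) := by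
    rw [← ENNReal.ofReal_add (by positivity) (by positivity), add_halves]
  -- Half of D is spent on the sampling noise and the failures of the curvature step; the other half
  -- remains as progress.
  refine (ENNReal.add_le_add_iff_right (ENNReal.ofReal_ne_top (r := D / 2))).mp ?_
  rw [add_assoc, ← e2]
  refine hkey.trans ?_
  calc _ ≤ ENNReal.ofReal (objective P f x - Fs + epochRate I p.m₁ * (V / p.m₁)) +
        ENNReal.ofReal (epochRate I p.m₁ * (V / p.mc) + D / 4) + ENNReal.ofReal D *
        ∫⁻ e, checkLaw P d p
          (Prod.mk e ⁻¹' {s : Seed Ξ d I.b p | (iteration f I p s x).2 = true}) ∂ε := by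
        gcongr
        exact hepoch
    _ ≤ ENNReal.ofReal (objective P f x - Fs) + ENNReal.ofReal (D / 2) + ENNReal.ofReal D *
        ∫⁻ e, checkLaw P d p
          (Prod.mk e ⁻¹' {s : Seed Ξ d I.b p | (iteration f I p s x).2 = true}) ∂ε := by
        gcongr
    _ = _ := by ring

/-- A measurable set of points that contains every point that is not an approximate second-order
stationary point, and is returned with small probability only. -/
def suspicious (P : Measure Ξ) [IsProbabilityMeasure P] (f : E d → Ξ → ℝ) (I : Input) (p : Tuning)
    (δ : ℝ) : Set (E d) :=
  {y | 2 * I.ε < ‖gradient (objective P f) y‖} ∪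
    -- Phrased through the probability of u = 0 instead of `lambdaMin`, so that measurability
    -- follows from joint measurability of the procedure.
    {y | neonLaw P d p.m₂ {s | curvatureVector f I p s y = 0} ≤ ENNReal.ofReal (2 * δ)}

omit t in
lemma measurableSet_suspicious : MeasurableSet (suspicious P f I p δ) := by
  have hgm : Measurable (gradient (objective P f)) :=
    h.isSmooth_objective.diff_grad.continuous.measurable
  have h1 : MeasurableSet {q : NeonSeed Ξ d p.m₂ × E d | curvatureVector f I p q.1 q.2 = 0} :=
    measurableSet_eq_fun (measurable_curvatureVector h.measurable h.isSmooth I p) measurable_const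
  have h2 : Measurable fun y : E d =>
      neonLaw P d p.m₂ {s | curvatureVector f I p s y = 0} :=
    measurable_measure_prodMk_right h1
  exact (measurableSet_lt measurable_const hgm.norm).union (measurableSet_le h2 measurable_const)

lemma mem_suspicious {y : E d} (hy : ¬ IsSSP (objective P f) (2 * I.ε) (2 * I.γ) y) :
    y ∈ suspicious P f I p δ := by
  rw [IsSSP, not_and_or, not_le, not_le] at hy
  rcases hy with hy | hy
  · exact Or.inl hy
  · exact Or.inr (t.toNegCurvTuned.measure_curvatureVector_eq_zero_le h y hy.le)

/-- A returned point is the output y of the epoch. For y in the set, returning requires either that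
the check accepts a large gradient or that u = 0 where this is unlikely, and the randomness used
after the epoch is independent of y. -/
lemma measure_bad_return_le (x : E d) :
    seedLaw P d I.b p {s | (iteration f I p s x).2 = true ∧
      (iteration f I p s x).1 ∈ suspicious P f I p δ} ≤ ENNReal.ofReal (2 * δ) := by
  classical
  have hδ := t.δ_nonneg
  have hit := measurable_iteration_left h.measurable h.isSmooth I p x
  have hset : MeasurableSet {s : Seed Ξ d I.b p | (iteration f I p s x).2 = true ∧
      (iteration f I p s x).1 ∈ suspicious P f I p δ} :=
    measurableSet_and (measurableSet_eq_fun hit.snd measurable_const)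
      (hit.fst (measurableSet_suspicious h))
  have hlaw : seedLaw P d I.b p = (epochLaw P p.m₁ I.b).prod (checkLaw P d p) := rfl
  rw [hlaw, Measure.prod_apply hset]
  have hpt : ∀ e : EpochSeed Ξ p.m₁ I.b, checkLaw P d p
      (Prod.mk e ⁻¹' {s : Seed Ξ d I.b p | (iteration f I p s x).2 = true ∧
        (iteration f I p s x).1 ∈ suspicious P f I p δ}) ≤ ENNReal.ofReal (2 * δ) := by
    intro e
    set y := scsgEpoch f I e x with hy
    by_cases hsus : y ∈ suspicious P f I p δ
    · rcases hsus with hg | hu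
      · refine (measure_mono (t := {S : Fin p.mc → Ξ | ‖gradient (batch f S) y‖ ≤ I.ε} ×ˢ
          Set.univ) ?_).trans ?_
        · intro q hq
          exact ⟨((iteration_snd (e, q) x).mp hq.1).1, trivial⟩
        · unfold checkLaw
          rw [Measure.prod_prod, measure_univ, mul_one]
          exact (t.check y hg).trans (ENNReal.ofReal_le_ofReal (by linarith))
      · refine (measure_mono (t := Set.univ ×ˢ
          {s : NeonSeed Ξ d p.m₂ | curvatureVector f I p s y = 0}) ?_).trans ?_
        · intro q hq
          exact ⟨trivial, ((iteration_snd (e, q) x).mp hq.1).2⟩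
        · unfold checkLaw
          rw [Measure.prod_prod, measure_univ, one_mul]
          exact hu
    · have : Prod.mk e ⁻¹' {s : Seed Ξ d I.b p | (iteration f I p s x).2 = true ∧
          (iteration f I p s x).1 ∈ suspicious P f I p δ} = ∅ := by
        refine Set.eq_empty_of_forall_notMem fun q hq => hsus ?_
        obtain ⟨h1, h2⟩ := (iteration_snd (e, q) x).mp hq.1
        have h3 := hq.2
        rw [iteration_fst, if_pos h1, escape_of_eq_zero h2] at h3
        exact h3
      rw [this, measure_empty]
      exact zero_le
  refine (lintegral_mono hpt).trans ?_
  rw [lintegral_const, measure_univ, mul_one]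

omit t [IsProbabilityMeasure P] in
lemma measurable_iterationCost : Measurable fun q : E d × Seed Ξ d I.b p =>
    (iterationCost f I p q.2 q.1 : ℝ≥0∞) := by
  classical
  have h1 : Measurable fun q : E d × Seed Ξ d I.b p =>
      if FirstOrderMet f I p q.2 q.1 then neonCost I.kind p else 0 := by
    refine Measurable.ite ?_ measurable_const measurable_const
    exact measurable_swap (measurableSet_firstOrderMet h.measurable h.isSmooth I p)
  have h2 : Measurable fun q : E d × Seed Ξ d I.b p => epochCost q.2.1 := by
    unfold epochCost
    fun_prop
  have h3 : Measurable fun q : E d × Seed Ξ d I.b p => iterationCost f I p q.2 q.1 := by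
    unfold iterationCost
    convert (h2.add_const p.mc).add h1 using 2 with q
    rfl
  exact (measurable_from_top (f := fun n : ℕ => (n : ℝ≥0∞))).comp h3

omit h in
lemma lintegral_iterationCost_le (x : E d) :
    ∫⁻ s, (iterationCost f I p s x : ℝ≥0∞) ∂(seedLaw P d I.b p) ≤
      ENNReal.ofReal (3 * p.m₁ + p.mc + neonCost I.kind p) := by
  have hm1 : Measurable fun e : EpochSeed Ξ p.m₁ I.b => (epochCost e : ℝ≥0∞) := by
    have : Measurable fun e : EpochSeed Ξ p.m₁ I.b => epochCost e := by
      unfold epochCost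
      fun_prop
    exact (measurable_from_top (f := fun n : ℕ => (n : ℝ≥0∞))).comp this
  have hm2 : Measurable fun s : Seed Ξ d I.b p => (epochCost s.1 : ℝ≥0∞) :=
    hm1.comp measurable_fst
  have h1 : ∫⁻ s, (epochCost s.1 : ℝ≥0∞) ∂(seedLaw P d I.b p) ≤ ENNReal.ofReal (3 * p.m₁) := by
    refine le_trans (le_of_eq ?_) (lintegral_epochCost_le (P := P) t.b_pos
      (t.b_pos.trans_le t.b_le))
    unfold seedLaw
    rw [lintegral_prod _ hm2.aemeasurable]
    simp
  calc _ ≤ ∫⁻ s, ((epochCost s.1 : ℝ≥0∞) + ((p.mc : ℝ≥0∞) + neonCost I.kind p))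
          ∂(seedLaw P d I.b p) := by
        refine lintegral_mono fun s => ?_
        unfold iterationCost
        push_cast
        rw [add_assoc]
        gcongr
        split_ifs <;> simp
    _ ≤ ENNReal.ofReal (3 * p.m₁) + ((p.mc : ℝ≥0∞) + neonCost I.kind p) := by
        rw [lintegral_add_right _ measurable_const, lintegral_const, measure_univ, mul_one]
        gcongr
    _ = _ := by
        rw [add_assoc, ENNReal.ofReal_add (by positivity) (by positivity),
          ENNReal.ofReal_add (by positivity) (by positivity), ENNReal.ofReal_natCast,
          ENNReal.ofReal_natCast]

end IterationTuned

end IterationBounds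

end NeonSCSG

end

noncomputable section

namespace NeonSCSG

variable {d : ℕ} {Ξ : Type*}

/-! ### The whole run -/

section Run

variable [MeasurableSpace Ξ] {P : Measure Ξ} [IsProbabilityMeasure P] {f : E d → Ξ → ℝ}
  {x₁ : E d} {I : Input} {p : Tuning} {G V Δ σ s₀ δ D : ℝ}

lemma measurable_comp₂ {α β γ Ω : Type*} [MeasurableSpace α] [MeasurableSpace β]
    [MeasurableSpace γ] [MeasurableSpace Ω] (F : α → β → γ)
    (hF : Measurable fun q : α × β => F q.1 q.2) {a : Ω → α} {b : Ω → β} (ha : Measurable a)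
    (hb : Measurable b) : Measurable fun ω => F (a ω) (b ω) := hF.comp (ha.prodMk hb)

/-- The transition of the run. -/
def transition (f : E d → Ξ → ℝ) (I : Input) (p : Tuning) (s : Seed Ξ d I.b p) (q : E d × Bool) :
    E d × Bool := if q.2 then q else iteration f I p s q.1

omit [MeasurableSpace Ξ] in
lemma run_eq_chain (x₁ : E d) (ω : ℕ → Seed Ξ d I.b p) (j : ℕ) :
    run f I p x₁ ω j = chain (transition f I p) (x₁, false) ω j := by
  induction j with
  | zero => rfl
  | succ j ih => rw [run, chain, ← ih]; rfl

lemma measurable_transition {L₁ L₂ : ℝ} (hm : ∀ x, Measurable (f x))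
    (hf : ∀ ξ, IsSmooth (fun x => f x ξ) L₁ L₂) (I : Input) (p : Tuning) :
    Measurable (Function.uncurry (transition f I p)) := by
  have h1 : Measurable fun q : Seed Ξ d I.b p × (E d × Bool) => iteration f I p q.1 q.2.1 :=
    measurable_comp₂ (fun s x => iteration f I p s x) (measurable_iteration hm hf I p)
      (by fun_prop) (by fun_prop)
  have h2 : MeasurableSet {q : Seed Ξ d I.b p × (E d × Bool) | q.2.2 = true} :=
    measurableSet_eq_fun (by fun_prop) measurable_const
  exact Measurable.ite h2 measurable_snd h1

namespace IterationTuned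

variable (t : IterationTuned P f I p σ s₀ δ V D) (h : Assumptions P f x₁ I.L₁ I.L₂ G V Δ)
include t h

/-- The set of states in which the run has not terminated. -/
def active (d : ℕ) : Set (E d × Bool) := {q | q.2 = false}

omit t h in
lemma measurableSet_active : MeasurableSet (active d) :=
  measurableSet_eq_fun measurable_snd measurable_const

/-- The potential adds D while the run is active. Returning releases this D, which matches the term
D · P(return) in the bound for an iteration; what is left is a drift of D/2 per active iteration. -/
lemma lintegral_transition_le {Fs : ℝ} (hFs : ∀ z, Fs ≤ objective P f z) (q : E d × Bool) :
    ∫⁻ s, (ENNReal.ofReal (objective P f (transition f I p s q).1 - Fs) +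
        ENNReal.ofReal D * (active d).indicator 1 (transition f I p s q)) ∂(seedLaw P d I.b p) +
      ENNReal.ofReal (D / 2) * (active d).indicator 1 q ≤
    ENNReal.ofReal (objective P f q.1 - Fs) + ENNReal.ofReal D * (active d).indicator 1 q := by
  obtain ⟨x, b⟩ := q
  cases b
  · have hmem : ((x, false) : E d × Bool) ∈ active d := rfl
    have e : ∀ s, transition f I p s (x, false) = iteration f I p s x := fun s => rfl
    have hit := measurable_iteration_left h.measurable h.isSmooth I p x
    have hFm : Measurable (objective P f) := h.isSmooth_objective.diff.continuous.measurable
    have hterm : MeasurableSet {s : Seed Ξ d I.b p | (iteration f I p s x).2 = true} :=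
      measurableSet_eq_fun hit.snd measurable_const
    have hind : ∀ s, (active d).indicator (1 : E d × Bool → ℝ≥0∞) (iteration f I p s x) =
        {s : Seed Ξ d I.b p | (iteration f I p s x).2 = true}ᶜ.indicator 1 s := by
      intro s
      by_cases hs : (iteration f I p s x).2 = true
      · have h1 : iteration f I p s x ∉ active d := by simp [active, hs]
        have h2 : s ∉ {s : Seed Ξ d I.b p | (iteration f I p s x).2 = true}ᶜ := by simp [hs]
        rw [Set.indicator_of_notMem h1, Set.indicator_of_notMem h2]
      · have h1 : iteration f I p s x ∈ active d := by simpa [active] using hs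
        have h2 : s ∈ {s : Seed Ξ d I.b p | (iteration f I p s x).2 = true}ᶜ := hs
        rw [Set.indicator_of_mem h1, Set.indicator_of_mem h2, Pi.one_apply, Pi.one_apply]
    simp_rw [e, hind]
    rw [Set.indicator_of_mem hmem, Pi.one_apply, mul_one, mul_one,
      lintegral_add_left (by exact ((hFm.comp hit.fst).sub_const _).ennreal_ofReal),
      lintegral_const_mul' _ _ ENNReal.ofReal_ne_top, lintegral_indicator_one hterm.compl]
    have hsum : seedLaw P d I.b p {s | (iteration f I p s x).2 = true} +
        seedLaw P d I.b p {s | (iteration f I p s x).2 = true}ᶜ = 1 := by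
      rw [measure_add_measure_compl hterm, measure_univ]
    have key := t.lintegral_iteration_le h hFs x
    calc _ = (∫⁻ s, ENNReal.ofReal (objective P f (iteration f I p s x).1 - Fs)
            ∂(seedLaw P d I.b p) + ENNReal.ofReal (D / 2)) +
            ENNReal.ofReal D * seedLaw P d I.b p {s | (iteration f I p s x).2 = true}ᶜ := by ring
      _ ≤ ENNReal.ofReal (objective P f x - Fs) + ENNReal.ofReal D *
            seedLaw P d I.b p {s | (iteration f I p s x).2 = true} +
            ENNReal.ofReal D * seedLaw P d I.b p {s | (iteration f I p s x).2 = true}ᶜ := by gcongr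
      _ = _ := by rw [add_assoc, ← mul_add, hsum, mul_one]
  · have hmem : ((x, true) : E d × Bool) ∉ active d := by simp [active]
    have e : ∀ s, transition f I p s (x, true) = (x, true) := fun s => rfl
    simp_rw [e]
    rw [Set.indicator_of_notMem hmem]
    simp

/-- The expected number of iterations. -/
lemma tsum_measure_active_le :
    ∑' j, runLaw P d I.b p {ω | (run f I p x₁ ω j).2 = false} ≤ ENNReal.ofReal (2 * Δ / D + 2) := by
  have hD := t.D_pos
  have hΔ : 0 ≤ Δ := by simpa using h.initial_gap x₁
  set Fs := objective P f x₁ - Δ with hFs_def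
  have hFs : ∀ z, Fs ≤ objective P f z := fun z => by linarith [h.initial_gap z]
  have hT := measurable_transition h.measurable h.isSmooth I p
  have hFm : Measurable (objective P f) := h.isSmooth_objective.diff.continuous.measurable
  set c : (ℕ → Seed Ξ d I.b p) → ℕ → E d × Bool :=
    fun ω j => chain (transition f I p) (x₁, false) ω j with hc
  have hcm : ∀ j, Measurable fun ω => c ω j := fun j =>
    (measurable_chain hT j).comp (measurable_const.prodMk measurable_id)
  set ν := runLaw P d I.b p with hν
  let val : E d × Bool → ℝ≥0∞ := fun q => ENNReal.ofReal (objective P f q.1 - Fs) +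
    ENNReal.ofReal D * (active d).indicator 1 q
  have hone : Measurable ((active d).indicator (1 : E d × Bool → ℝ≥0∞)) :=
    measurable_one.indicator measurableSet_active
  have hval : Measurable val :=
    ((hFm.comp measurable_fst).sub_const _).ennreal_ofReal.add (hone.const_mul _)
  have hact : ∀ j, ν {ω | (run f I p x₁ ω j).2 = false} =
      ∫⁻ ω, (active d).indicator 1 (c ω j) ∂ν := fun j => by
    have hset : MeasurableSet ((fun ω => c ω j) ⁻¹' active d) := hcm j measurableSet_active
    have e1 : ∀ ω, (active d).indicator (1 : E d × Bool → ℝ≥0∞) (c ω j) =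
        ((fun ω => c ω j) ⁻¹' active d).indicator 1 ω := fun ω => rfl
    simp_rw [e1]
    rw [lintegral_indicator_one hset]
    congr 1
    ext ω
    change (run f I p x₁ ω j).2 = false ↔ (c ω j).2 = false
    rw [run_eq_chain]
  have hstep : ∀ j, ∫⁻ ω, val (c ω (j + 1)) ∂ν +
      ENNReal.ofReal (D / 2) * ν {ω | (run f I p x₁ ω j).2 = false} ≤ ∫⁻ ω, val (c ω j) ∂ν := by
    intro j
    have h1 : ∫⁻ ω, val (c ω (j + 1)) ∂ν =
        ∫⁻ ω, ∫⁻ s, val (transition f I p s (c ω j)) ∂(seedLaw P d I.b p) ∂ν :=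
      lintegral_chain (seedLaw P d I.b p) hT (ψ := fun q s => val (transition f I p s q))
        (by exact hval.comp (hT.comp measurable_swap)) (x₁, false) j
    have hactm : Measurable fun ω => (active d).indicator (1 : E d × Bool → ℝ≥0∞) (c ω j) :=
      hone.comp (hcm j)
    rw [h1, hact, ← lintegral_const_mul' _ _ ENNReal.ofReal_ne_top,
      ← lintegral_add_right _ (hactm.const_mul _)]
    exact lintegral_mono fun ω => t.lintegral_transition_le h hFs (c ω j)
  have hpartial : ∀ K, ∫⁻ ω, val (c ω K) ∂ν + ENNReal.ofReal (D / 2) *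
      ∑ j ∈ Finset.range K, ν {ω | (run f I p x₁ ω j).2 = false} ≤ ENNReal.ofReal (Δ + D) := by
    intro K
    induction K with
    | zero =>
      have hmem : ((x₁, false) : E d × Bool) ∈ active d := rfl
      have e : ∀ ω, val (c ω 0) = ENNReal.ofReal (Δ + D) := fun ω => by
        change ENNReal.ofReal (objective P f x₁ - Fs) + ENNReal.ofReal D *
          (active d).indicator 1 (x₁, false) = _
        rw [Set.indicator_of_mem hmem, Pi.one_apply, mul_one, hFs_def, sub_sub_cancel,
          ENNReal.ofReal_add hΔ hD.le]
      simp_rw [e]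
      rw [lintegral_const, hν, runLaw, measure_univ]
      simp
    | succ K ih =>
      rw [Finset.sum_range_succ, mul_add, add_comm (ENNReal.ofReal (D / 2) * ∑ j ∈ _, _), ← add_assoc]
      exact (add_le_add_left (hstep K) _).trans ih
  refine ENNReal.tsum_le_of_sum_range_le fun K => ?_
  have h1 := le_add_self.trans (hpartial K)
  have hD2 : ENNReal.ofReal (D / 2) ≠ 0 := by simpa using hD
  calc _ ≤ ENNReal.ofReal (Δ + D) / ENNReal.ofReal (D / 2) := by
        rw [ENNReal.le_div_iff_mul_le (Or.inl hD2) (Or.inl ENNReal.ofReal_ne_top), mul_comm]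
        exact h1
    _ = _ := by
        rw [← ENNReal.ofReal_div_of_pos (by positivity)]
        congr 1
        field_simp

/-- The run terminates at an approximate second-order stationary point with high probability. -/
lemma measure_failure_le :
    runLaw P d I.b p {ω | ¬ ∃ y, Returns f I p x₁ ω y ∧
        IsSSP (objective P f) (2 * I.ε) (2 * I.γ) y} ≤
      ENNReal.ofReal ((2 * Δ / D + 2) * (2 * δ)) := by
  have hD := t.D_pos
  have hδ := t.δ_nonneg
  have hΔ : 0 ≤ Δ := by simpa using h.initial_gap x₁
  have hT := measurable_transition h.measurable h.isSmooth I p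
  set ν := runLaw P d I.b p with hν
  have hsum := t.tsum_measure_active_le h
  -- The probabilities of being active after j iterations are summable, so they tend to zero and the
  -- run returns almost surely.
  have hnt : ν {ω | ∀ j, (run f I p x₁ ω j).2 = false} = 0 := by
    have hlim := ENNReal.tendsto_atTop_zero_of_tsum_ne_top
      (hsum.trans_lt ENNReal.ofReal_lt_top).ne
    refine le_antisymm (ge_of_tendsto hlim (Filter.Eventually.of_forall fun j => ?_)) zero_le
    exact measure_mono fun ω hω => hω j
  -- A wrong result is produced in a single iteration, the one that returns, so a union over
  -- iterations covers it.
  let bad : ℕ → Set (ℕ → Seed Ξ d I.b p) := fun j =>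
    {ω | (run f I p x₁ ω j).2 = false ∧ (iteration f I p (ω j) (run f I p x₁ ω j).1).2 = true ∧
      (iteration f I p (ω j) (run f I p x₁ ω j).1).1 ∈ suspicious P f I p δ}
  have hsub : {ω | ¬ ∃ y, Returns f I p x₁ ω y ∧
      IsSSP (objective P f) (2 * I.ε) (2 * I.γ) y} ⊆
      {ω | ∀ j, (run f I p x₁ ω j).2 = false} ∪ ⋃ j, bad j := by
    classical
    intro ω hω
    by_cases hall : ∀ j, (run f I p x₁ ω j).2 = false
    · exact Or.inl hall
    · right
      have hex : ∃ j, (run f I p x₁ ω j).2 = true := by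
        simpa using hall
      obtain ⟨k, hk⟩ : ∃ k, Nat.find hex = k + 1 := by
        refine Nat.exists_eq_succ_of_ne_zero fun h0 => ?_
        have := Nat.find_spec hex
        rw [h0] at this
        exact Bool.false_ne_true this
      have hk1 : (run f I p x₁ ω (k + 1)).2 = true := hk ▸ Nat.find_spec hex
      have hk0 : (run f I p x₁ ω k).2 = false := by
        have := Nat.find_min hex (m := k) (by omega)
        simpa using this
      have hrun : run f I p x₁ ω (k + 1) = iteration f I p (ω k) (run f I p x₁ ω k).1 := by
        rw [run]
        simp [hk0]
      rw [hrun] at hk1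
      refine Set.mem_iUnion.mpr ⟨k, hk0, hk1, t.mem_suspicious h fun hssp => hω ⟨_, ⟨k + 1, ?_⟩, hssp⟩⟩
      rw [hrun]
      exact Prod.ext rfl hk1
  -- Seed j is independent of the state before iteration j. Keeping the factor P(active) makes the
  -- union bound cost the expected number of iterations.
  have hbad : ∀ j, ν (bad j) ≤
      ν {ω | (run f I p x₁ ω j).2 = false} * ENNReal.ofReal (2 * δ) := by
    intro j
    set c : (ℕ → Seed Ξ d I.b p) → E d × Bool :=
      fun ω => chain (transition f I p) (x₁, false) ω j with hc
    have hcm : Measurable c := (measurable_chain hT j).comp (measurable_const.prodMk measurable_id)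
    let A : Set ((E d × Bool) × Seed Ξ d I.b p) := {r | r.1.2 = false ∧
      (iteration f I p r.2 r.1.1).2 = true ∧ (iteration f I p r.2 r.1.1).1 ∈ suspicious P f I p δ}
    have hit : Measurable fun r : (E d × Bool) × Seed Ξ d I.b p => iteration f I p r.2 r.1.1 :=
      measurable_comp₂ (fun s x => iteration f I p s x)
        (measurable_iteration h.measurable h.isSmooth I p) (by fun_prop) (by fun_prop)
    have hA : MeasurableSet A :=
      measurableSet_and (measurableSet_eq_fun (by fun_prop) measurable_const)
        (measurableSet_and (measurableSet_eq_fun hit.snd measurable_const)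
          (hit.fst (measurableSet_suspicious h)))
    have hset : MeasurableSet {ω | (c ω, ω j) ∈ A} :=
      (hcm.prodMk (measurable_pi_apply j)) hA
    have e1 : bad j = {ω | (c ω, ω j) ∈ A} := by
      ext ω
      simp only [bad, A, hc, run_eq_chain]
      rfl
    have e2 : {ω | (run f I p x₁ ω j).2 = false} = c ⁻¹' active d := by
      ext ω
      change (run f I p x₁ ω j).2 = false ↔ (c ω).2 = false
      rw [run_eq_chain]
    have h1 := lintegral_chain (seedLaw P d I.b p) hT (ψ := fun q s => A.indicator 1 (q, s))
      (by exact measurable_one.indicator hA) (x₁, false) j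
    have h2 : ν (bad j) = ∫⁻ ω, A.indicator 1 (c ω, ω j) ∂ν := by
      rw [e1, ← lintegral_indicator_one hset]
      rfl
    have hactset : MeasurableSet (c ⁻¹' active d) := hcm measurableSet_active
    rw [h2, e2, ← lintegral_indicator_one hactset, ← lintegral_mul_const' _ _ ENNReal.ofReal_ne_top]
    refine (le_of_eq h1).trans (lintegral_mono fun ω => ?_)
    change ∫⁻ s, A.indicator 1 (c ω, s) ∂(seedLaw P d I.b p) ≤ _
    by_cases hω : c ω ∈ active d
    · rw [Set.indicator_of_mem (show ω ∈ c ⁻¹' active d from hω), Pi.one_apply, one_mul]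
      refine le_trans ?_ (t.measure_bad_return_le h (c ω).1)
      rw [← lintegral_indicator_one]
      · refine lintegral_mono fun s => ?_
        by_cases hs : (c ω, s) ∈ A
        · rw [Set.indicator_of_mem hs]
          rw [Set.indicator_of_mem (show s ∈ {s : Seed Ξ d I.b p |
            (iteration f I p s (c ω).1).2 = true ∧
              (iteration f I p s (c ω).1).1 ∈ suspicious P f I p δ} from hs.2)]
          rfl
        · rw [Set.indicator_of_notMem hs]
          exact zero_le
      · have hil := measurable_iteration_left h.measurable h.isSmooth I p (c ω).1
        exact measurableSet_and (measurableSet_eq_fun hil.snd measurable_const)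
          (hil.fst (measurableSet_suspicious h))
    · have hz : ∀ s, A.indicator (1 : (E d × Bool) × Seed Ξ d I.b p → ℝ≥0∞) (c ω, s) = 0 := fun s =>
        Set.indicator_of_notMem (fun hs => hω hs.1) _
      simp_rw [hz]
      simp
  calc _ ≤ ν {ω | ∀ j, (run f I p x₁ ω j).2 = false} + ∑' j, ν (bad j) :=
        (measure_mono hsub).trans ((measure_union_le _ _).trans (by gcongr; exact measure_iUnion_le _))
    _ ≤ ∑' j, ν {ω | (run f I p x₁ ω j).2 = false} * ENNReal.ofReal (2 * δ) := by
        rw [hnt, zero_add]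
        exact ENNReal.tsum_le_tsum hbad
    _ ≤ _ := by
        rw [ENNReal.tsum_mul_right, ENNReal.ofReal_mul (p := 2 * Δ / D + 2) (by positivity)]
        exact mul_le_mul_left hsum _

/-- The expected total complexity of the run. -/
lemma lintegral_totalCost_le :
    ∫⁻ ω, totalCost f I p x₁ ω ∂(runLaw P d I.b p) ≤
      ENNReal.ofReal ((2 * Δ / D + 2) * (3 * p.m₁ + p.mc + neonCost I.kind p)) := by
  have hD := t.D_pos
  have hΔ : 0 ≤ Δ := by simpa using h.initial_gap x₁
  have hT := measurable_transition h.measurable h.isSmooth I p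
  have hcost := measurable_iterationCost (p := p) h
  set ν := runLaw P d I.b p with hν
  let ψ : E d × Bool → Seed Ξ d I.b p → ℝ≥0∞ := fun q s =>
    if q.2 then 0 else (iterationCost f I p s q.1 : ℝ≥0∞)
  have hψ : Measurable (Function.uncurry ψ) := by
    refine Measurable.ite (measurableSet_eq_fun (by fun_prop) measurable_const) measurable_const ?_
    exact measurable_comp₂ (fun x s => (iterationCost f I p s x : ℝ≥0∞)) hcost
      (by fun_prop) (by fun_prop)
  have hcm : ∀ j, Measurable fun ω : ℕ → Seed Ξ d I.b p =>
      chain (transition f I p) (x₁, false) ω j := fun j =>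
    (measurable_chain hT j).comp (measurable_const.prodMk measurable_id)
  have e : ∀ ω, totalCost f I p x₁ ω =
      ∑' j, ψ (chain (transition f I p) (x₁, false) ω j) (ω j) := fun ω => by
    unfold totalCost
    simp_rw [run_eq_chain]
    rfl
  simp_rw [e]
  rw [lintegral_tsum fun j => by exact (hψ.comp ((hcm j).prodMk (measurable_pi_apply j))).aemeasurable]
  -- Wald's argument: the conditional cost of an iteration is bounded whatever the state, and it is
  -- only incurred while the run is active.
  have hj : ∀ j, ∫⁻ ω, ψ (chain (transition f I p) (x₁, false) ω j) (ω j) ∂ν ≤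
      ν {ω | (run f I p x₁ ω j).2 = false} *
        ENNReal.ofReal (3 * p.m₁ + p.mc + neonCost I.kind p) := by
    intro j
    have h1 := lintegral_chain (seedLaw P d I.b p) hT hψ (x₁, false) j
    have hset : MeasurableSet {ω | (run f I p x₁ ω j).2 = false} := by
      simp_rw [run_eq_chain]
      exact hcm j measurableSet_active
    rw [← lintegral_indicator_one hset, ← lintegral_mul_const' _ _ ENNReal.ofReal_ne_top]
    refine (le_of_eq h1).trans (lintegral_mono fun ω => ?_)
    rcases hb : (run f I p x₁ ω j).2 with _ | _
    · rw [Set.indicator_of_mem (show ω ∈ {ω | (run f I p x₁ ω j).2 = false} from hb), Pi.one_apply,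
        one_mul]
      rw [run_eq_chain] at hb
      simp only [ψ, hb]
      exact t.lintegral_iterationCost_le _
    · rw [run_eq_chain] at hb
      simp [ψ, hb]
  calc _ ≤ ∑' j, ν {ω | (run f I p x₁ ω j).2 = false} *
        ENNReal.ofReal (3 * p.m₁ + p.mc + neonCost I.kind p) := ENNReal.tsum_le_tsum hj
    _ ≤ _ := by
        rw [ENNReal.tsum_mul_right, ENNReal.ofReal_mul (by positivity)]
        gcongr
        exact t.tsum_measure_active_le h

end IterationTuned

end Run

end NeonSCSG

end

noncomputable section

namespace NeonSCSG

variable {d : ℕ} {Ξ : Type*}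

/-! ### The tuning of NEON and NEON⁺ -/

lemma exp_half_le_one_add {a : ℝ} (ha : 0 ≤ a) (ha1 : a ≤ 1) : Real.exp (a / 2) ≤ 1 + a := by
  have h1 := (abs_le.mp (Real.abs_exp_sub_one_sub_id_le
    (x := a / 2) (by rw [abs_of_nonneg (by positivity)]; linarith))).2
  nlinarith

/-- The number of iterations after which a factor `1 + a` has grown to more than `exp (4 X)`. -/
def growthTime (a X : ℝ) : ℕ := ⌈8 * X / a⌉₊

lemma growthTime_pos {a X : ℝ} (ha : 0 < a) (hX : 1 ≤ X) : 0 < growthTime a X :=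
  Nat.ceil_pos.mpr (by positivity)

lemma growthTime_le {a X : ℝ} (ha : 0 < a) (ha1 : a ≤ 1) (hX : 1 ≤ X) :
    (growthTime a X : ℝ) ≤ 9 * X / a := by
  have h1 := (Nat.ceil_lt_add_one (by positivity : 0 ≤ 8 * X / a)).le
  have h2 : 1 ≤ X / a := by rw [le_div_iff₀ ha]; linarith
  have h3 : 9 * X / a = 8 * X / a + X / a := by ring
  unfold growthTime
  linarith

/-- The left side is at most X · (10Q/a) ≤ exp (4X). The right side exceeds exp ((t + 1) a/2), and t
≥ 8X/a. -/
lemma mul_lt_growth {a X Q : ℝ} (ha : 0 < a) (ha1 : a ≤ 1) (hX : 1 ≤ X) (hQ : 0 ≤ Q)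
    (h : 10 * Q / a ≤ Real.exp (3 * X)) :
    ((growthTime a X : ℝ) + 1) * Q < (1 + a) ^ (growthTime a X + 1) := by
  set t := growthTime a X with ht
  have h1 : 8 * X / a ≤ t := Nat.le_ceil _
  have h2 : (t : ℝ) + 1 ≤ 10 * X / a := by
    have h3 := growthTime_le ha ha1 hX
    have h4 : 1 ≤ X / a := by rw [le_div_iff₀ ha]; linarith
    have h5 : 10 * X / a = 9 * X / a + X / a := by ring
    linarith
  have hexp : Real.exp (4 * X) < (1 + a) ^ (t + 1) := by
    calc Real.exp (4 * X) < Real.exp ((t + 1 : ℕ) * (a / 2)) := by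
          rw [Real.exp_lt_exp]
          rw [div_le_iff₀ ha] at h1
          push_cast
          nlinarith
      _ = Real.exp (a / 2) ^ (t + 1) := Real.exp_nat_mul _ _
      _ ≤ (1 + a) ^ (t + 1) := by
          gcongr
          exact exp_half_le_one_add ha.le ha1
  refine lt_of_le_of_lt ?_ hexp
  calc ((t : ℝ) + 1) * Q ≤ 10 * X / a * Q := by gcongr
    _ = X * (10 * Q / a) := by ring
    _ ≤ Real.exp X * Real.exp (3 * X) := by
        gcongr
        have := Real.add_one_le_exp X
        linarith
    _ = Real.exp (4 * X) := by rw [← Real.exp_add]; ring_nf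

/-- The curvature `σ` that both procedures certify. -/
def certified (γ X : ℝ) : ℝ := γ / (409600 * X ^ 2)

/-- The truncation radius `U` and the other parameters for a growth rate `a`. -/
def neonTuning (L₁ L₂ γ X a : ℝ) (k d m₁ mc m₂ : ℕ) (ζ : ℝ) : Tuning where
  m₁ := m₁
  mc := mc
  m₂ := m₂
  t := growthTime a X
  -- The Lipschitz constant is relaxed to L₁ + 1, which keeps ηγ below 1 even for small L₁.
  η := 1 / (L₁ + 1)
  -- For k = 2 this makes `√(6 * η * 𝓕)` equal to U/(4(t + 1)), so that t + 1 short steps of NEON⁺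
  -- cover at most U/4.
  𝓕 := (L₁ + 1) * (γ / 2 * (Real.exp (-X) / (12 * d)) /
    (64 * ((growthTime a X : ℝ) + 1) ^ 2 * L₂)) ^ 2 / (96 * ((growthTime a X : ℝ) + 1) ^ k)
  -- U is proportional to the slab width s₀ = exp (-X)/(12d), so that the nonlinear error L₂U² stays
  -- below (γ/2) r s₀ for the smallest noise component that has to be detected.
  U := γ / 2 * (Real.exp (-X) / (12 * d)) / (64 * ((growthTime a X : ℝ) + 1) ^ 2 * L₂)
  r := γ / 2 * (Real.exp (-X) / (12 * d)) / (64 * ((growthTime a X : ℝ) + 1) ^ 2 * L₂) /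
    (10 * ((growthTime a X : ℝ) + 1))
  ζ := ζ
  c := 2 * certified γ X / γ

section Neon

variable {L₁ L₂ γ X : ℝ}

/-- The growth rate of NEON. -/
def gradientRate (L₁ γ : ℝ) : ℝ := γ / (4 * (L₁ + 1))

/-- The square root of the growth rate of NEON, on which the momentum of NEON⁺ depends. -/
def momentumRate (L₁ γ : ℝ) : ℝ := √(γ / (4 * (L₁ + 1)))

lemma gradientRate_pos (hL₁ : 0 < L₁) (hγ : 0 < γ) : 0 < gradientRate L₁ γ := by
  unfold gradientRate; positivity

lemma gradientRate_le (hL₁ : 0 < L₁) (hγ1 : γ < 1) : gradientRate L₁ γ ≤ 1 / 4 := by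
  unfold gradientRate
  rw [div_le_div_iff₀ (by positivity) (by norm_num)]
  linarith

lemma momentumRate_sq (hL₁ : 0 < L₁) (hγ : 0 < γ) :
    momentumRate L₁ γ ^ 2 = gradientRate L₁ γ :=
  Real.sq_sqrt (gradientRate_pos hL₁ hγ).le

lemma momentumRate_pos (hL₁ : 0 < L₁) (hγ : 0 < γ) : 0 < momentumRate L₁ γ :=
  Real.sqrt_pos.mpr (gradientRate_pos hL₁ hγ)

lemma momentumRate_le (hL₁ : 0 < L₁) (hγ : 0 < γ) (hγ1 : γ < 1) : momentumRate L₁ γ ≤ 1 / 2 := by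
  have h1 := momentumRate_sq hL₁ hγ
  have h2 := gradientRate_le hL₁ hγ1
  have h3 := momentumRate_pos hL₁ hγ
  nlinarith

section Spec

variable {a s₀ : ℝ} {k m₁ mc m₂ : ℕ} {ζ : ℝ}

/-- The facts about the parameters that both procedures use. -/
lemma neonTuning_facts (hL₂ : 0 < L₂) (hγ : 0 < γ) (hγ1 : γ < 1) (hd : 0 < d)
    (hX : 1 ≤ X) (p : Tuning) (hp : p = neonTuning L₁ L₂ γ X a k d m₁ mc m₂ ζ)
    (hs₀ : s₀ = Real.exp (-X) / (12 * d)) :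
    p.t = growthTime a X ∧ p.η = 1 / (L₁ + 1) ∧ 0 < p.U ∧
      p.𝓕 = (L₁ + 1) * p.U ^ 2 / (96 * ((p.t : ℝ) + 1) ^ k) ∧
      p.r = p.U / (10 * ((p.t : ℝ) + 1)) ∧ 0 < s₀ ∧ s₀ ≤ 1 ∧
      L₂ * p.U = γ / 2 * s₀ / (64 * ((p.t : ℝ) + 1) ^ 2) := by
  have hd' : (1 : ℝ) ≤ d := by exact_mod_cast hd
  have hs : 0 < s₀ := by rw [hs₀]; positivity
  have hs1 : s₀ ≤ 1 := by
    rw [hs₀, div_le_one (by positivity)]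
    have : Real.exp (-X) ≤ 1 := Real.exp_le_one_iff.mpr (by linarith)
    linarith
  subst hp
  refine ⟨rfl, rfl, ?_, rfl, rfl, hs, hs1, ?_⟩
  · simp only [neonTuning]
    positivity
  · simp only [neonTuning, hs₀]
    field_simp

lemma L₂_mul_U_le (hγ1 : γ < 1) {T U : ℝ} (hT : 1 ≤ T) (hs1 : s₀ ≤ 1) (hs : 0 < s₀)
    (hU : L₂ * U = γ / 2 * s₀ / (64 * T ^ 2)) : L₂ * U ≤ 1 / (128 * T ^ 2) := by
  rw [hU, div_le_div_iff₀ (by positivity) (by positivity)]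
  have : γ / 2 * s₀ ≤ 1 / 2 * 1 := by gcongr
  nlinarith [sq_nonneg T]

lemma one_div_sq_le {T : ℝ} (hT : 1 ≤ T) : 1 / (64 * T ^ 2) ≤ 1 / (10 * T) := by
  apply one_div_le_one_div_of_le (by positivity)
  nlinarith

/-- By the choice of the threshold, 3𝓕/U² = (L₁ + 1)/(32Q), and 409600 = 2 · 32 · 6400. Here Q is t
+ 1 for NEON and its square for NEON⁺. In both cases Q is at most of order X²/γ, so both procedures
certify the same curvature. -/
lemma two_mul_certified_le (hL₁ : 0 < L₁) (hγ : 0 < γ) (hX : 1 ≤ X) {U 𝓕 Q : ℝ} (hU : 0 < U)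
    (hQ : 0 < Q) (hF : 𝓕 = (L₁ + 1) * U ^ 2 / (96 * Q)) (hQle : Q ≤ 6400 * (L₁ + 1) * X ^ 2 / γ) :
    2 * certified γ X ≤ 3 * 𝓕 / U ^ 2 := by
  have e : 3 * 𝓕 / U ^ 2 = (L₁ + 1) / (32 * Q) := by
    rw [hF]; field_simp; norm_num
  rw [e, certified, ← mul_div_assoc, div_le_div_iff₀ (by positivity) (by positivity)]
  rw [le_div_iff₀ hγ] at hQle
  nlinarith [sq_nonneg X]

lemma certified_pos (hγ : 0 < γ) (hX : 1 ≤ X) : 0 < certified γ X := by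
  unfold certified; positivity

lemma certified_le (hγ : 0 < γ) (hX : 1 ≤ X) : certified γ X ≤ γ / 409600 := by
  unfold certified
  gcongr
  nlinarith

/-- Soundness: a returned point has residual at most -2.5𝓕, and L₂U³ is small against 𝓕.
Completeness: `neon_ne_zero` with α = r s₀, where the growth over t + 1 steps beats U/(r s₀). -/
lemma neonSpec_neon {I : Input} (hkind : I.kind = .neon) (hL₁ : 0 < I.L₁) (hL₂ : 0 < I.L₂)
    (hIγ : I.γ = γ / 2) (hγ : 0 < γ) (hγ1 : γ < 1) (hd : 0 < d) (hX : 1 ≤ X)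
    (hbig : 100000 * (I.L₁ + 1) * d / γ ≤ Real.exp X) (m₁ mc m₂ : ℕ) (ζ : ℝ) :
    NeonSpec d I (neonTuning I.L₁ I.L₂ γ X (gradientRate I.L₁ γ) 1 d m₁ mc m₂ ζ) (certified γ X)
      (Real.exp (-X) / (12 * d)) := by
  set a := gradientRate I.L₁ γ with ha_def
  have ha := gradientRate_pos hL₁ hγ
  have ha4 := gradientRate_le hL₁ hγ1
  rw [← ha_def] at ha ha4
  obtain ⟨p, hp⟩ : ∃ p, p = neonTuning I.L₁ I.L₂ γ X a 1 d m₁ mc m₂ ζ := ⟨_, rfl⟩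
  obtain ⟨s₀, hs₀⟩ : ∃ s, s = Real.exp (-X) / (12 * (d : ℝ)) := ⟨_, rfl⟩
  obtain ⟨ht, hη, hU, hF, hr, hs, hs1, hLU⟩ := neonTuning_facts hL₂ hγ hγ1 hd hX p hp hs₀
  rw [← hp, ← hs₀]
  rw [pow_one] at hF
  have hd' : (0 : ℝ) < d := by exact_mod_cast hd
  have ht0 : 0 < p.t := ht ▸ growthTime_pos ha hX
  have hgt := growthTime_le ha (by linarith) hX
  rw [← ht] at hgt
  set T : ℝ := (p.t : ℝ) + 1 with hT_def
  have hT1 : 1 ≤ T := by rw [hT_def]; linarith [(Nat.cast_nonneg p.t : (0 : ℝ) ≤ p.t)]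
  have htT : (p.t : ℝ) ≤ T := by rw [hT_def]; linarith
  have htpos : (0 : ℝ) < p.t := by exact_mod_cast ht0
  have hF0 : 0 < p.𝓕 := by rw [hF]; positivity
  have hr0 : 0 < p.r := by rw [hr]; positivity
  have hLU' := L₂_mul_U_le hγ1 hT1 hs1 hs hLU
  have hTle : T ≤ 6400 * (I.L₁ + 1) * X ^ 2 / γ := by
    have e1 : 9 * X / a = 36 * ((I.L₁ + 1) * X / γ) := by
      rw [ha_def, gradientRate]; field_simp; norm_num
    have e2 : 1 ≤ (I.L₁ + 1) * X / γ := by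
      rw [le_div_iff₀ hγ]; nlinarith
    have e3 : (I.L₁ + 1) * X / γ ≤ (I.L₁ + 1) * X ^ 2 / γ := by gcongr; nlinarith
    rw [e1] at hgt
    have e4 : 6400 * (I.L₁ + 1) * X ^ 2 / γ = 6400 * ((I.L₁ + 1) * X ^ 2 / γ) := by ring
    rw [e4, hT_def]
    linarith
  refine ⟨fun g y u₀ hg _ hne => ?_, fun g y u₀ v μ hg hv hHv hμ hu hinner => ?_⟩
  · unfold negCurv at hne ⊢
    rw [hkind] at hne ⊢
    dsimp only at hne ⊢
    obtain ⟨h1, h2⟩ := neon_spec hne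
    refine (curvature_of_residual_le hg hL₂.le hU hF0 h2 (by linarith) ?_).trans ?_
    · have e : I.L₂ * p.U ^ 3 = I.L₂ * p.U * p.U ^ 2 := by ring
      rw [e, hF]
      have h3 : 1 / (128 * T ^ 2) ≤ 3 * ((I.L₁ + 1) / (96 * T)) := by
        rw [← mul_div_assoc, div_le_div_iff₀ (by positivity) (by positivity)]
        nlinarith [mul_pos hL₁ (pow_pos (by linarith : 0 < T) 2)]
      calc I.L₂ * p.U * p.U ^ 2 ≤ 3 * ((I.L₁ + 1) / (96 * T)) * p.U ^ 2 := by
            exact mul_le_mul_of_nonneg_right (hLU'.trans h3) (sq_nonneg _)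
        _ = _ := by ring
    · have h3 := two_mul_certified_le hL₁ hγ hX hU (by linarith : 0 < T) hF hTle
      exact mul_le_mul_of_nonneg_right (neg_le_neg h3) (sq_nonneg _)
  · unfold negCurv
    rw [hkind]
    dsimp only
    have hg' := hg.mono (by linarith : I.L₁ ≤ I.L₁ + 1)
    refine neon_ne_zero hg' (γ := I.γ) (α := p.r * s₀) (r := p.r) (by rw [hη]; positivity)
      (by rw [hη]; field_simp; exact le_refl _) (by linarith) hv hμ (by rw [hIγ]; positivity) hL₂.le hHv
      (by positivity) hinner ?_ ?_ hU hF0 ht0 hu ?_ ?_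
    · have e : I.L₂ * p.U ^ 2 = I.L₂ * p.U * p.U := by ring
      rw [e, hLU, hr, hIγ]
      have h3 := one_div_sq_le hT1
      calc γ / 2 * s₀ / (64 * T ^ 2) * p.U = γ / 2 * s₀ * p.U * (1 / (64 * T ^ 2)) := by ring
        _ ≤ γ / 2 * s₀ * p.U * (1 / (10 * T)) := by gcongr
        _ = _ := by ring
    -- Q = 10/s₀ because U = T · (10/s₀) · (r s₀) with T = t + 1; this is the factor by which the
    -- component must grow to leave the ball.
    · have h3 := mul_lt_growth (Q := 10 / s₀) ha (by linarith) hX (by positivity) (by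
        have e1 : 10 * (10 / s₀) / a = 4800 * (I.L₁ + 1) * d / γ * Real.exp X := by
          rw [hs₀, ha_def, gradientRate, Real.exp_neg]; field_simp; norm_num
        rw [e1]
        have e2 : 4800 * (I.L₁ + 1) * d / γ ≤ 100000 * (I.L₁ + 1) * d / γ := by
          gcongr; norm_num
        calc 4800 * (I.L₁ + 1) * d / γ * Real.exp X ≤ Real.exp X * Real.exp X := by
              gcongr; exact e2.trans hbig
          _ ≤ Real.exp (3 * X) := by
              rw [← Real.exp_add]
              exact Real.exp_le_exp.mpr (by linarith))
      rw [← ht, ← hT_def] at h3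
      have e3 : p.η * I.γ / 2 = a := by rw [hη, hIγ, ha_def, gradientRate]; field_simp; norm_num
      rw [e3, hr]
      have e4 : p.U = T * (10 / s₀) * (p.U / (10 * T) * s₀) := by field_simp
      calc p.U = T * (10 / s₀) * (p.U / (10 * T) * s₀) := e4
        _ < (1 + a) ^ (p.t + 1) * (p.U / (10 * T) * s₀) := by gcongr
    · rw [hr, ← mul_div_assoc, div_le_iff₀ (by positivity)]
      have := mul_le_mul_of_nonneg_left hT1 hU.le
      linarith
    · have e1 : p.r ^ 2 = p.U ^ 2 / (100 * T ^ 2) := by rw [hr, div_pow, mul_pow]; norm_num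
      have e2 : 9 / 128 * p.U ^ 2 / (p.η * p.t) = 9 / 128 * ((I.L₁ + 1) * p.U ^ 2 / p.t) := by
        rw [hη]; field_simp
      rw [e1, e2, hF]
      have h3 : (I.L₁ + 1) * p.U ^ 2 / T ≤ (I.L₁ + 1) * p.U ^ 2 / p.t := by gcongr
      have h4 : (I.L₁ + 1) * p.U ^ 2 / T ^ 2 ≤ (I.L₁ + 1) * p.U ^ 2 / T := by
        gcongr
        exact le_self_pow₀ hT1 two_ne_zero
      have e3 : 2.5 * ((I.L₁ + 1) * p.U ^ 2 / (96 * T)) + (I.L₁ + 1) / 2 * (p.U ^ 2 / (100 * T ^ 2)) =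
          2.5 / 96 * ((I.L₁ + 1) * p.U ^ 2 / T) + 1 / 200 * ((I.L₁ + 1) * p.U ^ 2 / T ^ 2) := by
        field_simp
        ring
      have h5 : 0 ≤ (I.L₁ + 1) * p.U ^ 2 / p.t := by positivity
      rw [e3]
      norm_num
      linarith

/-- Besides points with small residual, NEON⁺ may return v - u at a firing test. This is a direction
of curvature at most -`I.γ`/2, far below the certified level. Completeness uses the growth rate a =
s/4, with s² = η`I.γ`/2 dictated by the momentum. -/
lemma neonSpec_neonPlus {I : Input} (hkind : I.kind = .neonPlus) (hL₁ : 0 < I.L₁)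
    (hL₂ : 0 < I.L₂) (hIγ : I.γ = γ / 2) (hγ : 0 < γ) (hγ1 : γ < 1) (hd : 0 < d) (hX : 1 ≤ X)
    (hbig : 100000 * (I.L₁ + 1) * d / γ ≤ Real.exp X) (m₁ mc m₂ : ℕ) :
    NeonSpec d I (neonTuning I.L₁ I.L₂ γ X (momentumRate I.L₁ γ / 4) 2 d m₁ mc m₂
      (1 - momentumRate I.L₁ γ)) (certified γ X) (Real.exp (-X) / (12 * d)) := by
  set s := momentumRate I.L₁ γ with hs_def
  have hsp := momentumRate_pos hL₁ hγ
  have hs2 := momentumRate_le hL₁ hγ hγ1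
  have hsq := momentumRate_sq hL₁ hγ
  rw [← hs_def] at hsp hs2 hsq
  obtain ⟨a, ha_def⟩ : ∃ a, a = s / 4 := ⟨_, rfl⟩
  have ha : 0 < a := by rw [ha_def]; positivity
  have ha8 : a ≤ 1 / 8 := by rw [ha_def]; linarith
  have hasq : a ^ 2 = γ / (64 * (I.L₁ + 1)) := by
    rw [ha_def, div_pow, hsq, gradientRate]; field_simp; norm_num
  rw [← ha_def]
  obtain ⟨p, hp⟩ : ∃ p, p = neonTuning I.L₁ I.L₂ γ X a 2 d m₁ mc m₂ (1 - s) := ⟨_, rfl⟩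
  obtain ⟨s₀, hs₀⟩ : ∃ s, s = Real.exp (-X) / (12 * (d : ℝ)) := ⟨_, rfl⟩
  obtain ⟨ht, hη, hU, hF, hr, hs, hs1, hLU⟩ := neonTuning_facts hL₂ hγ hγ1 hd hX p hp hs₀
  have hζ : p.ζ = 1 - s := by rw [hp]; rfl
  rw [← hp, ← hs₀]
  have hd' : (0 : ℝ) < d := by exact_mod_cast hd
  have hgt := growthTime_le ha (by linarith) hX
  rw [← ht] at hgt
  set T : ℝ := (p.t : ℝ) + 1 with hT_def
  have hT1 : 1 ≤ T := by rw [hT_def]; linarith [(Nat.cast_nonneg p.t : (0 : ℝ) ≤ p.t)]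
  have hT0 : 0 < T := by linarith
  have hF0 : 0 < p.𝓕 := by rw [hF]; positivity
  have hr0 : 0 < p.r := by rw [hr]; positivity
  have hLU' := L₂_mul_U_le hγ1 hT1 hs1 hs hLU
  have hTle : T ^ 2 ≤ 6400 * (I.L₁ + 1) * X ^ 2 / γ := by
    have e1 : T ≤ 10 * X / a := by
      have h4 : 1 ≤ X / a := by rw [le_div_iff₀ ha]; linarith
      have h5 : 10 * X / a = 9 * X / a + X / a := by ring
      linarith
    calc T ^ 2 ≤ (10 * X / a) ^ 2 := by gcongr
      _ = _ := by rw [div_pow, hasq]; field_simp; norm_num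
  have hstep : √(6 * p.η * p.𝓕) = p.U / (4 * T) := by
    have : 6 * p.η * p.𝓕 = (p.U / (4 * T)) ^ 2 := by
      rw [hη, hF]; field_simp; norm_num
    rw [this, Real.sqrt_sq (by positivity)]
  have hnag : NagTuned p I.γ (I.L₁ + 1) p.r := by
    have hηγ : p.η * I.γ = 2 * s ^ 2 := by
      rw [hη, hIγ, hsq, gradientRate]; field_simp; norm_num
    refine ⟨by rw [hη]; positivity, by rw [hη]; field_simp; exact le_refl _, by linarith,
      by rw [hζ]; linarith, by rw [hζ]; linarith, ?_, hF0, ?_, ?_⟩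
    · rw [hζ, hηγ]
      have e1 : (1 - s) ^ 2 * (1 + 2 * s ^ 2) =
          1 - s * ((2 - 3 * s) + 2 * s ^ 2 * (2 - s)) := by ring
      have h1 : 0 ≤ 2 - 3 * s := by linarith
      have h3 : 0 ≤ 2 - s := by linarith
      have h2 : 0 ≤ s * ((2 - 3 * s) + 2 * s ^ 2 * (2 - s)) := by positivity
      rw [e1]
      linarith
    · have e1 : p.r ^ 2 = p.U ^ 2 / (100 * T ^ 2) := by rw [hr, div_pow, mul_pow]; norm_num
      rw [e1, hF]
      have : 0 ≤ (I.L₁ + 1) * p.U ^ 2 / T ^ 2 := by positivity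
      have e2 : (I.L₁ + 1) / 2 * (p.U ^ 2 / (100 * T ^ 2)) =
          1 / 200 * ((I.L₁ + 1) * p.U ^ 2 / T ^ 2) := by field_simp; norm_num
      have e3 : (I.L₁ + 1) * p.U ^ 2 / (96 * T ^ 2) / 2 =
          1 / 192 * ((I.L₁ + 1) * p.U ^ 2 / T ^ 2) := by field_simp; norm_num
      rw [e2, e3]
      linarith
    · rw [hstep, ← hT_def, hr]
      have e1 : T * (p.U / (4 * T)) = p.U / 4 := by field_simp
      have e2 : p.U / (10 * T) ≤ p.U / 10 := by
        gcongr
        linarith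
      rw [e1]
      linarith
  refine ⟨fun g y u₀ hg hu hne => ?_, fun g y u₀ v μ hg hv hHv hμ hu hinner => ?_⟩
  · have hg' := hg.mono (by linarith : I.L₁ ≤ I.L₁ + 1)
    unfold negCurv at hne ⊢
    rw [hkind] at hne ⊢
    dsimp only at hne ⊢
    rcases neonPlus_spec hg' hnag hu hne with ⟨h1, h2⟩ | ⟨u, h1, h2, h3⟩
    · refine (curvature_of_residual_le hg hL₂.le hU hF0 h2 h1 ?_).trans ?_
      · have e : I.L₂ * p.U ^ 3 = I.L₂ * p.U * p.U ^ 2 := by ring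
        rw [e, hF]
        have h3 : 1 / (128 * T ^ 2) ≤ 3 * ((I.L₁ + 1) / (96 * T ^ 2)) := by
          rw [← mul_div_assoc, div_le_div_iff₀ (by positivity) (by positivity)]
          have := mul_pos hL₁ (pow_pos hT0 2)
          have := pow_pos hT0 2
          linarith
        calc I.L₂ * p.U * p.U ^ 2 ≤ 3 * ((I.L₁ + 1) / (96 * T ^ 2)) * p.U ^ 2 := by
              exact mul_le_mul_of_nonneg_right (hLU'.trans h3) (sq_nonneg _)
          _ = _ := by ring
      · have h3 := two_mul_certified_le hL₁ hγ hX hU (pow_pos hT0 2) hF hTle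
        exact mul_le_mul_of_nonneg_right (neg_le_neg h3) (sq_nonneg _)
    · refine (curvature_of_test hg hL₂.le h1 h2 h3 ?_).trans ?_
      · rw [hLU, hIγ, ← mul_div_assoc, div_le_iff₀ (by positivity)]
        have : γ / 2 * s₀ ≤ γ / 2 * 1 := by gcongr
        have := mul_le_mul_of_nonneg_left (one_le_pow₀ hT1 (n := 2)) hγ.le
        linarith
      · have := certified_le hγ hX
        refine mul_le_mul_of_nonneg_right ?_ (sq_nonneg _)
        rw [hIγ]
        linarith
  · have hg' := hg.mono (by linarith : I.L₁ ≤ I.L₁ + 1)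
    unfold negCurv
    rw [hkind]
    dsimp only
    refine neonPlus_ne_zero hg' hnag (γ := I.γ) (α := p.r * s₀) hu hsp hs2
      (by rw [hη, hIγ, hsq, gradientRate]; field_simp; norm_num) hζ hv hμ hL₂.le hHv (by positivity)
      hinner ?_ ?_
    · have e : I.L₂ * p.U ^ 2 = I.L₂ * p.U * p.U := by ring
      rw [e, hLU, hr, hIγ]
      have h3 := one_div_sq_le hT1
      calc γ / 2 * s₀ / (64 * T ^ 2) * p.U = γ / 2 * s₀ * p.U * (1 / (64 * T ^ 2)) := by ring
        _ ≤ γ / 2 * s₀ * p.U * (1 / (10 * T)) := by gcongr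
        _ = _ := by ring
    · have h3 := mul_lt_growth (Q := 10 / (a * s₀)) ha (by linarith) hX (by positivity) (by
        have e1 : 10 * (10 / (a * s₀)) / a = 76800 * (I.L₁ + 1) * d / γ * Real.exp X := by
          have : 10 * (10 / (a * s₀)) / a = 100 / (a ^ 2 * s₀) := by field_simp; norm_num
          rw [this, hasq, hs₀, Real.exp_neg]; field_simp; norm_num
        rw [e1]
        have e2 : 76800 * (I.L₁ + 1) * d / γ ≤ 100000 * (I.L₁ + 1) * d / γ := by
          gcongr; norm_num
        calc 76800 * (I.L₁ + 1) * d / γ * Real.exp X ≤ Real.exp X * Real.exp X := by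
              gcongr; exact e2.trans hbig
          _ ≤ Real.exp (3 * X) := by
              rw [← Real.exp_add]
              exact Real.exp_le_exp.mpr (by linarith))
      rw [← ht, ← hT_def] at h3
      have e3 : 1 + 1 / (4 * s) ≤ 1 / a := by
        have : s = 4 * a := by rw [ha_def]; ring
        rw [this, le_div_iff₀ ha]
        have : (1 + 1 / (4 * (4 * a))) * a = a + 1 / 16 := by field_simp; ring
        rw [this]
        linarith
      rw [← ha_def, hr]
      calc p.U * (1 + 1 / (4 * s)) ≤ p.U * (1 / a) := by gcongr
        _ = T * (10 / (a * s₀)) * (p.U / (10 * T) * s₀) := by field_simp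
        _ < (1 + a) ^ (p.t + 1) * (p.U / (10 * T) * s₀) := by gcongr

end Spec

end Neon

end NeonSCSG

end

noncomputable section

namespace NeonSCSG

variable {d : ℕ} {Ξ : Type*}

/-! ### The choice of the parameters -/

/-- Half of the exponent, exp (X/2) = Λ^(n+8), absorbs the constant and Λ^8; the other half absorbs
X^6. The constant is beaten by 3^n ≤ Λ^n, which is why j can be chosen independently of Λ. -/
lemma exists_log_scale (W : ℝ) : ∃ j : ℝ, 1 ≤ j ∧ ∀ Λ : ℝ, 3 ≤ Λ →
    W * (j * Real.log Λ) ^ 6 * Λ ^ 8 ≤ Real.exp (j * Real.log Λ) := by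
  obtain ⟨n, hn⟩ := pow_unbounded_of_one_lt (W * 12 ^ 6) (by norm_num : (1 : ℝ) < 3)
  refine ⟨2 * (n + 8 : ℕ), ?_, fun Λ hΛ => ?_⟩
  · push_cast
    linarith [(Nat.cast_nonneg n : (0 : ℝ) ≤ n)]
  have hℓ : 0 ≤ Real.log Λ := Real.log_nonneg (by linarith)
  set X := 2 * ((n + 8 : ℕ) : ℝ) * Real.log Λ with hX
  have hX0 : 0 ≤ X := by positivity
  have h1 : Real.exp (X / 2) = Λ ^ (n + 8) := by
    have : X / 2 = (n + 8 : ℕ) * Real.log Λ := by rw [hX]; ring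
    rw [this, Real.exp_nat_mul, Real.exp_log (by linarith)]
  have h2 : X ^ 6 ≤ 12 ^ 6 * Real.exp (X / 2) := by
    have h3 : X / 12 ≤ Real.exp (X / 12) := by linarith [Real.add_one_le_exp (X / 12)]
    have h4 : (X / 12) ^ 6 ≤ Real.exp (X / 12) ^ 6 := by gcongr
    rw [← Real.exp_nat_mul] at h4
    have h5 : ((6 : ℕ) : ℝ) * (X / 12) = X / 2 := by push_cast; ring
    rw [h5, div_pow, div_le_iff₀ (by positivity)] at h4
    linarith
  have h3 : W * 12 ^ 6 * Λ ^ 8 ≤ Real.exp (X / 2) := by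
    rw [h1, pow_add]
    gcongr
    exact hn.le.trans (by gcongr)
  rcases le_total W 0 with hW | hW
  · have : W * X ^ 6 * Λ ^ 8 ≤ 0 := by
      have h7 : 0 ≤ X ^ 6 * Λ ^ 8 := by positivity
      rw [mul_assoc]
      exact mul_nonpos_of_nonpos_of_nonneg hW h7
    exact this.trans (Real.exp_pos _).le
  calc W * X ^ 6 * Λ ^ 8 ≤ W * (12 ^ 6 * Real.exp (X / 2)) * Λ ^ 8 := by gcongr
    _ = W * 12 ^ 6 * Λ ^ 8 * Real.exp (X / 2) := by ring
    _ ≤ Real.exp (X / 2) * Real.exp (X / 2) := by gcongr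
    _ = Real.exp X := by rw [← Real.exp_add]; ring_nf

/-- The reciprocal of the decrease `D` of one iteration, up to `X ^ 6` and the rates. -/
def progressFactor (L₁ L₂ c' : ℝ) : ℝ := 3 * L₂ ^ 2 * 409600 ^ 3 + 16 * L₁ / c'

/-- A constant from which all failure probabilities `exp (-X)` are small enough. -/
def scaleFactor (L₁ L₂ Δ c' : ℝ) : ℝ :=
  100000 * (L₁ + 1) + (12 + 6 * L₁ * 409600) + 64 * L₁ * (1 + L₁) / (c' * L₂ ^ 2) +
    (4 * Δ * progressFactor L₁ L₂ c' + 4)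

/-- The ratio of the noise of an epoch to the gain of a negative curvature step. -/
def noiseFactor (L₁ L₂ V c' : ℝ) : ℝ := 12 * c' * V * L₂ ^ 2 * 409600 ^ 3 / L₁

/-- The ratio of the sample size of an epoch to `X ^ 9` times its rate. -/
def sampleFactor (L₁ L₂ G V c' : ℝ) : ℝ :=
  (1 + noiseFactor L₁ L₂ V c') ^ 2 + 64 * V + 4 * (G + 8 * G ^ 2)

/-- The sample size of an epoch and of the first-order check. -/
def epochSample (I : Input) (G V ε γ X : ℝ) : ℕ :=
  ⌈sampleFactor I.L₁ I.L₂ G V I.c' * X ^ 9 * sampleRate ε γ I.b⌉₊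

/-- The sample size of a negative curvature step. -/
def hessianSample (L₁ γ X : ℝ) : ℕ := ⌈32 * L₁ ^ 2 * X / certified γ X ^ 2⌉₊

/-- The conditions on the data under which the parameters are chosen. -/
structure Setting (I : Input) (d : ℕ) (G V Δ ε γ δ X : ℝ) : Prop where
  L₁_pos : 0 < I.L₁
  L₂_pos : 0 < I.L₂
  G_pos : 0 < G
  V_pos : 0 < V
  Δ_nonneg : 0 ≤ Δ
  c'_pos : 0 < I.c'
  c'_le : I.c' ≤ 1 / 6
  d_pos : 0 < d
  b_pos : 0 < I.b
  b_le : (I.b : ℝ) ≤ sampleRate ε γ I.b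
  ε_pos : 0 < ε
  ε_lt : ε < 1
  γ_pos : 0 < γ
  γ_lt : γ < 1
  δ_pos : 0 < δ
  δ_lt : δ < 1
  ε_eq : I.ε = ε / 2
  γ_eq : I.γ = γ / 2
  one_le : 1 ≤ X
  scale_le : scaleFactor I.L₁ I.L₂ Δ I.c' * X ^ 6 * (3 * d / (ε * γ * δ)) ^ 8 ≤ Real.exp X

namespace Setting

variable {I : Input} {G V Δ ε γ δ X : ℝ}

/-- The form in which the choice of X is used: exp X exceeds every monomial of bounded degree in X,
d, 1/ε, 1/γ, 1/δ with an admissible constant. Each summand of `scaleFactor` serves one such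
application. -/
lemma le_exp (S : Setting I d G V Δ ε γ δ X) {w : ℝ} {i k₁ k₂ k₃ k₄ : ℕ} (hw : 0 ≤ w)
    (h : w ≤ scaleFactor I.L₁ I.L₂ Δ I.c') (hi : i ≤ 6) (hk : k₁ + k₂ + k₃ + k₄ ≤ 8) :
    w * X ^ i * ((d : ℝ) ^ k₁ * (1 / ε) ^ k₂ * (1 / γ) ^ k₃ * (1 / δ) ^ k₄) ≤ Real.exp X := by
  have hε := S.ε_pos
  have hγ := S.γ_pos
  have hδ := S.δ_pos
  have hX := S.one_le
  have hd : (1 : ℝ) ≤ d := by exact_mod_cast S.d_pos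
  have e : 3 * (d : ℝ) / (ε * γ * δ) = 3 * d * (1 / ε) * (1 / γ) * (1 / δ) := by field_simp
  have h1 : 1 ≤ 1 / ε := by rw [le_div_iff₀ hε]; linarith [S.ε_lt]
  have h2 : 1 ≤ 1 / γ := by rw [le_div_iff₀ hγ]; linarith [S.γ_lt]
  have h3 : 1 ≤ 1 / δ := by rw [le_div_iff₀ hδ]; linarith [S.δ_lt]
  have hs := S.scale_le
  rw [e] at hs
  generalize 1 / ε = x at *
  generalize 1 / γ = y at *
  generalize 1 / δ = z at *
  generalize (d : ℝ) = D at *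
  have hD : D ≤ 3 * D * x * y * z := by
    have : 1 ≤ 3 * x * y * z := by
      have := one_le_mul_of_one_le_of_one_le (one_le_mul_of_one_le_of_one_le h1 h2) h3
      linarith
    calc D = D * 1 := by ring
      _ ≤ D * (3 * x * y * z) := by gcongr
      _ = _ := by ring
  have hxx : x ≤ 3 * D * x * y * z := by
    have : 1 ≤ 3 * D * y * z := by
      have := one_le_mul_of_one_le_of_one_le (one_le_mul_of_one_le_of_one_le hd h2) h3
      linarith
    calc x = x * 1 := by ring
      _ ≤ x * (3 * D * y * z) := by gcongr
      _ = _ := by ring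
  have hyy : y ≤ 3 * D * x * y * z := by
    have : 1 ≤ 3 * D * x * z := by
      have := one_le_mul_of_one_le_of_one_le (one_le_mul_of_one_le_of_one_le hd h1) h3
      linarith
    calc y = y * 1 := by ring
      _ ≤ y * (3 * D * x * z) := by gcongr
      _ = _ := by ring
  have hzz : z ≤ 3 * D * x * y * z := by
    have : 1 ≤ 3 * D * x * y := by
      have := one_le_mul_of_one_le_of_one_le (one_le_mul_of_one_le_of_one_le hd h1) h2
      linarith
    calc z = z * 1 := by ring
      _ ≤ z * (3 * D * x * y) := by gcongr
      _ = _ := by ring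
  generalize 3 * D * x * y * z = Λ at *
  have hΛ : 1 ≤ Λ := h1.trans hxx
  have h0D : 0 ≤ D := by linarith
  have h0x : 0 ≤ x := by linarith
  have h0y : 0 ≤ y := by linarith
  have h0z : 0 ≤ z := by linarith
  have h0Λ : 0 ≤ Λ := by linarith
  have hprod : D ^ k₁ * x ^ k₂ * y ^ k₃ * z ^ k₄ ≤ Λ ^ 8 := by
    calc D ^ k₁ * x ^ k₂ * y ^ k₃ * z ^ k₄ ≤ Λ ^ k₁ * Λ ^ k₂ * Λ ^ k₃ * Λ ^ k₄ := by gcongr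
      _ = Λ ^ (k₁ + k₂ + k₃ + k₄) := by rw [pow_add, pow_add, pow_add]
      _ ≤ Λ ^ 8 := pow_le_pow_right₀ hΛ hk
  refine le_trans ?_ hs
  have hXi : X ^ i ≤ X ^ 6 := pow_le_pow_right₀ hX hi
  have hw' := hw.trans h
  have hX0 : 0 ≤ X := by linarith
  gcongr

section Factors

variable (S : Setting I d G V Δ ε γ δ X)
include S

lemma progressFactor_pos : 0 < progressFactor I.L₁ I.L₂ I.c' := by
  have := S.L₁_pos
  have := S.L₂_pos
  have := S.c'_pos
  unfold progressFactor; positivity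

lemma noiseFactor_pos : 0 < noiseFactor I.L₁ I.L₂ V I.c' := by
  have := S.L₁_pos
  have := S.L₂_pos
  have := S.c'_pos
  have := S.V_pos
  unfold noiseFactor; positivity

lemma scaleFactor_ge : 100000 * (I.L₁ + 1) ≤ scaleFactor I.L₁ I.L₂ Δ I.c' ∧
    12 + 6 * I.L₁ * 409600 ≤ scaleFactor I.L₁ I.L₂ Δ I.c' ∧
    64 * I.L₁ * (1 + I.L₁) / (I.c' * I.L₂ ^ 2) ≤ scaleFactor I.L₁ I.L₂ Δ I.c' ∧
    4 * Δ * progressFactor I.L₁ I.L₂ I.c' + 4 ≤ scaleFactor I.L₁ I.L₂ Δ I.c' := by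
  have h1 := S.L₁_pos
  have h2 := S.L₂_pos
  have h3 := S.c'_pos
  have h4 := S.Δ_nonneg
  have h5 := S.progressFactor_pos
  have a1 : 0 ≤ 100000 * (I.L₁ + 1) := by positivity
  have a2 : 0 ≤ 12 + 6 * I.L₁ * 409600 := by positivity
  have a3 : 0 ≤ 64 * I.L₁ * (1 + I.L₁) / (I.c' * I.L₂ ^ 2) := by positivity
  have a4 : 0 ≤ 4 * Δ * progressFactor I.L₁ I.L₂ I.c' + 4 := by positivity
  unfold scaleFactor
  refine ⟨?_, ?_, ?_, ?_⟩ <;> linarith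

lemma dim_le_exp : 100000 * (I.L₁ + 1) * d / γ ≤ Real.exp X := by
  have h := S.le_exp (i := 0) (k₁ := 1) (k₂ := 0) (k₃ := 1) (k₄ := 0)
    (by have := S.L₁_pos; positivity) S.scaleFactor_ge.1 (by norm_num) (by norm_num)
  refine le_trans (le_of_eq ?_) h
  ring

lemma one_le_exp_div : 2 * (d : ℝ) ≤ Real.exp X := by
  refine le_trans ?_ S.dim_le_exp
  have hγ := S.γ_pos
  have h1 := S.L₁_pos
  rw [le_div_iff₀ hγ]
  have hd : (0 : ℝ) ≤ d := Nat.cast_nonneg d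
  calc 2 * (d : ℝ) * γ ≤ 2 * d * 1 := by gcongr; exact S.γ_lt.le
    _ ≤ 100000 * (1 * d) := by linarith
    _ ≤ 100000 * ((I.L₁ + 1) * d) := by gcongr; linarith
    _ = _ := by ring

lemma gain_pos : 0 < gain I (certified γ X) := by
  have := certified_pos S.γ_pos S.one_le
  have := S.L₂_pos
  unfold gain; positivity

lemma gain_eq : gain I (certified γ X) = γ ^ 3 / (3 * I.L₂ ^ 2 * 409600 ^ 3 * X ^ 6) := by
  have := S.L₂_pos
  have := S.one_le
  unfold gain certified
  rw [div_pow, mul_pow, div_div]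
  congr 1
  ring

/-- The factor 3 collects one gain from the failure term of `NegCurvTuned.integral_escape_le` and
two from eigenvalues missed with probability 2 exp (-X). -/
lemma gain_add_loss_le : (3 * gain I (certified γ X) + loss I (certified γ X)) * Real.exp (-X) ≤
    gain I (certified γ X) / 4 := by
  have hL₁ := S.L₁_pos
  have hL₂ := S.L₂_pos
  have hγ := S.γ_pos
  have hX := S.one_le
  have h := S.le_exp (i := 2) (k₁ := 0) (k₂ := 0) (k₃ := 1) (k₄ := 0)
    (by positivity) S.scaleFactor_ge.2.1 (by norm_num) (by norm_num)
  have hg := S.gain_pos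
  have e : 4 * (3 * gain I (certified γ X) + loss I (certified γ X)) =
      (12 + 6 * I.L₁ * 409600 * X ^ 2 / γ) * gain I (certified γ X) := by
    unfold loss gain certified
    field_simp
    ring
  have h2 : 12 + 6 * I.L₁ * 409600 * X ^ 2 / γ ≤ Real.exp X := by
    refine le_trans ?_ h
    have h3 : 1 ≤ X ^ 2 / γ := by
      rw [le_div_iff₀ hγ]
      have := one_le_pow₀ hX (n := 2)
      linarith [S.γ_lt]
    calc 12 + 6 * I.L₁ * 409600 * X ^ 2 / γ
        = 12 * 1 + 6 * I.L₁ * 409600 * (X ^ 2 / γ) := by ring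
      _ ≤ 12 * (X ^ 2 / γ) + 6 * I.L₁ * 409600 * (X ^ 2 / γ) := by gcongr
      _ = _ := by ring
  have h4 : 4 * (3 * gain I (certified γ X) + loss I (certified γ X)) ≤
      Real.exp X * gain I (certified γ X) := by
    rw [e]; gcongr
  have h5 := mul_le_mul_of_nonneg_right h4 (Real.exp_pos (-X)).le
  have h6 : Real.exp X * gain I (certified γ X) * Real.exp (-X) = gain I (certified γ X) := by
    rw [mul_right_comm, ← Real.exp_add, add_neg_cancel, Real.exp_zero, one_mul]
  linarith

lemma one_le_inv_sq : 1 ≤ 1 / ε ^ 2 := by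
  have hε := S.ε_pos
  rw [le_div_iff₀ (by positivity)]
  have := pow_le_one₀ hε.le S.ε_lt.le (n := 2)
  linarith

lemma one_le_sampleRate : 1 ≤ sampleRate ε γ I.b := S.one_le_inv_sq.trans (le_max_left _ _)

lemma one_le_sampleFactor : 1 ≤ sampleFactor I.L₁ I.L₂ G V I.c' := by
  have h1 := S.noiseFactor_pos
  have h2 := S.V_pos
  have h3 := S.G_pos
  have h4 : 0 ≤ G + 8 * G ^ 2 := by positivity
  have h5 : 1 ≤ (1 + noiseFactor I.L₁ I.L₂ V I.c') ^ 2 := one_le_pow₀ (by linarith)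
  unfold sampleFactor
  linarith

lemma mul_sampleRate_le {w : ℝ} {i : ℕ} (hw : 0 ≤ w)
    (h : w ≤ sampleFactor I.L₁ I.L₂ G V I.c') (hi : i ≤ 9) :
    w * X ^ i * sampleRate ε γ I.b ≤ epochSample I G V ε γ X := by
  have hX := S.one_le
  have h1 : X ^ i ≤ X ^ 9 := pow_le_pow_right₀ hX hi
  have h2 := S.one_le_sampleRate
  have h3 : 0 ≤ X := by linarith
  refine le_trans ?_ (Nat.le_ceil _)
  gcongr
  linarith

lemma sampleRate_le : sampleRate ε γ I.b ≤ epochSample I G V ε γ X := by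
  have := S.mul_sampleRate_le (i := 0) zero_le_one S.one_le_sampleFactor (by norm_num)
  linarith

lemma batch_le : I.b ≤ epochSample I G V ε γ X := by
  exact_mod_cast S.b_le.trans S.sampleRate_le

lemma epochSample_pos : 0 < epochSample I G V ε γ X := S.b_pos.trans_le S.batch_le

lemma epochSample_le : (epochSample I G V ε γ X : ℝ) ≤
    2 * sampleFactor I.L₁ I.L₂ G V I.c' * X ^ 9 * sampleRate ε γ I.b := by
  have h1 := S.one_le_sampleFactor
  have h2 := one_le_pow₀ S.one_le (n := 9)
  have h3 := S.one_le_sampleRate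
  have h4 := one_le_mul_of_one_le_of_one_le (one_le_mul_of_one_le_of_one_le h1 h2) h3
  have h5 := (Nat.ceil_lt_add_one (zero_le_one.trans h4)).le
  unfold epochSample
  linarith

lemma variance_le : 64 * (V / epochSample I G V ε γ X) ≤ ε ^ 2 := by
  have hε := S.ε_pos
  have hm : (0 : ℝ) < epochSample I G V ε γ X := by exact_mod_cast S.epochSample_pos
  have hV := S.V_pos
  have h := S.mul_sampleRate_le (w := 64 * V) (i := 0) (by positivity) (by
    have := S.G_pos
    have h4 : 0 ≤ G + 8 * G ^ 2 := by positivity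
    unfold sampleFactor
    linarith [sq_nonneg (1 + noiseFactor I.L₁ I.L₂ V I.c')]) (by norm_num)
  have h2 : 1 / ε ^ 2 ≤ sampleRate ε γ I.b := le_max_left _ _
  have h3 : 64 * V * (1 / ε ^ 2) ≤ epochSample I G V ε γ X := by
    refine le_trans ?_ h
    rw [pow_zero, mul_one]
    gcongr
  rw [← mul_div_assoc, div_le_iff₀ hm]
  rw [← mul_div_assoc, mul_one, div_le_iff₀ (by positivity)] at h3
  linarith

lemma check_exponent_le :
    X ≤ epochSample I G V ε γ X * (ε ^ 2 / (4 * (G + 8 * G ^ 2))) := by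
  have hε := S.ε_pos
  have hV := S.V_pos
  have hG := S.G_pos
  have h4 : 0 < G + 8 * G ^ 2 := by positivity
  have hX := S.one_le
  have h := S.mul_sampleRate_le (w := 4 * (G + 8 * G ^ 2)) (i := 1) (by positivity) (by
    unfold sampleFactor
    linarith [sq_nonneg (1 + noiseFactor I.L₁ I.L₂ V I.c')]) (by norm_num)
  have h2 : 1 / ε ^ 2 ≤ sampleRate ε γ I.b := le_max_left _ _
  have h3 : 4 * (G + 8 * G ^ 2) * X ^ 1 * (1 / ε ^ 2) ≤ epochSample I G V ε γ X := by
    refine le_trans ?_ h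
    gcongr
  rw [pow_one, ← mul_div_assoc, mul_one, div_le_iff₀ (by positivity)] at h3
  rw [← mul_div_assoc, le_div_iff₀ (by positivity)]
  linarith

lemma rate_ratio_pos : 0 < ((epochSample I G V ε γ X : ℝ) / I.b) := by
  have hm : (0 : ℝ) < epochSample I G V ε γ X := by exact_mod_cast S.epochSample_pos
  have hb : (0 : ℝ) < I.b := by exact_mod_cast S.b_pos
  positivity

/-- The noise of an epoch is at most an eighth of the gain of a negative curvature step. -/
lemma noise_le_gain : epochRate I (epochSample I G V ε γ X) * (V / epochSample I G V ε γ X) ≤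
    gain I (certified γ X) / 8 := by
  have hL₁ := S.L₁_pos
  have hL₂ := S.L₂_pos
  have hγ := S.γ_pos
  have hX := S.one_le
  have hV := S.V_pos
  have hc := S.c'_pos
  have hb : (0 : ℝ) < I.b := by exact_mod_cast S.b_pos
  have hB := S.noiseFactor_pos
  have hq := S.rate_ratio_pos
  have hm : (0 : ℝ) < epochSample I G V ε γ X := by exact_mod_cast S.epochSample_pos
  have h := S.mul_sampleRate_le (w := (1 + noiseFactor I.L₁ I.L₂ V I.c') ^ 2) (i := 9)
    (by positivity) (by
      have := S.G_pos
      have h4 : 0 ≤ G + 8 * G ^ 2 := by positivity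
      unfold sampleFactor
      linarith) (by norm_num)
  rw [S.gain_eq]
  unfold epochRate
  set m : ℝ := (epochSample I G V ε γ X : ℝ) with hm_def
  set B := noiseFactor I.L₁ I.L₂ V I.c' with hB_def
  set w := (m / I.b) ^ (1 / 3 : ℝ) with hw_def
  have hw : 0 < w := Real.rpow_pos_of_pos hq _
  have hw3 : w ^ 3 = m / I.b := by
    rw [hw_def, ← Real.rpow_natCast, ← Real.rpow_mul hq.le]
    norm_num
  set Q := γ ^ (9 / 2 : ℝ) * (I.b : ℝ) ^ (1 / 2 : ℝ) with hQ_def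
  have hQ : 0 < Q := by positivity
  have hQ2 : Q ^ 2 = γ ^ 9 * I.b := by
    rw [hQ_def, mul_pow, ← Real.rpow_natCast, ← Real.rpow_mul hγ.le, ← Real.rpow_natCast,
      ← Real.rpow_mul hb.le]
    norm_num
  have h1 : (1 + B) ^ 2 * X ^ 9 ≤ m * Q := by
    have h2 : (1 + B) ^ 2 * X ^ 9 * (1 / Q) ≤ m :=
      le_trans (by gcongr; exact le_max_right _ _) h
    rw [← mul_div_assoc, mul_one, div_le_iff₀ hQ] at h2
    exact h2
  have h2 : (B * X ^ 6) ^ 3 ≤ m ^ 2 * (γ ^ 9 * I.b) := by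
    have h3 : ((1 + B) ^ 2 * X ^ 9) ^ 2 ≤ (m * Q) ^ 2 := by gcongr
    rw [mul_pow m, hQ2] at h3
    refine le_trans ?_ h3
    -- The condition is m ≥ B^(3/2) X^9/Q; replacing B^(3/2) by (1 + B)² keeps `sampleFactor` free
    -- of fractional powers.
    have h4 : B ^ 3 ≤ (1 + B) ^ 4 := by
      calc B ^ 3 ≤ (1 + B) ^ 3 := by gcongr; linarith
        _ ≤ (1 + B) ^ 4 := pow_le_pow_right₀ (by linarith) (by norm_num)
    calc (B * X ^ 6) ^ 3 = B ^ 3 * X ^ 18 := by ring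
      _ ≤ (1 + B) ^ 4 * X ^ 18 := by gcongr
      _ = _ := by ring
  -- Cubing turns the claim into B³X^18 ≤ m²γ^9 b. This is the origin of the rate γ^(-9/2) b^(-1/2)
  -- and of the factor X^9 in the sample size.
  have h3 : w * (B * X ^ 6) ≤ m * γ ^ 3 := by
    refine le_of_pow_le_pow_left₀ (n := 3) (by norm_num) (by positivity) ?_
    rw [mul_pow, hw3]
    calc m / I.b * (B * X ^ 6) ^ 3 ≤ m / I.b * (m ^ 2 * (γ ^ 9 * I.b)) := by gcongr
      _ = _ := by field_simp
  have e1 : I.c' / (2 * I.L₁) * w * (V / m) =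
      w * (B * X ^ 6) / (m * (24 * I.L₂ ^ 2 * 409600 ^ 3 * X ^ 6)) := by
    rw [hB_def, noiseFactor]
    field_simp
    norm_num
  have e2 : γ ^ 3 / (3 * I.L₂ ^ 2 * 409600 ^ 3 * X ^ 6) / 8 =
      m * γ ^ 3 / (m * (24 * I.L₂ ^ 2 * 409600 ^ 3 * X ^ 6)) := by
    field_simp
    norm_num
  rw [e1, e2]
  gcongr

lemma le_epochRate : I.c' / (2 * I.L₁) ≤ epochRate I (epochSample I G V ε γ X) := by
  have hL₁ := S.L₁_pos
  have hc := S.c'_pos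
  have hb : (0 : ℝ) < I.b := by exact_mod_cast S.b_pos
  have h : 1 ≤ ((epochSample I G V ε γ X : ℝ) / I.b) ^ (1 / 3 : ℝ) := by
    refine Real.one_le_rpow ?_ (by norm_num)
    rw [le_div_iff₀ hb, one_mul]
    exact_mod_cast S.batch_le
  unfold epochRate
  exact le_mul_of_one_le_right (by positivity) h

/-- Uses m ≥ ε^(-2) inside the cube root: (ε^(-2)/b)^(1/3) · ε² = ε^(4/3) b^(-1/3). -/
lemma rate_le_epochRate_mul : I.c' / (2 * I.L₁) * (ε ^ (4 / 3 : ℝ) / (I.b : ℝ) ^ (1 / 3 : ℝ)) ≤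
    epochRate I (epochSample I G V ε γ X) * ε ^ 2 := by
  have hL₁ := S.L₁_pos
  have hc := S.c'_pos
  have hε := S.ε_pos
  have hb : (0 : ℝ) < I.b := by exact_mod_cast S.b_pos
  have h1 : (1 / ε ^ 2 / I.b) ^ (1 / 3 : ℝ) ≤
      ((epochSample I G V ε γ X : ℝ) / I.b) ^ (1 / 3 : ℝ) := by
    have : 1 / ε ^ 2 ≤ epochSample I G V ε γ X := (le_max_left _ _).trans S.sampleRate_le
    gcongr
  have h2 : (1 / ε ^ 2 / I.b) ^ (1 / 3 : ℝ) * ε ^ 2 =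
      ε ^ (4 / 3 : ℝ) / (I.b : ℝ) ^ (1 / 3 : ℝ) := by
    rw [Real.div_rpow (by positivity) hb.le, div_mul_eq_mul_div]
    congr 1
    rw [one_div, Real.inv_rpow (by positivity), ← Real.rpow_natCast, ← Real.rpow_mul hε.le,
      ← Real.rpow_neg hε.le, ← Real.rpow_add hε]
    norm_num
  unfold epochRate
  rw [← h2, mul_assoc]
  gcongr

lemma epochRate_pos : 0 < epochRate I (epochSample I G V ε γ X) :=
  lt_of_lt_of_le (by have := S.L₁_pos; have := S.c'_pos; positivity) S.le_epochRate

end Factors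

end Setting

end NeonSCSG

end

/-! ### The tuning, its admissibility, cost and failure probability -/

noncomputable section

namespace NeonSCSG

variable {d : ℕ} {Ξ : Type*}

/-- The growth rate of the procedure along a direction of negative curvature. -/
def growthRate (L₁ γ : ℝ) : NeonKind → ℝ
  | .neon => gradientRate L₁ γ
  | .neonPlus => momentumRate L₁ γ / 4

/-- The power of the number of iterations in the threshold of the procedure. -/
def thresholdPower : NeonKind → ℕ
  | .neon => 1
  | .neonPlus => 2

/-- The momentum; any value is admissible for NEON, which does not use it. -/
def momentum (L₁ γ : ℝ) : NeonKind → ℝ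
  | .neon => 1 / 2
  | .neonPlus => 1 - momentumRate L₁ γ

/-- The parameters with which NEON-SCSG is run. -/
def tuning (I : Input) (d : ℕ) (G V ε γ X : ℝ) : Tuning :=
  neonTuning I.L₁ I.L₂ γ X (growthRate I.L₁ γ I.kind) (thresholdPower I.kind) d
    (epochSample I G V ε γ X) (epochSample I G V ε γ X) (hessianSample I.L₁ γ X)
    (momentum I.L₁ γ I.kind)

/-- The expected decrease of `F` in one iteration. -/
def progress (I : Input) (G V ε γ X : ℝ) : ℝ :=
  min (gain I (certified γ X)) (epochRate I (epochSample I G V ε γ X) * ε ^ 2 / 8)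

/-- The ratio of the complexity of a negative curvature step to `X ^ 6` times its rate. -/
def costFactor (L₁ : ℝ) : ℝ := 176 * (L₁ + 1) * (32 * L₁ ^ 2 * 409600 ^ 2 + 1)

namespace Setting

variable {I : Input} {G V Δ ε γ δ X : ℝ} (S : Setting I d G V Δ ε γ δ X)
include S

lemma growthRate_pos : 0 < growthRate I.L₁ γ I.kind := by
  have h1 := gradientRate_pos S.L₁_pos S.γ_pos
  have h2 := momentumRate_pos S.L₁_pos S.γ_pos
  cases I.kind <;> simp only [growthRate] <;> positivity

lemma growthRate_le : growthRate I.L₁ γ I.kind ≤ 1 := by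
  have h1 := gradientRate_le S.L₁_pos S.γ_lt
  have h2 := momentumRate_le S.L₁_pos S.γ_pos S.γ_lt
  cases I.kind <;> simp only [growthRate] <;> linarith

lemma hessianSample_pos : 0 < hessianSample I.L₁ γ X := by
  have := S.L₁_pos
  have := certified_pos S.γ_pos S.one_le
  have := S.one_le
  exact Nat.ceil_pos.mpr (by positivity)

lemma neonSpec : NeonSpec d I (tuning I d G V ε γ X) (certified γ X)
    (Real.exp (-X) / (12 * d)) := by
  cases hk : I.kind with
  | neon =>
    have := neonSpec_neon hk S.L₁_pos S.L₂_pos S.γ_eq S.γ_pos S.γ_lt S.d_pos S.one_le S.dim_le_exp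
      (epochSample I G V ε γ X) (epochSample I G V ε γ X) (hessianSample I.L₁ γ X) (1 / 2)
    simpa only [tuning, hk, growthRate, thresholdPower, momentum] using this
  | neonPlus =>
    have := neonSpec_neonPlus hk S.L₁_pos S.L₂_pos S.γ_eq S.γ_pos S.γ_lt S.d_pos S.one_le
      S.dim_le_exp (epochSample I G V ε γ X) (epochSample I G V ε γ X) (hessianSample I.L₁ γ X)
    simpa only [tuning, hk, growthRate, thresholdPower, momentum] using this

lemma radius_pos : 0 < (tuning I d G V ε γ X).U ∧ 0 < (tuning I d G V ε γ X).r ∧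
    0 < (tuning I d G V ε γ X).𝓕 := by
  have := S.L₁_pos
  have := S.L₂_pos
  have := S.γ_pos
  have hd : (0 : ℝ) < d := by exact_mod_cast S.d_pos
  refine ⟨?_, ?_, ?_⟩ <;> simp only [tuning, neonTuning] <;> positivity

lemma tuning_valid : (tuning I d G V ε γ X).Valid I.b := by
  have h1 := momentumRate_pos S.L₁_pos S.γ_pos
  have h2 := momentumRate_le S.L₁_pos S.γ_pos S.γ_lt
  have hc := certified_pos S.γ_pos S.one_le
  have hγ := S.γ_pos
  have hL₁ := S.L₁_pos
  refine ⟨S.batch_le, S.epochSample_pos, S.hessianSample_pos, ?_, S.radius_pos.2.2, S.radius_pos.1,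
    S.radius_pos.2.1, ?_, ?_, ?_⟩
  · simp only [tuning, neonTuning]; positivity
  · simp only [tuning, neonTuning]
    cases I.kind <;> simp only [momentum] <;> linarith
  · simp only [tuning, neonTuning]
    cases I.kind <;> simp only [momentum] <;> linarith
  · simp only [tuning, neonTuning]; positivity

lemma hessianSample_le : (hessianSample I.L₁ γ X : ℝ) ≤
    (32 * I.L₁ ^ 2 * 409600 ^ 2 + 1) * X ^ 5 / γ ^ 2 := by
  have hL₁ := S.L₁_pos
  have hγ := S.γ_pos
  have hX := S.one_le
  have hc := certified_pos S.γ_pos S.one_le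
  have h1 := (Nat.ceil_lt_add_one
    (by positivity : 0 ≤ 32 * I.L₁ ^ 2 * X / certified γ X ^ 2)).le
  have e : 32 * I.L₁ ^ 2 * X / certified γ X ^ 2 = 32 * I.L₁ ^ 2 * 409600 ^ 2 * X ^ 5 / γ ^ 2 := by
    unfold certified
    field_simp
  have h2 : 1 ≤ X ^ 5 / γ ^ 2 := by
    rw [le_div_iff₀ (by positivity)]
    have := one_le_pow₀ hX (n := 5)
    have := pow_le_one₀ hγ.le S.γ_lt.le (n := 2)
    linarith
  rw [e] at h1
  have e2 : (32 * I.L₁ ^ 2 * 409600 ^ 2 + 1) * X ^ 5 / γ ^ 2 =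
      32 * I.L₁ ^ 2 * 409600 ^ 2 * X ^ 5 / γ ^ 2 + X ^ 5 / γ ^ 2 := by ring
  rw [e2]
  unfold hessianSample
  rw [e]
  linarith

/-- The factor γ^(-2) is the Hessian sample, the other one the number of iterations, which is of
order 1/γ for NEON and 1/√γ for NEON⁺. This yields the exponents 3 and 5/2. -/
lemma one_div_growthRate_le : 1 / (growthRate I.L₁ γ I.kind * γ ^ 2) ≤
    8 * (I.L₁ + 1) * (1 / γ ^ neonExponent I.kind) := by
  have hL₁ := S.L₁_pos
  have hγ := S.γ_pos
  cases I.kind with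
  | neon =>
    have e : γ ^ (3 : ℝ) = γ ^ 3 := by exact_mod_cast Real.rpow_natCast γ 3
    simp only [growthRate, neonExponent, gradientRate, e]
    have : 1 / (γ / (4 * (I.L₁ + 1)) * γ ^ 2) = 4 * (I.L₁ + 1) * (1 / γ ^ 3) := by field_simp
    rw [this]
    gcongr
    norm_num
  | neonPlus =>
    have e : γ ^ (5 / 2 : ℝ) = √γ * γ ^ 2 := by
      rw [Real.sqrt_eq_rpow, ← Real.rpow_natCast, ← Real.rpow_add hγ]
      norm_num
    have h2 : √(4 * (I.L₁ + 1)) ≤ 2 * (I.L₁ + 1) := by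
      rw [Real.sqrt_le_left (by positivity)]
      nlinarith
    have hsq : 0 < √γ := Real.sqrt_pos.mpr hγ
    have hsq' : 0 < √(4 * (I.L₁ + 1)) := Real.sqrt_pos.mpr (by positivity)
    simp only [growthRate, neonExponent, momentumRate, e, Real.sqrt_div hγ.le]
    have : 1 / (√γ / √(4 * (I.L₁ + 1)) / 4 * γ ^ 2) =
        4 * √(4 * (I.L₁ + 1)) * (1 / (√γ * γ ^ 2)) := by field_simp
    rw [this]
    exact mul_le_mul_of_nonneg_right (by linarith) (by positivity)

/-- Since t ≤ 9X/a and 1 ≤ X/a, the 2t + 4 query points of NEON⁺ are at most 22X/a, and this also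
covers the t + 3 points of NEON. -/
lemma neonCost_le : (neonCost I.kind (tuning I d G V ε γ X) : ℝ) ≤
    costFactor I.L₁ * X ^ 6 * (1 / γ ^ neonExponent I.kind) := by
  have hL₁ := S.L₁_pos
  have hγ := S.γ_pos
  have hX := S.one_le
  have ha := S.growthRate_pos
  have ht := growthTime_le ha S.growthRate_le hX
  have h1 : 1 ≤ X / growthRate I.L₁ γ I.kind := by
    rw [le_div_iff₀ ha]; linarith [S.growthRate_le]
  have h2 : 9 * X / growthRate I.L₁ γ I.kind = 9 * (X / growthRate I.L₁ γ I.kind) := by ring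
  rw [h2] at ht
  have h3 : (neonCost I.kind (tuning I d G V ε γ X) : ℝ) ≤
      hessianSample I.L₁ γ X * (22 * (X / growthRate I.L₁ γ I.kind)) := by
    have hm : (tuning I d G V ε γ X).m₂ = hessianSample I.L₁ γ X := rfl
    have ht' : (tuning I d G V ε γ X).t = growthTime (growthRate I.L₁ γ I.kind) X := rfl
    unfold neonCost
    split <;> rw [hm, ht'] <;> push_cast <;> gcongr <;> linarith
  refine h3.trans ?_
  calc hessianSample I.L₁ γ X * (22 * (X / growthRate I.L₁ γ I.kind))
      ≤ (32 * I.L₁ ^ 2 * 409600 ^ 2 + 1) * X ^ 5 / γ ^ 2 *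
        (22 * (X / growthRate I.L₁ γ I.kind)) := by gcongr; exact S.hessianSample_le
    _ = 22 * (32 * I.L₁ ^ 2 * 409600 ^ 2 + 1) * X ^ 6 *
        (1 / (growthRate I.L₁ γ I.kind * γ ^ 2)) := by field_simp
    _ ≤ 22 * (32 * I.L₁ ^ 2 * 409600 ^ 2 + 1) * X ^ 6 *
        (8 * (I.L₁ + 1) * (1 / γ ^ neonExponent I.kind)) := by
      gcongr; exact S.one_div_growthRate_le
    _ = _ := by rw [costFactor]; ring

lemma certified_le_one : certified γ X ≤ 1 := by
  have := certified_le S.γ_pos S.one_le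
  have := S.γ_lt
  linarith

lemma progress_pos : 0 < progress I G V ε γ X := by
  have h1 := S.epochRate_pos
  have h2 := S.ε_pos
  exact lt_min S.gain_pos (by positivity)

/-- The failure of a negative curvature step costs less than what an epoch gains. -/
lemma gain_add_loss_le_rate : (gain I (certified γ X) + loss I (certified γ X)) * Real.exp (-X) ≤
    epochRate I (epochSample I G V ε γ X) * ε ^ 2 / 32 := by
  have hL₁ := S.L₁_pos
  have hL₂ := S.L₂_pos
  have hc := S.c'_pos
  have hε := S.ε_pos
  have hσ := certified_pos S.γ_pos S.one_le
  have hσ1 := S.certified_le_one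
  have h := S.le_exp (i := 0) (k₁ := 0) (k₂ := 2) (k₃ := 0) (k₄ := 0)
    (by positivity) S.scaleFactor_ge.2.2.1 (by norm_num) (by norm_num)
  have h1 : gain I (certified γ X) + loss I (certified γ X) ≤ (1 + I.L₁) / I.L₂ ^ 2 := by
    have e : gain I (certified γ X) + loss I (certified γ X) =
        (certified γ X ^ 3 / 3 + I.L₁ / 2 * certified γ X ^ 2) / I.L₂ ^ 2 := by
      unfold gain loss; field_simp
    rw [e]
    refine div_le_div_of_nonneg_right ?_ (sq_nonneg _)
    have := pow_le_one₀ hσ.le hσ1 (n := 3)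
    have h5 := mul_le_mul_of_nonneg_left (pow_le_one₀ hσ.le hσ1 (n := 2)) hL₁.le
    linarith
  have h2 : (1 + I.L₁) / I.L₂ ^ 2 ≤ Real.exp X * (I.c' / (2 * I.L₁) * ε ^ 2 / 32) := by
    have e : (1 + I.L₁) / I.L₂ ^ 2 = 64 * I.L₁ * (1 + I.L₁) / (I.c' * I.L₂ ^ 2) * X ^ 0 *
        ((d : ℝ) ^ 0 * (1 / ε) ^ 2 * (1 / γ) ^ 0 * (1 / δ) ^ 0) *
          (I.c' / (2 * I.L₁) * ε ^ 2 / 32) := by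
      simp only [pow_zero, one_mul, mul_one]
      field_simp
      norm_num
    rw [e]
    gcongr
  have h3 : I.c' / (2 * I.L₁) * ε ^ 2 / 32 ≤
      epochRate I (epochSample I G V ε γ X) * ε ^ 2 / 32 := by
    gcongr; exact S.le_epochRate
  have h4 := mul_le_mul_of_nonneg_right (h1.trans h2) (Real.exp_pos (-X)).le
  have e : Real.exp X * (I.c' / (2 * I.L₁) * ε ^ 2 / 32) * Real.exp (-X) =
      I.c' / (2 * I.L₁) * ε ^ 2 / 32 := by
    rw [mul_right_comm, ← Real.exp_add, add_neg_cancel, Real.exp_zero, one_mul]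
  linarith

/-- The reciprocal of a minimum is at most the sum of the reciprocals, which separates the rates
γ^(-3) and b^(1/3) ε^(-4/3). -/
lemma one_div_progress_le : 1 / progress I G V ε γ X ≤ 1 / gain I (certified γ X) +
    8 * (1 / (epochRate I (epochSample I G V ε γ X) * ε ^ 2)) := by
  have h1 := S.epochRate_pos
  have h2 := S.ε_pos
  have h3 := S.gain_pos
  have e : 8 * (1 / (epochRate I (epochSample I G V ε γ X) * ε ^ 2)) =
      1 / (epochRate I (epochSample I G V ε γ X) * ε ^ 2 / 8) := by field_simp
  rw [e, progress]
  rcases min_cases (gain I (certified γ X))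
    (epochRate I (epochSample I G V ε γ X) * ε ^ 2 / 8) with ⟨h, _⟩ | ⟨h, _⟩ <;> rw [h]
  · have : 0 ≤ 1 / (epochRate I (epochSample I G V ε γ X) * ε ^ 2 / 8) := by positivity
    linarith
  · have : 0 ≤ 1 / gain I (certified γ X) := by positivity
    linarith

lemma one_div_gain : 1 / gain I (certified γ X) = 3 * I.L₂ ^ 2 * 409600 ^ 3 * X ^ 6 * (1 / γ ^ 3) := by
  have := S.gain_pos
  rw [S.gain_eq, one_div_div]
  ring

/-- The probability of failure in a whole run is at most `δ`. -/
lemma failure_le :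
    (2 * Δ / progress I G V ε γ X + 2) * (2 * Real.exp (-X)) ≤ δ := by
  have hL₁ := S.L₁_pos
  have hL₂ := S.L₂_pos
  have hc := S.c'_pos
  have hε := S.ε_pos
  have hγ := S.γ_pos
  have hδ := S.δ_pos
  have hX := S.one_le
  have hΔ := S.Δ_nonneg
  have hPf := S.progressFactor_pos
  -- The number of iterations is at most a constant times X^6 ε^(-2) γ^(-3); the additional δ^(-1)
  -- leaves room for the union bound.
  have h := S.le_exp (i := 6) (k₁ := 0) (k₂ := 2) (k₃ := 3) (k₄ := 1)
    (by positivity) S.scaleFactor_ge.2.2.2 (by norm_num) (by norm_num)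
  have hx : 1 ≤ (1 / ε) ^ 2 := one_le_pow₀ (by rw [le_div_iff₀ hε]; linarith [S.ε_lt])
  have hy : 1 ≤ (1 / γ) ^ 3 := one_le_pow₀ (by rw [le_div_iff₀ hγ]; linarith [S.γ_lt])
  have hX6 : 1 ≤ X ^ 6 := one_le_pow₀ hX
  have h1 : 1 / progress I G V ε γ X ≤
      progressFactor I.L₁ I.L₂ I.c' * X ^ 6 * ((1 / ε) ^ 2 * (1 / γ) ^ 3) := by
    refine S.one_div_progress_le.trans ?_
    have h2 : 8 * (1 / (epochRate I (epochSample I G V ε γ X) * ε ^ 2)) ≤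
        8 * (1 / (I.c' / (2 * I.L₁) * ε ^ 2)) := by gcongr; exact S.le_epochRate
    have e2 : 8 * (1 / (I.c' / (2 * I.L₁) * ε ^ 2)) = 16 * I.L₁ / I.c' * (1 / ε) ^ 2 := by
      field_simp; norm_num
    rw [e2] at h2
    have e3 : (1 / γ ^ 3) = (1 / γ) ^ 3 := by rw [div_pow, one_pow]
    rw [S.one_div_gain, e3]
    have h3 : 3 * I.L₂ ^ 2 * 409600 ^ 3 * X ^ 6 * (1 / γ) ^ 3 ≤
        3 * I.L₂ ^ 2 * 409600 ^ 3 * X ^ 6 * ((1 / ε) ^ 2 * (1 / γ) ^ 3) := by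
      gcongr
      exact le_mul_of_one_le_left (by positivity) hx
    have h4 : 16 * I.L₁ / I.c' * (1 / ε) ^ 2 ≤
        16 * I.L₁ / I.c' * (X ^ 6 * ((1 / ε) ^ 2 * (1 / γ) ^ 3)) := by
      gcongr
      calc (1 / ε) ^ 2 = 1 * ((1 / ε) ^ 2 * 1) := by ring
        _ ≤ X ^ 6 * ((1 / ε) ^ 2 * (1 / γ) ^ 3) := by gcongr
    calc _ ≤ _ := add_le_add h3 (h2.trans h4)
      _ = _ := by rw [progressFactor]; ring
  set Q := X ^ 6 * ((1 / ε) ^ 2 * (1 / γ) ^ 3) with hQ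
  have hQ1 : 1 ≤ Q := one_le_mul_of_one_le_of_one_le hX6 (one_le_mul_of_one_le_of_one_le hx hy)
  have h2 : 2 * (2 * Δ / progress I G V ε γ X + 2) ≤ δ * Real.exp X := by
    have h3 : Δ * (1 / progress I G V ε γ X) ≤ Δ * (progressFactor I.L₁ I.L₂ I.c' * Q) := by
      gcongr
      rw [hQ, ← mul_assoc]
      exact h1
    have h4 : δ * ((4 * Δ * progressFactor I.L₁ I.L₂ I.c' + 4) * X ^ 6 *
        ((d : ℝ) ^ 0 * (1 / ε) ^ 2 * (1 / γ) ^ 3 * (1 / δ) ^ 1)) =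
        (4 * Δ * progressFactor I.L₁ I.L₂ I.c' + 4) * Q := by
      rw [hQ]; field_simp
    have h5 := mul_le_mul_of_nonneg_left h hδ.le
    rw [h4] at h5
    have e : 2 * (2 * Δ / progress I G V ε γ X + 2) =
        4 * (Δ * (1 / progress I G V ε γ X)) + 4 := by ring
    rw [e]
    linarith
  have h6 := mul_le_mul_of_nonneg_right h2 (Real.exp_pos (-X)).le
  rw [mul_assoc δ, ← Real.exp_add, add_neg_cancel, Real.exp_zero, mul_one] at h6
  linarith

end Setting

end NeonSCSG

end

/-! ### Guarantees of the tuned algorithm -/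

noncomputable section

namespace NeonSCSG

variable {d : ℕ} {Ξ : Type*}

namespace Setting

section Guarantees

variable {I : Input} {G V Δ ε γ δ X : ℝ} (S : Setting I d G V Δ ε γ δ X)
include S

variable [MeasurableSpace Ξ] {P : Measure Ξ} [IsProbabilityMeasure P] {f : E d → Ξ → ℝ}
  {x₁ : E d} (h : Assumptions P f x₁ I.L₁ I.L₂ G V Δ)
include h

/-- The sample size makes the exponent at least 2X; one exp X absorbs the factor 2d. -/
lemma concentration_le (y : E d) : (Measure.pi fun _ : Fin (hessianSample I.L₁ γ X) => P)
    {T | certified γ X < ‖hessian (batch f T) y - hessian (objective P f) y‖} ≤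
      ENNReal.ofReal (Real.exp (-X)) := by
  have hL₁ := S.L₁_pos
  have hσ := certified_pos S.γ_pos S.one_le
  refine (h.measure_hessian_le hL₁ S.hessianSample_pos hσ y).trans
    (ENNReal.ofReal_le_ofReal ?_)
  have h1 : 32 * I.L₁ ^ 2 * X / certified γ X ^ 2 ≤ hessianSample I.L₁ γ X := Nat.le_ceil _
  rw [div_le_iff₀ (by positivity)] at h1
  have h2 : 2 * X ≤ hessianSample I.L₁ γ X * certified γ X ^ 2 / (16 * I.L₁ ^ 2) := by
    rw [le_div_iff₀ (by positivity)]
    linarith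
  calc 2 * d * Real.exp (-(hessianSample I.L₁ γ X * certified γ X ^ 2 / (16 * I.L₁ ^ 2)))
      ≤ Real.exp X * Real.exp (-(2 * X)) := by
        gcongr
        exact S.one_le_exp_div
    _ = Real.exp (-X) := by rw [← Real.exp_add]; ring_nf

lemma check_le (x : E d) (hx : ε < ‖gradient (objective P f) x‖) :
    (Measure.pi fun _ : Fin (epochSample I G V ε γ X) => P)
      {T | ‖gradient (batch f T) x‖ ≤ ε / 2} ≤ ENNReal.ofReal (Real.exp (-X)) := by
  have hG := S.G_pos
  have hε := S.ε_pos
  have hk : 0 < G + 8 * G ^ 2 := by positivity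
  -- The Chernoff parameter ε/(G + 8G²) is of the optimal order ε/G²; the extra G in the denominator
  -- ensures θG ≤ 1 for small G.
  have hθ : ε / (G + 8 * G ^ 2) * G ≤ 1 := by
    rw [div_mul_eq_mul_div, div_le_one hk]
    have : ε * G ≤ 1 * G := by gcongr; exact S.ε_lt.le
    linarith [sq_nonneg G]
  refine (h.measure_check_le hG S.epochSample_pos (θ := ε / (G + 8 * G ^ 2)) (by positivity) ?_ x hx
    hε.le).trans (ENNReal.ofReal_le_ofReal (Real.exp_le_exp.mpr ?_))
  · rw [← mul_pow]
    exact pow_le_one₀ (by positivity) hθ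
  · have h1 := S.check_exponent_le
    have h2 : 2 * (ε / (G + 8 * G ^ 2)) ^ 2 * G ^ 2 - ε / (G + 8 * G ^ 2) * (ε / 2) ≤
        -(ε ^ 2 / (4 * (G + 8 * G ^ 2))) := by
      have h3 : G ^ 2 / (G + 8 * G ^ 2) ≤ 1 / 8 := by
        rw [div_le_div_iff₀ hk (by norm_num)]
        linarith
      have e : 2 * (ε / (G + 8 * G ^ 2)) ^ 2 * G ^ 2 - ε / (G + 8 * G ^ 2) * (ε / 2) =
          2 * (ε ^ 2 / (G + 8 * G ^ 2)) * (G ^ 2 / (G + 8 * G ^ 2)) -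
            ε ^ 2 / (G + 8 * G ^ 2) / 2 := by field_simp
      have e2 : ε ^ 2 / (4 * (G + 8 * G ^ 2)) = ε ^ 2 / (G + 8 * G ^ 2) / 4 := by field_simp
      have h4 : 2 * (ε ^ 2 / (G + 8 * G ^ 2)) * (G ^ 2 / (G + 8 * G ^ 2)) ≤
          2 * (ε ^ 2 / (G + 8 * G ^ 2)) * (1 / 8) := by gcongr
      rw [e, e2]
      linarith
    have h5 := mul_le_mul_of_nonneg_left h2
      (Nat.cast_nonneg (epochSample I G V ε γ X) : (0 : ℝ) ≤ _)
    linarith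

lemma negCurvTuned : NegCurvTuned P f I (tuning I d G V ε γ X) (certified γ X)
    (Real.exp (-X) / (12 * d)) (Real.exp (-X)) where
  toNeonSpec := S.neonSpec
  L₁_pos := S.L₁_pos
  L₂_pos := S.L₂_pos
  m₂_pos := S.hessianSample_pos
  σ_pos := certified_pos S.γ_pos S.one_le
  σ_le := by
    have := certified_le S.γ_pos S.one_le
    have := S.γ_pos
    rw [S.γ_eq]
    linarith
  γ_pos := by
    have := S.γ_pos
    rw [S.γ_eq]
    linarith
  r_pos := S.radius_pos.2.1
  δ_nonneg := (Real.exp_pos _).le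
  step := by
    have := S.γ_pos
    rw [S.γ_eq]
    simp only [tuning, neonTuning]
    field_simp
  concentration := S.concentration_le h
  slab v hv := by
    have hd : (0 : ℝ) < d := by exact_mod_cast S.d_pos
    refine (unitBallLaw_slab_le S.d_pos hv (by positivity)).trans (le_of_eq ?_)
    congr 1
    field_simp

lemma iterationTuned : IterationTuned P f I (tuning I d G V ε γ X) (certified γ X)
    (Real.exp (-X) / (12 * d)) (Real.exp (-X)) V (progress I G V ε γ X) where
  toNegCurvTuned := S.negCurvTuned h
  c'_pos := S.c'_pos
  c'_le := S.c'_le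
  b_pos := S.b_pos
  b_le := S.batch_le
  mc_pos := S.epochSample_pos
  V_nonneg := S.V_pos.le
  ε_pos := by
    have := S.ε_pos
    rw [S.ε_eq]
    linarith
  D_pos := S.progress_pos
  D_le_gain := min_le_left _ _
  D_le_rate := by
    refine (min_le_right _ _).trans (le_of_eq ?_)
    rw [S.ε_eq]
    simp only [tuning, neonTuning]
    ring
  failure := by
    have h1 := S.gain_add_loss_le
    have h2 := S.gain_add_loss_le_rate
    have h3 := mul_pos S.gain_pos (Real.exp_pos (-X))
    have h4 : 4 * ((gain I (certified γ X) + loss I (certified γ X)) * Real.exp (-X)) ≤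
        progress I G V ε γ X := le_min (by linarith) (by linarith)
    linarith
  -- The check uses the same sample size as S₁, so the noise term occurs twice; each occurrence is
  -- at most D/8 by comparison with both arguments of the minimum.
  noise := by
    have h1 := S.noise_le_gain
    have h2 := mul_le_mul_of_nonneg_left S.variance_le S.epochRate_pos.le
    have h3 : 8 * (epochRate I (epochSample I G V ε γ X) *
        (V / epochSample I G V ε γ X)) ≤ progress I G V ε γ X := le_min (by linarith) (by linarith)
    simp only [tuning, neonTuning]
    linarith
  check x hx := by
    have hε : I.ε = ε / 2 := S.ε_eq
    rw [hε] at hx ⊢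
    exact S.check_le h x (by linarith)

/-- C γ³ is half of `gain`, so C is an inverse power of X up to a constant. The other half covers
missed eigenvalues and inaccurate sample Hessians. -/
lemma escapeGuarantee : EscapeGuarantee P f I (tuning I d G V ε γ X) γ
    (gain I (certified γ X) / (2 * γ ^ 3)) := by
  intro y hy
  have t := S.negCurvTuned h
  refine ⟨t.integrable_escape h y, (t.integral_escape_le h y).trans ?_⟩
  have hγ := S.γ_pos
  have hg := S.gain_pos
  have h1 := t.measure_curvatureVector_eq_zero_le h y (by rw [S.γ_eq]; linarith)
  have hmeas : MeasurableSet {s : NeonSeed Ξ d (tuning I d G V ε γ X).m₂ |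
      curvatureVector f I (tuning I d G V ε γ X) s y = 0} :=
    measurableSet_eq_fun (measurable_curvatureVector_left h.measurable h.isSmooth I _ y)
      measurable_const
  have h2 : (neonLaw P d (tuning I d G V ε γ X).m₂).real
      {s | curvatureVector f I (tuning I d G V ε γ X) s y = 0} ≤ 2 * Real.exp (-X) :=
    ENNReal.toReal_le_of_le_ofReal (by positivity) h1
  have h3 := probReal_compl_eq_one_sub (μ := neonLaw P d (tuning I d G V ε γ X).m₂) hmeas
  have h4 : {s : NeonSeed Ξ d (tuning I d G V ε γ X).m₂ |
      curvatureVector f I (tuning I d G V ε γ X) s y = 0}ᶜ =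
      {s | curvatureVector f I (tuning I d G V ε γ X) s y ≠ 0} := rfl
  rw [h4] at h3
  have h5 := S.gain_add_loss_le
  have h6 : gain I (certified γ X) * (1 - 2 * Real.exp (-X)) ≤
      gain I (certified γ X) * (neonLaw P d (tuning I d G V ε γ X).m₂).real
        {s | curvatureVector f I (tuning I d G V ε γ X) s y ≠ 0} := by
    rw [h3]; gcongr
  have e : gain I (certified γ X) / (2 * γ ^ 3) * γ ^ 3 = gain I (certified γ X) / 2 := by
    field_simp
  rw [e]
  linarith

/-- Both claims come from E[F(y) + A‖∇F(y)‖²] ≤ F(x) + A V/m. Without information on the gradient, A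
V/m ≤ `gain`/8 is below C γ³/2 = `gain`/4. If E‖∇F(y)‖² ≥ ε², then A V/m ≤ Aε²/64 is negligible
against Aε². -/
lemma epochGuarantee {φ : ℝ}
    (hφ : φ ≤ I.c' / (4 * I.L₁) * (ε ^ (4 / 3 : ℝ) / (I.b : ℝ) ^ (1 / 3 : ℝ))) :
    EpochGuarantee P f I (tuning I d G V ε γ X).m₁ ε γ φ
      (gain I (certified γ X) / (2 * γ ^ 3)) := by
  intro x
  have hm₁ : (tuning I d G V ε γ X).m₁ = epochSample I G V ε γ X := rfl
  rw [hm₁]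
  have hγ := S.γ_pos
  have hA := S.epochRate_pos
  have hle := h.lintegral_scsgEpoch_le S.L₁_pos S.c'_pos S.c'_le S.V_pos.le
    (Fs := objective P f x₁ - Δ) (fun z => by linarith [h.initial_gap z]) S.b_pos S.batch_le x
  have hnoise := S.noise_le_gain
  have hvar := mul_le_mul_of_nonneg_left S.variance_le hA.le
  have hrate := S.rate_le_epochRate_mul
  rw [← epochRate] at hle
  set m := epochSample I G V ε γ X with hm
  set A := epochRate I m with hA_def
  set Fs := objective P f x₁ - Δ with hFs
  set ν := epochLaw P m I.b with hν
  have hsm := h.isSmooth_objective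
  have hstep : Measurable fun s : EpochSeed Ξ m I.b => scsgEpoch f I s x :=
    measurable_scsgEpoch_left h.measurable h.isSmooth I m x
  have hF : Measurable fun s : EpochSeed Ξ m I.b => objective P f (scsgEpoch f I s x) :=
    hsm.diff.continuous.measurable.comp hstep
  have hN : Measurable fun s : EpochSeed Ξ m I.b =>
      ‖gradient (objective P f) (scsgEpoch f I s x)‖ ^ 2 :=
    ((hsm.diff_grad.continuous.measurable.comp hstep).norm).pow_const 2
  set Y : EpochSeed Ξ m I.b → ℝ := fun s => objective P f (scsgEpoch f I s x) - Fs with hY_def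
  set n : EpochSeed Ξ m I.b → ℝ := fun s =>
    ‖gradient (objective P f) (scsgEpoch f I s x)‖ ^ 2 with hn_def
  have hY : Measurable Y := hF.sub_const _
  have hY0 : ∀ s, 0 ≤ Y s := fun s => by
    have := h.initial_gap (scsgEpoch f I s x)
    simp only [hY_def, hFs]
    linarith
  have hn0 : ∀ s, 0 ≤ n s := fun s => sq_nonneg _
  have hZ : Measurable fun s => Y s + A * n s := hY.add (hN.const_mul A)
  have hZ0 : ∀ s, 0 ≤ Y s + A * n s := fun s => add_nonneg (hY0 s) (mul_nonneg hA.le (hn0 s))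
  -- Finiteness of the Lebesgue integral gives integrability of the nonnegative sum, hence of each
  -- of its nonnegative summands.
  have hZi : Integrable (fun s => Y s + A * n s) ν := by
    rw [← lintegral_ofReal_ne_top_iff_integrable hZ.aestronglyMeasurable
      (Filter.Eventually.of_forall hZ0)]
    exact (hle.trans_lt ENNReal.ofReal_lt_top).ne
  have hYi : Integrable Y ν := hZi.mono' hY.aestronglyMeasurable
    (Filter.Eventually.of_forall fun s => by
      rw [Real.norm_of_nonneg (hY0 s)]
      linarith [mul_nonneg hA.le (hn0 s)])
  have hAni : Integrable (fun s => A * n s) ν := by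
    refine (hZi.sub hYi).congr (Filter.Eventually.of_forall fun s => ?_)
    simp
  have hni : Integrable n ν := by
    refine (hAni.const_mul A⁻¹).congr (Filter.Eventually.of_forall fun s => ?_)
    simp only
    rw [inv_mul_cancel_left₀ hA.ne']
  have hYint : ∫ s, Y s ∂ν + A * ∫ s, n s ∂ν ≤ objective P f x - Fs + A * (V / m) := by
    have h1 := (ENNReal.ofReal_le_ofReal_iff (by
      have := h.initial_gap x
      have : 0 ≤ A * (V / m) := by have := S.V_pos; positivity
      simp only [hFs]
      linarith)).mp ((ofReal_integral_eq_lintegral_ofReal hZi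
        (Filter.Eventually.of_forall hZ0)).trans_le hle)
    rwa [integral_add hYi hAni, integral_const_mul] at h1
  have hdiff : (fun s => objective P f (scsgEpoch f I s x) - objective P f x) =
      fun s => Y s - (objective P f x - Fs) := by
    funext s
    simp only [hY_def]
    ring
  have hnn : 0 ≤ ∫ s, n s ∂ν := integral_nonneg hn0
  have hint : ∫ s, (Y s - (objective P f x - Fs)) ∂ν = ∫ s, Y s ∂ν - (objective P f x - Fs) := by
    rw [integral_sub hYi (integrable_const _)]
    simp
  have e : gain I (certified γ X) / (2 * γ ^ 3) * γ ^ 3 = gain I (certified γ X) / 2 := by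
    field_simp
  have hg := S.gain_pos
  have hAn := mul_nonneg hA.le hnn
  rw [hdiff, hint, e]
  refine ⟨hYi.sub (integrable_const _), fun hε => ?_, by linarith⟩
  have h2 : ε ^ 2 ≤ ∫ s, n s ∂ν := by
    rw [← ofReal_integral_eq_lintegral_ofReal hni (Filter.Eventually.of_forall hn0)] at hε
    exact (ENNReal.ofReal_le_ofReal_iff hnn).mp hε
  have h3 := mul_le_mul_of_nonneg_left h2 hA.le
  have h4 : 2 * φ ≤ A * ε ^ 2 := by
    refine le_trans ?_ hrate
    have : I.c' / (2 * I.L₁) * (ε ^ (4 / 3 : ℝ) / (I.b : ℝ) ^ (1 / 3 : ℝ)) =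
        2 * (I.c' / (4 * I.L₁) * (ε ^ (4 / 3 : ℝ) / (I.b : ℝ) ^ (1 / 3 : ℝ))) := by
      have := S.L₁_pos
      field_simp
      norm_num
    linarith
  have h5 : 0 ≤ A * ε ^ 2 := by positivity
  linarith

lemma measure_run_le : runLaw P d I.b (tuning I d G V ε γ X)
    {ω | ¬ ∃ y, Returns f I (tuning I d G V ε γ X) x₁ ω y ∧ IsSSP (objective P f) ε γ y} ≤
      ENNReal.ofReal δ := by
  have h1 := (S.iterationTuned h).measure_failure_le h
  have e1 : 2 * I.ε = ε := by rw [S.ε_eq]; ring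
  have e2 : 2 * I.γ = γ := by rw [S.γ_eq]; ring
  rw [e1, e2] at h1
  exact h1.trans (ENNReal.ofReal_le_ofReal S.failure_le)

omit h in
lemma lintegral_epoch_le :
    ∫⁻ s, (epochCost s : ℝ≥0∞) ∂(epochLaw P (tuning I d G V ε γ X).m₁ I.b) ≤
      ENNReal.ofReal (6 * sampleFactor I.L₁ I.L₂ G V I.c' * X ^ 9 * sampleRate ε γ I.b) := by
  refine (lintegral_epochCost_le S.b_pos S.epochSample_pos).trans (ENNReal.ofReal_le_ofReal ?_)
  have := S.epochSample_le
  linarith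

end Guarantees

end Setting

end NeonSCSG

end

/-! ### Total complexity and its special cases -/

noncomputable section

namespace NeonSCSG

variable {d : ℕ} {Ξ : Type*}

/-- The ratio of the number of iterations to `X ^ 6` times its rate. -/
def iterationFactor (L₁ L₂ Δ c' : ℝ) : ℝ := 2 * Δ * progressFactor L₁ L₂ c' + 2

/-- The rate of the number of iterations. -/
def iterationRate (ε γ : ℝ) (b : ℕ) : ℝ :=
  max ((b : ℝ) ^ (1 / 3 : ℝ) / ε ^ (4 / 3 : ℝ)) (1 / γ ^ 3)

/-- The constant in the bound on the total complexity. -/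
def totalFactor (L₁ L₂ G V Δ c' : ℝ) : ℝ :=
  8 * sampleFactor L₁ L₂ G V c' * iterationFactor L₁ L₂ Δ c'

/-- The bound on the expected total complexity of a run. -/
def runBound (I : Input) (d : ℕ) (G V Δ ε γ X : ℝ) : ℝ :=
  (2 * Δ / progress I G V ε γ X + 2) *
    (4 * epochSample I G V ε γ X + neonCost I.kind (tuning I d G V ε γ X))

namespace Setting

variable {I : Input} {G V Δ ε γ δ X : ℝ} (S : Setting I d G V Δ ε γ δ X)
include S

lemma lintegral_totalCost_le [MeasurableSpace Ξ] {P : Measure Ξ} [IsProbabilityMeasure P]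
    {f : E d → Ξ → ℝ} {x₁ : E d} (h : Assumptions P f x₁ I.L₁ I.L₂ G V Δ) :
    ∫⁻ ω, totalCost f I (tuning I d G V ε γ X) x₁ ω ∂(runLaw P d I.b (tuning I d G V ε γ X)) ≤
      ENNReal.ofReal (runBound I d G V Δ ε γ X) := by
  refine ((S.iterationTuned h).lintegral_totalCost_le h).trans (le_of_eq ?_)
  congr 1
  unfold runBound
  have h1 : (tuning I d G V ε γ X).m₁ = epochSample I G V ε γ X := rfl
  have h2 : (tuning I d G V ε γ X).mc = epochSample I G V ε γ X := rfl
  rw [h1, h2]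
  ring

lemma iterationFactor_pos : 0 < iterationFactor I.L₁ I.L₂ Δ I.c' := by
  have := S.progressFactor_pos
  have := S.Δ_nonneg
  unfold iterationFactor
  positivity

lemma totalFactor_pos : 0 < totalFactor I.L₁ I.L₂ G V Δ I.c' := by
  have := S.iterationFactor_pos
  have := S.one_le_sampleFactor
  unfold totalFactor
  positivity

lemma costFactor_pos : 0 < costFactor I.L₁ := by
  have := S.L₁_pos
  unfold costFactor
  positivity

lemma one_le_iterationRate : 1 ≤ iterationRate ε γ I.b := by
  have hγ := S.γ_pos
  refine le_trans ?_ (le_max_right _ _)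
  rw [le_div_iff₀ (by positivity)]
  have := pow_le_one₀ hγ.le S.γ_lt.le (n := 3)
  linarith

lemma iterations_le : 2 * Δ / progress I G V ε γ X + 2 ≤
    iterationFactor I.L₁ I.L₂ Δ I.c' * X ^ 6 * iterationRate ε γ I.b := by
  have hL₁ := S.L₁_pos
  have hL₂ := S.L₂_pos
  have hc := S.c'_pos
  have hε := S.ε_pos
  have hγ := S.γ_pos
  have hΔ := S.Δ_nonneg
  have hb : (0 : ℝ) < I.b := by exact_mod_cast S.b_pos
  have hX6 : 1 ≤ X ^ 6 := one_le_pow₀ S.one_le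
  have hR := S.one_le_iterationRate
  have hR' : 0 ≤ iterationRate ε γ I.b := by linarith
  have h1 : 1 / progress I G V ε γ X ≤
      progressFactor I.L₁ I.L₂ I.c' * (X ^ 6 * iterationRate ε γ I.b) := by
    refine S.one_div_progress_le.trans ?_
    have h2 : 8 * (1 / (epochRate I (epochSample I G V ε γ X) * ε ^ 2)) ≤
        16 * I.L₁ / I.c' * ((I.b : ℝ) ^ (1 / 3 : ℝ) / ε ^ (4 / 3 : ℝ)) := by
      calc 8 * (1 / (epochRate I (epochSample I G V ε γ X) * ε ^ 2))
          ≤ 8 * (1 / (I.c' / (2 * I.L₁) *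
              (ε ^ (4 / 3 : ℝ) / (I.b : ℝ) ^ (1 / 3 : ℝ)))) :=
            mul_le_mul_of_nonneg_left
              (one_div_le_one_div_of_le (by positivity) S.rate_le_epochRate_mul) (by norm_num)
        _ = _ := by field_simp; norm_num
    have h3 : 1 / γ ^ 3 ≤ X ^ 6 * iterationRate ε γ I.b :=
      le_trans (le_max_right _ _) (le_mul_of_one_le_left hR' hX6)
    have h4 : (I.b : ℝ) ^ (1 / 3 : ℝ) / ε ^ (4 / 3 : ℝ) ≤ X ^ 6 * iterationRate ε γ I.b :=
      le_trans (le_max_left _ _) (le_mul_of_one_le_left hR' hX6)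
    have h5 : 1 / γ ^ 3 ≤ iterationRate ε γ I.b := le_max_right _ _
    rw [S.one_div_gain]
    calc _ ≤ 3 * I.L₂ ^ 2 * 409600 ^ 3 * X ^ 6 * iterationRate ε γ I.b +
          16 * I.L₁ / I.c' * (X ^ 6 * iterationRate ε γ I.b) :=
          add_le_add (by gcongr) (h2.trans (by gcongr))
      _ = _ := by rw [progressFactor]; ring
  have hQ := one_le_mul_of_one_le_of_one_le hX6 hR
  have h2 := mul_le_mul_of_nonneg_left h1 hΔ
  have e : 2 * Δ / progress I G V ε γ X = 2 * (Δ * (1 / progress I G V ε γ X)) := by ring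
  rw [e, iterationFactor]
  linarith

/-- The number of iterations contributes X^6 and the sample size X^9. The cost of NEON is kept as a
number here, so its own X^6 is not yet included. -/
lemma runBound_le : runBound I d G V Δ ε γ X ≤ totalFactor I.L₁ I.L₂ G V Δ I.c' * X ^ 15 *
    (iterationRate ε γ I.b * (neonCost I.kind (tuning I d G V ε γ X) + 1 / ε ^ 2 +
      1 / (γ ^ (9 / 2 : ℝ) * (I.b : ℝ) ^ (1 / 2 : ℝ)))) := by
  have hε := S.ε_pos
  have hγ := S.γ_pos
  have hX := S.one_le
  have hb : (0 : ℝ) < I.b := by exact_mod_cast S.b_pos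
  have hM := S.one_le_sampleFactor
  have hI := S.iterationFactor_pos
  have hR := S.one_le_iterationRate
  have hX9 : 1 ≤ X ^ 9 := one_le_pow₀ hX
  have h1 := S.iterations_le
  have h2 := S.epochSample_le
  set c : ℝ := (neonCost I.kind (tuning I d G V ε γ X) : ℝ) with hc
  have hc0 : 0 ≤ c := Nat.cast_nonneg _
  have h3 : sampleRate ε γ I.b ≤ 1 / ε ^ 2 + 1 / (γ ^ (9 / 2 : ℝ) * (I.b : ℝ) ^ (1 / 2 : ℝ)) :=
    max_le_add_of_nonneg (by positivity) (by positivity)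
  have h4 : 4 * (epochSample I G V ε γ X : ℝ) + c ≤ 8 * sampleFactor I.L₁ I.L₂ G V I.c' * X ^ 9 *
      (c + 1 / ε ^ 2 + 1 / (γ ^ (9 / 2 : ℝ) * (I.b : ℝ) ^ (1 / 2 : ℝ))) := by
    have h5 : sampleFactor I.L₁ I.L₂ G V I.c' * X ^ 9 * sampleRate ε γ I.b ≤
        sampleFactor I.L₁ I.L₂ G V I.c' * X ^ 9 *
          (1 / ε ^ 2 + 1 / (γ ^ (9 / 2 : ℝ) * (I.b : ℝ) ^ (1 / 2 : ℝ))) := by gcongr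
    have h6 : c ≤ sampleFactor I.L₁ I.L₂ G V I.c' * X ^ 9 * c :=
      le_mul_of_one_le_left hc0 (one_le_mul_of_one_le_of_one_le hM hX9)
    linarith
  unfold runBound
  calc (2 * Δ / progress I G V ε γ X + 2) * (4 * epochSample I G V ε γ X + c)
      ≤ iterationFactor I.L₁ I.L₂ Δ I.c' * X ^ 6 * iterationRate ε γ I.b *
        (8 * sampleFactor I.L₁ I.L₂ G V I.c' * X ^ 9 *
          (c + 1 / ε ^ 2 + 1 / (γ ^ (9 / 2 : ℝ) * (I.b : ℝ) ^ (1 / 2 : ℝ)))) :=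
        mul_le_mul h1 h4 (by positivity) (by positivity)
    _ = _ := by rw [totalFactor]; ring

/-- The total complexity when both rates are powers of `ε`. -/
lemma runBound_le_of_rates {p : ℝ} (hR : iterationRate ε γ I.b ≤ 2 / ε ^ p)
    (hγ3 : 1 / γ ^ 3 ≤ 1 / ε ^ 2)
    (hγb : 1 / (γ ^ (9 / 2 : ℝ) * (I.b : ℝ) ^ (1 / 2 : ℝ)) ≤ 2 / ε ^ 2) :
    runBound I d G V Δ ε γ X ≤ 2 * totalFactor I.L₁ I.L₂ G V Δ I.c' * (costFactor I.L₁ + 3) *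
      X ^ 21 * (1 / ε ^ (p + 2)) := by
  have hε := S.ε_pos
  have hγ := S.γ_pos
  have hX := S.one_le
  have hT := S.totalFactor_pos
  have hC := S.costFactor_pos
  have hR0 := S.one_le_iterationRate
  have h1 : (neonCost I.kind (tuning I d G V ε γ X) : ℝ) ≤ costFactor I.L₁ * X ^ 6 * (1 / ε ^ 2) := by
    refine S.neonCost_le.trans (mul_le_mul_of_nonneg_left (le_trans ?_ hγ3) (by positivity))
    have e : γ ^ 3 = γ ^ (3 : ℝ) := by exact_mod_cast (Real.rpow_natCast γ 3).symm
    rw [e]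
    refine one_div_le_one_div_of_le (by positivity)
      (Real.rpow_le_rpow_of_exponent_ge hγ S.γ_lt.le ?_)
    cases I.kind <;> norm_num [neonExponent]
  have h2 : neonCost I.kind (tuning I d G V ε γ X) + 1 / ε ^ 2 +
      1 / (γ ^ (9 / 2 : ℝ) * (I.b : ℝ) ^ (1 / 2 : ℝ)) ≤
      (costFactor I.L₁ + 3) * X ^ 6 * (1 / ε ^ 2) := by
    have h3 : 1 / ε ^ 2 ≤ X ^ 6 * (1 / ε ^ 2) :=
      le_mul_of_one_le_left (by positivity) (one_le_pow₀ hX)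
    have e : 2 / ε ^ 2 = 2 * (1 / ε ^ 2) := by ring
    rw [e] at hγb
    linarith
  have e : ε ^ (p + 2) = ε ^ p * ε ^ 2 := by
    rw [Real.rpow_add hε]
    congr 1
    exact_mod_cast Real.rpow_natCast ε 2
  refine S.runBound_le.trans ?_
  calc _ ≤ totalFactor I.L₁ I.L₂ G V Δ I.c' * X ^ 15 *
        (2 / ε ^ p * ((costFactor I.L₁ + 3) * X ^ 6 * (1 / ε ^ 2))) := by
        refine mul_le_mul_of_nonneg_left (mul_le_mul hR h2 ?_ (by positivity)) (by positivity)
        positivity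
    _ = _ := by rw [e]; field_simp

/-- With s = √ε, the distance |b - 1/s| < 1 and b ≥ 1 give 1/(2s) ≤ b ≤ 2/s. Then both arguments of
the iteration rate are of order s^(-3) = ε^(-3/2), and the sample rate is of order ε^(-2). -/
lemma runBound_le_of_sqrt (hγε : γ = ε ^ (1 / 2 : ℝ))
    (hb : |(I.b : ℝ) - 1 / ε ^ (1 / 2 : ℝ)| < 1) :
    runBound I d G V Δ ε γ X ≤ 2 * totalFactor I.L₁ I.L₂ G V Δ I.c' * (costFactor I.L₁ + 3) *
      X ^ 21 * (1 / ε ^ (7 / 2 : ℝ)) := by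
  have hε := S.ε_pos
  have hε1 := S.ε_lt.le
  have hb1 : (1 : ℝ) ≤ I.b := by exact_mod_cast S.b_pos
  have hb0 : (0 : ℝ) < I.b := by linarith
  set s := ε ^ (1 / 2 : ℝ) with hs
  have hs0 : 0 < s := Real.rpow_pos_of_pos hε _
  have hs1 : s ≤ 1 := Real.rpow_le_one hε.le hε1 (by norm_num)
  have hs2 : s ^ 2 = ε := by
    rw [hs, ← Real.rpow_natCast, ← Real.rpow_mul hε.le]; norm_num
  have hinv : 1 ≤ 1 / s := by rw [le_div_iff₀ hs0]; linarith
  rw [abs_lt] at hb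
  have hpow : ∀ q : ℝ, ε ^ q = s ^ (2 * q) := fun q => by
    rw [Real.rpow_mul hs0.le]
    congr 1
    rw [← hs2]
    exact_mod_cast (Real.rpow_natCast s 2).symm
  have e3 : s ^ (3 : ℝ) = s ^ 3 := by exact_mod_cast Real.rpow_natCast s 3
  have e72 : (7 / 2 : ℝ) = 3 / 2 + 2 := by norm_num
  rw [e72]
  refine S.runBound_le_of_rates ?_ ?_ ?_
  · have e : ε ^ (3 / 2 : ℝ) = s ^ 3 := by rw [hpow, ← e3]; norm_num
    rw [e]
    refine max_le ?_ ?_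
    · have h1 : (I.b : ℝ) ^ (1 / 3 : ℝ) ≤ 2 * (1 / s) ^ (1 / 3 : ℝ) := by
        calc (I.b : ℝ) ^ (1 / 3 : ℝ) ≤ (2 * (1 / s)) ^ (1 / 3 : ℝ) := by
              gcongr; linarith
          _ = 2 ^ (1 / 3 : ℝ) * (1 / s) ^ (1 / 3 : ℝ) :=
              Real.mul_rpow (by norm_num) (by positivity)
          _ ≤ 2 * (1 / s) ^ (1 / 3 : ℝ) := by
              gcongr
              calc (2 : ℝ) ^ (1 / 3 : ℝ) ≤ 2 ^ (1 : ℝ) :=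
                    Real.rpow_le_rpow_of_exponent_le (by norm_num) (by norm_num)
                _ = 2 := Real.rpow_one 2
      calc (I.b : ℝ) ^ (1 / 3 : ℝ) / ε ^ (4 / 3 : ℝ)
          ≤ 2 * (1 / s) ^ (1 / 3 : ℝ) / ε ^ (4 / 3 : ℝ) := by gcongr
        _ = 2 / s ^ 3 := by
            rw [hpow, one_div, Real.inv_rpow hs0.le, ← e3, mul_div_assoc, ← one_div, div_div,
              ← Real.rpow_add hs0]
            norm_num
            ring
    · rw [hγε]
      gcongr
      norm_num
  · rw [hγε, ← hs2, ← pow_mul]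
    exact one_div_le_one_div_of_le (by positivity)
      (pow_le_pow_of_le_one hs0.le hs1 (by norm_num))
  · have h1 : 1 / 2 * (1 / s) ^ (1 / 2 : ℝ) ≤ (I.b : ℝ) ^ (1 / 2 : ℝ) := by
      calc 1 / 2 * (1 / s) ^ (1 / 2 : ℝ) ≤ (1 / 2) ^ (1 / 2 : ℝ) * (1 / s) ^ (1 / 2 : ℝ) := by
            gcongr
            calc (1 / 2 : ℝ) = (1 / 2) ^ (1 : ℝ) := (Real.rpow_one _).symm
              _ ≤ (1 / 2) ^ (1 / 2 : ℝ) :=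
                Real.rpow_le_rpow_of_exponent_ge (by norm_num) (by norm_num) (by norm_num)
        _ = (1 / 2 * (1 / s)) ^ (1 / 2 : ℝ) :=
            (Real.mul_rpow (by norm_num) (by positivity)).symm
        _ ≤ (I.b : ℝ) ^ (1 / 2 : ℝ) := by gcongr; linarith
    have h2 : 1 / 2 * s ^ 4 ≤ γ ^ (9 / 2 : ℝ) * (I.b : ℝ) ^ (1 / 2 : ℝ) := by
      calc 1 / 2 * s ^ 4 = s ^ (9 / 2 : ℝ) * (1 / 2 * (1 / s) ^ (1 / 2 : ℝ)) := by
            have e4 : s ^ 4 = s ^ (9 / 2 : ℝ) * s ^ (-(1 / 2) : ℝ) := by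
              rw [← Real.rpow_add hs0]
              norm_num
            rw [e4, one_div s, Real.inv_rpow hs0.le, ← Real.rpow_neg hs0.le]
            ring
        _ ≤ _ := by rw [hγε]; gcongr
    calc 1 / (γ ^ (9 / 2 : ℝ) * (I.b : ℝ) ^ (1 / 2 : ℝ)) ≤ 1 / (1 / 2 * s ^ 4) :=
          one_div_le_one_div_of_le (by positivity) h2
      _ = 2 / ε ^ 2 := by
          rw [← hs2, ← pow_mul]
          field_simp

/-- The condition γ ≥ ε^(4/9) is equivalent to γ³ ≥ ε^(4/3) and to γ^(9/2) ≥ ε², so the ε-rates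
dominate in both factors. -/
lemma runBound_le_of_batch_eq_one (hγε : ε ^ (4 / 9 : ℝ) ≤ γ) (hb : I.b = 1) :
    runBound I d G V Δ ε γ X ≤ 2 * totalFactor I.L₁ I.L₂ G V Δ I.c' * (costFactor I.L₁ + 3) *
      X ^ 21 * (1 / ε ^ (10 / 3 : ℝ)) := by
  have hε := S.ε_pos
  have hε1 := S.ε_lt.le
  have hγ := S.γ_pos
  have e2 : ε ^ (2 : ℝ) = ε ^ 2 := by exact_mod_cast Real.rpow_natCast ε 2
  have e103 : (10 / 3 : ℝ) = 4 / 3 + 2 := by norm_num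
  have h3 : ε ^ (4 / 3 : ℝ) ≤ γ ^ 3 := by
    calc ε ^ (4 / 3 : ℝ) = (ε ^ (4 / 9 : ℝ)) ^ 3 := by
          rw [← Real.rpow_natCast, ← Real.rpow_mul hε.le]; norm_num
      _ ≤ γ ^ 3 := by gcongr
  have h4 : ε ^ 2 ≤ ε ^ (4 / 3 : ℝ) := by
    rw [← e2]
    exact Real.rpow_le_rpow_of_exponent_ge hε hε1 (by norm_num)
  have h5 : ε ^ 2 ≤ γ ^ (9 / 2 : ℝ) := by
    calc ε ^ 2 = (ε ^ (4 / 9 : ℝ)) ^ (9 / 2 : ℝ) := by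
          rw [← e2, ← Real.rpow_mul hε.le]; norm_num
      _ ≤ γ ^ (9 / 2 : ℝ) := by gcongr
  rw [e103]
  refine S.runBound_le_of_rates ?_ ?_ ?_
  · have h6 : 1 / ε ^ (4 / 3 : ℝ) ≤ 2 / ε ^ (4 / 3 : ℝ) := by gcongr; norm_num
    rw [iterationRate, hb, Nat.cast_one, Real.one_rpow]
    exact max_le h6 ((one_div_le_one_div_of_le (by positivity) h3).trans h6)
  · exact one_div_le_one_div_of_le (by positivity) (h4.trans h3)
  · rw [hb, Nat.cast_one, Real.one_rpow, mul_one]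
    have h6 : 1 / ε ^ 2 ≤ 2 / ε ^ 2 := by gcongr; norm_num
    exact (one_div_le_one_div_of_le (by positivity) h5).trans h6

end Setting

/-- The constant of the main theorem for `X = j log (3 d / (ε γ δ))`. -/
def mainFactor (L₁ L₂ G V Δ c' : ℝ) : ℝ :=
  6 * sampleFactor L₁ L₂ G V c' + costFactor L₁ + 6 * L₂ ^ 2 * 409600 ^ 3 + 4 * L₁ / c' +
    2 * totalFactor L₁ L₂ G V Δ c' * (costFactor L₁ + 3)

end NeonSCSG

end

/-! ### Assembly -/

theorem mainTheorem5 (kind : NeonKind) (L₁ L₂ G V Δ c' : ℝ) (hL₁ : 0 < L₁) (hL₂ : 0 < L₂)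
    (hG : 0 < G) (hV : 0 < V) (hΔ : 0 ≤ Δ) (hc' : 0 < c') (hc'_le : c' ≤ 1 / 6) :
    ∃ (K : ℝ) (q : ℕ), 0 < K ∧
      ∀ (d b : ℕ) (ε γ δ : ℝ), 0 < d → 0 < b → 0 < ε → ε < 1 → 0 < γ → γ < 1 → 0 < δ → δ < 1 →
        (b : ℝ) ≤ sampleRate ε γ b →
        ∃ (p : Tuning) (C : ℝ),
          p.Valid b ∧
          (p.m₁ : ℝ) ≤ K * logFactor d ε γ δ ^ q * sampleRate ε γ b ∧
          (neonCost kind p : ℝ) ≤ K * logFactor d ε γ δ ^ q * (1 / γ ^ neonExponent kind) ∧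
          1 / (K * logFactor d ε γ δ ^ q) ≤ C ∧
          ∀ (Ξ : Type*) [MeasurableSpace Ξ] (P : Measure Ξ) [IsProbabilityMeasure P]
            (f : E d → Ξ → ℝ) (x₁ : E d), Assumptions P f x₁ L₁ L₂ G V Δ →
            EscapeGuarantee P f ⟨kind, L₁, L₂, c', b, ε / 2, γ / 2⟩ p γ C ∧
            EpochGuarantee P f ⟨kind, L₁, L₂, c', b, ε / 2, γ / 2⟩ p.m₁ ε γ
              (1 / K * (ε ^ (4 / 3 : ℝ) / (b : ℝ) ^ (1 / 3 : ℝ))) C ∧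
            ∫⁻ s, (epochCost s : ℝ≥0∞) ∂(epochLaw P p.m₁ b) ≤
              ENNReal.ofReal (K * logFactor d ε γ δ ^ q * sampleRate ε γ b) ∧
            runLaw P d b p {ω | ¬ ∃ y,
                Returns f ⟨kind, L₁, L₂, c', b, ε / 2, γ / 2⟩ p x₁ ω y ∧
                  IsSSP (objective P f) ε γ y} ≤ ENNReal.ofReal δ ∧
            ∫⁻ ω, totalCost f ⟨kind, L₁, L₂, c', b, ε / 2, γ / 2⟩ p x₁ ω ∂(runLaw P d b p) ≤
              ENNReal.ofReal (K * logFactor d ε γ δ ^ q *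
                (max ((b : ℝ) ^ (1 / 3 : ℝ) / ε ^ (4 / 3 : ℝ)) (1 / γ ^ 3) *
                  (neonCost kind p + 1 / ε ^ 2 +
                    1 / (γ ^ (9 / 2 : ℝ) * (b : ℝ) ^ (1 / 2 : ℝ))))) ∧
            (γ = ε ^ (1 / 2 : ℝ) → |(b : ℝ) - 1 / ε ^ (1 / 2 : ℝ)| < 1 →
              ∫⁻ ω, totalCost f ⟨kind, L₁, L₂, c', b, ε / 2, γ / 2⟩ p x₁ ω ∂(runLaw P d b p) ≤
                ENNReal.ofReal (K * logFactor d ε γ δ ^ q * (1 / ε ^ (7 / 2 : ℝ)))) ∧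
            (ε ^ (4 / 9 : ℝ) ≤ γ → b = 1 →
              ∫⁻ ω, totalCost f ⟨kind, L₁, L₂, c', b, ε / 2, γ / 2⟩ p x₁ ω ∂(runLaw P d b p) ≤
                ENNReal.ofReal (K * logFactor d ε γ δ ^ q * (1 / ε ^ (10 / 3 : ℝ)))) := by
  obtain ⟨j, hj1, hj⟩ := exists_log_scale (scaleFactor L₁ L₂ Δ c')
  have hB : 0 < noiseFactor L₁ L₂ V c' := by unfold noiseFactor; positivity
  have hM : 0 < sampleFactor L₁ L₂ G V c' := by unfold sampleFactor; positivity
  have hPf : 0 < progressFactor L₁ L₂ c' := by unfold progressFactor; positivity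
  have hIf : 0 < iterationFactor L₁ L₂ Δ c' := by unfold iterationFactor; positivity
  have hTf : 0 < totalFactor L₁ L₂ G V Δ c' := by unfold totalFactor; positivity
  have hCf : 0 < costFactor L₁ := by unfold costFactor; positivity
  have hTC : 0 < totalFactor L₁ L₂ G V Δ c' * (costFactor L₁ + 3) := by positivity
  have hL₂' : 0 < 6 * L₂ ^ 2 * 409600 ^ 3 := by positivity
  have hLc : 0 < 4 * L₁ / c' := by positivity
  obtain ⟨K₀, hK₀⟩ : ∃ K₀, K₀ = mainFactor L₁ L₂ G V Δ c' := ⟨_, rfl⟩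
  rw [mainFactor] at hK₀
  have hT3 : totalFactor L₁ L₂ G V Δ c' ≤ totalFactor L₁ L₂ G V Δ c' * (costFactor L₁ + 3) :=
    le_mul_of_one_le_right hTf.le (by linarith)
  have hK₀pos : 0 < K₀ := by linarith
  -- The largest power of X that occurs is 21 = 15 + 6, from the two special cases. As X = j ·
  -- `logFactor`, the constant j^21 moves into K.
  refine ⟨K₀ * j ^ 21, 21, by positivity, ?_⟩
  intro d b ε γ δ hd hb hε hε1 hγ hγ1 hδ hδ1 hbR
  have hd1 : (1 : ℝ) ≤ d := by exact_mod_cast hd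
  have hΛ : 3 ≤ 3 * (d : ℝ) / (ε * γ * δ) := by
    rw [le_div_iff₀ (by positivity)]
    have h1 : ε * γ * δ ≤ 1 := mul_le_one₀ (mul_le_one₀ hε1.le hγ.le hγ1.le) hδ.le hδ1.le
    linarith
  -- The logarithm is at least log 3 > 1, so all smaller powers of X can be raised to the common
  -- exponent 21.
  have hℓ1 : 1 ≤ logFactor d ε γ δ := by
    unfold logFactor
    rw [Real.le_log_iff_exp_le (by linarith)]
    exact (Real.exp_one_lt_d9.le.trans (by norm_num)).trans hΛ
  obtain ⟨X, hX⟩ : ∃ X, X = j * logFactor d ε γ δ := ⟨_, rfl⟩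
  have hX1 : 1 ≤ X := hX ▸ one_le_mul_of_one_le_of_one_le hj1 hℓ1
  have hKX : ∀ {w : ℝ} {i : ℕ}, 0 ≤ w → w ≤ K₀ → i ≤ 21 →
      w * X ^ i ≤ K₀ * j ^ 21 * logFactor d ε γ δ ^ 21 := fun {w i} hw hwK hi => by
    rw [mul_assoc, ← mul_pow, ← hX]
    gcongr
  have S : Setting ⟨kind, L₁, L₂, c', b, ε / 2, γ / 2⟩ d G V Δ ε γ δ X :=
    { L₁_pos := hL₁, L₂_pos := hL₂, G_pos := hG, V_pos := hV, Δ_nonneg := hΔ, c'_pos := hc',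
      c'_le := hc'_le, d_pos := hd, b_pos := hb, b_le := hbR, ε_pos := hε, ε_lt := hε1,
      γ_pos := hγ, γ_lt := hγ1, δ_pos := hδ, δ_lt := hδ1, ε_eq := rfl, γ_eq := rfl,
      one_le := hX1
      scale_le := by rw [hX]; exact hj _ hΛ }
  have hR := S.one_le_sampleRate
  have hrate := S.one_le_iterationRate
  refine ⟨tuning ⟨kind, L₁, L₂, c', b, ε / 2, γ / 2⟩ d G V ε γ X,
    gain ⟨kind, L₁, L₂, c', b, ε / 2, γ / 2⟩ (certified γ X) / (2 * γ ^ 3), S.tuning_valid,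
    S.epochSample_le.trans (mul_le_mul_of_nonneg_right
      (hKX (by positivity) (by linarith) (by norm_num)) (by linarith)),
    S.neonCost_le.trans (mul_le_mul_of_nonneg_right
      (hKX hCf.le (by linarith) (by norm_num)) (by positivity)), ?_, ?_⟩
  · rw [S.gain_eq]
    have e : γ ^ 3 / (3 * L₂ ^ 2 * 409600 ^ 3 * X ^ 6) / (2 * γ ^ 3) =
        1 / (6 * L₂ ^ 2 * 409600 ^ 3 * X ^ 6) := by
      field_simp
      norm_num
    rw [e]
    exact one_div_le_one_div_of_le (by positivity) (hKX hL₂'.le (by linarith) (by norm_num))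
  intro Ξ _ P _ f x₁ h
  have htotal := S.lintegral_totalCost_le h
  refine ⟨S.escapeGuarantee h, S.epochGuarantee h ?_, ?_, S.measure_run_le h, ?_, ?_, ?_⟩
  · refine mul_le_mul_of_nonneg_right ?_ (by positivity)
    have e : c' / (4 * L₁) = 1 / (4 * L₁ / c') := by rw [one_div_div]
    rw [e]
    refine one_div_le_one_div_of_le hLc ?_
    calc 4 * L₁ / c' ≤ K₀ := by linarith
      _ ≤ K₀ * j ^ 21 := le_mul_of_one_le_right hK₀pos.le (one_le_pow₀ hj1)
  · exact S.lintegral_epoch_le.trans (ENNReal.ofReal_le_ofReal (mul_le_mul_of_nonneg_right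
      (hKX (by positivity) (by linarith) (by norm_num)) (by linarith)))
  · refine htotal.trans (ENNReal.ofReal_le_ofReal (S.runBound_le.trans ?_))
    exact mul_le_mul_of_nonneg_right (hKX hTf.le (by linarith) (by norm_num))
      (mul_nonneg (by linarith) (by positivity))
  · intro h1 h2
    exact htotal.trans (ENNReal.ofReal_le_ofReal ((S.runBound_le_of_sqrt h1 h2).trans
      (mul_le_mul_of_nonneg_right (hKX (by positivity) (by linarith) le_rfl) (by positivity))))
  · intro h1 h2
    exact htotal.trans (ENNReal.ofReal_le_ofReal ((S.runBound_le_of_batch_eq_one h1 h2).trans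
      (mul_le_mul_of_nonneg_right (hKX (by positivity) (by linarith) le_rfl) (by positivity))))
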